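/- **Setup.** Let $\mathcal G$ be a three-dimensional nilpotent Lie group (its Lie algebra is nilpotent), $M$ a compact one-dimensional smooth manifold without boundary and $\pi:P\to M$ a smooth principal $\mathcal G$-bundle. A $\mathcal G$-invariant Riemannian metric $\bar g$ on $P$ determines a principal connection $\bar A$ (its horizontal spaces are the orthogonal complements of the fibres), a metric $g$ on $M$ (for which $\pi$ is a Riemannian submersion) and a fibre metric $G$ on the adjoint bundle $\mathfrak G$. Sections of $\mathcal E=\mathfrak G\oplus TM$ correspond to invariant vector fields on $P$, those of $\mathfrak G$ to vertical and those of $TM$ to horizontal ones; let $[\,,]$ be the bracket on $\Gamma(\mathcal E)$ given by the Lie bracket on $P$, $d$ the exterior derivative on $\Gamma(\Lambda^\bullet\mathcal E^*)$ that it defines, and $D$ the connection on $\mathcal E$ with $D_v\eta=[v,\eta]$ on $\mathfrak G$ and equal to the Levi-Civita connection of $g$ on $TM$. An invariant three-form $\bar H$ on $P$ is viewed as a section $H$ of $\Lambda^3\mathcal E^*$. Locally, $v$ denotes a $g$-unit vector field of $M$ and $(\eta_1,\eta_2,\eta_3)$ a $G$-orthonormal frame of $\mathfrak G$, and a repeated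 dot denotes a trace with respect to $G$ over $\mathfrak G$ (with respect to $g$ over $TM$ where the slot requires it). Put $H^2(X,Y)=\sum_{a,b}H(X,e_a,e_b)H(Y,e_a,e_b)$ with $(e_a)=(v,\eta_1,\eta_2,\eta_3)$, $\operatorname{tr}_gH^2=H^2(v,v)$, $|DG|^2=\sum_{i,j}(D_vG(\eta_i,\eta_j))^2$, $|[,]|^2=\sum_{i,j}|[\eta_i,\eta_j]|_G^2$ and $|H^{\mathfrak G}|^2=\sum_{i,j,k}H(\eta_i,\eta_j,\eta_k)^2$. **Flow.** Let $J\subset\mathbb R$ be open and let $(\bar g(t),\bar H(t))$, $t\in J$, be a smooth family of invariant metrics and closed invariant three-forms on $P$ that satisfies the generalized Ricci flow equations in the canonical gauge: for $\eta,\eta'\in\mathfrak G$ and $w,w'\in TM$, $$\begin{aligned} \tfrac{\partial G}{\partial t}(\eta,\eta')&=(D_\cdot DG)_\cdot(\eta,\eta')-D_{\cdot_2}G(\eta,\cdot_1)D_{\cdot_2}G(\cdot_1,\eta')+G([\cdot,\eta],[\cdot,\eta'])-\tfrac12G([\cdot_1,\cdot_2],\eta)G([\cdot_1,\cdot_2],\eta')+\tfrac12H^2(\eta,\eta'),\\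 G\big(\tfrac{\partial A}{\partial t}w,\eta\big)&=D_wG([\cdot,\eta],\cdot)+\tfrac12H^2(w,\eta),\\ \tfrac{\partial g}{\partial t}(w,w')&=\tfrac12D_wG(\cdot_1,\cdot_2)D_{w'}G(\cdot_1,\cdot_2)+\tfrac12H^2(w,w'),\\ \tfrac{\partial\bar H}{\partial t}&=dB,\qquad B=D_\cdot H(\cdot,*,*)-D_{\cdot_1}G(\cdot_2,\pi_{\mathfrak G}*)\wedge H(\cdot_1,\cdot_2,*)+\tfrac12G([\cdot_1,\cdot_2],\pi_{\mathfrak G}*)\wedge H(\cdot_1,\cdot_2,*), \end{aligned}$$ where $\partial\bar H/\partial t$ is viewed as a section of $\Lambda^3\mathcal E^*$ through the splitting at time $t$, $\partial A/\partial t$ is the section of $T^*M\otimes\mathfrak G$ corresponding to $\partial\bar A/\partial t$, $\pi_{\mathfrak G}:\mathcal E\to\mathfrak G$ is the projection, and $(\alpha\wedge\beta)(X,Y)=\alpha(X)\beta(Y)-\alpha(Y)\beta(X)$. **Definitions.** For $\tau>0$ put $$\mathcal I(\bar g,\bar H,\tau)=\tau\int_M\Big(|DG|^2+\operatorname{tr}_gH^2+\tfrac2\tau\Big)\frac{dV_g}{\sqrt\tau}.$$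 Choosing the frame so that $\eta_3$ lies in the centre $Z(\mathfrak G)$, put $$\begin{aligned} S_B={}&2\sum_{i,j}\Big((D_vDG)_v(\eta_i,\eta_j)-\sum_kD_vG(\eta_i,\eta_k)D_vG(\eta_j,\eta_k)+\sum_kH(v,\eta_i,\eta_k)H(v,\eta_j,\eta_k)\Big)^2\\ &+2\sum_{i,j}\Big((D_vH)(v,\eta_i,\eta_j)+\sum_k\big(H(v,\eta_k,\eta_i)D_vG(\eta_k,\eta_j)-H(v,\eta_k,\eta_j)D_vG(\eta_k,\eta_i)\big)\Big)^2\\ &+|[,]|^2\Big(\sum_kD_vG(\eta_k,\eta_k)-2D_vG(\eta_3,\eta_3)\Big)^2+2|[,]|^2\Big(\sum_k D_vG(\eta_k,\eta_3)^2-D_vG(\eta_3,\eta_3)^2\Big)\\ &+2\sum_i\Big(\sum_kD_vG([\eta_k,\eta_i],\eta_k)\Big)^2+2\sum_i\Big(\sum_kD_vG([\eta_k,\eta_i],\eta_k)+H^2(v,\eta_i)\Big)^2\\ &+2\Big|\sum_{i,j}H(v,\eta_i,\eta_j)[\eta_i,\eta_j]\Big|_G^2+\tfrac13|H^{\mathfrak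 G}|^2\Big(\sum_kD_vG(\eta_k,\eta_k)\Big)^2 . \end{aligned}$$ These quantities do not depend on the choice of frame. **Proposition.** For every $t\in J$ with $t>0$, the integrands below are integrable, $s\mapsto\mathcal I(\bar g(s),\bar H(s),s)$ is differentiable at $t$, and $$\frac{d}{dt}\mathcal I(\bar g(t),\bar H(t),t)=-t\int_MS_B\,\frac{dV_g}{\sqrt t}-\frac t4\int_M\Big(|DG|^2+\operatorname{tr}_gH^2-\frac2t\Big)^2\frac{dV_g}{\sqrt t}\le0 .$$ -/

import Mathlib

open scoped Manifold ContDiff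
open MeasureTheory Set

noncomputable section

namespace InvariantFlow

/-- A smooth Lie group has the finite smoothness that Mathlib's Lie algebra of a Lie group uses. -/
instance lieGroupMinSmoothness {E G : Type*} [NormedAddCommGroup E] [NormedSpace ℝ E]
    [TopologicalSpace G] [ChartedSpace E G] [Group G] [LieGroup 𝓘(ℝ, E) ∞ G] :
    LieGroup 𝓘(ℝ, E) (minSmoothness ℝ 3) G :=
  LieGroup.of_le (n := ∞) (by simpa using ENat.LEInfty.out (m := 3))

/-- A smooth principal bundle `P → M` with structure group `G` acting on the right. -/
structure PrincipalBundle (EP EG P M G : Type*)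
    [NormedAddCommGroup EP] [NormedSpace ℝ EP] [NormedAddCommGroup EG] [NormedSpace ℝ EG]
    [TopologicalSpace P] [ChartedSpace EP P] [TopologicalSpace M] [ChartedSpace ℝ M]
    [TopologicalSpace G] [ChartedSpace EG G] [Group G] where
  proj : P → M
  act : P → G → P
  act_one : ∀ p, act p 1 = p
  act_mul : ∀ p a b, act p (a * b) = act (act p a) b
  proj_act : ∀ p a, proj (act p a) = proj p
  contMDiff_proj : ContMDiff 𝓘(ℝ, EP) 𝓘(ℝ, ℝ) ∞ proj
  contMDiff_act : ContMDiff (𝓘(ℝ, EP).prod 𝓘(ℝ, EG)) 𝓘(ℝ, EP) ∞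
    (fun q : P × G => act q.1 q.2)
  locallyTrivial : ∀ m : M, ∃ (U : Set M) (Φ : OpenPartialHomeomorph P (M × G)),
    IsOpen U ∧ m ∈ U ∧ Φ.source = proj ⁻¹' U ∧ Φ.target = U ×ˢ univ ∧
    ContMDiffOn 𝓘(ℝ, EP) (𝓘(ℝ, ℝ).prod 𝓘(ℝ, EG)) ∞ Φ Φ.source ∧
    ContMDiffOn (𝓘(ℝ, ℝ).prod 𝓘(ℝ, EG)) 𝓘(ℝ, EP) ∞ Φ.symm Φ.target ∧
    ∀ p ∈ Φ.source, (Φ p).1 = proj p ∧ ∀ a : G, Φ (act p a) = (proj p, (Φ p).2 * a)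

section Fields

variable {EP P : Type*} [NormedAddCommGroup EP] [NormedSpace ℝ EP]
  [TopologicalSpace P] [ChartedSpace EP P] [IsManifold 𝓘(ℝ, EP) ∞ P]

variable (EP P) in
/-- A (not necessarily smooth) vector field on `P`. -/
abbrev VF : Type _ := (p : P) → TangentSpace 𝓘(ℝ, EP) p

variable (EP P) in
/-- A field of bilinear forms on the tangent spaces of `P`. -/
abbrev BilinField : Type _ :=
  (p : P) → TangentSpace 𝓘(ℝ, EP) p →L[ℝ] TangentSpace 𝓘(ℝ, EP) p →L[ℝ] ℝ

variable (EP P) in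
/-- A field of trilinear forms on the tangent spaces of `P`. -/
abbrev TrilinField : Type _ :=
  (p : P) → TangentSpace 𝓘(ℝ, EP) p →L[ℝ] TangentSpace 𝓘(ℝ, EP) p →L[ℝ]
    TangentSpace 𝓘(ℝ, EP) p →L[ℝ] ℝ

/-- Smoothness of a vector field on a set. -/
def SmoothOn (X : VF EP P) (W : Set P) : Prop :=
  ContMDiffOn 𝓘(ℝ, EP) 𝓘(ℝ, EP).tangent ∞ (fun p => (⟨p, X p⟩ : TangentBundle 𝓘(ℝ, EP) P)) W

/-- The derivative `X[f]` of a function along a vector field. -/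
def dirDeriv (X : VF EP P) (f : P → ℝ) (p : P) : ℝ := mfderiv 𝓘(ℝ, EP) 𝓘(ℝ, ℝ) f p (X p)

/-- The Lie bracket `[X, Y]` of vector fields on `P`. -/
def bracket (X Y : VF EP P) : VF EP P := VectorField.mlieBracket 𝓘(ℝ, EP) X Y

/-- The function `g(X, Y)`. -/
def evalB (g : BilinField EP P) (X Y : VF EP P) (p : P) : ℝ := g p (X p) (Y p)

/-- The function `H(X, Y, Z)`. -/
def evalT (H : TrilinField EP P) (X Y Z : VF EP P) (p : P) : ℝ := H p (X p) (Y p) (Z p)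

/-- The exterior derivative of a two-form, given by its values on vector fields:
`dB(X₁,X₂,X₃) = ∑ (-1)^(i-1) Xᵢ[B(..)] + ∑ (-1)^(i+j) B([Xᵢ,Xⱼ],..)`. -/
def extDeriv₂ (B : VF EP P → VF EP P → P → ℝ) (X Y Z : VF EP P) (p : P) : ℝ :=
  dirDeriv X (B Y Z) p - dirDeriv Y (B X Z) p + dirDeriv Z (B X Y) p
    - B (bracket X Y) Z p + B (bracket X Z) Y p - B (bracket Y Z) X p

/-- The exterior derivative of a three-form, given by its values on vector fields. -/
def extDeriv₃ (H : VF EP P → VF EP P → VF EP P → P → ℝ) (X Y Z W : VF EP P) (p : P) : ℝ :=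
  dirDeriv X (H Y Z W) p - dirDeriv Y (H X Z W) p + dirDeriv Z (H X Y W) p
      - dirDeriv W (H X Y Z) p
    - H (bracket X Y) Z W p + H (bracket X Z) Y W p - H (bracket X W) Y Z p
    - H (bracket Y Z) X W p + H (bracket Y W) X Z p - H (bracket Z W) X Y p

/-- Joint smoothness on `P × J` of a time-dependent field of bilinear forms: its values on smooth
local vector fields (in particular its components in local frames) are smooth on `P × J`. -/
def SmoothFamilyB (J : Set ℝ) (g : ℝ → BilinField EP P) : Prop :=
  ∀ (O : Set P) (X Y : VF EP P), IsOpen O → SmoothOn X O → SmoothOn Y O →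
    ContMDiffOn (𝓘(ℝ, EP).prod 𝓘(ℝ, ℝ)) 𝓘(ℝ, ℝ) ∞
      (fun q : P × ℝ => evalB (g q.2) X Y q.1) (O ×ˢ J)

/-- Joint smoothness on `P × J` of a time-dependent field of trilinear forms. -/
def SmoothFamilyT (J : Set ℝ) (H : ℝ → TrilinField EP P) : Prop :=
  ∀ (O : Set P) (X Y Z : VF EP P), IsOpen O → SmoothOn X O → SmoothOn Y O → SmoothOn Z O →
    ContMDiffOn (𝓘(ℝ, EP).prod 𝓘(ℝ, ℝ)) 𝓘(ℝ, ℝ) ∞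
      (fun q : P × ℝ => evalT (H q.2) X Y Z q.1) (O ×ˢ J)

end Fields

section Bundle

variable {EP EG P M G : Type*}
  [NormedAddCommGroup EP] [NormedSpace ℝ EP] [NormedAddCommGroup EG] [NormedSpace ℝ EG]
  [TopologicalSpace P] [ChartedSpace EP P] [IsManifold 𝓘(ℝ, EP) ∞ P]
  [TopologicalSpace M] [ChartedSpace ℝ M]
  [TopologicalSpace G] [ChartedSpace EG G] [Group G]
  (pb : PrincipalBundle EP EG P M G)

/-- `X` is invariant under the structure group over `U`. -/
def IsInvariantOn (X : VF EP P) (U : Set M) : Prop :=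
  ∀ p, pb.proj p ∈ U → ∀ a : G,
    mfderiv 𝓘(ℝ, EP) 𝓘(ℝ, EP) (fun q => pb.act q a) p (X p) = X (pb.act p a)

/-- `g` is an invariant positive definite inner product on the tangent spaces of `P`. -/
structure IsInvariantMetric (g : BilinField EP P) : Prop where
  symm : ∀ p X Y, g p X Y = g p Y X
  pos : ∀ p X, X ≠ 0 → 0 < g p X X
  invariant : ∀ p (a : G) X Y,
    g (pb.act p a) (mfderiv 𝓘(ℝ, EP) 𝓘(ℝ, EP) (fun q => pb.act q a) p X)
      (mfderiv 𝓘(ℝ, EP) 𝓘(ℝ, EP) (fun q => pb.act q a) p Y) = g p X Y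

/-- `H` is an invariant closed three-form on `P`. -/
structure IsInvariantClosedForm (H : TrilinField EP P) : Prop where
  swap₁ : ∀ p X Y Z, H p X Y Z = - H p Y X Z
  swap₂ : ∀ p X Y Z, H p X Y Z = - H p X Z Y
  invariant : ∀ p (a : G) X Y Z,
    H (pb.act p a) (mfderiv 𝓘(ℝ, EP) 𝓘(ℝ, EP) (fun q => pb.act q a) p X)
      (mfderiv 𝓘(ℝ, EP) 𝓘(ℝ, EP) (fun q => pb.act q a) p Y)
      (mfderiv 𝓘(ℝ, EP) 𝓘(ℝ, EP) (fun q => pb.act q a) p Z) = H p X Y Z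
  closed : ∀ (O : Set P) (X Y Z W : VF EP P), IsOpen O →
    SmoothOn X O → SmoothOn Y O → SmoothOn Z O → SmoothOn W O →
    ∀ p ∈ O, extDeriv₃ (evalT H) X Y Z W p = 0

/-- The horizontal lift to `p` of a tangent vector of `M` at `proj p`: the vector that projects to
it and is orthogonal to the fibre. -/
def horLift (g : BilinField EP P) (p : P) (v : TangentBundle 𝓘(ℝ, ℝ) M) :
    TangentSpace 𝓘(ℝ, EP) p :=
  open Classical in
  if h : ∃ Z : TangentSpace 𝓘(ℝ, EP) p,
      tangentMap 𝓘(ℝ, EP) 𝓘(ℝ, ℝ) pb.proj ⟨p, Z⟩ = v ∧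
      ∀ W : TangentSpace 𝓘(ℝ, EP) p, mfderiv 𝓘(ℝ, EP) 𝓘(ℝ, ℝ) pb.proj p W = 0 → g p Z W = 0
  then h.choose else 0

/-- The vertical part of a tangent vector of `P`. Under the identification of vertical vectors with
elements of the Lie algebra this is the connection form `Ā` of `g`. -/
def connectionForm (g : BilinField EP P) (p : P) (Z : TangentSpace 𝓘(ℝ, EP) p) :
    TangentSpace 𝓘(ℝ, EP) p :=
  Z - horLift pb g p (tangentMap 𝓘(ℝ, EP) 𝓘(ℝ, ℝ) pb.proj ⟨p, Z⟩)

/-- The metric on `M` induced by an invariant metric on `P`. -/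
def baseMetric (g : BilinField EP P) (m : M) (v w : TangentSpace 𝓘(ℝ, ℝ) m) : ℝ :=
  open Classical in
  if h : ∃ p, pb.proj p = m then
    g h.choose (horLift pb g h.choose ⟨m, v⟩) (horLift pb g h.choose ⟨m, w⟩)
  else 0

/-- An orthonormal frame `(V, η₁, η₂, η₃)` of `𝔊 ⊕ TM` near `m`. A section of `𝔊 ⊕ TM` over `U` is
an invariant vector field on the part of `P` over `U`; sections of the adjoint bundle `𝔊` are the
vertical ones and sections of `TM` the horizontal ones. Since `V` is orthogonal to the vertical
`ηᵢ`, it is the horizontal lift of a unit vector field of `M`. -/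
structure OrthonormalFrame (g : BilinField EP P) (m : M) where
  U : Set M
  isOpen : IsOpen U
  mem : m ∈ U
  V : VF EP P
  η : Fin 3 → VF EP P
  smooth_V : SmoothOn V (pb.proj ⁻¹' U)
  smooth_η : ∀ i, SmoothOn (η i) (pb.proj ⁻¹' U)
  invariant_V : IsInvariantOn pb V U
  invariant_η : ∀ i, IsInvariantOn pb (η i) U
  vertical_η : ∀ i p, pb.proj p ∈ U → mfderiv 𝓘(ℝ, EP) 𝓘(ℝ, ℝ) pb.proj p (η i p) = 0
  unit_V : ∀ p, pb.proj p ∈ U → evalB g V V p = 1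
  orthogonal : ∀ i p, pb.proj p ∈ U → evalB g V (η i) p = 0
  orthonormal_η : ∀ i j p, pb.proj p ∈ U → evalB g (η i) (η j) p = if i = j then 1 else 0

namespace OrthonormalFrame

variable {pb} {g : BilinField EP P} {m : M} (F : OrthonormalFrame pb g m)
  (H : TrilinField EP P)

/-- The four fields `V, η₁, η₂, η₃` as one family. -/
def e : Fin 4 → VF EP P := Fin.cons F.V F.η

/-- `η₃` is a section of the centre `Z(𝔊)`. -/
def IsAdapted : Prop := ∀ j p, pb.proj p ∈ F.U → bracket (F.η 2) (F.η j) p = 0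

/-- The component of a section of `𝔊 ⊕ TM` in `𝔊`. -/
def vert (X : VF EP P) : VF EP P := fun p => X p - evalB g X F.V p • F.V p

/-- `D_V X` for a section `X` of `𝔊 ⊕ TM`: on `𝔊` it is `[V, X]`; on `TM` it is the Levi-Civita
connection of the one-dimensional base, for which the unit field `V` is parallel. -/
def covD (X : VF EP P) : VF EP P :=
  fun p => bracket F.V (F.vert X) p + dirDeriv F.V (evalB g X F.V) p • F.V p

/-- `D_V G(X, Y)` for sections `X, Y` of `𝔊`. -/
def DG (X Y : VF EP P) (p : P) : ℝ :=
  dirDeriv F.V (evalB g X Y) p - evalB g (F.covD X) Y p - evalB g X (F.covD Y) p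

/-- `(D_· DG)_·(X, Y)`, that is `(D_V DG)_V(X, Y)`, for sections `X, Y` of `𝔊` (`D_V V = 0`). -/
def DDG (X Y : VF EP P) (p : P) : ℝ :=
  dirDeriv F.V (F.DG X Y) p - F.DG (F.covD X) Y p - F.DG X (F.covD Y) p

/-- `D_V H(X, Y, Z)` for sections `X, Y, Z` of `𝔊 ⊕ TM`. -/
def DH (X Y Z : VF EP P) (p : P) : ℝ :=
  dirDeriv F.V (evalT H X Y Z) p - evalT H (F.covD X) Y Z p - evalT H X (F.covD Y) Z p
    - evalT H X Y (F.covD Z) p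

/-- `H²(X, Y) = ⟨i_X H, i_Y H⟩`, traced over all of `𝔊 ⊕ TM`. -/
def Hsq (X Y : VF EP P) (p : P) : ℝ :=
  ∑ a, ∑ b, evalT H X (F.e a) (F.e b) p * evalT H Y (F.e a) (F.e b) p

/-- `|DG|²`. -/
def normSqDG (p : P) : ℝ := ∑ i, ∑ j, F.DG (F.η i) (F.η j) p ^ 2

/-- `tr_g H² = H²(V, V)`. -/
def trHsq (p : P) : ℝ := F.Hsq H F.V F.V p

/-- `D_V G(·, ·)`. -/
def trDG (p : P) : ℝ := ∑ i, F.DG (F.η i) (F.η i) p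

/-- `D_V G([·, X], ·)`. -/
def trDGbracket (X : VF EP P) (p : P) : ℝ := ∑ i, F.DG (bracket (F.η i) X) (F.η i) p

/-- `|[,]|²`, the square norm of the bracket of `𝔊`. -/
def normSqBracket (p : P) : ℝ :=
  ∑ i, ∑ j, evalB g (bracket (F.η i) (F.η j)) (bracket (F.η i) (F.η j)) p

/-- `|H^𝔊|²`, the square norm of the restriction of `H` to `𝔊`. -/
def normSqHG (p : P) : ℝ := ∑ i, ∑ j, ∑ k, evalT H (F.η i) (F.η j) (F.η k) p ^ 2

/-- The section `H(V, ·₁, ·₂)[·₁, ·₂]` of `𝔊`. -/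
def HVbracket : VF EP P := fun p =>
  ∑ i, ∑ j, evalT H F.V (F.η i) (F.η j) p • bracket (F.η i) (F.η j) p

/-- The two-form `B = D_·H(·,*,*) - D_{·₁}G(·₂, π_𝔊 *) ∧ H(·₁,·₂,*)
+ ½ G([·₁,·₂], π_𝔊 *) ∧ H(·₁,·₂,*)`, where `(α ∧ β)(X, Y) = α(X) β(Y) - α(Y) β(X)`. -/
def B (X Y : VF EP P) (p : P) : ℝ :=
  F.DH H F.V X Y p
    - ∑ k, (F.DG (F.η k) (F.vert X) p * evalT H F.V (F.η k) Y p
        - F.DG (F.η k) (F.vert Y) p * evalT H F.V (F.η k) X p)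
    + (1 / 2) * ∑ k, ∑ l,
        (evalB g (bracket (F.η k) (F.η l)) (F.vert X) p * evalT H (F.η k) (F.η l) Y p
          - evalB g (bracket (F.η k) (F.η l)) (F.vert Y) p * evalT H (F.η k) (F.η l) X p)

/-- The right-hand side of the equation for `∂G/∂t (X, Y)`. -/
def rhsG (X Y : VF EP P) (p : P) : ℝ :=
  F.DDG X Y p - ∑ k, F.DG X (F.η k) p * F.DG (F.η k) Y p
    + ∑ k, evalB g (bracket (F.η k) X) (bracket (F.η k) Y) p
    - (1 / 2) * ∑ k, ∑ l,
        evalB g (bracket (F.η k) (F.η l)) X p * evalB g (bracket (F.η k) (F.η l)) Y p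
    + (1 / 2) * F.Hsq H X Y p

/-- The quantity `S_B`, computed in a frame whose last vector `η₃` lies in `Z(𝔊)`. -/
def SB (p : P) : ℝ :=
  2 * ∑ i, ∑ j, (F.DDG (F.η i) (F.η j) p
      - ∑ k, F.DG (F.η i) (F.η k) p * F.DG (F.η j) (F.η k) p
      + ∑ k, evalT H F.V (F.η i) (F.η k) p * evalT H F.V (F.η j) (F.η k) p) ^ 2
  + 2 * ∑ i, ∑ j, (F.DH H F.V (F.η i) (F.η j) p
      + ∑ k, evalT H F.V (F.η k) (F.η i) p * F.DG (F.η k) (F.η j) p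
      - ∑ k, evalT H F.V (F.η k) (F.η j) p * F.DG (F.η k) (F.η i) p) ^ 2
  + F.normSqBracket p * (F.trDG p - 2 * F.DG (F.η 2) (F.η 2) p) ^ 2
  + 2 * F.normSqBracket p * (∑ k, F.DG (F.η k) (F.η 2) p ^ 2 - F.DG (F.η 2) (F.η 2) p ^ 2)
  + 2 * ∑ i, F.trDGbracket (F.η i) p ^ 2
  + 2 * ∑ i, (F.trDGbracket (F.η i) p + F.Hsq H F.V (F.η i) p) ^ 2
  + 2 * evalB g (F.HVbracket H) (F.HVbracket H) p
  + (1 / 3) * F.normSqHG H p * F.trDG p ^ 2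

end OrthonormalFrame

/-- `|DG|²` as a function on `M` (it does not depend on the chosen frame and point). -/
def normSqDG (g : BilinField EP P) (m : M) : ℝ :=
  open Classical in
  if h : Nonempty ({p : P // pb.proj p = m} × OrthonormalFrame pb g m) then
    h.some.2.normSqDG h.some.1
  else 0

/-- `tr_g H²` as a function on `M` (it does not depend on the chosen frame and point). -/
def trHsq (g : BilinField EP P) (H : TrilinField EP P) (m : M) : ℝ :=
  open Classical in
  if h : Nonempty ({p : P // pb.proj p = m} × OrthonormalFrame pb g m) then
    h.some.2.trHsq H h.some.1
  else 0

/-- `S_B` as a function on `M` (it does not depend on the chosen adapted frame and point; when `𝔊`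
is abelian, the only terms that involve `η₃` have the factor `|[,]|² = 0`). -/
def SB (g : BilinField EP P) (H : TrilinField EP P) (m : M) : ℝ :=
  open Classical in
  if h : Nonempty ({p : P // pb.proj p = m} × {F : OrthonormalFrame pb g m // F.IsAdapted}) then
    h.some.2.1.SB H h.some.1
  else 0

/-- The flow equations in the canonical gauge for a time-dependent invariant metric `g` and
three-form `H` on a principal bundle over a one-dimensional base. They are tensor equations on
`𝔊 ⊕ TM`, written out in orthonormal frames; the frame at time `t` is held fixed when
differentiating in time. -/
structure SatisfiesFlow (J : Set ℝ) (g : ℝ → BilinField EP P) (H : ℝ → TrilinField EP P) :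
    Prop where
  eqG : ∀ t ∈ J, ∀ p, ∀ F : OrthonormalFrame pb (g t) (pb.proj p), ∀ i j,
    HasDerivAt (fun s => g s p (F.η i p) (F.η j p)) (F.rhsG (H t) (F.η i) (F.η j) p) t
  /-- `G(∂A/∂t V, ηᵢ) = D_V G([·, ηᵢ], ·) + ½ H²(V, ηᵢ)` -/
  eqA : ∀ t ∈ J, ∀ p, ∀ F : OrthonormalFrame pb (g t) (pb.proj p), ∀ i,
    HasDerivAt (fun s => g t p (connectionForm pb (g s) p (F.V p)) (F.η i p))
      (F.trDGbracket (F.η i) p + (1 / 2) * F.Hsq (H t) F.V (F.η i) p) t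
  /-- `∂g/∂t(v, v) = ½ |DG|² + ½ H²(V, V)` for the unit tangent vector `v` below `V` -/
  eqg : ∀ t ∈ J, ∀ p, ∀ F : OrthonormalFrame pb (g t) (pb.proj p),
    HasDerivAt (fun s => baseMetric pb (g s) (pb.proj p)
        (mfderiv 𝓘(ℝ, EP) 𝓘(ℝ, ℝ) pb.proj p (F.V p))
        (mfderiv 𝓘(ℝ, EP) 𝓘(ℝ, ℝ) pb.proj p (F.V p)))
      ((1 / 2) * F.normSqDG p + (1 / 2) * F.Hsq (H t) F.V F.V p) t
  eqH : ∀ t ∈ J, ∀ p, ∀ F : OrthonormalFrame pb (g t) (pb.proj p), ∀ a b c,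
    HasDerivAt (fun s => H s p (F.e a p) (F.e b p) (F.e c p))
      (extDeriv₂ (F.B (H t)) (F.e a) (F.e b) (F.e c) p) t

variable [MeasurableSpace M]

/-- The Riemannian volume measure of a metric `g` on a one-dimensional manifold: it is the smallest
measure that dominates, for each chart `x` of the atlas, the image under `x⁻¹` of the measure
`√g(∂ₓ, ∂ₓ) dx`. These local measures agree on overlaps, so it restricts to each of them. -/
def riemannianVolume (g : (m : M) → TangentSpace 𝓘(ℝ, ℝ) m → TangentSpace 𝓘(ℝ, ℝ) m → ℝ) :
    Measure M :=
  ⨆ m₀ : M, Measure.map (chartAt ℝ m₀).symm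
    ((volume.restrict (chartAt ℝ m₀).target).withDensity fun x =>
      ENNReal.ofReal √(g ((chartAt ℝ m₀).symm x)
        (mfderiv 𝓘(ℝ, ℝ) 𝓘(ℝ, ℝ) (chartAt ℝ m₀).symm x (1 : ℝ))
        (mfderiv 𝓘(ℝ, ℝ) 𝓘(ℝ, ℝ) (chartAt ℝ m₀).symm x (1 : ℝ))))

/-- `dV_g` for the metric on `M` induced by `g`. -/
def baseVolume (g : BilinField EP P) : Measure M := riemannianVolume (baseMetric pb g)

/-- The energy `I(ḡ, H̄, τ) = τ ∫_M (|DG|² + tr_g H² + 2/τ) dV_g/√τ`. -/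
def energy (g : BilinField EP P) (H : TrilinField EP P) (τ : ℝ) : ℝ :=
  τ * ∫ m, (normSqDG pb g m + trHsq pb g H m + 2 / τ) / √τ ∂(baseVolume pb g)

end Bundle

end InvariantFlow

end

open InvariantFlow

/-! Put Q = |DG|² + tr_g H², a function on the one-dimensional base. The proof rests on two
evolution equations along the flow: ∂g/∂t = ½ Q g, which is the flow equation for g, and ∂Q/∂t = ΔQ
− ½ Q² − S_B. Given these, the length element changes by ¼ Q dV. Since the energy equals ∫ (√t Q +
2/√t) dV and the Laplacian integrates to zero over the closed manifold M, what remains besides −√t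
S_B is Q/√t − t^(-3/2) − (√t/4) Q², and this is −(√t/4)(Q − 2/t)². This analytic half is
`energy_evolution`. The sign of the derivative follows because every summand of S_B is nonnegative
(`SB_nonneg`).

The equation for Q is proved pointwise at a fixed time t, in an orthonormal frame of g(t) whose last
vertical vector η₃ is central (`exists_isAdapted`). A nilpotent Lie algebra is unimodular, so the
only bracket left is [η₁, η₂] = l η₃ (`IsAdapted.struc_eq`). The Jacobi identity with V determines V
l and shows that D_V preserves the central line wherever l ≠ 0. Closedness of H determines V f for f
= H(η₁, η₂, η₃). At another time s the frame is no longer orthonormal. Therefore Q(s) is rewritten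
in the fixed frame as a sum of two traces tr(G⁻¹ K G⁻¹ Kᵀ)/u. Here G is the Gram matrix of g(s), u
is the g(s)-square length of the horizontal part of V, and K is the derivative of the fibre metric
or the contraction of H along that horizontal part (`normSqDG_eq_normSqVarG`,
`trHsq_eq_normSqVarH`). The flow equations differentiate each ingredient at s = t, where G = 1 and u
= 1. What is left is a polynomial identity between components, `variation_identity`; the assembly is
`hasDerivAt_density`.

The time derivative has to be exchanged with the derivative along V. Invariant functions descend to
the base, so in a base coordinate a family of them is a function φ(x, s) of two real variables, and
the exchange is the symmetry of second derivatives (`hasDerivAt_dirDeriv`). With γ the square length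
of the coordinate vector, V V Q becomes (Q'/√γ)'/√γ (`dirDeriv_dirDeriv_coord`). A partition of
unity and integration by parts in each chart remove this term (`sum_integral_laplacian_eq_zero`).
The volume, defined as a supremum of chart measures, is handled through `riemannianVolume_restrict`:
it restricts to each chart measure. -/

section

open scoped Topology
open Filter

set_option linter.unusedSectionVars false

noncomputable section

namespace InvariantFlow

/-! ### Directional derivatives and Lie brackets of vector fields. -/

section Calculus

variable {EP P : Type*} [NormedAddCommGroup EP] [NormedSpace ℝ EP]
  [TopologicalSpace P] [ChartedSpace EP P]

/-- Smoothness of a function on a set. -/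
abbrev SmoothFun (f : P → ℝ) (W : Set P) : Prop := ContMDiffOn 𝓘(ℝ, EP) 𝓘(ℝ, ℝ) ∞ f W

variable {W : Set P} {p : P} {X Y Z : VF EP P} {f h : P → ℝ}

theorem SmoothFun.mdifferentiableAt (hf : SmoothFun (EP := EP) f W) (hW : IsOpen W) (hp : p ∈ W) :
    MDifferentiableAt 𝓘(ℝ, EP) 𝓘(ℝ, ℝ) f p :=
  (hf.contMDiffAt (hW.mem_nhds hp)).mdifferentiableAt (by simp)

theorem dirDeriv_congr (hfh : f =ᶠ[𝓝 p] h) : dirDeriv X f p = dirDeriv X h p := by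
  unfold dirDeriv
  rw [hfh.mfderiv_eq]
  rfl

theorem dirDeriv_congr_of_eqOn (hW : IsOpen W) (hfh : EqOn f h W) (hp : p ∈ W) :
    dirDeriv X f p = dirDeriv X h p :=
  dirDeriv_congr (hfh.eventuallyEq_of_mem (hW.mem_nhds hp))

theorem dirDeriv_of_eq_zero (h : X p = 0) : dirDeriv X f p = 0 := by
  unfold dirDeriv
  rw [h]
  exact map_zero _

theorem dirDeriv_const (c : ℝ) : dirDeriv X (fun _ => c) p = 0 := by
  have := congrArg (fun L => L (X p)) (mvfderiv_const (I := 𝓘(ℝ, EP)) (x := p) c)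
  exact this

theorem dirDeriv_eq_zero_of_eqOn_const {c : ℝ} (hW : IsOpen W) (hf : ∀ q ∈ W, f q = c)
    (hp : p ∈ W) : dirDeriv X f p = 0 := by
  rw [dirDeriv_congr_of_eqOn (h := fun _ => c) hW hf hp, dirDeriv_const]

theorem dirDeriv_add (hf : MDifferentiableAt 𝓘(ℝ, EP) 𝓘(ℝ, ℝ) f p)
    (hh : MDifferentiableAt 𝓘(ℝ, EP) 𝓘(ℝ, ℝ) h p) :
    dirDeriv X (fun q => f q + h q) p = dirDeriv X f p + dirDeriv X h p :=
  congrArg (fun L => L (X p)) (mvfderiv_add hf hh)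

theorem dirDeriv_sub (hf : MDifferentiableAt 𝓘(ℝ, EP) 𝓘(ℝ, ℝ) f p)
    (hh : MDifferentiableAt 𝓘(ℝ, EP) 𝓘(ℝ, ℝ) h p) :
    dirDeriv X (fun q => f q - h q) p = dirDeriv X f p - dirDeriv X h p :=
  congrArg (fun L => L (X p)) (mvfderiv_sub hf hh)

theorem dirDeriv_mul (hf : MDifferentiableAt 𝓘(ℝ, EP) 𝓘(ℝ, ℝ) f p)
    (hh : MDifferentiableAt 𝓘(ℝ, EP) 𝓘(ℝ, ℝ) h p) :
    dirDeriv X (fun q => f q * h q) p = f p * dirDeriv X h p + h p * dirDeriv X f p :=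
  congrArg (fun L => L (X p)) (mvfderiv_mul hf hh)

theorem dirDeriv_const_mul (c : ℝ) (hf : MDifferentiableAt 𝓘(ℝ, EP) 𝓘(ℝ, ℝ) f p) :
    dirDeriv X (fun q => c * f q) p = c * dirDeriv X f p := by
  rw [dirDeriv_mul (f := fun _ => c) mdifferentiableAt_const hf, dirDeriv_const]
  ring

theorem MDifferentiableAt.sum_fun {ι : Type*} (s : Finset ι) {f : ι → P → ℝ}
    (hf : ∀ i ∈ s, MDifferentiableAt 𝓘(ℝ, EP) 𝓘(ℝ, ℝ) (f i) p) :
    MDifferentiableAt 𝓘(ℝ, EP) 𝓘(ℝ, ℝ) (fun q => ∑ i ∈ s, f i q) p := by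
  classical
  induction s using Finset.induction_on with
  | empty => simpa using mdifferentiableAt_const
  | insert i s hi ih =>
    simp only [Finset.sum_insert hi]
    exact (hf i (by simp)).add (ih fun j hj => hf j (by simp [hj]))

theorem dirDeriv_sum {ι : Type*} (s : Finset ι) {f : ι → P → ℝ}
    (hf : ∀ i ∈ s, MDifferentiableAt 𝓘(ℝ, EP) 𝓘(ℝ, ℝ) (f i) p) :
    dirDeriv X (fun q => ∑ i ∈ s, f i q) p = ∑ i ∈ s, dirDeriv X (f i) p := by
  classical
  induction s using Finset.induction_on with
  | empty => simpa using dirDeriv_const 0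
  | insert i s hi ih =>
    simp only [Finset.sum_insert hi]
    rw [dirDeriv_add (hf i (by simp)) (MDifferentiableAt.sum_fun s fun j hj => hf j (by simp [hj])),
      ih fun j hj => hf j (by simp [hj])]

variable [IsManifold 𝓘(ℝ, EP) ∞ P]

theorem SmoothOn.mdifferentiableAt (hX : SmoothOn X W) (hW : IsOpen W) (hp : p ∈ W) :
    MDifferentiableAt 𝓘(ℝ, EP) 𝓘(ℝ, EP).tangent
      (fun p => (⟨p, X p⟩ : TangentBundle 𝓘(ℝ, EP) P)) p :=
  (ContMDiffOn.contMDiffAt hX (hW.mem_nhds hp)).mdifferentiableAt (by simp)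

theorem SmoothOn.add (hX : SmoothOn X W) (hY : SmoothOn Y W) : SmoothOn (X + Y) W :=
  ContMDiffOn.add_section hX hY

theorem SmoothOn.smul (hf : SmoothFun (EP := EP) f W) (hX : SmoothOn X W) :
    SmoothOn (f • X) W :=
  ContMDiffOn.smul_section hf hX

theorem SmoothOn.sub (hX : SmoothOn X W) (hY : SmoothOn Y W) : SmoothOn (X - Y) W :=
  ContMDiffOn.sub_section hX hY

theorem SmoothOn.zero : SmoothOn (0 : VF EP P) W :=
  (Bundle.contMDiff_zeroSection ℝ _).contMDiffOn

theorem SmoothOn.sum {ι : Type*} (s : Finset ι) {X : ι → VF EP P}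
    (hX : ∀ i ∈ s, SmoothOn (X i) W) : SmoothOn (∑ i ∈ s, X i) W := by
  classical
  induction s using Finset.induction_on with
  | empty => simpa using SmoothOn.zero
  | insert i s hi ih =>
    rw [Finset.sum_insert hi]
    exact (hX i (by simp)).add (ih fun j hj => hX j (by simp [hj]))

theorem SmoothOn.mono {W' : Set P} (hX : SmoothOn X W) (h : W' ⊆ W) : SmoothOn X W' :=
  ContMDiffOn.mono hX h

theorem SmoothOn.congr (hX : SmoothOn X W) (h : EqOn Y X W) : SmoothOn Y W :=
  ContMDiffOn.congr hX fun p hp => by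
    show (⟨p, Y p⟩ : TangentBundle 𝓘(ℝ, EP) P) = ⟨p, X p⟩
    rw [h hp]

theorem SmoothFun.dirDeriv (hf : SmoothFun (EP := EP) f W) (hX : SmoothOn X W) (hW : IsOpen W) :
    SmoothFun (EP := EP) (dirDeriv X f) W := by
  have h1 : ContMDiffOn 𝓘(ℝ, EP).tangent 𝓘(ℝ, ℝ).tangent ∞ (tangentMapWithin 𝓘(ℝ, EP) 𝓘(ℝ, ℝ) f W)
      (Bundle.TotalSpace.proj ⁻¹' W) :=
    hf.contMDiffOn_tangentMapWithin (by simp) hW.uniqueMDiffOn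
  have h2 := (h1.comp hX (fun p hp => hp))
  have h3 := (contMDiff_snd_tangentBundle_modelSpace ℝ 𝓘(ℝ, ℝ) (n := ∞)).comp_contMDiffOn h2
  refine h3.congr fun p hp => ?_
  simp only [Function.comp, tangentMapWithin]
  rw [mfderivWithin_of_isOpen hW hp]
  rfl

theorem SmoothOn.bracket [CompleteSpace EP] (hX : SmoothOn X W) (hY : SmoothOn Y W)
    (hW : IsOpen W) : SmoothOn (bracket X Y) W := by
  intro p hp
  have : IsManifold 𝓘(ℝ, EP) (minSmoothness ℝ 2) P :=
    IsManifold.of_le (n := ∞) (by simpa using ENat.LEInfty.out (m := 2))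
  have : IsManifold 𝓘(ℝ, EP) (((⊤ : ℕ∞) : WithTop ℕ∞) + 1) P :=
    inferInstanceAs (IsManifold 𝓘(ℝ, EP) ∞ P)
  exact (ContMDiffAt.mlieBracket_vectorField (m := ⊤) (n := ⊤)
    (ContMDiffOn.contMDiffAt hX (hW.mem_nhds hp))
    (ContMDiffOn.contMDiffAt hY (hW.mem_nhds hp)) (by simp)).contMDiffWithinAt

theorem bracket_congr {X' Y' : VF EP P} (hW : IsOpen W) (hX : EqOn X X' W) (hY : EqOn Y Y' W)
    (hp : p ∈ W) : bracket X Y p = bracket X' Y' p :=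
  (hX.eventuallyEq_of_mem (hW.mem_nhds hp)).mlieBracket_vectorField_eq
    (hY.eventuallyEq_of_mem (hW.mem_nhds hp))

theorem bracket_swap : bracket X Y p = - bracket Y X p :=
  VectorField.mlieBracket_swap_apply

variable [CompleteSpace EP]

theorem bracket_add_right (hW : IsOpen W) (hY : SmoothOn Y W) (hZ : SmoothOn Z W) (hp : p ∈ W) :
    bracket X (Y + Z) p = bracket X Y p + bracket X Z p :=
  VectorField.mlieBracket_add_right (hY.mdifferentiableAt hW hp) (hZ.mdifferentiableAt hW hp)

theorem bracket_smul_right (hW : IsOpen W) (hf : SmoothFun (EP := EP) f W) (hY : SmoothOn Y W)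
    (hp : p ∈ W) : bracket X (f • Y) p = dirDeriv X f p • Y p + f p • bracket X Y p :=
  VectorField.mlieBracket_smul_right (hf.mdifferentiableAt hW hp) (hY.mdifferentiableAt hW hp)

theorem bracket_zero_right : bracket X (0 : VF EP P) p = 0 := by
  unfold bracket
  rw [VectorField.mlieBracket_zero_right]
  rfl

theorem bracket_sum_smul_right {ι : Type*} (s : Finset ι) {f : ι → P → ℝ} {Y : ι → VF EP P}
    (hW : IsOpen W) (hf : ∀ i ∈ s, SmoothFun (EP := EP) (f i) W) (hY : ∀ i ∈ s, SmoothOn (Y i) W)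
    (hp : p ∈ W) : bracket X (∑ i ∈ s, f i • Y i) p =
      ∑ i ∈ s, (dirDeriv X (f i) p • Y i p + f i p • bracket X (Y i) p) := by
  classical
  induction s using Finset.induction_on with
  | empty => simpa using bracket_zero_right
  | insert i s hi ih =>
    rw [Finset.sum_insert hi, Finset.sum_insert hi,
      bracket_add_right hW ((hY i (by simp)).smul (hf i (by simp)))
        (SmoothOn.sum s fun j hj => (hY j (by simp [hj])).smul (hf j (by simp [hj]))) hp,
      bracket_smul_right hW (hf i (by simp)) (hY i (by simp)) hp,
      ih (fun j hj => hf j (by simp [hj])) (fun j hj => hY j (by simp [hj]))]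

theorem bracket_jacobi (hW : IsOpen W) (hX : SmoothOn X W) (hY : SmoothOn Y W)
    (hZ : SmoothOn Z W) (hp : p ∈ W) :
    bracket X (bracket Y Z) p = bracket (bracket X Y) Z p + bracket Y (bracket X Z) p := by
  have : IsManifold 𝓘(ℝ, EP) (minSmoothness ℝ 3) P :=
    IsManifold.of_le (n := ∞) (by simpa using ENat.LEInfty.out (m := 3))
  have key : ∀ {X : VF EP P}, SmoothOn X W → ContMDiffAt 𝓘(ℝ, EP) 𝓘(ℝ, EP).tangent
      (minSmoothness ℝ 2) (fun p => (⟨p, X p⟩ : TangentBundle 𝓘(ℝ, EP) P)) p := fun hX =>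
    (ContMDiffOn.contMDiffAt hX (hW.mem_nhds hp)).of_le (by simpa using ENat.LEInfty.out (m := 2))
  exact VectorField.leibniz_identity_mlieBracket_apply (key hX) (key hY) (key hZ)

theorem exists_smoothOn_extension (p : P) (v : TangentSpace 𝓘(ℝ, EP) p) :
    ∃ (W : Set P) (Z : VF EP P), IsOpen W ∧ p ∈ W ∧ SmoothOn Z W ∧ Z p = v := by
  obtain ⟨s, hs, h⟩ := FiberBundle.exists_contMDiffOn_extend (k := ∞) 𝓘(ℝ, EP) EP
    (V := fun q : P => TangentSpace 𝓘(ℝ, EP) q) v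
  obtain ⟨W, hWs, hW, hp⟩ := mem_nhds_iff.1 hs
  exact ⟨W, _, hW, hp, ContMDiffOn.mono h hWs, FiberBundle.extend_apply_self EP v⟩

/-- The Jacobi identity for X, Y and fZ, with Z a local field that does not vanish at p, reduces to
the commutator formula for f times Z(p). -/
theorem dirDeriv_bracket (hW : IsOpen W) (hX : SmoothOn X W) (hY : SmoothOn Y W)
    (hf : SmoothFun (EP := EP) f W) (hp : p ∈ W) :
    dirDeriv (bracket X Y) f p = dirDeriv X (dirDeriv Y f) p - dirDeriv Y (dirDeriv X f) p := by
  -- If the tangent space is zero, no such Z exists, but then every directional derivative vanishes.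
  by_cases hn : ∃ v : TangentSpace 𝓘(ℝ, EP) p, v ≠ 0
  swap
  · push Not at hn
    rw [dirDeriv_of_eq_zero (hn _), dirDeriv_of_eq_zero (hn _), dirDeriv_of_eq_zero (hn _), sub_zero]
  obtain ⟨v, hv⟩ := hn
  obtain ⟨W', Z, hW', hp', hZ, rfl⟩ := exists_smoothOn_extension p v
  have hO : IsOpen (W ∩ W') := hW.inter hW'
  have hpO : p ∈ W ∩ W' := ⟨hp, hp'⟩
  replace hX := hX.mono (inter_subset_left (t := W'))
  replace hY := hY.mono (inter_subset_left (t := W'))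
  replace hf : SmoothFun (EP := EP) f (W ∩ W') := hf.mono (inter_subset_left (t := W'))
  replace hZ := hZ.mono (inter_subset_right (s := W))
  have hXf := hf.dirDeriv hX hO
  have hYf := hf.dirDeriv hY hO
  have key : ∀ {A B : VF EP P}, SmoothOn A (W ∩ W') → SmoothOn B (W ∩ W') →
      bracket A (bracket B (f • Z)) p = dirDeriv A (dirDeriv B f) p • Z p
        + dirDeriv B f p • bracket A Z p + dirDeriv A f p • bracket B Z p
        + f p • bracket A (bracket B Z) p := by
    intro A B hA hB
    rw [bracket_congr (X' := A) (Y' := dirDeriv B f • Z + f • bracket B Z) hO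
      (fun q _ => rfl) (fun q hq => bracket_smul_right hO hf hZ hq) hpO,
      bracket_add_right hO (hZ.smul (hf.dirDeriv hB hO)) ((hB.bracket hZ hO).smul hf) hpO,
      bracket_smul_right hO (hf.dirDeriv hB hO) hZ hpO,
      bracket_smul_right hO hf (hB.bracket hZ hO) hpO]
    module
  -- Terms in which f is differentiated once cancel, and those with f undifferentiated form the
  -- Jacobi identity for X, Y, Z; only the second-order terms times Z survive.
  have h1 := bracket_jacobi hO hX hY (hZ.smul hf) hpO
  rw [key hX hY, key hY hX, bracket_smul_right hO hf hZ hpO, bracket_jacobi hO hX hY hZ hpO] at h1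
  have h2 : (dirDeriv (bracket X Y) f p
      - (dirDeriv X (dirDeriv Y f) p - dirDeriv Y (dirDeriv X f) p)) • Z p = 0 := by
    rw [← sub_eq_zero] at h1
    rw [← neg_eq_zero, ← h1]
    module
  rcases smul_eq_zero.1 h2 with h3 | h3
  · linarith
  · exact absurd h3 hv

omit [CompleteSpace EP] in
/-- A tangent vector is determined by the derivatives of functions along it. -/
theorem eq_of_forall_mfderiv_eq {v w : TangentSpace 𝓘(ℝ, EP) p}
    (h : ∀ (W : Set P) (f : P → ℝ), IsOpen W → p ∈ W → SmoothFun (EP := EP) f W →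
      (mfderiv 𝓘(ℝ, EP) 𝓘(ℝ, ℝ) f p v : ℝ) = mfderiv 𝓘(ℝ, EP) 𝓘(ℝ, ℝ) f p w) : v = w := by
  -- The functions `L ∘ extChartAt` with L a continuous linear functional suffice: the chart has
  -- invertible differential and functionals separate points.
  have hinv := isInvertible_mfderiv_extChartAt (I := 𝓘(ℝ, EP)) (mem_extChartAt_source p)
  apply hinv.injective
  refine (SeparatingDual.eq_iff_forall_dual_eq (R := ℝ) (V := EP)).2 fun L => ?_
  have hc : ContMDiffOn 𝓘(ℝ, EP) 𝓘(ℝ, EP) ∞ (extChartAt 𝓘(ℝ, EP) p) (chartAt EP p).source :=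
    contMDiffOn_extChartAt
  have h1 := h (chartAt EP p).source (L ∘ extChartAt 𝓘(ℝ, EP) p) (chartAt EP p).open_source
    (mem_chart_source EP p) (L.contDiff.contMDiff.comp_contMDiffOn hc)
  have h2 : MDifferentiableAt 𝓘(ℝ, EP) 𝓘(ℝ, EP) (extChartAt 𝓘(ℝ, EP) p) p :=
    mdifferentiableAt_extChartAt (mem_chart_source EP p)
  have h3 : MDifferentiableAt 𝓘(ℝ, EP) 𝓘(ℝ, ℝ) L (extChartAt 𝓘(ℝ, EP) p p) :=
    L.differentiableAt.mdifferentiableAt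
  rw [mfderiv_comp p h3 h2] at h1
  simp only [mfderiv_eq_fderiv, ContinuousLinearMap.fderiv] at h1
  exact h1

end Calculus

/-! ### Brackets of related vector fields. -/

section Related

variable {EN N EP P : Type*} [NormedAddCommGroup EN] [NormedSpace ℝ EN] [CompleteSpace EN]
  [TopologicalSpace N] [ChartedSpace EN N] [IsManifold 𝓘(ℝ, EN) ∞ N]
  [NormedAddCommGroup EP] [NormedSpace ℝ EP] [CompleteSpace EP]
  [TopologicalSpace P] [ChartedSpace EP P] [IsManifold 𝓘(ℝ, EP) ∞ P]

omit [CompleteSpace EN] [IsManifold 𝓘(ℝ, EN) ∞ N] [CompleteSpace EP] [IsManifold 𝓘(ℝ, EP) ∞ P] in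
theorem dirDeriv_comp {φ : N → P} {n : N} {X : VF EN N} {f : P → ℝ}
    (hf : MDifferentiableAt 𝓘(ℝ, EP) 𝓘(ℝ, ℝ) f (φ n))
    (hφ : MDifferentiableAt 𝓘(ℝ, EN) 𝓘(ℝ, EP) φ n) :
    dirDeriv X (fun q => f (φ q)) n
      = mfderiv 𝓘(ℝ, EP) 𝓘(ℝ, ℝ) f (φ n) (mfderiv 𝓘(ℝ, EN) 𝓘(ℝ, EP) φ n (X n)) := by
  have := mfderiv_comp n hf hφ
  unfold dirDeriv
  exact congrArg (fun L => L (X n)) this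

/-- The bracket of vector fields that are related by a map. -/
theorem mfderiv_bracket_of_related {φ : N → P} {O : Set N} {W : Set P} {X₁ X₂ : VF EN N}
    {Y₁ Y₂ : VF EP P} (hO : IsOpen O) (hW : IsOpen W)
    (hφ : ContMDiffOn 𝓘(ℝ, EN) 𝓘(ℝ, EP) ∞ φ O) (hmaps : MapsTo φ O W)
    (hX₁ : SmoothOn X₁ O) (hX₂ : SmoothOn X₂ O) (hY₁ : SmoothOn Y₁ W) (hY₂ : SmoothOn Y₂ W)
    (h₁ : ∀ n ∈ O, mfderiv 𝓘(ℝ, EN) 𝓘(ℝ, EP) φ n (X₁ n) = Y₁ (φ n))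
    (h₂ : ∀ n ∈ O, mfderiv 𝓘(ℝ, EN) 𝓘(ℝ, EP) φ n (X₂ n) = Y₂ (φ n)) {n : N} (hn : n ∈ O) :
    mfderiv 𝓘(ℝ, EN) 𝓘(ℝ, EP) φ n (bracket X₁ X₂ n) = bracket Y₁ Y₂ (φ n) := by
  -- Test on a function f: composition with φ turns derivatives along Yᵢ into derivatives along Xᵢ,
  -- so both sides become the same commutator of iterated derivatives.
  refine eq_of_forall_mfderiv_eq fun W' f hW' hp hf => ?_
  have hφd : ∀ {q}, q ∈ O → MDifferentiableAt 𝓘(ℝ, EN) 𝓘(ℝ, EP) φ q := fun hq =>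
    (hφ.contMDiffAt (hO.mem_nhds hq)).mdifferentiableAt (by simp)
  have hV : IsOpen (W ∩ W') := hW.inter hW'
  have hO' : IsOpen (O ∩ φ ⁻¹' W') := hφ.continuousOn.isOpen_inter_preimage hO hW'
  have hn' : n ∈ O ∩ φ ⁻¹' W' := ⟨hn, hp⟩
  replace hφ := hφ.mono (inter_subset_left (t := φ ⁻¹' W'))
  have hmaps' : MapsTo φ (O ∩ φ ⁻¹' W') (W ∩ W') := fun q hq => ⟨hmaps hq.1, hq.2⟩
  replace hX₁ := hX₁.mono (inter_subset_left (t := φ ⁻¹' W'))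
  replace hX₂ := hX₂.mono (inter_subset_left (t := φ ⁻¹' W'))
  replace hY₁ := hY₁.mono (inter_subset_left (t := W'))
  replace hY₂ := hY₂.mono (inter_subset_left (t := W'))
  replace hf : SmoothFun (EP := EP) f (W ∩ W') := hf.mono inter_subset_right
  have comp : ∀ {X : VF EN N} {Y : VF EP P} {k : P → ℝ},
      (∀ q ∈ O, mfderiv 𝓘(ℝ, EN) 𝓘(ℝ, EP) φ q (X q) = Y (φ q)) →
      SmoothFun (EP := EP) k (W ∩ W') → ∀ q ∈ O ∩ φ ⁻¹' W',
      dirDeriv X (fun q => k (φ q)) q = dirDeriv Y k (φ q) := by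
    intro X Y k h hk q hq
    rw [dirDeriv_comp (hk.mdifferentiableAt hV (hmaps' hq)) (hφd hq.1), h q hq.1]
    rfl
  have hfφ : SmoothFun (EP := EN) (fun q => f (φ q)) (O ∩ φ ⁻¹' W') := hf.comp hφ hmaps'
  have e1 : dirDeriv (bracket X₁ X₂) (fun q => f (φ q)) n
      = mfderiv 𝓘(ℝ, EP) 𝓘(ℝ, ℝ) f (φ n)
        (mfderiv 𝓘(ℝ, EN) 𝓘(ℝ, EP) φ n (bracket X₁ X₂ n)) :=
    dirDeriv_comp (hf.mdifferentiableAt hV (hmaps' hn')) (hφd hn)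
  rw [← e1, dirDeriv_bracket hO' hX₁ hX₂ hfφ hn',
    dirDeriv_congr_of_eqOn hO' (comp h₂ hf) hn', dirDeriv_congr_of_eqOn hO' (comp h₁ hf) hn',
    comp h₁ (hf.dirDeriv hY₂ hV) n hn', comp h₂ (hf.dirDeriv hY₁ hV) n hn',
    ← dirDeriv_bracket hV hY₁ hY₂ hf (hmaps' hn')]
  rfl

end Related

/-! ### Smoothness of velocity fields. -/

section PartialDerivative

variable {EN N EP P : Type*} [NormedAddCommGroup EN] [NormedSpace ℝ EN]
  [TopologicalSpace N] [ChartedSpace EN N] [IsManifold 𝓘(ℝ, EN) ∞ N]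
  [NormedAddCommGroup EP] [NormedSpace ℝ EP]
  [TopologicalSpace P] [ChartedSpace EP P] [IsManifold 𝓘(ℝ, EP) ∞ P]

/-- The velocity field of a smooth family of deformations of the identity is smooth. -/
theorem smoothOn_velocity {R : P × N → P} {Ω : Set (P × N)} (hΩ : IsOpen Ω)
    (hR : ContMDiffOn (𝓘(ℝ, EP).prod 𝓘(ℝ, EN)) 𝓘(ℝ, EP) ∞ R Ω) {W : Set P} {n₀ : N}
    (hW : ∀ p ∈ W, (p, n₀) ∈ Ω) (hid : ∀ p ∈ W, R (p, n₀) = p)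
    (ν : TangentSpace 𝓘(ℝ, EN) n₀) {E : VF EP P}
    (hE : ∀ p ∈ W, (E p : EP) = mfderiv 𝓘(ℝ, EN) 𝓘(ℝ, EP) (fun n => R (p, n)) n₀ ν) :
    SmoothOn E W := by
  -- The velocity at p is the tangent map of R applied to the pair (zero vector at p, ν at n₀),
  -- hence a composition of smooth maps between tangent bundles.
  let fg : P → TangentBundle 𝓘(ℝ, EP) P := fun p => Bundle.TotalSpace.mk' EP p 0
  have sfg : ContMDiff 𝓘(ℝ, EP) 𝓘(ℝ, EP).tangent ∞ fg := Bundle.contMDiff_zeroSection ℝ _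
  let fv : P → TangentBundle 𝓘(ℝ, EN) N := fun _ => Bundle.TotalSpace.mk' EN n₀ ν
  have sfv : ContMDiff 𝓘(ℝ, EP) 𝓘(ℝ, EN).tangent ∞ fv := contMDiff_const
  have S₁ := sfg.prodMk sfv
  have S₂ : ContMDiff (𝓘(ℝ, EP).tangent.prod 𝓘(ℝ, EN).tangent)
    (𝓘(ℝ, EP).prod 𝓘(ℝ, EN)).tangent ∞
    (equivTangentBundleProd 𝓘(ℝ, EP) P 𝓘(ℝ, EN) N).symm := contMDiff_equivTangentBundleProd_symm
  have S₃ := hR.contMDiffOn_tangentMapWithin (m := ∞) (by simp) hΩ.uniqueMDiffOn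
  have S := S₃.comp (s := W) ((S₂.comp S₁).contMDiffOn) (fun p hp => hW p hp)
  refine ContMDiffOn.congr S fun p hp => ?_
  have hd : MDifferentiableAt (𝓘(ℝ, EP).prod 𝓘(ℝ, EN)) 𝓘(ℝ, EP) R (p, n₀) :=
    (hR.contMDiffAt (hΩ.mem_nhds (hW p hp))).mdifferentiableAt (by simp)
  have h1 : mfderiv (𝓘(ℝ, EP).prod 𝓘(ℝ, EN)) 𝓘(ℝ, EP) R (p, n₀) ((0 : EP), (ν : EN))
      = mfderiv 𝓘(ℝ, EN) 𝓘(ℝ, EP) (fun n => R (p, n)) n₀ ν := by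
    have h2 := mfderiv_comp (I := 𝓘(ℝ, EN)) n₀ hd
      (mdifferentiableAt_const.prodMk mdifferentiableAt_id : MDifferentiableAt 𝓘(ℝ, EN)
        (𝓘(ℝ, EP).prod 𝓘(ℝ, EN)) (fun n => (p, n)) n₀)
    have h3 := congrArg (fun L => L ν) h2
    rw [mfderiv_prod_right] at h3
    exact h3.symm
  refine Bundle.TotalSpace.ext (hid p hp).symm (heq_of_eq ?_)
  refine (hE p hp).trans (h1.symm.trans ?_)
  change _ = mfderivWithin (𝓘(ℝ, EP).prod 𝓘(ℝ, EN)) 𝓘(ℝ, EP) R Ω (p, n₀) _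
  rw [mfderivWithin_of_isOpen hΩ (hW p hp)]
  rfl

end PartialDerivative

/-! ### Local sections and fibres of a principal bundle. -/

section Bundle

variable {EP EG P M G : Type*}
  [NormedAddCommGroup EP] [NormedSpace ℝ EP] [NormedAddCommGroup EG] [NormedSpace ℝ EG]
  [TopologicalSpace P] [ChartedSpace EP P] [IsManifold 𝓘(ℝ, EP) ∞ P]
  [TopologicalSpace M] [ChartedSpace ℝ M] [IsManifold 𝓘(ℝ, ℝ) ∞ M]
  [TopologicalSpace G] [ChartedSpace EG G] [Group G] [LieGroup 𝓘(ℝ, EG) ∞ G]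

namespace PrincipalBundle

variable (pb : PrincipalBundle EP EG P M G)

theorem isOpen_preimage {U : Set M} (hU : IsOpen U) : IsOpen (pb.proj ⁻¹' U) :=
  hU.preimage pb.contMDiff_proj.continuous

theorem contMDiff_act_right (a : G) :
    ContMDiff 𝓘(ℝ, EP) 𝓘(ℝ, EP) ∞ (fun q => pb.act q a) :=
  pb.contMDiff_act.comp (contMDiff_id.prodMk contMDiff_const)

theorem mdifferentiableAt_act (a : G) (p : P) :
    MDifferentiableAt 𝓘(ℝ, EP) 𝓘(ℝ, EP) (fun q => pb.act q a) p :=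
  (pb.contMDiff_act_right a).mdifferentiableAt (by simp)

theorem mdifferentiableAt_proj (p : P) : MDifferentiableAt 𝓘(ℝ, EP) 𝓘(ℝ, ℝ) pb.proj p :=
  pb.contMDiff_proj.mdifferentiableAt (by simp)

theorem act_act_inv (p : P) (a : G) : pb.act (pb.act p a) a⁻¹ = p := by
  rw [← pb.act_mul, mul_inv_cancel, pb.act_one]

/-- The differential of the projection is invariant under the action. -/
theorem mfderiv_proj_act (p : P) (a : G) (X : TangentSpace 𝓘(ℝ, EP) p) :
    (mfderiv 𝓘(ℝ, EP) 𝓘(ℝ, ℝ) pb.proj (pb.act p a)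
      (mfderiv 𝓘(ℝ, EP) 𝓘(ℝ, EP) (fun q => pb.act q a) p X) : ℝ)
      = mfderiv 𝓘(ℝ, EP) 𝓘(ℝ, ℝ) pb.proj p X := by
  have h := mfderiv_comp p (pb.mdifferentiableAt_proj (pb.act p a)) (pb.mdifferentiableAt_act a p)
  have h2 : pb.proj ∘ (fun q => pb.act q a) = pb.proj := funext fun q => pb.proj_act q a
  rw [h2] at h
  exact (congrArg (fun L => L X) h).symm

/-- A local section `σ` of the bundle together with the induced trivialisation `ψ`. -/
structure Gauge (m : M) where
  U : Set M
  isOpen : IsOpen U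
  mem : m ∈ U
  σ : M → P
  ψ : P → G
  smooth_σ : ContMDiffOn 𝓘(ℝ, ℝ) 𝓘(ℝ, EP) ∞ σ U
  smooth_ψ : ContMDiffOn 𝓘(ℝ, EP) 𝓘(ℝ, EG) ∞ ψ (pb.proj ⁻¹' U)
  proj_σ : ∀ x ∈ U, pb.proj (σ x) = x
  act_ψ : ∀ p, pb.proj p ∈ U → pb.act (σ (pb.proj p)) (ψ p) = p
  ψ_act : ∀ p, pb.proj p ∈ U → ∀ a, ψ (pb.act p a) = ψ p * a
  ψ_σ : ∀ x ∈ U, ψ (σ x) = 1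

/-- A local trivialisation Φ yields σ(x) = Φ⁻¹(x, 1) and ψ the group component of Φ; equivariance of
Φ gives the remaining relations. -/
theorem nonempty_gauge (m : M) : Nonempty (pb.Gauge m) := by
  obtain ⟨U, Φ, hU, hm, hs, ht, hΦ, hΦs, h⟩ := pb.locallyTrivial m
  have key : ∀ x ∈ U, ∀ a : G, Φ.symm (x, a) ∈ Φ.source := fun x hx a =>
    Φ.map_target (by rw [ht]; exact ⟨hx, mem_univ _⟩)
  have hproj : ∀ x ∈ U, ∀ a : G, pb.proj (Φ.symm (x, a)) = x := fun x hx a => by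
    rw [← (h _ (key x hx a)).1, Φ.right_inv (by rw [ht]; exact ⟨hx, mem_univ _⟩)]
  have hψ : ∀ x ∈ U, ∀ a : G, (Φ (Φ.symm (x, a))).2 = a := fun x hx a => by
    rw [Φ.right_inv (by rw [ht]; exact ⟨hx, mem_univ _⟩)]
  refine ⟨⟨U, hU, hm, fun x => Φ.symm (x, 1), fun p => (Φ p).2, ?_, ?_,
    fun x hx => hproj x hx 1, ?_, ?_, fun x hx => hψ x hx 1⟩⟩
  · refine hΦs.comp (contMDiff_id.prodMk contMDiff_const).contMDiffOn fun x hx => ?_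
    rw [mem_preimage, ht]
    exact ⟨hx, mem_univ _⟩
  · rw [← hs]
    exact contMDiff_snd.comp_contMDiffOn hΦ
  · intro p hp
    have hps : p ∈ Φ.source := by rw [hs]; exact hp
    have hσ := key _ hp 1
    have e : Φ (pb.act (Φ.symm (pb.proj p, 1)) (Φ p).2) = Φ p := by
      rw [(h _ hσ).2, hproj _ hp, hψ _ hp, one_mul]
      exact Prod.ext (h p hps).1.symm rfl
    refine Φ.injOn ?_ hps e
    rw [hs, mem_preimage, pb.proj_act, hproj _ hp]
    exact hp
  · intro p hp a
    have hps : p ∈ Φ.source := by rw [hs]; exact hp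
    rw [(h p hps).2]

theorem exists_proj_eq (m : M) : ∃ p, pb.proj p = m := by
  obtain ⟨T⟩ := pb.nonempty_gauge m
  exact ⟨T.σ m, T.proj_σ m T.mem⟩

/-- In a gauge p and q are translates of the same point of the section by ψ(p) and ψ(q), so
ψ(p)⁻¹ψ(q) moves p to q. -/
theorem exists_act_eq {p q : P} (h : pb.proj p = pb.proj q) : ∃ a, pb.act p a = q := by
  obtain ⟨T⟩ := pb.nonempty_gauge (pb.proj q)
  refine ⟨(T.ψ p)⁻¹ * T.ψ q, ?_⟩
  have h1 := T.act_ψ p (by rw [h]; exact T.mem)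
  have h2 := T.act_ψ q T.mem
  calc pb.act p ((T.ψ p)⁻¹ * T.ψ q)
      = pb.act (pb.act (T.σ (pb.proj p)) (T.ψ p)) ((T.ψ p)⁻¹ * T.ψ q) := by rw [h1]
    _ = pb.act (T.σ (pb.proj q)) (T.ψ q) := by rw [← pb.act_mul, mul_inv_cancel_left, h]
    _ = q := h2

end PrincipalBundle

end Bundle

section ChainRule

variable {E₁ E₂ E₃ H₁ H₂ H₃ A B C : Type*}
  [NormedAddCommGroup E₁] [NormedSpace ℝ E₁] [TopologicalSpace H₁] {I₁ : ModelWithCorners ℝ E₁ H₁}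
  [NormedAddCommGroup E₂] [NormedSpace ℝ E₂] [TopologicalSpace H₂] {I₂ : ModelWithCorners ℝ E₂ H₂}
  [NormedAddCommGroup E₃] [NormedSpace ℝ E₃] [TopologicalSpace H₃] {I₃ : ModelWithCorners ℝ E₃ H₃}
  [TopologicalSpace A] [ChartedSpace H₁ A] [TopologicalSpace B] [ChartedSpace H₂ B]
  [TopologicalSpace C] [ChartedSpace H₃ C]

/-- The chain rule, with all tangent vectors read in the model spaces. -/
theorem mfderiv_apply_of_comp_eq {f : A → B} {g : B → C} {k : A → C} {x : A} {y : B}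
    (hg : MDifferentiableAt I₂ I₃ g y) (hf : MDifferentiableAt I₁ I₂ f x) (hy : f x = y)
    (hk : k =ᶠ[𝓝 x] g ∘ f) (v : E₁) :
    (mfderiv I₁ I₃ k x v : E₃) = mfderiv I₂ I₃ g y (mfderiv I₁ I₂ f x v : E₂) := by
  subst hy
  rw [hk.mfderiv_eq]
  have := mfderiv_comp x hg hf
  exact congrArg (fun L => L v) this

end ChainRule

/-! ### Left invariant fields and the vertical tangent spaces. -/

section LieGroupFields

variable {EG G : Type*} [NormedAddCommGroup EG] [NormedSpace ℝ EG]
  [TopologicalSpace G] [ChartedSpace EG G] [Group G] [LieGroup 𝓘(ℝ, EG) ∞ G]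

theorem smoothOn_mulInvariantVectorField (v : GroupLieAlgebra 𝓘(ℝ, EG) G) :
    SmoothOn (mulInvariantVectorField v : VF EG G) univ :=
  smoothOn_velocity (R := fun q : G × G => q.1 * q.2) (n₀ := (1 : G)) isOpen_univ
    (contMDiff_mul 𝓘(ℝ, EG) ∞).contMDiffOn (fun _ _ => mem_univ _) (fun p _ => mul_one p) v
    (fun _ _ => rfl)

end LieGroupFields

section Bundle

variable {EP EG P M G : Type*}
  [NormedAddCommGroup EP] [NormedSpace ℝ EP] [NormedAddCommGroup EG] [NormedSpace ℝ EG]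
  [TopologicalSpace P] [ChartedSpace EP P] [IsManifold 𝓘(ℝ, EP) ∞ P]
  [TopologicalSpace M] [ChartedSpace ℝ M] [IsManifold 𝓘(ℝ, ℝ) ∞ M]
  [TopologicalSpace G] [ChartedSpace EG G] [Group G] [LieGroup 𝓘(ℝ, EG) ∞ G]

namespace PrincipalBundle

variable (pb : PrincipalBundle EP EG P M G)

/-- The parametrisation of a fibre by the structure group, acting by inverses. -/
def orbit (q : P) (b : G) : P := pb.act q b⁻¹

theorem contMDiff_orbit (q : P) : ContMDiff 𝓘(ℝ, EG) 𝓘(ℝ, EP) ∞ (pb.orbit q) :=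
  pb.contMDiff_act.comp (contMDiff_const.prodMk (contMDiff_inv 𝓘(ℝ, EG) ∞))

theorem mdifferentiableAt_orbit (q : P) (b : G) :
    MDifferentiableAt 𝓘(ℝ, EG) 𝓘(ℝ, EP) (pb.orbit q) b :=
  (pb.contMDiff_orbit q).mdifferentiableAt (by simp)

theorem orbit_one (q : P) : pb.orbit q 1 = q := by
  rw [orbit, inv_one, pb.act_one]

theorem proj_orbit (q : P) (b : G) : pb.proj (pb.orbit q b) = pb.proj q := pb.proj_act _ _

/-- The vertical vector at `q` given by an element of the Lie algebra. -/
def vertical (q : P) (ξ : GroupLieAlgebra 𝓘(ℝ, EG) G) : TangentSpace 𝓘(ℝ, EP) q :=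
  (mfderiv 𝓘(ℝ, EG) 𝓘(ℝ, EP) (pb.orbit q) 1 ξ : EP)

theorem vertical_add (q : P) (ξ ζ : GroupLieAlgebra 𝓘(ℝ, EG) G) :
    pb.vertical q (ξ + ζ) = pb.vertical q ξ + pb.vertical q ζ :=
  map_add (mfderiv 𝓘(ℝ, EG) 𝓘(ℝ, EP) (pb.orbit q) 1) ξ ζ

theorem vertical_smul (q : P) (r : ℝ) (ξ : GroupLieAlgebra 𝓘(ℝ, EG) G) :
    pb.vertical q (r • ξ) = r • pb.vertical q ξ :=
  map_smul (mfderiv 𝓘(ℝ, EG) 𝓘(ℝ, EP) (pb.orbit q) 1) r ξ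

/-- The tangent space at `q` splits into the vertical space, a copy of the Lie algebra, and a line
that projects isomorphically to the base. -/
theorem exists_splitting (q : P) : ∃ (K : TangentSpace 𝓘(ℝ, EP) q →L[ℝ] GroupLieAlgebra 𝓘(ℝ, EG) G)
    (S : ℝ →L[ℝ] TangentSpace 𝓘(ℝ, EP) q),
    (∀ ξ, K (pb.vertical q ξ) = ξ) ∧ (∀ r, K (S r) = 0) ∧
    (∀ ξ, (mfderiv 𝓘(ℝ, EP) 𝓘(ℝ, ℝ) pb.proj q (pb.vertical q ξ) : ℝ) = 0) ∧
    (∀ r, (mfderiv 𝓘(ℝ, EP) 𝓘(ℝ, ℝ) pb.proj q (S r) : ℝ) = r) ∧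
    (∀ Z, Z = S (mfderiv 𝓘(ℝ, EP) 𝓘(ℝ, ℝ) pb.proj q Z) + pb.vertical q (K Z)) := by
  obtain ⟨T⟩ := pb.nonempty_gauge (pb.proj q)
  set x₀ := pb.proj q with hx₀
  have hUx : T.U ∈ 𝓝 x₀ := T.isOpen.mem_nhds T.mem
  have hUq : pb.proj ⁻¹' T.U ∈ 𝓝 q := (pb.isOpen_preimage T.isOpen).mem_nhds T.mem
  -- the comparison with the point `q` in the fibre direction
  let lam : P → G := fun p => (T.ψ p)⁻¹ * T.ψ q
  have hlam : ContMDiffAt 𝓘(ℝ, EP) 𝓘(ℝ, EG) ∞ lam q :=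
    ((T.smooth_ψ.contMDiffAt hUq).inv).mul contMDiffAt_const
  have dlam : MDifferentiableAt 𝓘(ℝ, EP) 𝓘(ℝ, EG) lam q := hlam.mdifferentiableAt (by simp)
  -- F composed with p ↦ (π(p), lam p) is the identity near q. Its partial derivative along the base
  -- is the horizontal splitting S, and the one along the group is `vertical q`, because F(x₀, b) =
  -- q b⁻¹.
  let F : M × G → P := fun z => pb.act (T.σ z.1) (T.ψ q * z.2⁻¹)
  have hF : ContMDiffAt (𝓘(ℝ, ℝ).prod 𝓘(ℝ, EG)) 𝓘(ℝ, EP) ∞ F (x₀, 1) := by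
    refine pb.contMDiff_act.contMDiffAt.comp (x₀, (1 : G)) (ContMDiffAt.prodMk ?_ ?_)
    · exact (T.smooth_σ.contMDiffAt hUx).comp (x₀, (1 : G)) contMDiffAt_fst
    · exact contMDiffAt_const.mul contMDiffAt_snd.inv
  have dF : MDifferentiableAt (𝓘(ℝ, ℝ).prod 𝓘(ℝ, EG)) 𝓘(ℝ, EP) F (x₀, 1) :=
    hF.mdifferentiableAt (by simp)
  let s : M → P := fun x => F (x, 1)
  have hs : s = fun x => pb.act (T.σ x) (T.ψ q) := by
    funext x
    simp [s, F]
  have hsq : s x₀ = q := by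
    rw [hs]
    exact T.act_ψ q T.mem
  have ds : MDifferentiableAt 𝓘(ℝ, ℝ) 𝓘(ℝ, EP) s x₀ :=
    dF.comp x₀ (mdifferentiableAt_id.prodMk mdifferentiableAt_const :
      MDifferentiableAt 𝓘(ℝ, ℝ) (𝓘(ℝ, ℝ).prod 𝓘(ℝ, EG)) (fun x => (x, (1 : G))) x₀)
  have hFo : (fun b => F (x₀, b)) = pb.orbit q := by
    funext b
    have := T.act_ψ q T.mem
    simp only [F, orbit, pb.act_mul]
    rw [this]
  have horb1 := pb.orbit_one q
  have hlamq : lam q = 1 := by simp [lam]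
  refine ⟨mfderiv 𝓘(ℝ, EP) 𝓘(ℝ, EG) lam q, mfderiv 𝓘(ℝ, ℝ) 𝓘(ℝ, EP) s x₀, ?_, ?_, ?_, ?_, ?_⟩
  · intro ξ
    have h2 : id = lam ∘ pb.orbit q := by
      funext b
      simp [lam, orbit, T.ψ_act q T.mem]
    have h := mfderiv_apply_of_comp_eq dlam (pb.mdifferentiableAt_orbit q 1) horb1
      (Eq.eventuallyEq h2) ξ
    rw [mfderiv_id] at h
    exact h.symm
  · intro r
    have h2 : (fun _ => 1) =ᶠ[𝓝 x₀] lam ∘ s := by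
      filter_upwards [hUx] with x hx
      simp only [Function.comp, hs, lam]
      rw [T.ψ_act _ (by rw [T.proj_σ x hx]; exact hx), T.ψ_σ x hx]
      simp
    have h := mfderiv_apply_of_comp_eq dlam ds hsq h2 r
    rw [mfderiv_const] at h
    exact h.symm
  · intro ξ
    have h2 : (fun _ => x₀) = pb.proj ∘ pb.orbit q := funext fun b => (pb.proj_orbit q b).symm
    have h := mfderiv_apply_of_comp_eq (pb.mdifferentiableAt_proj q)
      (pb.mdifferentiableAt_orbit q 1) horb1 (Eq.eventuallyEq h2) ξ
    rw [mfderiv_const] at h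
    exact h.symm
  · intro r
    have h2 : id =ᶠ[𝓝 x₀] pb.proj ∘ s := by
      filter_upwards [hUx] with x hx
      simp only [Function.comp, hs, pb.proj_act, T.proj_σ x hx, id]
    have h := mfderiv_apply_of_comp_eq (pb.mdifferentiableAt_proj q) ds hsq h2 r
    rw [mfderiv_id] at h
    exact h.symm
  · intro Z
    have e : id =ᶠ[𝓝 q] F ∘ fun p => (pb.proj p, lam p) := by
      filter_upwards [hUq] with p hp
      simp only [Function.comp, F, lam, mul_inv_rev, inv_inv, mul_inv_cancel_left, id]
      exact (T.act_ψ p hp).symm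
    have dpair := (pb.mdifferentiableAt_proj q).prodMk dlam
    have h := mfderiv_apply_of_comp_eq (y := (x₀, (1 : G))) dF dpair (by rw [hlamq]) e Z
    rw [mfderiv_id, mfderiv_prodMk (pb.mdifferentiableAt_proj q) dlam] at h
    refine Eq.trans h ((mfderiv_prod_eq_add_apply dF).trans ?_)
    have h5 : ∀ v : EG, (mfderiv 𝓘(ℝ, EG) 𝓘(ℝ, EP) (fun z => F (x₀, z)) 1 v : EP)
        = mfderiv 𝓘(ℝ, EG) 𝓘(ℝ, EP) (pb.orbit q) 1 v := by
      intro v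
      rw [hFo]
      rfl
    exact congrArg (@HAdd.hAdd EP EP EP _ (mfderiv 𝓘(ℝ, ℝ) 𝓘(ℝ, EP) s x₀
      (mfderiv 𝓘(ℝ, EP) 𝓘(ℝ, ℝ) pb.proj q Z))) (h5 _)

variable [FiniteDimensional ℝ EP] [FiniteDimensional ℝ EG]

theorem finrank_total (pb : PrincipalBundle EP EG P M G) (q : P) : Module.finrank ℝ EP = 1 + Module.finrank ℝ EG := by
  obtain ⟨K, S, hKv, hKS, hDv, hDS, hZ⟩ := pb.exists_splitting q
  let D : TangentSpace 𝓘(ℝ, EP) q →L[ℝ] ℝ := mfderiv 𝓘(ℝ, EP) 𝓘(ℝ, ℝ) pb.proj q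
  let v : GroupLieAlgebra 𝓘(ℝ, EG) G →ₗ[ℝ] TangentSpace 𝓘(ℝ, EP) q :=
    ⟨⟨pb.vertical q, pb.vertical_add q⟩, pb.vertical_smul q⟩
  let e : TangentSpace 𝓘(ℝ, EP) q ≃ₗ[ℝ] ℝ × GroupLieAlgebra 𝓘(ℝ, EG) G :=
    LinearEquiv.ofLinearMap (D.toLinearMap.prod K.toLinearMap) (S.toLinearMap.coprod v)
      (by
        refine LinearMap.ext fun z => Prod.ext ?_ ?_
        · change D (S z.1 + pb.vertical q z.2) = z.1
          rw [map_add]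
          exact (congrArg₂ (· + ·) (hDS z.1) (hDv z.2)).trans (add_zero _)
        · change K (S z.1 + pb.vertical q z.2) = z.2
          rw [map_add, hKS, hKv, zero_add])
      (LinearMap.ext fun Z => (hZ Z).symm)
  have : Module.Finite ℝ (GroupLieAlgebra 𝓘(ℝ, EG) G) := inferInstanceAs (Module.Finite ℝ EG)
  have h1 := e.finrank_eq
  rw [Module.finrank_prod, Module.finrank_self] at h1
  exact h1

theorem vertical_injective (q : P) : Function.Injective (pb.vertical q) := by
  obtain ⟨K, S, hKv, -⟩ := pb.exists_splitting q
  exact Function.LeftInverse.injective hKv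

theorem exists_vertical_eq (q : P) {Z : TangentSpace 𝓘(ℝ, EP) q}
    (hZ : (mfderiv 𝓘(ℝ, EP) 𝓘(ℝ, ℝ) pb.proj q Z : ℝ) = 0) : ∃ ξ, pb.vertical q ξ = Z := by
  obtain ⟨K, S, -, -, -, -, h⟩ := pb.exists_splitting q
  refine ⟨K Z, ?_⟩
  have h1 := h Z
  have h2 : S (mfderiv 𝓘(ℝ, EP) 𝓘(ℝ, ℝ) pb.proj q Z) = 0 := (congrArg S hZ).trans (map_zero S)
  rw [h2, zero_add] at h1
  exact h1.symm

theorem exists_mfderiv_proj_eq_one (q : P) :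
    ∃ Z : TangentSpace 𝓘(ℝ, EP) q, (mfderiv 𝓘(ℝ, EP) 𝓘(ℝ, ℝ) pb.proj q Z : ℝ) = (1 : ℝ) := by
  obtain ⟨K, S, -, -, -, h, -⟩ := pb.exists_splitting q
  exact ⟨S 1, h 1⟩

variable {pb} in
/-- An invariant vertical field is related, along each fibre, to a left invariant field on the
structure group. -/
theorem mfderiv_orbit_mulInvariantVectorField {X : VF EP P} {U : Set M}
    (hX : IsInvariantOn pb X U) {q : P} (hq : pb.proj q ∈ U) {ξ : GroupLieAlgebra 𝓘(ℝ, EG) G}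
    (hξ : X q = pb.vertical q ξ) (b : G) :
    mfderiv 𝓘(ℝ, EG) 𝓘(ℝ, EP) (pb.orbit q) b (mulInvariantVectorField ξ b) = X (pb.orbit q b) := by
  have h1 := hX q hq b⁻¹
  -- Here q (bc)⁻¹ = (q c⁻¹) b⁻¹: because of the inverse, left multiplication in the group becomes
  -- the right action on the fibre, and left invariant fields match invariant vertical fields
  -- without a sign.
  have h2 : pb.orbit q ∘ (fun c => b * c) = (fun p => pb.act p b⁻¹) ∘ pb.orbit q := by
    funext c
    simp [orbit, pb.act_mul]
  have h3 := mfderiv_apply_of_comp_eq (pb.mdifferentiableAt_act b⁻¹ q)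
    (pb.mdifferentiableAt_orbit q 1) (pb.orbit_one q) (Eq.eventuallyEq h2) ξ
  have h4 := mfderiv_apply_of_comp_eq (x := (1 : G)) (f := fun c => b * c) (y := b)
    (pb.mdifferentiableAt_orbit q b)
    ((contMDiff_mul_left (I := 𝓘(ℝ, EG)) (n := ∞)).mdifferentiableAt (by simp))
    (mul_one b) (Eq.eventuallyEq (f := pb.orbit q ∘ (fun c => b * c)) rfl) ξ
  rw [hξ] at h1
  refine Eq.trans ?_ h1
  exact h4.symm.trans h3

variable [CompleteSpace EG]

variable {pb} in
/-- The bracket of invariant vertical fields is given by the bracket of the Lie algebra. -/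
theorem bracket_eq_vertical {X Y : VF EP P} {U : Set M} (hU : IsOpen U)
    (hX : IsInvariantOn pb X U) (hY : IsInvariantOn pb Y U)
    (sX : SmoothOn X (pb.proj ⁻¹' U)) (sY : SmoothOn Y (pb.proj ⁻¹' U))
    {q : P} (hq : pb.proj q ∈ U) {ξ ζ : GroupLieAlgebra 𝓘(ℝ, EG) G}
    (hξ : X q = pb.vertical q ξ) (hζ : Y q = pb.vertical q ζ) :
    bracket X Y q = pb.vertical q ⁅ξ, ζ⁆ := by
  have hc : CompleteSpace EP := FiniteDimensional.complete ℝ EP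
  have h := mfderiv_bracket_of_related (n := (1 : G)) isOpen_univ (pb.isOpen_preimage hU)
    (pb.contMDiff_orbit q).contMDiffOn
    (fun b _ => by rw [mem_preimage, pb.proj_orbit]; exact hq)
    (smoothOn_mulInvariantVectorField ξ) (smoothOn_mulInvariantVectorField ζ) sX sY
    (fun b _ => mfderiv_orbit_mulInvariantVectorField hX hq hξ b)
    (fun b _ => mfderiv_orbit_mulInvariantVectorField hY hq hζ b) (mem_univ _)
  -- The point `orbit q 1` equals q only propositionally, so the values are compared in the model
  -- space.
  have e : ∀ q', q' = q → (bracket X Y q' : EP) = bracket X Y q := by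
    rintro _ rfl
    rfl
  exact (e _ (pb.orbit_one q)).symm.trans h.symm

end PrincipalBundle

end Bundle

/-! ### Three-dimensional nilpotent Lie algebras. -/

section LieAlgebra

variable {L : Type*} [LieRing L] [LieAlgebra ℝ L]

/-- A nonzero nilpotent Lie algebra has a nonzero central vector; it is completed to three
independent vectors and put in the last place. -/
theorem exists_basis_central (hdim : Module.finrank ℝ L = 3) (hnil : LieRing.IsNilpotent L) :
    ∃ ξ : Fin 3 → L, LinearIndependent ℝ ξ ∧ ∀ ζ, ⁅ξ 2, ζ⁆ = (0 : L) := by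
  have : Nontrivial L := Module.nontrivial_of_finrank_pos (R := ℝ) (by omega)
  have h := LieModule.nontrivial_max_triv_of_isNilpotent ℝ L L
  obtain ⟨⟨z, hz⟩, hz0⟩ := exists_ne (0 : LieModule.maxTrivSubmodule ℝ L L)
  rw [LieModule.mem_maxTrivSubmodule] at hz
  have hz0' : z ≠ 0 := fun h => hz0 (Subtype.ext h)
  have h1 : LinearIndependent ℝ ![z] := LinearIndependent.of_subsingleton (R := ℝ) 0 (by simpa)
  obtain ⟨y, hy⟩ := exists_linearIndependent_cons_of_lt_finrank h1 (by omega)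
  obtain ⟨x, hx⟩ := exists_linearIndependent_cons_of_lt_finrank hy (by omega)
  refine ⟨_, hx, fun ζ => ?_⟩
  change ⁅z, ζ⁆ = (0 : L)
  rw [← lie_skew, hz, neg_zero]

/-- The sum is the trace of ad ξᵢ, which is a nilpotent endomorphism: nilpotent Lie algebras are
unimodular. -/
theorem sum_structure_eq_zero (hdim : Module.finrank ℝ L = 3) (hnil : LieRing.IsNilpotent L)
    {ξ : Fin 3 → L} (hξ : LinearIndependent ℝ ξ) {c : Fin 3 → Fin 3 → Fin 3 → ℝ}
    (hc : ∀ i j, ⁅ξ i, ξ j⁆ = ∑ k, c i j k • ξ k) (i : Fin 3) : ∑ k, c i k k = 0 := by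
  let b := basisOfLinearIndependentOfCardEqFinrank hξ (by simp [hdim])
  have hb : ∀ k, b k = ξ k := fun k => by
    simp [b]
  have h1 := LieModule.isNilpotent_toEnd_of_isNilpotent ℝ L L (ξ i)
  have h2 := (LinearMap.isNilpotent_trace_of_isNilpotent h1).eq_zero
  rw [LinearMap.trace_eq_matrix_trace ℝ b, Matrix.trace] at h2
  rw [← h2]
  refine Finset.sum_congr rfl fun k _ => ?_
  rw [Matrix.diag_apply, LinearMap.toMatrix_apply, hb, LieModule.toEnd_apply_apply, hc]
  simp_rw [← hb]
  simp [Finsupp.single_apply]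

end LieAlgebra

/-! ### Invariant vector fields built from a local trivialisation. -/

section Bundle

variable {EP EG P M G : Type*}
  [NormedAddCommGroup EP] [NormedSpace ℝ EP] [NormedAddCommGroup EG] [NormedSpace ℝ EG]
  [TopologicalSpace P] [ChartedSpace EP P] [IsManifold 𝓘(ℝ, EP) ∞ P]
  [TopologicalSpace M] [ChartedSpace ℝ M] [IsManifold 𝓘(ℝ, ℝ) ∞ M]
  [TopologicalSpace G] [ChartedSpace EG G] [Group G] [LieGroup 𝓘(ℝ, EG) ∞ G]
  {pb : PrincipalBundle EP EG P M G} {U : Set M} {X Y : VF EP P}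

theorem IsInvariantOn.mono (hX : IsInvariantOn pb X U) {U' : Set M} (h : U' ⊆ U) :
    IsInvariantOn pb X U' := fun p hp a => hX p (h hp) a

/-- An invariant field is related to itself by every right translation, and brackets of related
fields are related. -/
theorem IsInvariantOn.bracket [CompleteSpace EP] (hU : IsOpen U)
    (hX : IsInvariantOn pb X U) (hY : IsInvariantOn pb Y U)
    (sX : SmoothOn X (pb.proj ⁻¹' U)) (sY : SmoothOn Y (pb.proj ⁻¹' U)) :
    IsInvariantOn pb (bracket X Y) U := fun p hp a =>
  mfderiv_bracket_of_related (pb.isOpen_preimage hU) (pb.isOpen_preimage hU)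
    (pb.contMDiff_act_right a).contMDiffOn
    (fun q hq => by rw [mem_preimage, pb.proj_act]; exact hq) sX sY sX sY
    (fun q hq => hX q hq a) (fun q hq => hY q hq a) hp

namespace PrincipalBundle.Gauge

variable {m : M} (T : pb.Gauge m)

/-- The deformation of the identity whose velocity is `T.vfield ξ`. -/
def vmap (z : P × G) : P := pb.act (T.σ (pb.proj z.1)) (z.2⁻¹ * T.ψ z.1)

/-- The invariant vertical field given, in the trivialisation, by an element of the Lie algebra. -/
def vfield (ξ : GroupLieAlgebra 𝓘(ℝ, EG) G) : VF EP P := fun p =>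
  (mfderiv 𝓘(ℝ, EG) 𝓘(ℝ, EP) (fun b => T.vmap (p, b)) 1 ξ : EP)

theorem contMDiffOn_vmap :
    ContMDiffOn (𝓘(ℝ, EP).prod 𝓘(ℝ, EG)) 𝓘(ℝ, EP) ∞ T.vmap ((pb.proj ⁻¹' T.U) ×ˢ univ) := by
  refine pb.contMDiff_act.comp_contMDiffOn (ContMDiffOn.prodMk ?_ ?_)
  · exact T.smooth_σ.comp (pb.contMDiff_proj.comp contMDiff_fst).contMDiffOn fun z hz => hz.1
  · exact (contMDiff_snd.inv.contMDiffOn).mul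
      (T.smooth_ψ.comp contMDiff_fst.contMDiffOn fun z hz => hz.1)

theorem vmap_one {p : P} (hp : pb.proj p ∈ T.U) : T.vmap (p, 1) = p := by
  simp only [vmap, inv_one, one_mul]
  exact T.act_ψ p hp

theorem mdifferentiableAt_vmap {p : P} (hp : pb.proj p ∈ T.U) (b : G) :
    MDifferentiableAt 𝓘(ℝ, EG) 𝓘(ℝ, EP) (fun b => T.vmap (p, b)) b := by
  have h := (T.contMDiffOn_vmap.contMDiffAt (x := (p, b))
    (((pb.isOpen_preimage T.isOpen).prod isOpen_univ).mem_nhds ⟨hp, mem_univ _⟩)).mdifferentiableAt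
    (by simp)
  exact h.comp b (mdifferentiableAt_const.prodMk mdifferentiableAt_id : MDifferentiableAt 𝓘(ℝ, EG)
    (𝓘(ℝ, EP).prod 𝓘(ℝ, EG)) (fun b => (p, b)) b)

theorem smoothOn_vfield (ξ : GroupLieAlgebra 𝓘(ℝ, EG) G) :
    SmoothOn (T.vfield ξ) (pb.proj ⁻¹' T.U) :=
  smoothOn_velocity ((pb.isOpen_preimage T.isOpen).prod isOpen_univ) T.contMDiffOn_vmap
    (fun _ hp => ⟨hp, mem_univ _⟩) (fun _ hp => T.vmap_one hp) ξ (fun _ _ => rfl)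

/-- The deformation multiplies ψ(p) by b⁻¹ on the left, so it commutes with the right action. -/
theorem mfderiv_act_vfield (ξ : GroupLieAlgebra 𝓘(ℝ, EG) G) :
    IsInvariantOn pb (T.vfield ξ) T.U := by
  intro p hp a
  have h : (fun b => T.vmap (pb.act p a, b)) = (fun q => pb.act q a) ∘ fun b => T.vmap (p, b) := by
    funext b
    simp only [vmap, Function.comp, pb.proj_act, ← pb.act_mul, T.ψ_act p hp, mul_assoc]
  exact (mfderiv_apply_of_comp_eq (pb.mdifferentiableAt_act a p) (T.mdifferentiableAt_vmap hp 1)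
    (T.vmap_one hp) (Eq.eventuallyEq h) ξ).symm

theorem vfield_σ {x : M} (hx : x ∈ T.U) (ξ : GroupLieAlgebra 𝓘(ℝ, EG) G) :
    T.vfield ξ (T.σ x) = pb.vertical (T.σ x) ξ := by
  have h : (fun b => T.vmap (T.σ x, b)) = pb.orbit (T.σ x) := by
    funext b
    simp only [vmap, PrincipalBundle.orbit, T.proj_σ x hx, T.ψ_σ x hx, mul_one]
  unfold vfield PrincipalBundle.vertical
  rw [h]
  rfl

theorem mfderiv_proj_vfield {p : P} (hp : pb.proj p ∈ T.U) (ξ : GroupLieAlgebra 𝓘(ℝ, EG) G) :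
    (mfderiv 𝓘(ℝ, EP) 𝓘(ℝ, ℝ) pb.proj p (T.vfield ξ p) : ℝ) = 0 := by
  have h : (fun _ : G => pb.proj p) = pb.proj ∘ fun b => T.vmap (p, b) := by
    funext b
    simp only [vmap, Function.comp, pb.proj_act, T.proj_σ _ hp]
  have h1 := mfderiv_apply_of_comp_eq (pb.mdifferentiableAt_proj p) (T.mdifferentiableAt_vmap hp 1)
    (T.vmap_one hp) (Eq.eventuallyEq h) ξ
  rw [mfderiv_const] at h1
  exact h1.symm

/-- The differential of the action of a group element is injective. -/
theorem _root_.InvariantFlow.PrincipalBundle.mfderiv_act_injective (pb : PrincipalBundle EP EG P M G)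
    (p : P) (a : G) :
    Function.Injective (mfderiv 𝓘(ℝ, EP) 𝓘(ℝ, EP) (fun q => pb.act q a) p) := by
  intro v w hvw
  have h : id = (fun q => pb.act q a⁻¹) ∘ fun q => pb.act q a := by
    funext q
    simp [pb.act_act_inv]
  have key : ∀ v : TangentSpace 𝓘(ℝ, EP) p, (v : EP) = mfderiv 𝓘(ℝ, EP) 𝓘(ℝ, EP)
      (fun q => pb.act q a⁻¹) (pb.act p a)
      (mfderiv 𝓘(ℝ, EP) 𝓘(ℝ, EP) (fun q => pb.act q a) p v) := by
    intro v
    have h1 := mfderiv_apply_of_comp_eq (pb.mdifferentiableAt_act a⁻¹ (pb.act p a))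
      (pb.mdifferentiableAt_act a p) rfl (Eq.eventuallyEq h) v
    rw [mfderiv_id] at h1
    exact h1
  have h2 := key v
  rw [hvw] at h2
  exact h2.trans (key w).symm

/-- On the section the fields are the values of the injective map `vertical`; invariance and
injectivity of the differential of the action carry independence along the fibre. -/
theorem linearIndependent_vfield [FiniteDimensional ℝ EP] [FiniteDimensional ℝ EG]
    {ξ : Fin 3 → GroupLieAlgebra 𝓘(ℝ, EG) G}
    (hξ : LinearIndependent ℝ ξ) {p : P} (hp : pb.proj p ∈ T.U) :
    LinearIndependent ℝ (fun i => T.vfield (ξ i) p) := by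
  have key : ∀ p', p' = p → LinearIndependent ℝ (fun i => T.vfield (ξ i) p') →
      LinearIndependent ℝ (fun i => T.vfield (ξ i) p) := by
    rintro _ rfl h
    exact h
  refine key _ (T.act_ψ p hp) ?_
  have hσ : pb.proj (T.σ (pb.proj p)) ∈ T.U := by rw [T.proj_σ _ hp]; exact hp
  have h1 : LinearIndependent ℝ (fun i => T.vfield (ξ i) (T.σ (pb.proj p))) := by
    simp_rw [T.vfield_σ hp]
    let v : GroupLieAlgebra 𝓘(ℝ, EG) G →ₗ[ℝ] TangentSpace 𝓘(ℝ, EP) (T.σ (pb.proj p)) :=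
      ⟨⟨pb.vertical _, pb.vertical_add _⟩, pb.vertical_smul _⟩
    exact hξ.map' v (LinearMap.ker_eq_bot.2 (pb.vertical_injective _))
  have h2 := h1.map' (mfderiv 𝓘(ℝ, EP) 𝓘(ℝ, EP) (fun q => pb.act q (T.ψ p))
    (T.σ (pb.proj p))).toLinearMap (LinearMap.ker_eq_bot.2 (pb.mfderiv_act_injective _ _))
  have h3 : ∀ i, mfderiv 𝓘(ℝ, EP) 𝓘(ℝ, EP) (fun q => pb.act q (T.ψ p)) (T.σ (pb.proj p))
      (T.vfield (ξ i) (T.σ (pb.proj p))) = T.vfield (ξ i) (pb.act (T.σ (pb.proj p)) (T.ψ p)) :=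
    fun i => T.mfderiv_act_vfield (ξ i) _ hσ _
  convert! h2 using 1
  funext i
  exact (h3 i).symm

/-- On the section the bracket is the vertical vector of ⁅ξ, ζ⁆, and it is an invariant field, so it
vanishes along the whole fibre. -/
theorem bracket_vfield [FiniteDimensional ℝ EP] [FiniteDimensional ℝ EG] [CompleteSpace EG]
    {ξ ζ : GroupLieAlgebra 𝓘(ℝ, EG) G} (h : ⁅ξ, ζ⁆ = 0) {p : P} (hp : pb.proj p ∈ T.U) :
    bracket (T.vfield ξ) (T.vfield ζ) p = 0 := by
  have hc : CompleteSpace EP := FiniteDimensional.complete ℝ EP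
  have hσ : pb.proj (T.σ (pb.proj p)) ∈ T.U := by rw [T.proj_σ _ hp]; exact hp
  have h1 := PrincipalBundle.bracket_eq_vertical T.isOpen (T.mfderiv_act_vfield ξ)
    (T.mfderiv_act_vfield ζ) (T.smoothOn_vfield ξ) (T.smoothOn_vfield ζ) hσ
    (T.vfield_σ hp ξ) (T.vfield_σ hp ζ)
  have h2 := (T.mfderiv_act_vfield ξ).bracket T.isOpen (T.mfderiv_act_vfield ζ)
    (T.smoothOn_vfield ξ) (T.smoothOn_vfield ζ) _ hσ (T.ψ p)
  have h3 : pb.vertical (T.σ (pb.proj p)) 0 = 0 := by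
    simpa using pb.vertical_smul (T.σ (pb.proj p)) 0 0
  rw [h1, h, h3] at h2
  have key : ∀ p', p' = p → bracket (T.vfield ξ) (T.vfield ζ) p' = 0 →
      bracket (T.vfield ξ) (T.vfield ζ) p = 0 := by
    rintro _ rfl h
    exact h
  exact key _ (T.act_ψ p hp) (h2.symm.trans (map_zero _))

/-- The deformation of the identity along the base whose velocity is `T.hfield`. -/
def hmap (z : P × ℝ) : P :=
  pb.act (T.σ ((chartAt ℝ m).symm (chartAt ℝ m (pb.proj z.1) + z.2))) (T.ψ z.1)

/-- An invariant field transversal to the fibres. -/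
def hfield : VF EP P := fun p =>
  (mfderiv 𝓘(ℝ, ℝ) 𝓘(ℝ, EP) (fun y => T.hmap (p, y)) 0 (1 : ℝ) : EP)

/-- The domain of `T.hmap`. -/
def hdomain : Set (P × ℝ) :=
  {z | z.1 ∈ pb.proj ⁻¹' (T.U ∩ (chartAt ℝ m).source)} ∩
    (fun z => chartAt ℝ m (pb.proj z.1) + z.2) ⁻¹'
      ((chartAt ℝ m).target ∩ (chartAt ℝ m).symm ⁻¹' T.U)

theorem contMDiffOn_shift : ContMDiffOn (𝓘(ℝ, EP).prod 𝓘(ℝ, ℝ)) 𝓘(ℝ, ℝ) ∞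
    (fun z : P × ℝ => chartAt ℝ m (pb.proj z.1) + z.2)
    {z | z.1 ∈ pb.proj ⁻¹' (T.U ∩ (chartAt ℝ m).source)} :=
  ((contMDiffOn_chart (I := 𝓘(ℝ, ℝ))).comp
    (pb.contMDiff_proj.comp contMDiff_fst).contMDiffOn fun z hz => hz.2).add
    contMDiff_snd.contMDiffOn

theorem isOpen_hdomain : IsOpen T.hdomain := by
  have h1 : IsOpen {z : P × ℝ | z.1 ∈ pb.proj ⁻¹' (T.U ∩ (chartAt ℝ m).source)} :=
    (pb.isOpen_preimage (T.isOpen.inter (chartAt ℝ m).open_source)).preimage continuous_fst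
  exact T.contMDiffOn_shift.continuousOn.isOpen_inter_preimage h1
    ((chartAt ℝ m).isOpen_inter_preimage_symm T.isOpen)

theorem contMDiffOn_hmap :
    ContMDiffOn (𝓘(ℝ, EP).prod 𝓘(ℝ, ℝ)) 𝓘(ℝ, EP) ∞ T.hmap T.hdomain := by
  refine pb.contMDiff_act.comp_contMDiffOn (ContMDiffOn.prodMk ?_ ?_)
  · exact T.smooth_σ.comp ((contMDiffOn_chart_symm (I := 𝓘(ℝ, ℝ))).comp
      (T.contMDiffOn_shift.mono inter_subset_left) fun z hz => hz.2.1) fun z hz => hz.2.2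
  · exact T.smooth_ψ.comp contMDiff_fst.contMDiffOn fun z hz => hz.1.1

theorem mem_hdomain {p : P} (hp : pb.proj p ∈ T.U ∩ (chartAt ℝ m).source) :
    (p, (0 : ℝ)) ∈ T.hdomain := by
  refine ⟨hp, ?_⟩
  simp only [mem_preimage, add_zero]
  exact ⟨(chartAt ℝ m).map_source hp.2, by rw [mem_preimage, (chartAt ℝ m).left_inv hp.2]; exact hp.1⟩

theorem hmap_zero {p : P} (hp : pb.proj p ∈ T.U ∩ (chartAt ℝ m).source) : T.hmap (p, 0) = p := by
  simp only [hmap, add_zero, (chartAt ℝ m).left_inv hp.2]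
  exact T.act_ψ p hp.1

theorem mdifferentiableAt_hmap {p : P} (hp : pb.proj p ∈ T.U ∩ (chartAt ℝ m).source) :
    MDifferentiableAt 𝓘(ℝ, ℝ) 𝓘(ℝ, EP) (fun y => T.hmap (p, y)) 0 := by
  have h := (T.contMDiffOn_hmap.contMDiffAt (x := (p, (0 : ℝ)))
    (T.isOpen_hdomain.mem_nhds (T.mem_hdomain hp))).mdifferentiableAt (by simp)
  exact h.comp (0 : ℝ) (mdifferentiableAt_const.prodMk mdifferentiableAt_id :
    MDifferentiableAt 𝓘(ℝ, ℝ) (𝓘(ℝ, EP).prod 𝓘(ℝ, ℝ)) (fun b => (p, b)) (0 : ℝ))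

theorem smoothOn_hfield : SmoothOn T.hfield (pb.proj ⁻¹' (T.U ∩ (chartAt ℝ m).source)) :=
  smoothOn_velocity T.isOpen_hdomain T.contMDiffOn_hmap (fun _ hp => T.mem_hdomain hp)
    (fun _ hp => T.hmap_zero hp) (1 : ℝ) (fun _ _ => rfl)

theorem mfderiv_act_hfield : IsInvariantOn pb T.hfield (T.U ∩ (chartAt ℝ m).source) := by
  intro p hp a
  have h : (fun y => T.hmap (pb.act p a, y)) = (fun q => pb.act q a) ∘ fun y => T.hmap (p, y) := by
    funext b
    simp only [hmap, Function.comp, pb.proj_act, ← pb.act_mul, T.ψ_act p hp.1]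
  exact (mfderiv_apply_of_comp_eq (pb.mdifferentiableAt_act a p) (T.mdifferentiableAt_hmap hp)
    (T.hmap_zero hp) (Eq.eventuallyEq h) (1 : ℝ)).symm

/-- In the base chart the deformation is the translation by y, whose velocity is 1. -/
theorem mfderiv_proj_hfield {p : P} (hp : pb.proj p ∈ T.U ∩ (chartAt ℝ m).source) :
    (mfderiv 𝓘(ℝ, EP) 𝓘(ℝ, ℝ) pb.proj p (T.hfield p) : ℝ) ≠ 0 := by
  intro h0
  have hd : MDifferentiableAt 𝓘(ℝ, ℝ) 𝓘(ℝ, ℝ) (chartAt ℝ m) (pb.proj p) :=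
    (mdifferentiable_chart (I := 𝓘(ℝ, ℝ)) m).mdifferentiableAt hp.2
  have hcomp : MDifferentiableAt 𝓘(ℝ, EP) 𝓘(ℝ, ℝ) (fun q => chartAt ℝ m (pb.proj q)) p :=
    hd.comp p (pb.mdifferentiableAt_proj p)
  have hopen : {y : ℝ | (p, y) ∈ T.hdomain} ∈ 𝓝 (0 : ℝ) :=
    (T.isOpen_hdomain.preimage (Continuous.prodMk_right p)).mem_nhds (T.mem_hdomain hp)
  have h : (fun y : ℝ => chartAt ℝ m (pb.proj p) + y) =ᶠ[𝓝 0]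
      (fun q => chartAt ℝ m (pb.proj q)) ∘ fun y => T.hmap (p, y) := by
    filter_upwards [hopen] with y hy
    simp only [hmap, Function.comp, pb.proj_act]
    rw [T.proj_σ _ hy.2.2, (chartAt ℝ m).right_inv hy.2.1]
  have h1 := mfderiv_apply_of_comp_eq hcomp (T.mdifferentiableAt_hmap hp) (T.hmap_zero hp) h (1 : ℝ)
  have h2 := mfderiv_apply_of_comp_eq hd (pb.mdifferentiableAt_proj p) rfl
    (Eq.eventuallyEq (f := fun q => chartAt ℝ m (pb.proj q)) rfl) (T.hfield p)
  have h3 : (mfderiv 𝓘(ℝ, EP) 𝓘(ℝ, ℝ) (fun q => chartAt ℝ m (pb.proj q)) p (T.hfield p) : ℝ) = 0 :=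
    h2.trans ((congrArg (mfderiv 𝓘(ℝ, ℝ) 𝓘(ℝ, ℝ) (chartAt ℝ m) (pb.proj p)) h0).trans (map_zero _))
  have h4 := h1.trans h3
  rw [mfderiv_eq_fderiv] at h4
  have h5 : fderiv ℝ (fun y : ℝ => chartAt ℝ m (pb.proj p) + y) 0 (1 : ℝ) = 1 := by
    rw [fderiv_const_add]
    simp
  exact one_ne_zero (α := ℝ) (h5.symm.trans h4)

end PrincipalBundle.Gauge

end Bundle

/-! ### Invariant functions, invariant fields and the Gram-Schmidt step. -/

section Bundle

variable {EP EG P M G : Type*}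
  [NormedAddCommGroup EP] [NormedSpace ℝ EP] [NormedAddCommGroup EG] [NormedSpace ℝ EG]
  [TopologicalSpace P] [ChartedSpace EP P] [IsManifold 𝓘(ℝ, EP) ∞ P]
  [TopologicalSpace M] [ChartedSpace ℝ M] [IsManifold 𝓘(ℝ, ℝ) ∞ M]
  [TopologicalSpace G] [ChartedSpace EG G] [Group G] [LieGroup 𝓘(ℝ, EG) ∞ G]

/-- Smooth invariant vector fields over `U`. -/
structure InvField (pb : PrincipalBundle EP EG P M G) (X : VF EP P) (U : Set M) : Prop where
  smooth : SmoothOn X (pb.proj ⁻¹' U)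
  inv : IsInvariantOn pb X U

/-- Smooth invariant functions over `U`. -/
structure InvFun (pb : PrincipalBundle EP EG P M G) (f : P → ℝ) (U : Set M) : Prop where
  smooth : SmoothFun (EP := EP) f (pb.proj ⁻¹' U)
  inv : ∀ p, pb.proj p ∈ U → ∀ a, f (pb.act p a) = f p

/-- Vertical vector fields over `U`. -/
def IsVertical (pb : PrincipalBundle EP EG P M G) (X : VF EP P) (U : Set M) : Prop :=
  ∀ p, pb.proj p ∈ U → (mfderiv 𝓘(ℝ, EP) 𝓘(ℝ, ℝ) pb.proj p (X p) : ℝ) = 0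

variable {pb : PrincipalBundle EP EG P M G} {U U' : Set M} {X Y Z : VF EP P} {f h : P → ℝ}

namespace InvFun

theorem mono (hf : InvFun pb f U) (h : U' ⊆ U) : InvFun pb f U' :=
  ⟨hf.smooth.mono (preimage_mono h), fun p hp a => hf.inv p (h hp) a⟩

theorem congr {f' : P → ℝ} (hf : InvFun pb f U) (h : ∀ p, pb.proj p ∈ U → f' p = f p) : InvFun pb f' U :=
  ⟨hf.smooth.congr h, fun p hp a => by
    rw [h p hp, h _ (by rw [pb.proj_act]; exact hp), hf.inv p hp]⟩

theorem const (c : ℝ) : InvFun pb (fun _ => c) U := ⟨contMDiffOn_const, fun _ _ _ => rfl⟩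

theorem add (hf : InvFun pb f U) (hh : InvFun pb h U) : InvFun pb (fun p => f p + h p) U :=
  ⟨hf.smooth.add hh.smooth, fun p hp a => by rw [hf.inv p hp, hh.inv p hp]⟩

theorem neg (hf : InvFun pb f U) : InvFun pb (fun p => - f p) U :=
  ⟨hf.smooth.neg, fun p hp a => by rw [hf.inv p hp]⟩

theorem sub (hf : InvFun pb f U) (hh : InvFun pb h U) : InvFun pb (fun p => f p - h p) U :=
  ⟨hf.smooth.sub hh.smooth, fun p hp a => by rw [hf.inv p hp, hh.inv p hp]⟩

theorem mul (hf : InvFun pb f U) (hh : InvFun pb h U) : InvFun pb (fun p => f p * h p) U :=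
  ⟨hf.smooth.mul hh.smooth, fun p hp a => by rw [hf.inv p hp, hh.inv p hp]⟩

theorem sum {ι : Type*} (s : Finset ι) {f : ι → P → ℝ} (hf : ∀ i ∈ s, InvFun pb (f i) U) :
    InvFun pb (fun p => ∑ i ∈ s, f i p) U :=
  ⟨contMDiffOn_finsetSum fun i hi => (hf i hi).smooth,
    fun p hp a => Finset.sum_congr rfl fun i hi => (hf i hi).inv p hp a⟩

theorem comp {φ : ℝ → ℝ} (hf : InvFun pb f U)
    (hφ : ∀ p, pb.proj p ∈ U → ContDiffAt ℝ ∞ φ (f p)) : InvFun pb (fun p => φ (f p)) U :=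
  ⟨fun p hp => ((hφ p hp).contMDiffAt).comp_contMDiffWithinAt p (hf.smooth p hp),
    fun p hp a => by rw [hf.inv p hp]⟩

theorem mdifferentiableAt (hf : InvFun pb f U) (hU : IsOpen U) {p : P} (hp : pb.proj p ∈ U) :
    MDifferentiableAt 𝓘(ℝ, EP) 𝓘(ℝ, ℝ) f p :=
  hf.smooth.mdifferentiableAt (pb.isOpen_preimage hU) hp

theorem dirDeriv (hf : InvFun pb f U) (hX : InvField pb X U) (hU : IsOpen U) :
    InvFun pb (dirDeriv X f) U := by
  refine ⟨hf.smooth.dirDeriv hX.smooth (pb.isOpen_preimage hU), fun p hp a => ?_⟩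
  have hp' : pb.proj (pb.act p a) ∈ U := by rw [pb.proj_act]; exact hp
  have h : f =ᶠ[𝓝 p] f ∘ fun q => pb.act q a := by
    filter_upwards [(pb.isOpen_preimage hU).mem_nhds hp] with q hq
    exact (hf.inv q hq a).symm
  have h1 := mfderiv_apply_of_comp_eq (hf.mdifferentiableAt hU hp') (pb.mdifferentiableAt_act a p)
    rfl h (X p)
  have h2 := hX.inv p hp a
  unfold InvariantFlow.dirDeriv
  rw [← h2]
  exact h1.symm

/-- Invariant functions are constant along the fibres. -/
theorem dirDeriv_eq_zero [FiniteDimensional ℝ EP] [FiniteDimensional ℝ EG] (hf : InvFun pb f U)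
    (hU : IsOpen U) {p : P} (hp : pb.proj p ∈ U)
    (hX : (mfderiv 𝓘(ℝ, EP) 𝓘(ℝ, ℝ) pb.proj p (X p) : ℝ) = 0) :
    InvariantFlow.dirDeriv X f p = 0 := by
  obtain ⟨ξ, hξ⟩ := pb.exists_vertical_eq p hX
  have h : (fun _ => f p) = f ∘ pb.orbit p := funext fun b => (hf.inv p hp b⁻¹).symm
  have h1 := mfderiv_apply_of_comp_eq (hf.mdifferentiableAt hU hp) (pb.mdifferentiableAt_orbit p 1)
    (pb.orbit_one p) (Eq.eventuallyEq h) ξ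
  rw [mfderiv_const] at h1
  unfold InvariantFlow.dirDeriv
  rw [← hξ]
  exact h1.symm

end InvFun

namespace InvField

theorem mono (hX : InvField pb X U) (h : U' ⊆ U) : InvField pb X U' :=
  ⟨hX.smooth.mono (preimage_mono h), hX.inv.mono h⟩

theorem add (hX : InvField pb X U) (hY : InvField pb Y U) : InvField pb (X + Y) U :=
  ⟨hX.smooth.add hY.smooth, fun p hp a => (map_add _ _ _).trans
    (congrArg₂ (· + ·) (hX.inv p hp a) (hY.inv p hp a))⟩

theorem sub (hX : InvField pb X U) (hY : InvField pb Y U) : InvField pb (X - Y) U :=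
  ⟨hX.smooth.sub hY.smooth, fun p hp a => (map_sub _ _ _).trans
    (congrArg₂ (· - ·) (hX.inv p hp a) (hY.inv p hp a))⟩

theorem zero : InvField pb (0 : VF EP P) U := ⟨SmoothOn.zero, fun _ _ _ => map_zero _⟩

theorem smul (hf : InvFun pb f U) (hX : InvField pb X U) : InvField pb (f • X) U :=
  ⟨hX.smooth.smul hf.smooth, fun p hp a => (map_smul _ _ _).trans
    (congrArg₂ (· • ·) (hf.inv p hp a).symm (hX.inv p hp a))⟩

theorem sum {ι : Type*} (s : Finset ι) {X : ι → VF EP P}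
    (hX : ∀ i ∈ s, InvField pb (X i) U) : InvField pb (∑ i ∈ s, X i) U := by
  classical
  induction s using Finset.induction_on with
  | empty => simpa using InvField.zero
  | insert i s hi ih =>
    rw [Finset.sum_insert hi]
    exact (hX i (by simp)).add (ih fun j hj => hX j (by simp [hj]))

theorem bracket [CompleteSpace EP] (hU : IsOpen U) (hX : InvField pb X U) (hY : InvField pb Y U) :
    InvField pb (bracket X Y) U :=
  ⟨hX.smooth.bracket hY.smooth (pb.isOpen_preimage hU),
    hX.inv.bracket hU hY.inv hX.smooth hY.smooth⟩

end InvField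

namespace IsVertical

theorem add (hX : IsVertical pb X U) (hY : IsVertical pb Y U) : IsVertical pb (X + Y) U :=
  fun p hp => (map_add _ _ _).trans ((congrArg₂ (· + ·) (hX p hp) (hY p hp)).trans (add_zero 0))

theorem sub (hX : IsVertical pb X U) (hY : IsVertical pb Y U) : IsVertical pb (X - Y) U :=
  fun p hp => (map_sub _ _ _).trans ((congrArg₂ (· - ·) (hX p hp) (hY p hp)).trans (sub_zero 0))

theorem smul (hX : IsVertical pb X U) : IsVertical pb (f • X) U :=
  fun p hp => (map_smul _ _ _).trans ((congrArg (f p • ·) (hX p hp)).trans (smul_zero (f p)))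

theorem zero : IsVertical pb (0 : VF EP P) U := fun _ _ => map_zero _

theorem sum {ι : Type*} (s : Finset ι) {X : ι → VF EP P} (hX : ∀ i ∈ s, IsVertical pb (X i) U) :
    IsVertical pb (∑ i ∈ s, X i) U := by
  classical
  induction s using Finset.induction_on with
  | empty => simpa using IsVertical.zero
  | insert i s hi ih =>
    rw [Finset.sum_insert hi]
    exact (hX i (by simp)).add (ih fun j hj => hX j (by simp [hj]))

/-- The bracket of an invariant field with an invariant vertical field is vertical. -/
theorem bracket [FiniteDimensional ℝ EP] [FiniteDimensional ℝ EG] (hU : IsOpen U)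
    (hX : InvField pb X U) (hY : InvField pb Y U) (hv : IsVertical pb Y U) :
    IsVertical pb (bracket X Y) U := by
  have hc : CompleteSpace EP := FiniteDimensional.complete ℝ EP
  intro p hp
  set c := chartAt ℝ (pb.proj p) with hcdef
  have hO : IsOpen (U ∩ c.source) := hU.inter c.open_source
  have hpO : pb.proj p ∈ U ∩ c.source := ⟨hp, mem_chart_source ℝ _⟩
  -- Verticality of [X, Y] is tested on the base coordinate c ∘ π. In X(Y c) − Y(X c) the first term
  -- vanishes because Y is vertical, the second because X c is an invariant function.
  have hf : InvFun pb (fun q => c (pb.proj q)) (U ∩ c.source) :=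
    ⟨(contMDiffOn_chart (I := 𝓘(ℝ, ℝ))).comp pb.contMDiff_proj.contMDiffOn fun q hq => hq.2,
      fun q _ a => by rw [pb.proj_act]⟩
  have hX' := hX.mono (inter_subset_left (t := c.source))
  have hY' := hY.mono (inter_subset_left (t := c.source))
  have hW := pb.isOpen_preimage hO
  have h1 := dirDeriv_bracket hW hX'.smooth hY'.smooth hf.smooth hpO
  rw [dirDeriv_eq_zero_of_eqOn_const (c := 0) hW
      (fun q hq => hf.dirDeriv_eq_zero hO hq (hv q hq.1)) hpO,
    (hf.dirDeriv hX' hO).dirDeriv_eq_zero hO hpO (hv p hp), sub_zero] at h1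
  have hd : MDifferentiableAt 𝓘(ℝ, ℝ) 𝓘(ℝ, ℝ) c (pb.proj p) :=
    (mdifferentiable_chart (I := 𝓘(ℝ, ℝ)) (pb.proj p)).mdifferentiableAt hpO.2
  have h2 := mfderiv_apply_of_comp_eq hd (pb.mdifferentiableAt_proj p) rfl
    (Eq.eventuallyEq (f := fun q => c (pb.proj q)) rfl) (InvariantFlow.bracket X Y p)
  have h3 := h2.symm.trans h1
  have hinj : Function.Injective (mfderiv 𝓘(ℝ, ℝ) 𝓘(ℝ, ℝ) c (pb.proj p)) :=
    ((mdifferentiable_chart (I := 𝓘(ℝ, ℝ)) (pb.proj p)).mfderiv_injective hpO.2)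
  exact hinj (h3.trans (map_zero _).symm)

end IsVertical

/-- A smooth invariant metric. -/
structure SmoothMetric (pb : PrincipalBundle EP EG P M G) (g : BilinField EP P) : Prop
    extends IsInvariantMetric pb g where
  smooth : ∀ (O : Set P) (X Y : VF EP P), IsOpen O → SmoothOn X O → SmoothOn Y O →
    SmoothFun (EP := EP) (evalB g X Y) O

/-- A smooth closed invariant three-form. -/
structure SmoothForm (pb : PrincipalBundle EP EG P M G) (H : TrilinField EP P) : Prop
    extends IsInvariantClosedForm pb H where
  smooth : ∀ (O : Set P) (X Y Z : VF EP P), IsOpen O → SmoothOn X O → SmoothOn Y O →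
    SmoothOn Z O → SmoothFun (EP := EP) (evalT H X Y Z) O

theorem SmoothMetric.invFun {g : BilinField EP P} (hg : SmoothMetric pb g) (hU : IsOpen U)
    (hX : InvField pb X U) (hY : InvField pb Y U) : InvFun pb (evalB g X Y) U :=
  ⟨hg.smooth _ X Y (pb.isOpen_preimage hU) hX.smooth hY.smooth, fun p hp a => by
    unfold evalB
    rw [← hX.inv p hp a, ← hY.inv p hp a, hg.invariant]⟩

theorem SmoothForm.invFun {H : TrilinField EP P} (hH : SmoothForm pb H) (hU : IsOpen U)
    (hX : InvField pb X U) (hY : InvField pb Y U) (hZ : InvField pb Z U) :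
    InvFun pb (evalT H X Y Z) U :=
  ⟨hH.smooth _ X Y Z (pb.isOpen_preimage hU) hX.smooth hY.smooth hZ.smooth, fun p hp a => by
    unfold evalT
    rw [← hX.inv p hp a, ← hY.inv p hp a, ← hZ.inv p hp a, hH.invariant]⟩

/-- One step of the Gram-Schmidt process. -/
theorem exists_gramSchmidt_step {g : BilinField EP P} (hg : SmoothMetric pb g) (hU : IsOpen U)
    {n : ℕ} {e : Fin n → VF EP P} (he : ∀ i, InvField pb (e i) U)
    (ho : ∀ i j p, pb.proj p ∈ U → evalB g (e i) (e j) p = if i = j then 1 else 0)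
    (hX : InvField pb X U)
    (hne : ∀ p, pb.proj p ∈ U → X p - ∑ i, evalB g X (e i) p • e i p ≠ 0) :
    ∃ φ : P → ℝ, InvFun pb φ U ∧ InvField pb (φ • (X - ∑ i, evalB g X (e i) • e i)) U ∧
      (∀ p, pb.proj p ∈ U → φ p ≠ 0) ∧
      (∀ p, pb.proj p ∈ U → evalB g (φ • (X - ∑ i, evalB g X (e i) • e i))
        (φ • (X - ∑ i, evalB g X (e i) • e i)) p = 1) ∧
      ∀ i p, pb.proj p ∈ U → evalB g (φ • (X - ∑ i, evalB g X (e i) • e i)) (e i) p = 0 := by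
  set D : VF EP P := X - ∑ i, evalB g X (e i) • e i with hD
  have hDf : InvField pb D U := hX.sub
    (InvField.sum _ fun i _ => InvField.smul (hg.invFun hU hX (he i)) (he i))
  have hDp : ∀ p, D p = X p - ∑ i, evalB g X (e i) p • e i p := fun p => by
    simp only [hD, Pi.sub_apply, Finset.sum_apply, Pi.smul_apply']
  have hpos : ∀ p, pb.proj p ∈ U → 0 < evalB g D D p := fun p hp =>
    hg.pos p _ (by rw [hDp]; exact hne p hp)
  have hφ : InvFun pb (fun p => (√(evalB g D D p))⁻¹) U :=
    (hg.invFun hU hDf hDf).comp (φ := fun x => (√x)⁻¹) fun p hp =>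
      (Real.contDiffAt_sqrt (hpos p hp).ne').inv (Real.sqrt_pos.2 (hpos p hp)).ne'
  refine ⟨_, hφ, InvField.smul hφ hDf, fun p hp => (inv_pos.2 (Real.sqrt_pos.2 (hpos p hp))).ne',
    fun p hp => ?_, fun i p hp => ?_⟩
  · have h1 := Real.mul_self_sqrt (hpos p hp).le
    have h2 := (Real.sqrt_pos.2 (hpos p hp)).ne'
    simp only [evalB, Pi.smul_apply', map_smul, smul_apply, smul_eq_mul]
    change (√(evalB g D D p))⁻¹ * ((√(evalB g D D p))⁻¹ * evalB g D D p) = 1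
    field_simp
    rw [sq, h1]
  · have h0 : evalB g D (e i) p = 0 := by
      simp only [evalB, hDp, map_sub, map_sum, map_smul, sub_apply,
        sum_apply, smul_apply, smul_eq_mul]
      have : ∀ j, g p (e j p) (e i p) = if j = i then 1 else 0 := fun j => ho j i p hp
      simp [this]
    simp only [evalB, Pi.smul_apply', map_smul, smul_apply, smul_eq_mul]
    rw [show g p (D p) (e i p) = 0 from h0, mul_zero]

end Bundle

/-! ### Existence of adapted orthonormal frames. -/

section Bundle

variable {EP EG P M G : Type*}
  [NormedAddCommGroup EP] [NormedSpace ℝ EP] [NormedAddCommGroup EG] [NormedSpace ℝ EG]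
  [FiniteDimensional ℝ EP] [FiniteDimensional ℝ EG]
  [TopologicalSpace P] [ChartedSpace EP P] [IsManifold 𝓘(ℝ, EP) ∞ P]
  [TopologicalSpace M] [ChartedSpace ℝ M] [IsManifold 𝓘(ℝ, ℝ) ∞ M]
  [TopologicalSpace G] [ChartedSpace EG G] [Group G] [LieGroup 𝓘(ℝ, EG) ∞ G]
  {pb : PrincipalBundle EP EG P M G} {U : Set M} {X Y Z : VF EP P} {f h : P → ℝ}

/-- Invariant functions are constant along the fibres, so the derivative term of the Leibniz rule
drops out and brackets with a vertical field are linear over them. -/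
theorem bracket_smul_right_of_vertical (hU : IsOpen U) (hX : IsVertical pb X U)
    (hf : InvFun pb f U) (hY : InvField pb Y U) {p : P} (hp : pb.proj p ∈ U) :
    bracket X (f • Y) p = f p • bracket X Y p := by
  have hc : CompleteSpace EP := FiniteDimensional.complete ℝ EP
  rw [bracket_smul_right (pb.isOpen_preimage hU) hf.smooth hY.smooth hp,
    hf.dirDeriv_eq_zero hU hp (hX p hp), zero_smul, zero_add]

theorem bracket_smul_left_of_vertical (hU : IsOpen U) (hX : IsVertical pb X U)
    (hf : InvFun pb f U) (hY : InvField pb Y U) {p : P} (hp : pb.proj p ∈ U) :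
    bracket (f • Y) X p = f p • bracket Y X p := by
  rw [bracket_swap, bracket_smul_right_of_vertical hU hX hf hY hp, bracket_swap (X := X), smul_neg,
    neg_neg]

/-- Near every point there are invariant fields: a transversal one and three independent vertical
ones, the last of which is central. -/
theorem exists_invariant_fields [CompleteSpace EG] (hdim : Module.finrank ℝ EG = 3)
    (hnil : LieRing.IsNilpotent (GroupLieAlgebra 𝓘(ℝ, EG) G)) (pb : PrincipalBundle EP EG P M G)
    (m : M) : ∃ (U : Set M) (E₀ : VF EP P) (E : Fin 3 → VF EP P), IsOpen U ∧ m ∈ U ∧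
      InvField pb E₀ U ∧ (∀ i, InvField pb (E i) U) ∧ (∀ i, IsVertical pb (E i) U) ∧
      (∀ p, pb.proj p ∈ U → (mfderiv 𝓘(ℝ, EP) 𝓘(ℝ, ℝ) pb.proj p (E₀ p) : ℝ) ≠ 0) ∧
      (∀ p, pb.proj p ∈ U → LinearIndependent ℝ fun i => E i p) ∧
      ∀ j p, pb.proj p ∈ U → bracket (E 2) (E j) p = 0 := by
  obtain ⟨T⟩ := pb.nonempty_gauge m
  have hdim' : Module.finrank ℝ (GroupLieAlgebra 𝓘(ℝ, EG) G) = 3 := hdim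
  obtain ⟨ξ, hξ, hc⟩ := exists_basis_central hdim' hnil
  exact ⟨T.U ∩ (chartAt ℝ m).source, T.hfield, fun i => T.vfield (ξ i),
    T.isOpen.inter (chartAt ℝ m).open_source, ⟨T.mem, mem_chart_source ℝ m⟩,
    ⟨T.smoothOn_hfield, T.mfderiv_act_hfield⟩,
    fun i => InvField.mono ⟨T.smoothOn_vfield _, T.mfderiv_act_vfield _⟩ inter_subset_left,
    fun i p hp => T.mfderiv_proj_vfield hp.1 _, fun p hp => T.mfderiv_proj_hfield hp,
    fun p hp => T.linearIndependent_vfield hξ hp.1, fun j p hp => T.bracket_vfield (hc _) hp.1⟩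

/-- Gram-Schmidt is started at the central field, continued with the other two vertical fields and
finished with the transversal one. Only invariant coefficients enter, so the first field stays
central. -/
theorem exists_isAdapted [CompleteSpace EG] (hdim : Module.finrank ℝ EG = 3)
    (hnil : LieRing.IsNilpotent (GroupLieAlgebra 𝓘(ℝ, EG) G)) {g : BilinField EP P}
    (hg : SmoothMetric pb g) (m : M) : ∃ F : OrthonormalFrame pb g m, F.IsAdapted := by
  have hcP : CompleteSpace EP := FiniteDimensional.complete ℝ EP
  obtain ⟨U, E₀, E, hU, hm, hE₀, hE, hEv, hE₀p, hli, hbr⟩ := exists_invariant_fields hdim hnil pb m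
  have coeff : ∀ p, pb.proj p ∈ U → ∀ c : Fin 3 → ℝ, ∑ i, c i • E i p = 0 → ∀ i, c i = 0 :=
    fun p hp => Fintype.linearIndependent_iff.1 (hli p hp)
  -- the normalised central field
  obtain ⟨φ, hφ, hX₂, hφ0, hn₂, -⟩ := exists_gramSchmidt_step hg hU (n := 0)
    (e := Fin.elim0) (fun i => i.elim0) (fun i => i.elim0) (hE 2) (fun p hp h0 => by
      have := coeff p hp ![0, 0, 1] (by simpa [Fin.sum_univ_three] using h0) 2
      simp at this)
  simp only [Finset.univ_eq_empty, Finset.sum_empty, sub_zero] at hX₂ hn₂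
  set X₂ := φ • E 2 with hX₂def
  obtain ⟨φ₀, hφ₀, hX₀, hφ₀0, hn₀, ho₀⟩ := exists_gramSchmidt_step hg hU (e := ![X₂])
    (fun i => by fin_cases i; exact hX₂) (fun i j p hp => by
      fin_cases i; fin_cases j; simpa using hn₂ p hp) (hE 0) (fun p hp h0 => by
      -- These are the coordinates of the Gram-Schmidt remainder in the independent fields E. The
      -- coordinate of the new field is 1, so the remainder cannot vanish; the same device serves
      -- the next step.
      have := coeff p hp ![1, 0, -(evalB g (E 0) X₂ p * φ p)] (by
        rw [← h0]
        simp only [Fin.sum_univ_three, Matrix.cons_val, Fin.sum_univ_one, X₂, Pi.smul_apply']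
        module) 0
      simp at this)
  simp only [Fin.sum_univ_one, Matrix.cons_val] at hX₀ hn₀ ho₀
  set X₀ := φ₀ • (E 0 - evalB g (E 0) X₂ • X₂) with hX₀def
  have o₀₂ : ∀ p, pb.proj p ∈ U → evalB g X₀ X₂ p = 0 := fun p hp => ho₀ 0 p hp
  have o₂₀ : ∀ p, pb.proj p ∈ U → evalB g X₂ X₀ p = 0 := fun p hp =>
    (hg.symm p _ _).trans (o₀₂ p hp)
  obtain ⟨φ₁, hφ₁, hX₁, hφ₁0, hn₁, ho₁⟩ := exists_gramSchmidt_step hg hU (e := ![X₀, X₂])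
    (fun i => by fin_cases i <;> assumption) (fun i j p hp => by
      fin_cases i <;> fin_cases j
      · simpa using hn₀ p hp
      · simpa using o₀₂ p hp
      · simpa using o₂₀ p hp
      · simpa using hn₂ p hp) (hE 1) (fun p hp h0 => by
      have := coeff p hp ![-(evalB g (E 1) X₀ p * φ₀ p), 1, evalB g (E 1) X₀ p * φ₀ p *
        (evalB g (E 0) X₂ p * φ p) - evalB g (E 1) X₂ p * φ p] (by
        rw [← h0]
        simp only [Fin.sum_univ_three, Matrix.cons_val, Fin.sum_univ_two, X₀, X₂, Pi.smul_apply',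
          Pi.sub_apply]
        module) 1
      simp at this)
  simp only [Fin.sum_univ_two, Matrix.cons_val] at hX₁ hn₁ ho₁
  set X₁ := φ₁ • (E 1 - (evalB g (E 1) X₀ • X₀ + evalB g (E 1) X₂ • X₂)) with hX₁def
  have o₁₀ : ∀ p, pb.proj p ∈ U → evalB g X₁ X₀ p = 0 := fun p hp => ho₁ 0 p hp
  have o₁₂ : ∀ p, pb.proj p ∈ U → evalB g X₁ X₂ p = 0 := fun p hp => ho₁ 1 p hp
  have v₂ : IsVertical pb X₂ U := (hEv 2).smul
  have v₀ : IsVertical pb X₀ U := ((hEv 0).sub v₂.smul).smul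
  have v₁ : IsVertical pb X₁ U := ((hEv 1).sub (v₀.smul.add v₂.smul)).smul
  let η : Fin 3 → VF EP P := ![X₀, X₁, X₂]
  have vη : ∀ i, IsVertical pb (η i) U := fun i => by fin_cases i <;> assumption
  have iη : ∀ i, InvField pb (η i) U := fun i => by fin_cases i <;> assumption
  have oη : ∀ i j p, pb.proj p ∈ U → evalB g (η i) (η j) p = if i = j then 1 else 0 := by
    intro i j p hp
    have s01 : evalB g X₀ X₁ p = 0 := (hg.symm p _ _).trans (o₁₀ p hp)
    have s21 : evalB g X₂ X₁ p = 0 := (hg.symm p _ _).trans (o₁₂ p hp)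
    fin_cases i <;> fin_cases j <;>
      simp [η, hn₀ p hp, hn₁ p hp, hn₂ p hp, o₁₀ p hp, o₁₂ p hp, o₀₂ p hp, o₂₀ p hp, s01, s21]
  -- The remainder of E₀ is nonzero because the part removed is vertical and E₀ is not.
  obtain ⟨φ₃, hφ₃, hV, hφ₃0, hnV, hoV⟩ := exists_gramSchmidt_step hg hU iη oη hE₀
    (fun p hp h0 => hE₀p p hp (by
      rw [sub_eq_zero.1 h0]
      have := IsVertical.sum (pb := pb) (U := U) Finset.univ (X := fun i => evalB g E₀ (η i) • η i)
        (fun i _ => (vη i).smul) p hp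
      simpa only [Finset.sum_apply, Pi.smul_apply'] using this))
  refine ⟨⟨U, hU, hm, _, η, hV.smooth, fun i => (iη i).smooth, hV.inv, fun i => (iη i).inv, vη, hnV,
    hoV, oη⟩, ?_⟩
  -- centrality
  have c2 : ∀ {X : VF EP P}, InvField pb X U → IsVertical pb X U →
      (∀ p, pb.proj p ∈ U → bracket (E 2) X p = 0) →
      ∀ p, pb.proj p ∈ U → bracket X₂ X p = 0 := by
    intro X hX hXv h p hp
    rw [hX₂def, bracket_smul_left_of_vertical hU hXv hφ (hE 2) hp, h p hp, smul_zero]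
  have csmul : ∀ {X : VF EP P} {f : P → ℝ}, InvField pb X U → InvFun pb f U →
      (∀ p, pb.proj p ∈ U → bracket (E 2) X p = 0) →
      ∀ p, pb.proj p ∈ U → bracket (E 2) (f • X) p = 0 := by
    intro X f hX hf h p hp
    rw [bracket_smul_right_of_vertical hU (hEv 2) hf hX hp, h p hp, smul_zero]
  have cadd : ∀ {X Y : VF EP P}, InvField pb X U → InvField pb Y U →
      (∀ p, pb.proj p ∈ U → bracket (E 2) X p = 0) →
      (∀ p, pb.proj p ∈ U → bracket (E 2) Y p = 0) →
      ∀ p, pb.proj p ∈ U → bracket (E 2) (X + Y) p = 0 := by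
    intro X Y hX hY h1 h2 p hp
    rw [bracket_add_right (pb.isOpen_preimage hU) hX.smooth hY.smooth hp, h1 p hp, h2 p hp,
      add_zero]
  have csub : ∀ {X Y : VF EP P}, InvField pb X U → InvField pb Y U →
      (∀ p, pb.proj p ∈ U → bracket (E 2) X p = 0) →
      (∀ p, pb.proj p ∈ U → bracket (E 2) Y p = 0) →
      ∀ p, pb.proj p ∈ U → bracket (E 2) (X - Y) p = 0 := by
    intro X Y hX hY h1 h2
    have e : X - Y = X + (fun _ : P => (-1 : ℝ)) • Y := by
      funext p
      simp [sub_eq_add_neg]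
    rw [e]
    exact cadd hX (InvField.smul (InvFun.const _) hY) h1 (csmul hY (InvFun.const _) h2)
  have b2 := csmul (hE 2) hφ (hbr 2)
  have g02 := hg.invFun hU (hE 0) hX₂
  have g10 := hg.invFun hU (hE 1) hX₀
  have g12 := hg.invFun hU (hE 1) hX₂
  have b0 := csmul ((hE 0).sub (InvField.smul g02 hX₂)) hφ₀
    (csub (hE 0) (InvField.smul g02 hX₂) (hbr 0) (csmul hX₂ g02 b2))
  have b1 := csmul ((hE 1).sub ((InvField.smul g10 hX₀).add (InvField.smul g12 hX₂))) hφ₁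
    (csub (hE 1) ((InvField.smul g10 hX₀).add (InvField.smul g12 hX₂)) (hbr 1)
      (cadd (InvField.smul g10 hX₀) (InvField.smul g12 hX₂) (csmul hX₀ g10 b0)
        (csmul hX₂ g12 b2)))
  intro j p hp
  fin_cases j
  · exact c2 hX₀ v₀ b0 p hp
  · exact c2 hX₁ v₁ b1 p hp
  · exact c2 hX₂ v₂ b2 p hp

end Bundle

/-! ### Frame expansions and the covariant derivative along V. -/

section Bundle

variable {EP EG P M G : Type*}
  [NormedAddCommGroup EP] [NormedSpace ℝ EP] [NormedAddCommGroup EG] [NormedSpace ℝ EG]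
  [FiniteDimensional ℝ EP] [FiniteDimensional ℝ EG]
  [TopologicalSpace P] [ChartedSpace EP P] [IsManifold 𝓘(ℝ, EP) ∞ P]
  [TopologicalSpace M] [ChartedSpace ℝ M] [IsManifold 𝓘(ℝ, ℝ) ∞ M]
  [TopologicalSpace G] [ChartedSpace EG G] [Group G] [LieGroup 𝓘(ℝ, EG) ∞ G]
  {pb : PrincipalBundle EP EG P M G} {U : Set M} {X Y Z : VF EP P} {f h : P → ℝ}

theorem InvField.congr (hX : InvField pb X U) (h : ∀ p, pb.proj p ∈ U → Y p = X p) :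
    InvField pb Y U :=
  ⟨hX.smooth.congr fun p hp => h p hp, fun p hp a => by
    rw [h p hp, h _ (by rw [pb.proj_act]; exact hp), hX.inv p hp]⟩

theorem IsVertical.congr (hX : IsVertical pb X U) (h : ∀ p, pb.proj p ∈ U → Y p = X p) :
    IsVertical pb Y U := fun p hp => by rw [h p hp]; exact hX p hp

theorem bracket_sum_smul_of_vertical {ι : Type*} [Fintype ι] (hU : IsOpen U)
    (hX : IsVertical pb X U) {f : ι → P → ℝ} {Y : ι → VF EP P} (hf : ∀ i, InvFun pb (f i) U)
    (hY : ∀ i, InvField pb (Y i) U) {p : P} (hp : pb.proj p ∈ U) :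
    bracket X (∑ i, f i • Y i) p = ∑ i, f i p • bracket X (Y i) p := by
  have hc : CompleteSpace EP := FiniteDimensional.complete ℝ EP
  rw [bracket_sum_smul_right _ (pb.isOpen_preimage hU) (fun i _ => (hf i).smooth)
    (fun i _ => (hY i).smooth) hp]
  refine Finset.sum_congr rfl fun i _ => ?_
  rw [(hf i).dirDeriv_eq_zero hU hp (hX p hp), zero_smul, zero_add]

namespace OrthonormalFrame

variable {g : BilinField EP P} {m : M} (F : OrthonormalFrame pb g m)

/-- The same frame, regarded as a frame near another point of its domain. -/
def at' {m' : M} (h : m' ∈ F.U) : OrthonormalFrame pb g m' := { F with mem := h }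

theorem invField_V : InvField pb F.V F.U := ⟨F.smooth_V, F.invariant_V⟩

theorem invField_η (i : Fin 3) : InvField pb (F.η i) F.U := ⟨F.smooth_η i, F.invariant_η i⟩

theorem isVertical_η (i : Fin 3) : IsVertical pb (F.η i) F.U := F.vertical_η i

variable {F} (hdim : Module.finrank ℝ EG = 3) (hg : SmoothMetric pb g) {p : P}
  (hp : pb.proj p ∈ F.U)
include hg hp

theorem g_VV : g p (F.V p) (F.V p) = 1 := F.unit_V p hp

theorem g_Vη (i : Fin 3) : g p (F.V p) (F.η i p) = 0 := F.orthogonal i p hp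

theorem g_ηV (i : Fin 3) : g p (F.η i p) (F.V p) = 0 := (hg.symm _ _ _).trans (F.orthogonal i p hp)

theorem g_ηη (i j : Fin 3) : g p (F.η i p) (F.η j p) = if i = j then 1 else 0 :=
  F.orthonormal_η i j p hp

include hdim

/-- Expansion of a tangent vector in an orthonormal frame. -/
theorem expansion (Z : TangentSpace 𝓘(ℝ, EP) p) :
    Z = g p Z (F.V p) • F.V p + ∑ i, g p Z (F.η i p) • F.η i p := by
  have hli : LinearIndependent ℝ (fun a => F.e a p) := by
    rw [Fintype.linearIndependent_iff]
    intro c hc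
    have hc' : c 0 • F.V p + ∑ i : Fin 3, c i.succ • F.η i p = 0 := by
      rw [Fin.sum_univ_succ] at hc
      simpa [OrthonormalFrame.e] using hc
    have h0 := congrArg (fun Z => g p Z (F.V p)) hc'
    have h1 := fun j => congrArg (fun Z => g p Z (F.η j p)) hc'
    simp only [map_add, map_sum, map_smul, add_apply, sum_apply, smul_apply, smul_eq_mul,
      g_VV hg hp, g_ηV hg hp, g_Vη hg hp, g_ηη hg hp, map_zero, zero_apply] at h0 h1
    intro a
    refine Fin.cases ?_ (fun j => ?_) a
    · simpa using h0
    · simpa using h1 j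
  have hfr : Module.finrank ℝ EP = 4 := by rw [pb.finrank_total p, hdim]
  have hfin : FiniteDimensional ℝ (TangentSpace 𝓘(ℝ, EP) p) := ‹FiniteDimensional ℝ EP›
  have hfr' : Fintype.card (Fin 4) = Module.finrank ℝ (TangentSpace 𝓘(ℝ, EP) p) := by
    rw [Fintype.card_fin]; exact hfr.symm
  have hspan := hli.span_eq_top_of_card_eq_finrank' hfr'
  have hZ : Z ∈ Submodule.span ℝ (Set.range fun a => F.e a p) := by rw [hspan]; trivial
  obtain ⟨c, rfl⟩ := (Submodule.mem_span_range_iff_exists_fun ℝ).1 hZ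
  have hs : ∑ a, c a • F.e a p = c 0 • F.V p + ∑ i : Fin 3, c i.succ • F.η i p := by
    rw [Fin.sum_univ_succ]; simp [OrthonormalFrame.e]
  rw [hs]
  simp only [map_add, map_sum, map_smul, add_apply, sum_apply, smul_apply, smul_eq_mul,
      g_VV hg hp, g_ηV hg hp, g_Vη hg hp, g_ηη hg hp]
  simp

/-- Otherwise the frame expansion would make every tangent vector vertical, although the projection
is a submersion. -/
theorem proj_V_ne_zero : (mfderiv 𝓘(ℝ, EP) 𝓘(ℝ, ℝ) pb.proj p (F.V p) : ℝ) ≠ 0 := by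
  intro h
  obtain ⟨Z, hZ⟩ := pb.exists_mfderiv_proj_eq_one p
  rw [expansion hdim hg hp Z, map_add, map_sum, map_smul] at hZ
  have h' : mfderiv 𝓘(ℝ, EP) 𝓘(ℝ, ℝ) pb.proj p (F.V p) = 0 := h
  simp only [map_smul, F.vertical_η _ p hp, h', smul_zero, Finset.sum_const_zero, add_zero] at hZ
  exact zero_ne_one (α := ℝ) hZ

/-- Projecting the frame expansion of Z leaves only its V-component times the nonzero projection of
V. -/
theorem g_V_of_vertical {Z : TangentSpace 𝓘(ℝ, EP) p}
    (hZ : (mfderiv 𝓘(ℝ, EP) 𝓘(ℝ, ℝ) pb.proj p Z : ℝ) = 0) : g p Z (F.V p) = 0 := by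
  have h1 := hZ
  rw [expansion hdim hg hp Z, map_add, map_sum, map_smul] at h1
  simp only [map_smul, F.vertical_η _ p hp, smul_zero, Finset.sum_const_zero, add_zero] at h1
  exact (mul_eq_zero.1 h1).resolve_right (proj_V_ne_zero hdim hg hp)

theorem expansion_vertical {Z : TangentSpace 𝓘(ℝ, EP) p}
    (hZ : (mfderiv 𝓘(ℝ, EP) 𝓘(ℝ, ℝ) pb.proj p Z : ℝ) = 0) :
    Z = ∑ i, g p Z (F.η i p) • F.η i p := by
  conv_lhs => rw [expansion hdim hg hp Z, g_V_of_vertical hdim hg hp hZ, zero_smul, zero_add]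

theorem vert_of_vertical {X : VF EP P}
    (hX : (mfderiv 𝓘(ℝ, EP) 𝓘(ℝ, ℝ) pb.proj p (X p) : ℝ) = 0) : F.vert X p = X p := by
  unfold vert evalB
  rw [g_V_of_vertical hdim hg hp hX, zero_smul, sub_zero]

theorem vert_V : F.vert F.V p = 0 := by
  unfold vert evalB
  rw [g_VV hg hp, one_smul, sub_self]

omit hp
variable (F)

/-- The V-component of a vertical field vanishes on all of U, so its derivative vanishes too and
`vert` acts as the identity. -/
theorem covD_of_vertical {X : VF EP P} (hX : IsVertical pb X F.U) {p : P} (hp : pb.proj p ∈ F.U) :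
    F.covD X p = bracket F.V X p := by
  unfold covD
  have hW := pb.isOpen_preimage F.isOpen
  rw [dirDeriv_eq_zero_of_eqOn_const (f := evalB g X F.V) (c := 0) hW
      (fun q hq => g_V_of_vertical hdim hg hq (hX q hq)) hp, zero_smul, add_zero]
  exact bracket_congr hW (fun q _ => rfl)
    (fun q hq => vert_of_vertical hdim hg hq (hX q hq)) hp

theorem covD_V {p : P} (hp : pb.proj p ∈ F.U) : F.covD F.V p = 0 := by
  unfold covD
  have hW := pb.isOpen_preimage F.isOpen
  rw [dirDeriv_eq_zero_of_eqOn_const (f := evalB g F.V F.V) (c := 1) hW (fun q hq => g_VV hg hq) hp, zero_smul, add_zero,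
    bracket_congr hW (X' := F.V) (Y' := 0) (fun q _ => rfl) (fun q hq => vert_V hdim hg hq) hp,
    bracket_zero_right]

theorem invField_covD {X : VF EP P} (hX : InvField pb X F.U) (hv : IsVertical pb X F.U) :
    InvField pb (F.covD X) F.U :=
  have _hc : CompleteSpace EP := FiniteDimensional.complete ℝ EP
  (F.invField_V.bracket F.isOpen hX).congr fun _ hp => F.covD_of_vertical hdim hg hv hp

theorem isVertical_covD {X : VF EP P} (hX : InvField pb X F.U) (hv : IsVertical pb X F.U) :
    IsVertical pb (F.covD X) F.U :=
  (IsVertical.bracket F.isOpen F.invField_V hX hv).congr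
    fun _ hp => F.covD_of_vertical hdim hg hv hp

end OrthonormalFrame

end Bundle

/-! ### Tensor calculus on the adjoint bundle. -/

section Bundle

variable {EP EG P M G : Type*}
  [NormedAddCommGroup EP] [NormedSpace ℝ EP] [NormedAddCommGroup EG] [NormedSpace ℝ EG]
  [FiniteDimensional ℝ EP] [FiniteDimensional ℝ EG]
  [TopologicalSpace P] [ChartedSpace EP P] [IsManifold 𝓘(ℝ, EP) ∞ P]
  [TopologicalSpace M] [ChartedSpace ℝ M] [IsManifold 𝓘(ℝ, ℝ) ∞ M]
  [TopologicalSpace G] [ChartedSpace EG G] [Group G] [LieGroup 𝓘(ℝ, EG) ∞ G]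
  {pb : PrincipalBundle EP EG P M G}

namespace OrthonormalFrame

variable {g : BilinField EP P} {m : M} (F : OrthonormalFrame pb g m) {H : TrilinField EP P}

/-- The coefficients of `[V, ηᵢ] = ∑ₖ aᵢₖ ηₖ`. -/
def conn (i k : Fin 3) : P → ℝ := evalB g (bracket F.V (F.η i)) (F.η k)

/-- The coefficients of `[ηᵢ, ηⱼ] = ∑ₖ cᵢⱼₖ ηₖ`. -/
def struc (i j k : Fin 3) : P → ℝ := evalB g (bracket (F.η i) (F.η j)) (F.η k)

/-- Fields of bilinear forms on the adjoint bundle, given by their values on sections. -/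
structure IsTensorial (T : VF EP P → VF EP P → P → ℝ) : Prop where
  inv : ∀ i j, InvFun pb (T (F.η i) (F.η j)) F.U
  expand : ∀ X Y, InvField pb X F.U → IsVertical pb X F.U → InvField pb Y F.U →
    IsVertical pb Y F.U → ∀ p, pb.proj p ∈ F.U →
    T X Y p = ∑ i, ∑ j, evalB g X (F.η i) p * evalB g Y (F.η j) p * T (F.η i) (F.η j) p

/-- Fields of linear forms on the adjoint bundle, given by their values on sections. -/
structure IsTensorial₁ (T : VF EP P → P → ℝ) : Prop where
  inv : ∀ i, InvFun pb (T (F.η i)) F.U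
  expand : ∀ X, InvField pb X F.U → IsVertical pb X F.U → ∀ p, pb.proj p ∈ F.U →
    T X p = ∑ i, evalB g X (F.η i) p * T (F.η i) p

/-- The covariant derivative of a field of bilinear forms on the adjoint bundle. -/
def lie (T : VF EP P → VF EP P → P → ℝ) (X Y : VF EP P) (p : P) : ℝ :=
  dirDeriv F.V (T X Y) p - T (F.covD X) Y p - T X (F.covD Y) p

variable {F} {T T' : VF EP P → VF EP P → P → ℝ} {L L' : VF EP P → P → ℝ}

section Closure

theorem IsTensorial.add (hT : F.IsTensorial T) (hT' : F.IsTensorial T') :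
    F.IsTensorial fun X Y p => T X Y p + T' X Y p :=
  ⟨fun i j => (hT.inv i j).add (hT'.inv i j), fun X Y hX hXv hY hYv p hp => by
    rw [hT.expand X Y hX hXv hY hYv p hp, hT'.expand X Y hX hXv hY hYv p hp]
    simp only [mul_add, Finset.sum_add_distrib]⟩

theorem IsTensorial.sub (hT : F.IsTensorial T) (hT' : F.IsTensorial T') :
    F.IsTensorial fun X Y p => T X Y p - T' X Y p :=
  ⟨fun i j => (hT.inv i j).sub (hT'.inv i j), fun X Y hX hXv hY hYv p hp => by
    rw [hT.expand X Y hX hXv hY hYv p hp, hT'.expand X Y hX hXv hY hYv p hp]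
    simp only [mul_sub, Finset.sum_sub_distrib]⟩

theorem IsTensorial.const_mul (c : ℝ) (hT : F.IsTensorial T) :
    F.IsTensorial fun X Y p => c * T X Y p :=
  ⟨fun i j => (InvFun.const c).mul (hT.inv i j), fun X Y hX hXv hY hYv p hp => by
    rw [hT.expand X Y hX hXv hY hYv p hp]
    simp only [Finset.mul_sum]
    exact Finset.sum_congr rfl fun i _ => Finset.sum_congr rfl fun j _ => by ring⟩

theorem IsTensorial.sum {ι : Type*} [Fintype ι] {T : ι → VF EP P → VF EP P → P → ℝ}
    (hT : ∀ i, F.IsTensorial (T i)) : F.IsTensorial fun X Y p => ∑ i, T i X Y p :=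
  ⟨fun i j => InvFun.sum _ fun k _ => (hT k).inv i j, fun X Y hX hXv hY hYv p hp => by
    simp only [fun k => (hT k).expand X Y hX hXv hY hYv p hp, Finset.mul_sum]
    rw [Finset.sum_comm]
    exact Finset.sum_congr rfl fun i _ => by rw [Finset.sum_comm]⟩

theorem IsTensorial₁.mul (hL : F.IsTensorial₁ L) (hL' : F.IsTensorial₁ L') :
    F.IsTensorial fun X Y p => L X p * L' Y p :=
  ⟨fun i j => (hL.inv i).mul (hL'.inv j), fun X Y hX hXv hY hYv p hp => by
    rw [hL.expand X hX hXv p hp, hL'.expand Y hY hYv p hp, Finset.sum_mul_sum]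
    exact Finset.sum_congr rfl fun i _ => Finset.sum_congr rfl fun j _ => by ring⟩

theorem IsTensorial₁.mul' (hL : F.IsTensorial₁ L) (hL' : F.IsTensorial₁ L') :
    F.IsTensorial fun X Y p => L Y p * L' X p :=
  ⟨fun i j => (hL.inv j).mul (hL'.inv i), fun X Y hX hXv hY hYv p hp => by
    rw [hL.expand Y hY hYv p hp, hL'.expand X hX hXv p hp, Finset.sum_mul_sum, Finset.sum_comm]
    exact Finset.sum_congr rfl fun i _ => Finset.sum_congr rfl fun j _ => by ring⟩

end Closure

variable (hdim : Module.finrank ℝ EG = 3) (hg : SmoothMetric pb g) (hH : SmoothForm pb H)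

include hg in
theorem IsTensorial.right (hT : F.IsTensorial T) (k : Fin 3) : F.IsTensorial₁ (T (F.η k)) :=
  ⟨hT.inv k, fun X hX hXv p hp => by
    rw [hT.expand _ X (F.invField_η k) (F.isVertical_η k) hX hXv p hp]
    simp [evalB, g_ηη hg hp]⟩

include hg in
theorem invFun_conn (i k : Fin 3) : InvFun pb (F.conn i k) F.U :=
  have _hc : CompleteSpace EP := FiniteDimensional.complete ℝ EP
  hg.invFun F.isOpen (F.invField_V.bracket F.isOpen (F.invField_η i)) (F.invField_η k)

include hg in
theorem invFun_struc (i j k : Fin 3) : InvFun pb (F.struc i j k) F.U :=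
  have _hc : CompleteSpace EP := FiniteDimensional.complete ℝ EP
  hg.invFun F.isOpen ((F.invField_η i).bracket F.isOpen (F.invField_η j)) (F.invField_η k)

include hdim hg in
theorem bracket_V_η (i : Fin 3) {p : P} (hp : pb.proj p ∈ F.U) :
    bracket F.V (F.η i) p = ∑ k, F.conn i k p • F.η k p :=
  expansion_vertical hdim hg hp
    (IsVertical.bracket F.isOpen F.invField_V (F.invField_η i) (F.isVertical_η i) p hp)

include hdim hg in
theorem bracket_η_η (i j : Fin 3) {p : P} (hp : pb.proj p ∈ F.U) :
    bracket (F.η i) (F.η j) p = ∑ k, F.struc i j k p • F.η k p :=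
  expansion_vertical hdim hg hp
    (IsVertical.bracket F.isOpen (F.invField_η i) (F.invField_η j) (F.isVertical_η j) p hp)

include hdim hg in
theorem g_covD {X : VF EP P} (hX : InvField pb X F.U) (hv : IsVertical pb X F.U) (k : Fin 3)
    {p : P} (hp : pb.proj p ∈ F.U) : evalB g (F.covD X) (F.η k) p
      = dirDeriv F.V (evalB g X (F.η k)) p + ∑ i, evalB g X (F.η i) p * F.conn i k p := by
  have _hc : CompleteSpace EP := FiniteDimensional.complete ℝ EP
  have hW := pb.isOpen_preimage F.isOpen
  have h1 : bracket F.V X p = bracket F.V (∑ i, evalB g X (F.η i) • F.η i) p :=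
    bracket_congr hW (fun q _ => rfl) (fun q hq => by
      rw [Finset.sum_apply]; exact expansion_vertical hdim hg hq (hv q hq)) hp
  have h2 := bracket_sum_smul_right (X := F.V) Finset.univ hW
    (fun i _ => (hg.invFun F.isOpen hX (F.invField_η i)).smooth)
    (fun i _ => F.smooth_η i) hp
  unfold evalB conn
  rw [F.covD_of_vertical hdim hg hv hp, h1, h2]
  simp only [map_add, map_sum, map_smul, add_apply, sum_apply, smul_apply, smul_eq_mul,
    Finset.sum_add_distrib, g_ηη hg hp]
  simp [evalB]
  rfl

theorem IsTensorial.invFun (hg : SmoothMetric pb g) (hT : F.IsTensorial T) {X Y : VF EP P} (hX : InvField pb X F.U)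
    (hXv : IsVertical pb X F.U) (hY : InvField pb Y F.U) (hYv : IsVertical pb Y F.U) :
    InvFun pb (T X Y) F.U :=
  InvFun.congr (InvFun.sum _ fun i _ => InvFun.sum _ fun j _ =>
    ((hg.invFun F.isOpen hX (F.invField_η i)).mul (hg.invFun F.isOpen hY (F.invField_η j))).mul
      (hT.inv i j)) fun p hp => hT.expand X Y hX hXv hY hYv p hp

include hdim hg in
theorem IsTensorial.lie_apply (hT : F.IsTensorial T) (i j : Fin 3) {p : P} (hp : pb.proj p ∈ F.U) :
    F.lie T (F.η i) (F.η j) p = dirDeriv F.V (T (F.η i) (F.η j)) p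
      - ∑ k, F.conn i k p * T (F.η k) (F.η j) p - ∑ k, F.conn j k p * T (F.η i) (F.η k) p := by
  have hi := F.invField_η i
  have hiv := F.isVertical_η i
  have hj := F.invField_η j
  have hjv := F.isVertical_η j
  have h : ∀ i k, evalB g (F.covD (F.η i)) (F.η k) p = F.conn i k p := fun i k => by
    unfold evalB
    rw [F.covD_of_vertical hdim hg (F.isVertical_η i) hp]; rfl
  unfold lie
  rw [hT.expand _ _ (F.invField_covD hdim hg hi hiv) (F.isVertical_covD hdim hg hi hiv) hj hjv p hp,
    hT.expand _ _ hi hiv (F.invField_covD hdim hg hj hjv) (F.isVertical_covD hdim hg hj hjv) p hp]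
  simp only [h]
  simp [evalB, g_ηη hg hp]

include hdim hg in
-- By the Leibniz rule the derivatives of the coefficients of X and Y in V(T(X, Y)) cancel against
-- those in T(D_V X, Y) and T(X, D_V Y). Iterating this makes DG, its second derivative and D_V H(V,
-- ·, ·) tensors, determined by their frame components.
theorem IsTensorial.lie (hT : F.IsTensorial T) : F.IsTensorial (F.lie T) := by
  refine ⟨fun i j => ?_, fun X Y hX hXv hY hYv p hp => ?_⟩
  · refine InvFun.congr ?_ fun p hp => hT.lie_apply hdim hg i j hp
    exact (((hT.inv i j).dirDeriv F.invField_V F.isOpen).sub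
      (InvFun.sum _ fun k _ => (invFun_conn hg i k).mul (hT.inv k j))).sub
      (InvFun.sum _ fun k _ => (invFun_conn hg j k).mul (hT.inv i k))
  · have hW := pb.isOpen_preimage F.isOpen
    have hx := fun i => hg.invFun F.isOpen hX (F.invField_η i)
    have hy := fun i => hg.invFun F.isOpen hY (F.invField_η i)
    have dx := fun i => (hx i).mdifferentiableAt F.isOpen hp
    have dy := fun i => (hy i).mdifferentiableAt F.isOpen hp
    have dT := fun i j => (hT.inv i j).mdifferentiableAt F.isOpen hp
    have dxyT := fun i j =>
      (((hx i).mul (hy j)).mul (hT.inv i j)).mdifferentiableAt F.isOpen hp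
    have h1 : dirDeriv F.V (T X Y) p = ∑ i, ∑ j,
        (evalB g X (F.η i) p * evalB g Y (F.η j) p * dirDeriv F.V (T (F.η i) (F.η j)) p
        + T (F.η i) (F.η j) p * (evalB g X (F.η i) p * dirDeriv F.V (evalB g Y (F.η j)) p
          + evalB g Y (F.η j) p * dirDeriv F.V (evalB g X (F.η i)) p)) := by
      rw [dirDeriv_congr_of_eqOn hW (fun q hq => hT.expand X Y hX hXv hY hYv q hq) hp,
        dirDeriv_sum _ fun i _ => MDifferentiableAt.sum_fun _ fun j _ =>
          dxyT i j]
      refine Finset.sum_congr rfl fun i _ => ?_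
      rw [dirDeriv_sum _ fun j _ => dxyT i j]
      refine Finset.sum_congr rfl fun j _ => ?_
      rw [dirDeriv_mul (f := fun q => evalB g X (F.η i) q * evalB g Y (F.η j) q)
        (((hx i).mul (hy j)).mdifferentiableAt F.isOpen hp) (dT i j), dirDeriv_mul (dx i) (dy j)]
    have h2 := hT.expand _ _ (F.invField_covD hdim hg hX hXv) (F.isVertical_covD hdim hg hX hXv)
      hY hYv p hp
    have h3 := hT.expand _ _ hX hXv (F.invField_covD hdim hg hY hYv)
      (F.isVertical_covD hdim hg hY hYv) p hp
    simp only [g_covD hdim hg hX hXv _ hp] at h2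
    simp only [g_covD hdim hg hY hYv _ hp] at h3
    simp only [hT.lie_apply hdim hg _ _ hp]
    unfold OrthonormalFrame.lie
    rw [h1, h2, h3]
    simp only [Fin.sum_univ_three]
    ring

theorem _root_.InvariantFlow.SmoothMetric.isTensorial (F : OrthonormalFrame pb g m)
    (hdim : Module.finrank ℝ EG = 3) (hg : SmoothMetric pb g) : F.IsTensorial (evalB g) :=
  ⟨fun i j => hg.invFun F.isOpen (F.invField_η i) (F.invField_η j), fun X Y hX hXv hY hYv p hp => by
    have e1 := expansion_vertical hdim hg hp (hXv p hp)
    have e2 := expansion_vertical hdim hg hp (hYv p hp)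
    have : evalB g X Y p = g p (∑ i, g p (X p) (F.η i p) • F.η i p)
      (∑ i, g p (Y p) (F.η i p) • F.η i p) := by rw [← e1, ← e2]; rfl
    rw [this]
    simp only [map_sum, map_smul, sum_apply, smul_apply, smul_eq_mul, evalB, Finset.mul_sum]
    exact (Finset.sum_comm).trans
      (Finset.sum_congr rfl fun i _ => Finset.sum_congr rfl fun j _ => by ring)⟩

theorem _root_.InvariantFlow.SmoothForm.isTensorial (F : OrthonormalFrame pb g m)
    (hdim : Module.finrank ℝ EG = 3) (hg : SmoothMetric pb g) (hH : SmoothForm pb H)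
    {W : VF EP P} (hW : InvField pb W F.U) : F.IsTensorial (evalT H W) :=
  ⟨fun i j => hH.invFun F.isOpen hW (F.invField_η i) (F.invField_η j),
    fun X Y hX hXv hY hYv p hp => by
    have e1 := expansion_vertical hdim hg hp (hXv p hp)
    have e2 := expansion_vertical hdim hg hp (hYv p hp)
    have : evalT H W X Y p = H p (W p) (∑ i, g p (X p) (F.η i p) • F.η i p)
      (∑ i, g p (Y p) (F.η i p) • F.η i p) := by rw [← e1, ← e2]; rfl
    rw [this]
    simp only [map_sum, map_smul, sum_apply, smul_apply, smul_eq_mul, evalB, evalT, Finset.mul_sum]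
    exact (Finset.sum_comm).trans
      (Finset.sum_congr rfl fun i _ => Finset.sum_congr rfl fun j _ => by ring)⟩

variable (F)

include hdim hg in
theorem isTensorial_DG : F.IsTensorial F.DG := (hg.isTensorial F hdim).lie hdim hg

include hdim hg in
theorem isTensorial_DDG : F.IsTensorial F.DDG := (F.isTensorial_DG hdim hg).lie hdim hg

include hdim hg in
-- The components G(ηᵢ, ηⱼ) are constant, so D_V G is minus the symmetrised connection matrix. Only
-- the symmetric part of the connection is thus controlled by DG.
theorem DG_η (i j : Fin 3) {p : P} (hp : pb.proj p ∈ F.U) :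
    F.DG (F.η i) (F.η j) p = -(F.conn i j p + F.conn j i p) := by
  have h := (hg.isTensorial F hdim).lie_apply hdim hg i j hp
  have h0 : dirDeriv F.V (evalB g (F.η i) (F.η j)) p = 0 :=
    dirDeriv_eq_zero_of_eqOn_const (pb.isOpen_preimage F.isOpen)
      (fun q hq => F.orthonormal_η i j q hq) hp
  refine h.trans ?_
  rw [h0]
  simp [evalB, g_ηη hg hp]
  ring

include hdim hg in
-- V is parallel, so the slot filled by V contributes nothing to the covariant derivative.
theorem DH_V_eq_lie (X Y : VF EP P) {p : P} (hp : pb.proj p ∈ F.U) :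
    F.DH H F.V X Y p = F.lie (evalT H F.V) X Y p := by
  unfold DH lie
  have : evalT H (F.covD F.V) X Y p = 0 := by
    unfold evalT
    rw [F.covD_V hdim hg hp, map_zero, zero_apply, zero_apply]
  rw [this, sub_zero]

theorem IsTensorial.congr (hT : F.IsTensorial T)
    (h : ∀ X Y p, pb.proj p ∈ F.U → T' X Y p = T X Y p) : F.IsTensorial T' :=
  ⟨fun i j => (hT.inv i j).congr (h _ _), fun X Y hX hXv hY hYv p hp => by
    rw [h _ _ p hp, hT.expand X Y hX hXv hY hYv p hp]
    exact Finset.sum_congr rfl fun i _ => Finset.sum_congr rfl fun j _ => by rw [h _ _ p hp]⟩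

include hdim hg hH in
theorem isTensorial_DH : F.IsTensorial (F.DH H F.V) :=
  ((hH.isTensorial F hdim hg F.invField_V).lie hdim hg).congr F
    fun X Y _ hp => F.DH_V_eq_lie hdim hg X Y hp

end OrthonormalFrame

end Bundle

/-- The structure constants of the Heisenberg algebra with centre spanned by the last vector. -/
def heisenberg : Fin 3 → Fin 3 → Fin 3 → ℝ :=
  ![![![0, 0, 0], ![0, 0, 1], ![0, 0, 0]], ![![0, 0, -1], ![0, 0, 0], ![0, 0, 0]],
    ![![0, 0, 0], ![0, 0, 0], ![0, 0, 0]]]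

/-- The Levi-Civita symbol. -/
def leviCivita : Fin 3 → Fin 3 → Fin 3 → ℝ :=
  ![![![0, 0, 0], ![0, 0, 1], ![0, -1, 0]], ![![0, 0, -1], ![0, 0, 0], ![1, 0, 0]],
    ![![0, 1, 0], ![-1, 0, 0], ![0, 0, 0]]]

/-! ### Structure equations in an adapted frame: Jacobi identity and closedness of H. -/

section Bundle

variable {EP EG P M G : Type*}
  [NormedAddCommGroup EP] [NormedSpace ℝ EP] [NormedAddCommGroup EG] [NormedSpace ℝ EG]
  [FiniteDimensional ℝ EP] [FiniteDimensional ℝ EG]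
  [TopologicalSpace P] [ChartedSpace EP P] [IsManifold 𝓘(ℝ, EP) ∞ P]
  [TopologicalSpace M] [ChartedSpace ℝ M] [IsManifold 𝓘(ℝ, ℝ) ∞ M]
  [TopologicalSpace G] [ChartedSpace EG G] [Group G] [LieGroup 𝓘(ℝ, EG) ∞ G]
  {pb : PrincipalBundle EP EG P M G}

theorem evalT_self_left {H : TrilinField EP P} (hH : IsInvariantClosedForm pb H) (X Y : VF EP P)
    (p : P) : evalT H X X Y p = 0 := by
  have := hH.swap₁ p (X p) (X p) (Y p)
  unfold evalT
  linarith

theorem evalT_self_right {H : TrilinField EP P} (hH : IsInvariantClosedForm pb H) (X Y : VF EP P)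
    (p : P) : evalT H X Y Y p = 0 := by
  have := hH.swap₂ p (X p) (Y p) (Y p)
  unfold evalT
  linarith

theorem evalT_swap_left {H : TrilinField EP P} (hH : IsInvariantClosedForm pb H) (X Y Z : VF EP P)
    (p : P) : evalT H X Y Z p = - evalT H Y X Z p := hH.swap₁ _ _ _ _

theorem evalT_swap_right {H : TrilinField EP P} (hH : IsInvariantClosedForm pb H)
    (X Y Z : VF EP P) (p : P) : evalT H X Y Z p = - evalT H X Z Y p := hH.swap₂ _ _ _ _

theorem evalT_self_outer {H : TrilinField EP P} (hH : IsInvariantClosedForm pb H)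
    (X Y : VF EP P) (p : P) : evalT H X Y X p = 0 := by
  rw [evalT_swap_right hH, evalT_self_left hH, neg_zero]

namespace OrthonormalFrame

variable {g : BilinField EP P} {m : M} {F : OrthonormalFrame pb g m} {H : TrilinField EP P}

/-- A three-form on a space of dimension three is a multiple of the volume form. -/
theorem evalT_η (hH : IsInvariantClosedForm pb H) (i j k : Fin 3) (p : P) :
    evalT H (F.η i) (F.η j) (F.η k) p
      = evalT H (F.η 0) (F.η 1) (F.η 2) p * leviCivita i j k := by
  have s1 := evalT_swap_left hH (F.η 1) (F.η 0) (F.η 2) p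
  have s2 := evalT_swap_right hH (F.η 0) (F.η 2) (F.η 1) p
  have s3 := evalT_swap_right hH (F.η 1) (F.η 2) (F.η 0) p
  have s4 := evalT_swap_left hH (F.η 2) (F.η 0) (F.η 1) p
  have s5 := evalT_swap_left hH (F.η 2) (F.η 1) (F.η 0) p
  fin_cases i <;> fin_cases j <;> fin_cases k <;>
    simp [leviCivita, evalT_self_left hH, evalT_self_right hH, evalT_self_outer hH] <;>
    linarith

theorem struc_swap (i j k : Fin 3) (p : P) : F.struc i j k p = - F.struc j i k p := by
  unfold struc evalB
  rw [bracket_swap, map_neg, neg_apply]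

variable (hdim : Module.finrank ℝ EG = 3) (hg : SmoothMetric pb g) (hH : SmoothForm pb H)

include hdim hg in
-- At a point the vertical frame corresponds to independent elements ξᵢ of the Lie algebra, and its
-- bracket coefficients are the structure constants of that basis; unimodularity applies.
theorem sum_struc_eq_zero [CompleteSpace EG] (hnil : LieRing.IsNilpotent (GroupLieAlgebra 𝓘(ℝ, EG) G))
    (i : Fin 3) {p : P} (hp : pb.proj p ∈ F.U) : ∑ k, F.struc i k k p = 0 := by
  choose ξ hξ using fun i => pb.exists_vertical_eq p (F.vertical_η i p hp)
  have hsum : ∀ c : Fin 3 → ℝ, pb.vertical p (∑ k, c k • ξ k) = ∑ k, c k • F.η k p := fun c => by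
    simp only [Fin.sum_univ_three, pb.vertical_add, pb.vertical_smul, hξ]
  refine sum_structure_eq_zero (ξ := ξ) (c := fun i j k => F.struc i j k p) hdim hnil ?_
    (fun i j => ?_) i
  · rw [Fintype.linearIndependent_iff]
    intro c hc j
    have h := hsum c
    rw [hc] at h
    have h0 : pb.vertical p 0 = 0 := by
      have := pb.vertical_smul p 0 (0 : GroupLieAlgebra 𝓘(ℝ, EG) G)
      rwa [zero_smul, zero_smul] at this
    have h1 := congrArg (fun Z => g p Z (F.η j p)) (h.symm.trans h0)
    simp only [map_sum, map_smul, sum_apply, smul_apply, smul_eq_mul, g_ηη hg hp, map_zero,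
      zero_apply] at h1
    simpa using h1
  · apply pb.vertical_injective p
    rw [hsum, ← bracket_η_η hdim hg i j hp]
    exact (pb.bracket_eq_vertical F.isOpen (F.invariant_η i) (F.invariant_η j) (F.smooth_η i)
      (F.smooth_η j) hp (hξ i).symm (hξ j).symm).symm

include hdim hg in
-- Centrality of η₃ kills every bracket that involves the index 2. The trace conditions for the
-- indices 0 and 1 then remove the η₁- and η₂-components of [η₁, η₂], so only its η₃-component
-- remains.
theorem IsAdapted.struc_eq [CompleteSpace EG] (hA : F.IsAdapted)
    (hnil : LieRing.IsNilpotent (GroupLieAlgebra 𝓘(ℝ, EG) G)) (i j k : Fin 3) {p : P}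
    (hp : pb.proj p ∈ F.U) : F.struc i j k p = F.struc 0 1 2 p * heisenberg i j k := by
  have h2 : ∀ j k, F.struc 2 j k p = 0 := fun j k => by
    unfold struc evalB
    rw [hA j p hp, map_zero, zero_apply]
  have hs := fun i j k => F.struc_swap (i := i) (j := j) (k := k) (p := p)
  have h0 := sum_struc_eq_zero hdim hg hnil 0 hp
  have h1 := sum_struc_eq_zero hdim hg hnil 1 hp
  rw [Fin.sum_univ_three] at h0 h1
  have h00 := fun k => hs 0 0 k
  have h11 := fun k => hs 1 1 k
  have h01 := fun k => hs 0 1 k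
  have h02 := fun k => hs 0 2 k
  have h12 := fun k => hs 1 2 k
  simp only [h2, neg_zero] at h02 h12
  rw [h02] at h0
  rw [h12] at h1
  have e0 : ∀ k, F.struc 0 0 k p = 0 := fun k => by linarith [h00 k]
  have e1 : ∀ k, F.struc 1 1 k p = 0 := fun k => by linarith [h11 k]
  rw [e0] at h0
  rw [e1] at h1
  have := h01 0
  have := h01 1
  have := h01 2
  fin_cases i <;> fin_cases j <;> fin_cases k <;>
    simp [heisenberg, h2, h02, h12, e0, e1] <;> linarith

include hdim hg in
/-- The Jacobi identity for `V, ηᵢ, ηⱼ`. -/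
theorem dirDeriv_struc (i j l : Fin 3) {p : P} (hp : pb.proj p ∈ F.U) :
    dirDeriv F.V (F.struc i j l) p + ∑ k, F.struc i j k p * F.conn k l p
      = ∑ k, F.conn i k p * F.struc k j l p + ∑ k, F.conn j k p * F.struc i k l p := by
  have _hc : CompleteSpace EP := FiniteDimensional.complete ℝ EP
  have hW := pb.isOpen_preimage F.isOpen
  have hJ := bracket_jacobi hW F.smooth_V (F.smooth_η i) (F.smooth_η j) hp
  have e1 : bracket F.V (bracket (F.η i) (F.η j)) p
      = bracket F.V (∑ k, F.struc i j k • F.η k) p :=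
    bracket_congr hW (fun q _ => rfl) (fun q hq => by
      rw [Finset.sum_apply]; exact bracket_η_η hdim hg i j hq) hp
  have e2 : bracket (bracket F.V (F.η i)) (F.η j) p
      = - bracket (F.η j) (∑ k, F.conn i k • F.η k) p := by
    rw [bracket_swap]
    exact congrArg _ (bracket_congr hW (fun q _ => rfl) (fun q hq => by
      rw [Finset.sum_apply]; exact bracket_V_η hdim hg i hq) hp)
  have e3 : bracket (F.η i) (bracket F.V (F.η j)) p
      = bracket (F.η i) (∑ k, F.conn j k • F.η k) p :=
    bracket_congr hW (fun q _ => rfl) (fun q hq => by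
      rw [Finset.sum_apply]; exact bracket_V_η hdim hg j hq) hp
  rw [e1, e2, e3, bracket_sum_smul_right _ hW (fun k _ => (invFun_struc hg i j k).smooth)
      (fun k _ => F.smooth_η k) hp,
    bracket_sum_smul_of_vertical F.isOpen (F.isVertical_η j) (fun k => invFun_conn hg i k)
      F.invField_η hp,
    bracket_sum_smul_of_vertical F.isOpen (F.isVertical_η i) (fun k => invFun_conn hg j k)
      F.invField_η hp] at hJ
  have h := congrArg (fun Z => g p Z (F.η l p)) hJ
  simp only [map_sum, map_add, map_neg, map_smul, sum_apply, add_apply, neg_apply, smul_apply,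
    smul_eq_mul, g_ηη hg hp, Finset.sum_add_distrib] at h
  have hs := fun k => F.struc_swap (i := k) (j := j) (k := l) (p := p)
  unfold struc conn at *
  unfold evalB at *
  simp only [hs, mul_neg, Finset.sum_neg_distrib]
  simpa using h

include hdim hg in
-- These are the three components of the Jacobi identity for V, η₁, η₂. The last one differentiates
-- l; the other two say that [V, η₃] stays on the central line unless l = 0.
theorem IsAdapted.dirDeriv_struc [CompleteSpace EG] (hA : F.IsAdapted)
    (hnil : LieRing.IsNilpotent (GroupLieAlgebra 𝓘(ℝ, EG) G)) {p : P} (hp : pb.proj p ∈ F.U) :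
    dirDeriv F.V (F.struc 0 1 2) p
      = F.struc 0 1 2 p * (F.conn 0 0 p + F.conn 1 1 p - F.conn 2 2 p) ∧
    F.struc 0 1 2 p * F.conn 2 0 p = 0 ∧ F.struc 0 1 2 p * F.conn 2 1 p = 0 := by
  have hs := fun i j k => hA.struc_eq hdim hg hnil i j k hp
  have hz : ∀ k : Fin 3, k ≠ 2 → dirDeriv F.V (F.struc 0 1 k) p = 0 := fun k hk =>
    dirDeriv_eq_zero_of_eqOn_const (c := 0) (pb.isOpen_preimage F.isOpen)
      (fun q hq => by
        rw [hA.struc_eq hdim hg hnil 0 1 k hq]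
        fin_cases k <;> simp [heisenberg] at hk ⊢) hp
  have h0 := F.dirDeriv_struc hdim hg 0 1 0 hp
  have h1 := F.dirDeriv_struc hdim hg 0 1 1 hp
  have h2 := F.dirDeriv_struc hdim hg 0 1 2 hp
  rw [hz 0 (by decide)] at h0
  rw [hz 1 (by decide)] at h1
  generalize hd : dirDeriv F.V (F.struc 0 1 2) p = d at h2 ⊢
  have ht : ∀ i j k, F.struc i j k p = F.struc 0 1 2 p * heisenberg i j k := hs
  generalize F.struc 0 1 2 p = l at ht ⊢
  simp only [Fin.sum_univ_three, ht] at h0 h1 h2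
  simp [heisenberg] at h0 h1 h2
  refine ⟨by linear_combination h2, ?_, ?_⟩
  · exact mul_eq_zero.2 h0
  · exact mul_eq_zero.2 h1

include hdim hg hH in
/-- Closedness of `H` on `V, η₁, η₂, η₃`. -/
theorem IsAdapted.dirDeriv_evalT [CompleteSpace EG] (hA : F.IsAdapted)
    (hnil : LieRing.IsNilpotent (GroupLieAlgebra 𝓘(ℝ, EG) G)) {p : P} (hp : pb.proj p ∈ F.U) :
    dirDeriv F.V (evalT H (F.η 0) (F.η 1) (F.η 2)) p
      = (F.conn 0 0 p + F.conn 1 1 p + F.conn 2 2 p) * evalT H (F.η 0) (F.η 1) (F.η 2) p := by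
  have hH' := hH.toIsInvariantClosedForm
  have hcl := hH.closed _ F.V (F.η 0) (F.η 1) (F.η 2) (pb.isOpen_preimage F.isOpen) F.smooth_V
    (F.smooth_η 0) (F.smooth_η 1) (F.smooth_η 2) p hp
  unfold extDeriv₃ at hcl
  -- Components of H in the invariant frame are constant along fibres, so of the derivative terms in
  -- dH only the one along V survives.
  have hz : ∀ i j k, dirDeriv (F.η i) (evalT H F.V (F.η j) (F.η k)) p = 0 := fun i j k =>
    (hH.invFun F.isOpen F.invField_V (F.invField_η j) (F.invField_η k)).dirDeriv_eq_zero F.isOpen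
      hp (F.isVertical_η i p hp)
  have ea : ∀ i j k, evalT H (bracket F.V (F.η i)) (F.η j) (F.η k) p
      = ∑ l, F.conn i l p * evalT H (F.η l) (F.η j) (F.η k) p := fun i j k => by
    simp only [evalT, bracket_V_η hdim hg i hp, map_sum, map_smul, sum_apply, smul_apply,
      smul_eq_mul]
  have ec : ∀ i j k, evalT H (bracket (F.η i) (F.η j)) F.V (F.η k) p
      = ∑ l, F.struc i j l p * evalT H (F.η l) F.V (F.η k) p := fun i j k => by
    simp only [evalT, bracket_η_η hdim hg i j hp, map_sum, map_smul, sum_apply, smul_apply,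
      smul_eq_mul]
  have h2 : evalT H (F.η 2) F.V (F.η 2) p = 0 := evalT_self_outer hH' _ _ _
  have hs := fun i j k => hA.struc_eq hdim hg hnil i j k hp
  have hf := fun i j k => F.evalT_η hH' i j k p
  generalize F.struc 0 1 2 p = l at hs
  simp only [hz, ea, ec, hs] at hcl
  generalize evalT H (F.η 0) (F.η 1) (F.η 2) p = f at hf ⊢
  simp only [hf] at hcl
  simp [Fin.sum_univ_three, heisenberg, leviCivita, h2] at hcl
  linear_combination hcl

end OrthonormalFrame

end Bundle

/-! ### The two-form B and its exterior derivative in an adapted frame. -/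

section Bundle

variable {EP EG P M G : Type*}
  [NormedAddCommGroup EP] [NormedSpace ℝ EP] [NormedAddCommGroup EG] [NormedSpace ℝ EG]
  [FiniteDimensional ℝ EP] [FiniteDimensional ℝ EG]
  [TopologicalSpace P] [ChartedSpace EP P] [IsManifold 𝓘(ℝ, EP) ∞ P]
  [TopologicalSpace M] [ChartedSpace ℝ M] [IsManifold 𝓘(ℝ, ℝ) ∞ M]
  [TopologicalSpace G] [ChartedSpace EG G] [Group G] [LieGroup 𝓘(ℝ, EG) ∞ G]
  {pb : PrincipalBundle EP EG P M G}

namespace OrthonormalFrame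

variable {g : BilinField EP P} {m : M} {F : OrthonormalFrame pb g m} {H : TrilinField EP P}
  {T : VF EP P → VF EP P → P → ℝ} {L : VF EP P → P → ℝ}
  (hdim : Module.finrank ℝ EG = 3) (hg : SmoothMetric pb g) (hH : SmoothForm pb H)

theorem IsTensorial.right_of (hg : SmoothMetric pb g) (hT : F.IsTensorial T) {W : VF EP P}
    (hW : InvField pb W F.U) (hWv : IsVertical pb W F.U) : F.IsTensorial₁ (T W) :=
  ⟨fun i => hT.invFun hg hW hWv (F.invField_η i) (F.isVertical_η i), fun X hX hXv p hp => by
    have h : ∀ i, T W (F.η i) p = ∑ k, evalB g W (F.η k) p * T (F.η k) (F.η i) p := fun i => by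
      rw [hT.expand W _ hW hWv (F.invField_η i) (F.isVertical_η i) p hp]
      simp [evalB, g_ηη hg hp]
    rw [hT.expand W X hW hWv hX hXv p hp, Finset.sum_comm]
    simp only [h, Finset.mul_sum]
    exact Finset.sum_congr rfl fun i _ => Finset.sum_congr rfl fun j _ => by ring⟩

include hdim hg in
theorem invField_vert {X : VF EP P} (hX : InvField pb X F.U) (hv : IsVertical pb X F.U) :
    InvField pb (F.vert X) F.U := hX.congr fun p hp => vert_of_vertical hdim hg hp (hv p hp)

include hdim hg in
theorem isVertical_vert {X : VF EP P} (hv : IsVertical pb X F.U) :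
    IsVertical pb (F.vert X) F.U := hv.congr fun p hp => vert_of_vertical hdim hg hp (hv p hp)

theorem IsTensorial₁.vert_apply (hdim : Module.finrank ℝ EG = 3) (hg : SmoothMetric pb g)
    (hL : F.IsTensorial₁ L) {X : VF EP P} (hX : InvField pb X F.U)
    (hv : IsVertical pb X F.U) {p : P} (hp : pb.proj p ∈ F.U) : L (F.vert X) p = L X p := by
  rw [hL.expand _ (invField_vert hdim hg hX hv) (isVertical_vert hdim hg hv) p hp,
    hL.expand _ hX hv p hp]
  refine Finset.sum_congr rfl fun i _ => ?_
  unfold evalB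
  rw [vert_of_vertical hdim hg hp (hv p hp)]

theorem IsTensorial₁.comp_vert (hdim : Module.finrank ℝ EG = 3) (hg : SmoothMetric pb g)
    (hL : F.IsTensorial₁ L) : F.IsTensorial₁ fun X => L (F.vert X) :=
  ⟨fun i => (hL.inv i).congr fun _ hp =>
    hL.vert_apply hdim hg (F.invField_η i) (F.isVertical_η i) hp, fun X hX hv p hp => by
    rw [hL.vert_apply hdim hg hX hv hp, hL.expand X hX hv p hp]
    exact Finset.sum_congr rfl fun i _ => by
      rw [hL.vert_apply hdim hg (F.invField_η i) (F.isVertical_η i) hp]⟩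

theorem IsTensorial₁.vert_V (hdim : Module.finrank ℝ EG = 3) (hg : SmoothMetric pb g)
    (hL : F.IsTensorial₁ L) {p : P} (hp : pb.proj p ∈ F.U) : L (F.vert F.V) p = 0 := by
  have h0 : ∀ q, pb.proj q ∈ F.U → F.vert F.V q = (0 : VF EP P) q :=
    fun q hq => F.vert_V hdim hg hq
  rw [hL.expand _ (InvField.zero.congr h0) (IsVertical.zero.congr h0) p hp]
  refine Finset.sum_eq_zero fun i _ => ?_
  unfold evalB
  rw [F.vert_V hdim hg hp, map_zero, zero_apply, zero_mul]

include hdim hg in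
theorem isTensorial_bracket (k l : Fin 3) : F.IsTensorial₁ (evalB g (bracket (F.η k) (F.η l))) :=
  have _hc : CompleteSpace EP := FiniteDimensional.complete ℝ EP
  (hg.isTensorial F hdim).right_of hg ((F.invField_η k).bracket F.isOpen (F.invField_η l))
    (IsVertical.bracket F.isOpen (F.invField_η k) (F.invField_η l) (F.isVertical_η l))

include hdim hg hH in
theorem isTensorial_B : F.IsTensorial (F.B H) := by
  have t1 := fun k => ((F.isTensorial_DG hdim hg).right hg k).comp_vert hdim hg
  have t2 := fun k => (hH.isTensorial F hdim hg F.invField_V).right hg k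
  have t3 := fun k l => (isTensorial_bracket (F := F) hdim hg k l).comp_vert hdim hg
  have t4 := fun k l => (hH.isTensorial F hdim hg (F.invField_η k)).right hg l
  exact ((F.isTensorial_DH hdim hg hH).sub
    (IsTensorial.sum fun k => ((t1 k).mul (t2 k)).sub ((t1 k).mul' (t2 k)))).add
    (IsTensorial.const_mul _ (IsTensorial.sum fun k => IsTensorial.sum fun l =>
      ((t3 k l).mul (t4 k l)).sub ((t3 k l).mul' (t4 k l))))

include hdim hg hH in
-- V is parallel and has no vertical part, and H(V, ·, V) = 0; hence only the term −½ G([ηₖ, ηₗ],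
-- ηⱼ) H(ηₖ, ηₗ, V) is left, which sees just the bracket [η₁, η₂].
theorem B_V_η [CompleteSpace EG] (hA : F.IsAdapted)
    (hnil : LieRing.IsNilpotent (GroupLieAlgebra 𝓘(ℝ, EG) G)) (j : Fin 3) {p : P}
    (hp : pb.proj p ∈ F.U) : F.B H F.V (F.η j) p
      = - (F.struc 0 1 2 p * evalT H F.V (F.η 0) (F.η 1) p * if j = 2 then 1 else 0) := by
  have hH' := hH.toIsInvariantClosedForm
  have t1 := fun k => (F.isTensorial_DG hdim hg).right hg k
  have t3 := fun k l => isTensorial_bracket (F := F) hdim hg k l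
  have e1 : F.DH H F.V F.V (F.η j) p = 0 := by
    unfold DH
    have e0 : evalT H F.V F.V (F.η j) = fun _ => 0 := funext (evalT_self_left hH' _ _)
    rw [e0, dirDeriv_const]
    simp only [evalT, F.covD_V hdim hg hp, map_zero, zero_apply]
    have := hH'.swap₁ p (F.V p) (F.V p) (F.covD (F.η j) p)
    linarith
  have e3 : ∀ k l, evalB g (bracket (F.η k) (F.η l)) (F.vert (F.η j)) p = F.struc k l j p :=
    fun k l => (t3 k l).vert_apply hdim hg (F.invField_η j) (F.isVertical_η j) hp
  have e4 : ∀ k l, evalT H (F.η k) (F.η l) F.V p = evalT H F.V (F.η k) (F.η l) p := fun k l => by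
    rw [evalT_swap_right hH', evalT_swap_left hH', neg_neg]
  have hs := fun i j k => hA.struc_eq hdim hg hnil i j k hp
  have h10 := evalT_swap_right hH' F.V (F.η 1) (F.η 0) p
  unfold B
  rw [e1]
  simp only [(t1 _).vert_V hdim hg hp, (t3 _ _).vert_V hdim hg hp, evalT_self_outer hH', e3, e4]
  generalize F.struc 0 1 2 p = l at hs ⊢
  simp only [hs]
  fin_cases j <;> simp [Fin.sum_univ_three, heisenberg, h10]
  ring

include hdim hg hH in
-- The same cancellation for an arbitrary vertical first argument; it is needed for the term B([ηᵢ,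
-- ηⱼ], V) of dB.
theorem B_vertical_V [CompleteSpace EG] (hA : F.IsAdapted)
    (hnil : LieRing.IsNilpotent (GroupLieAlgebra 𝓘(ℝ, EG) G)) {X : VF EP P}
    (hX : InvField pb X F.U) (hv : IsVertical pb X F.U) {p : P}
    (hp : pb.proj p ∈ F.U) : F.B H X F.V p
      = evalB g X (F.η 2) p * (F.struc 0 1 2 p * evalT H F.V (F.η 0) (F.η 1) p) := by
  have hH' := hH.toIsInvariantClosedForm
  have t1 := fun k => (F.isTensorial_DG hdim hg).right hg k
  have t3 := fun k l => isTensorial_bracket (F := F) hdim hg k l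
  have e1 : F.DH H F.V X F.V p = 0 := by
    unfold DH
    have e0 : evalT H F.V X F.V = fun _ => 0 := funext (evalT_self_outer hH' _ _)
    rw [e0, dirDeriv_const]
    simp only [evalT, F.covD_V hdim hg hp, map_zero, zero_apply]
    have h1 := hH'.swap₁ p (F.V p) (F.V p) (F.covD X p)
    have h2 := hH'.swap₂ p (F.V p) (F.covD X p) (F.V p)
    linarith
  have e3 : ∀ k l, evalB g (bracket (F.η k) (F.η l)) (F.vert X) p
      = ∑ j, evalB g X (F.η j) p * F.struc k l j p := fun k l => by
    rw [(t3 k l).vert_apply hdim hg hX hv hp, (t3 k l).expand X hX hv p hp]; rfl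
  have e4 : ∀ k l, evalT H (F.η k) (F.η l) F.V p = evalT H F.V (F.η k) (F.η l) p := fun k l => by
    rw [evalT_swap_right hH', evalT_swap_left hH', neg_neg]
  have hs := fun i j k => hA.struc_eq hdim hg hnil i j k hp
  have h10 := evalT_swap_right hH' F.V (F.η 1) (F.η 0) p
  unfold B
  rw [e1]
  simp only [(t1 _).vert_V hdim hg hp, (t3 _ _).vert_V hdim hg hp, evalT_self_outer hH', e3, e4]
  generalize F.struc 0 1 2 p = l at hs ⊢
  simp only [hs]
  simp [Fin.sum_univ_three, heisenberg, h10]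
  ring

include hdim hg hH in
-- The bracket terms cancel: the sum of G([ηₖ, ηₗ], ηᵢ) H(ηₖ, ηₗ, ηⱼ) is nonzero only for i = j = 2,
-- hence symmetric, and B takes its skew part.
theorem B_η [CompleteSpace EG] (hA : F.IsAdapted)
    (hnil : LieRing.IsNilpotent (GroupLieAlgebra 𝓘(ℝ, EG) G)) (i j : Fin 3) {p : P}
    (hp : pb.proj p ∈ F.U) : F.B H (F.η i) (F.η j) p
      = F.DH H F.V (F.η i) (F.η j) p
        - ∑ k, (F.DG (F.η k) (F.η i) p * evalT H F.V (F.η k) (F.η j) p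
          - F.DG (F.η k) (F.η j) p * evalT H F.V (F.η k) (F.η i) p) := by
  have hH' := hH.toIsInvariantClosedForm
  have t1 := fun k => (F.isTensorial_DG hdim hg).right hg k
  have t3 := fun k l => isTensorial_bracket (F := F) hdim hg k l
  have hi := F.invField_η
  have hv := F.isVertical_η
  have e3 : ∀ k l i, evalB g (bracket (F.η k) (F.η l)) (F.vert (F.η i)) p = F.struc k l i p :=
    fun k l i => (t3 k l).vert_apply hdim hg (hi i) (hv i) hp
  have hs := fun i j k => hA.struc_eq hdim hg hnil i j k hp
  have hf := fun i j k => F.evalT_η hH' i j k p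
  unfold B
  simp only [(t1 _).vert_apply hdim hg (hi _) (hv _) hp, e3]
  generalize F.struc 0 1 2 p = l at hs ⊢
  generalize evalT H (F.η 0) (F.η 1) (F.η 2) p = f at hf
  simp only [hs, hf]
  rw [add_eq_left]
  fin_cases i <;> fin_cases j <;> simp [Fin.sum_univ_three, heisenberg, leviCivita]

include hdim hg hH in
-- Derivatives along the fibres vanish by invariance. The brackets [V, ηᵢ] produce the connection
-- coefficients, and [ηᵢ, ηⱼ] produces the last term through `B_vertical_V`.
theorem extDeriv₂_B [CompleteSpace EG] (hA : F.IsAdapted)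
    (hnil : LieRing.IsNilpotent (GroupLieAlgebra 𝓘(ℝ, EG) G)) (i j : Fin 3) {p : P}
    (hp : pb.proj p ∈ F.U) : extDeriv₂ (F.B H) F.V (F.η i) (F.η j) p
      = dirDeriv F.V (F.B H (F.η i) (F.η j)) p
        - ∑ k, F.conn i k p * F.B H (F.η k) (F.η j) p
        + ∑ k, F.conn j k p * F.B H (F.η k) (F.η i) p
        - F.struc 0 1 2 p ^ 2 * evalT H F.V (F.η 0) (F.η 1) p * heisenberg i j 2 := by
  have _hc : CompleteSpace EP := FiniteDimensional.complete ℝ EP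
  have hB := isTensorial_B (F := F) hdim hg hH
  have hz : ∀ i j, dirDeriv (F.η i) (F.B H F.V (F.η j)) p = 0 := fun i j => by
    have hinv : InvFun pb (F.B H F.V (F.η j)) F.U := InvFun.congr
      (((invFun_struc hg 0 1 2).mul (hH.invFun F.isOpen F.invField_V (F.invField_η 0)
        (F.invField_η 1))).mul (InvFun.const (if j = 2 then 1 else 0))).neg
      fun q hq => B_V_η hdim hg hH hA hnil j hq
    exact hinv.dirDeriv_eq_zero F.isOpen hp (F.isVertical_η i p hp)
  have hV : ∀ i, InvField pb (bracket F.V (F.η i)) F.U := fun i =>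
    F.invField_V.bracket F.isOpen (F.invField_η i)
  have hVv : ∀ i, IsVertical pb (bracket F.V (F.η i)) F.U := fun i =>
    IsVertical.bracket F.isOpen F.invField_V (F.invField_η i) (F.isVertical_η i)
  have ha : ∀ i j, F.B H (bracket F.V (F.η i)) (F.η j) p
      = ∑ k, F.conn i k p * F.B H (F.η k) (F.η j) p := fun i j => by
    rw [hB.expand _ _ (hV i) (hVv i) (F.invField_η j) (F.isVertical_η j) p hp]
    simp [evalB, g_ηη hg hp, conn]
  have hb := B_vertical_V hdim hg hH hA hnil
    ((F.invField_η i).bracket F.isOpen (F.invField_η j))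
    (IsVertical.bracket F.isOpen (F.invField_η i) (F.invField_η j) (F.isVertical_η j)) hp
  have hs : evalB g (bracket (F.η i) (F.η j)) (F.η 2) p = F.struc 0 1 2 p * heisenberg i j 2 :=
    hA.struc_eq hdim hg hnil i j 2 hp
  unfold extDeriv₂
  rw [hz, hz, ha, ha, hb, hs]
  ring

end OrthonormalFrame

end Bundle

/-- The variation of `|DG|² + tr_g H²` under the flow in terms of the components, at a point where
the bracket has structure constants `l • heisenberg` and `H(η₁, η₂, η₃) = f`. -/
theorem variation_identity {a K X Y h z y S B vK vX vh vz vS vB dK dh : Fin 3 → Fin 3 → ℝ}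
    {A₀ A : Fin 3 → ℝ} {l f vl vf Q VVQ : ℝ}
    (hK : ∀ i j, K i j = -(a i j + a j i)) (hX : ∀ i j, X i j = X j i)
    (hh : ∀ i j, h i j = -h j i) (hz : ∀ i j, z i j = -z j i) (hy : ∀ i j, y i j = -y j i)
    (hl0 : l * a 2 0 = 0) (hl1 : l * a 2 1 = 0)
    (hvK : ∀ i j, vK i j = X i j + ∑ k, a i k * K k j + ∑ k, a j k * K i k)
    (hvX : ∀ i j, vX i j = Y i j + ∑ k, a i k * X k j + ∑ k, a j k * X i k)
    (hvh : ∀ i j, vh i j = z i j + ∑ k, a i k * h k j + ∑ k, a j k * h i k)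
    (hvz : ∀ i j, vz i j = y i j + ∑ k, a i k * z k j + ∑ k, a j k * z i k)
    (hvl : vl = l * (a 0 0 + a 1 1 - a 2 2)) (hvf : vf = (a 0 0 + a 1 1 + a 2 2) * f)
    (hS : ∀ i j, S i j = X i j - ∑ k, K i k * K k j
      + l * l * (if i = j then ![1, 1, -1] i else 0) + ∑ k, h i k * h j k
      + f * f * (if i = j then 1 else 0))
    (hvS : ∀ i j, vS i j = vX i j - ∑ k, (vK i k * K k j + K i k * vK k j)
      + (vl * l + l * vl) * (if i = j then ![1, 1, -1] i else 0)
      + ∑ k, (vh i k * h j k + h i k * vh j k) + (vf * f + f * vf) * (if i = j then 1 else 0))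
    (hB : ∀ i j, B i j = z i j - ∑ k, (K k i * h k j - K k j * h k i))
    (hvB : ∀ i j, vB i j = vz i j - ∑ k, ((vK k i * h k j + K k i * vh k j)
      - (vK k j * h k i + K k j * vh k i)))
    (hA₀ : ∀ i, A₀ i = ∑ k, ∑ j, l * heisenberg k i j * K j k)
    (hA : ∀ i, A i = A₀ i + 1 / 2 * (f * ∑ j, ∑ k, h j k * leviCivita i j k))
    (hdK : ∀ i j, dK i j = vS i j - ∑ k, a i k * S k j - ∑ k, a j k * S i k
      + ∑ k, A k * (l * heisenberg k i j) + ∑ k, A k * (l * heisenberg k j i))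
    (hdh : ∀ i j, dh i j = vB i j - ∑ k, a i k * B k j + ∑ k, a j k * B k i
      - l ^ 2 * h 0 1 * heisenberg i j 2 - ∑ k, A k * (f * leviCivita k i j))
    (hQ : Q = ∑ i, ∑ j, K i j ^ 2 + ∑ i, ∑ j, h i j ^ 2)
    (hVVQ : VVQ = 2 * ∑ i, ∑ j, (vK i j * X i j + K i j * vX i j)
      - 2 * ∑ i, ∑ j, ∑ k, (vK i j * K j k * K k i + K i j * vK j k * K k i
        + K i j * K j k * vK k i)
      + 2 * ∑ i, ∑ j, (vh i j * z i j + h i j * vz i j)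
      - 2 * ∑ i, ∑ j, ∑ k, (vK i j * h j k * h i k + K i j * vh j k * h i k
        + K i j * h j k * vh i k)) :
    - 2 * ∑ i, ∑ j, ∑ k, S i j * K j k * K i k + 2 * ∑ i, ∑ j, dK i j * K i j
      - 2 * ∑ i, ∑ j, ∑ k, S i j * h j k * h i k + 2 * ∑ i, ∑ j, dh i j * h i j - 1 / 2 * Q * Q
    = VVQ - 1 / 2 * Q ^ 2
      - (2 * ∑ i, ∑ j, (X i j - ∑ k, K i k * K j k + ∑ k, h i k * h j k) ^ 2
        + 2 * ∑ i, ∑ j, (z i j + ∑ k, h k i * K k j - ∑ k, h k j * K k i) ^ 2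
        + 2 * l ^ 2 * (∑ k, K k k - 2 * K 2 2) ^ 2
        + 4 * l ^ 2 * (∑ k, K k 2 ^ 2 - K 2 2 ^ 2)
        + 2 * ∑ i, A₀ i ^ 2
        + 2 * ∑ i, (A₀ i + f * ∑ j, ∑ k, h j k * leviCivita i j k) ^ 2
        + 8 * (l * h 0 1) ^ 2 + 2 * f ^ 2 * (∑ k, K k k) ^ 2) := by
  have diag : ∀ u : Fin 3 → Fin 3 → ℝ, (∀ i j, u i j = - u j i) → ∀ i, u i i = 0 :=
    fun u hu i => by linarith [hu i i]
  have h0 := diag h hh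
  have z0 := diag z hz
  have y0 := diag y hy
  have h10 := hh 1 0
  have h20 := hh 2 0
  have h21 := hh 2 1
  have z10 := hz 1 0
  have z20 := hz 2 0
  have z21 := hz 2 1
  have y10 := hy 1 0
  have y20 := hy 2 0
  have y21 := hy 2 1
  have X10 := hX 1 0
  have X20 := hX 2 0
  have X21 := hX 2 1
  -- The identity is polynomial only modulo l a₂₀ = l a₂₁ = 0. In each of the two cases the
  -- off-diagonal relations can be substituted, after which everything is a polynomial in free
  -- variables.
  have hcase : l = 0 ∨ (a 2 0 = 0 ∧ a 2 1 = 0) := by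
    rcases eq_or_ne l 0 with hl | hl
    · exact Or.inl hl
    · exact Or.inr ⟨(mul_eq_zero.1 hl0).resolve_left hl, (mul_eq_zero.1 hl1).resolve_left hl⟩
  clear hh hz hy hX hl0 hl1 diag
  subst hQ hVVQ
  rcases hcase with rfl | ⟨ha, hb⟩
  · simp only [hdK, hdh, hA, hA₀, hvB, hB, hvS, hS, hvl, hvf, hvz, hvh, hvX, hvK]
    simp only [Fin.sum_univ_three, heisenberg, leviCivita]
    simp [h0, z0, y0, h10, h20, h21, z10, z20, z21, y10, y20, y21, X10, X20, X21]
    simp only [hK]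
    ring
  · simp only [hdK, hdh, hA, hA₀, hvB, hB, hvS, hS, hvl, hvf, hvz, hvh, hvX, hvK]
    simp only [Fin.sum_univ_three, heisenberg, leviCivita]
    simp [h0, z0, y0, h10, h20, h21, z10, z20, z21, y10, y20, y21, X10, X20, X21]
    simp only [hK, ha, hb]
    ring

open scoped Matrix in
-- From O G Oᵀ = 1 follows Oᵀ O = G⁻¹. The sum of squares is the trace of (O K Oᵀ)(O K Oᵀ)ᵀ, and
-- cyclic invariance collects the factors Oᵀ O. An orthonormal frame O thereby disappears from
-- square norms.
theorem sum_sq_congruence {O G K : Matrix (Fin 3) (Fin 3) ℝ} (h : O * G * Oᵀ = 1) (φ : ℝ) :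
    ∑ i, ∑ j, (φ * (O * K * Oᵀ) i j) ^ 2 = φ ^ 2 * (G⁻¹ * K * G⁻¹ * Kᵀ).trace := by
  have h1 : G * Oᵀ * O = 1 := by
    rw [Matrix.mul_assoc] at h
    exact mul_eq_one_comm.1 h
  have h2 : Oᵀ * O = G⁻¹ := by
    rw [Matrix.mul_assoc] at h1
    exact (Matrix.inv_eq_right_inv h1).symm
  have h3 : (G⁻¹ * K * G⁻¹ * Kᵀ).trace = ((O * K * Oᵀ) * (O * K * Oᵀ)ᵀ).trace := by
    rw [← h2]
    simp only [Matrix.transpose_mul, Matrix.transpose_transpose]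
    have : Oᵀ * O * K * (Oᵀ * O) * Kᵀ = Oᵀ * (O * K * Oᵀ * O * Kᵀ) := by
      simp only [Matrix.mul_assoc]
    rw [this, Matrix.trace_mul_comm]
    simp only [Matrix.mul_assoc]
  rw [h3]
  simp only [Matrix.trace, Matrix.diag, Matrix.mul_apply (M := O * K * Oᵀ), Matrix.transpose_apply,
    Finset.mul_sum]
  exact Finset.sum_congr rfl fun i _ => Finset.sum_congr rfl fun j _ => by ring

/-! ### A second metric expressed in a fixed frame. -/

section Bundle

variable {EP EG P M G : Type*}
  [NormedAddCommGroup EP] [NormedSpace ℝ EP] [NormedAddCommGroup EG] [NormedSpace ℝ EG]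
  [FiniteDimensional ℝ EP] [FiniteDimensional ℝ EG]
  [TopologicalSpace P] [ChartedSpace EP P] [IsManifold 𝓘(ℝ, EP) ∞ P]
  [TopologicalSpace M] [ChartedSpace ℝ M] [IsManifold 𝓘(ℝ, ℝ) ∞ M]
  [TopologicalSpace G] [ChartedSpace EG G] [Group G] [LieGroup 𝓘(ℝ, EG) ∞ G]
  {pb : PrincipalBundle EP EG P M G}

namespace OrthonormalFrame

variable {g g' : BilinField EP P} {m m' : M} (F : OrthonormalFrame pb g m)
  {H' : TrilinField EP P}

/-- The Gram matrix of the vertical frame fields with respect to another metric. -/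
def gram (g' : BilinField EP P) (p : P) : Matrix (Fin 3) (Fin 3) ℝ :=
  Matrix.of fun i j => evalB g' (F.η i) (F.η j) p

/-- The coefficients of the vertical part of `V` with respect to another metric. -/
def shift (g' : BilinField EP P) (i : Fin 3) (p : P) : ℝ :=
  ∑ j, (F.gram g' p)⁻¹ i j * evalB g' F.V (F.η j) p

/-- The square norm of the horizontal part of `V` with respect to another metric. -/
def normSqHor (g' : BilinField EP P) (p : P) : ℝ :=
  evalB g' F.V F.V p - ∑ i, F.shift g' i p * evalB g' F.V (F.η i) p

/-- The derivative of the fibre metric of another metric along the horizontal part of `V`. -/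
def varG (g' : BilinField EP P) (p : P) : Matrix (Fin 3) (Fin 3) ℝ :=
  Matrix.of fun i j => dirDeriv F.V (evalB g' (F.η i) (F.η j)) p
    - ∑ k, (F.conn i k p - ∑ l, F.shift g' l p * F.struc l i k p) * evalB g' (F.η k) (F.η j) p
    - ∑ k, (F.conn j k p - ∑ l, F.shift g' l p * F.struc l j k p) * evalB g' (F.η i) (F.η k) p

/-- The contraction of a three-form with the part of `V` horizontal for another metric. -/
def varH (g' : BilinField EP P) (H' : TrilinField EP P) (p : P) : Matrix (Fin 3) (Fin 3) ℝ :=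
  Matrix.of fun i j => evalT H' F.V (F.η i) (F.η j) p
    - ∑ k, F.shift g' k p * evalT H' (F.η k) (F.η i) (F.η j) p

/-- `|DG|²` of another metric in the given frame. -/
def normSqVarG (g' : BilinField EP P) (p : P) : ℝ :=
  ((F.gram g' p)⁻¹ * F.varG g' p * (F.gram g' p)⁻¹ * (F.varG g' p).transpose).trace
    / F.normSqHor g' p

/-- `tr_g H²` for another metric in the given frame. -/
def normSqVarH (g' : BilinField EP P) (H' : TrilinField EP P) (p : P) : ℝ :=
  ((F.gram g' p)⁻¹ * F.varH g' H' p * (F.gram g' p)⁻¹ * (F.varH g' H' p).transpose).trace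
    / F.normSqHor g' p

variable {F} (hdim : Module.finrank ℝ EG = 3) (hg : SmoothMetric pb g)
  (hg' : SmoothMetric pb g')

include hg hg' in
-- A kernel vector x would give a combination ∑ xⱼ ηⱼ of zero g'-length, which forces x = 0 because
-- the ηⱼ are independent.
theorem det_gram_ne_zero {p : P} (hp : pb.proj p ∈ F.U) : (F.gram g' p).det ≠ 0 := by
  intro h
  obtain ⟨x, hx, hx0⟩ := Matrix.exists_mulVec_eq_zero_iff.2 h
  apply hx
  have h1 : ∀ i, ∑ j, g' p (F.η i p) (F.η j p) * x j = 0 := fun i => congrFun hx0 i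
  set Z : TangentSpace 𝓘(ℝ, EP) p := ∑ j, x j • F.η j p with hZ
  have h2 : g' p Z Z = 0 := by
    have h3 : ∀ i, g' p (F.η i p) Z = 0 := fun i => by
      rw [hZ, map_sum, ← h1 i]
      exact Finset.sum_congr rfl fun j _ => by rw [map_smul, smul_eq_mul, mul_comm]
    refine (congrArg (g' p Z) hZ).trans ?_
    rw [map_sum]
    exact Finset.sum_eq_zero fun i _ => by rw [map_smul, hg'.symm, h3, smul_zero]
  have hZ0 : Z = 0 := by
    by_contra hne
    exact (hg'.pos p Z hne).ne' h2
  funext j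
  have h4 := congrArg (fun Z => g p Z (F.η j p)) hZ0
  simp only [hZ, map_sum, map_smul, sum_apply, smul_apply, smul_eq_mul, g_ηη hg hp, map_zero,
    zero_apply] at h4
  simpa using h4

/-- The horizontal part of `V` for another metric. -/
def horPart (F : OrthonormalFrame pb g m) (g' : BilinField EP P) (p : P) :
    TangentSpace 𝓘(ℝ, EP) p := F.V p - ∑ i, F.shift g' i p • F.η i p

include hg hg' in
-- The coefficients `shift` solve the linear system of the Gram matrix, and that system is exactly
-- this orthogonality.
theorem g_horPart_η (j : Fin 3) {p : P} (hp : pb.proj p ∈ F.U) :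
    g' p (F.horPart g' p) (F.η j p) = 0 := by
  have hdet := det_gram_ne_zero hg hg' hp
  have h1 : F.gram g' p * (F.gram g' p)⁻¹ = 1 :=
    Matrix.mul_nonsing_inv _ (isUnit_iff_ne_zero.2 hdet)
  have h2 : ∀ k, ∑ i, g' p (F.η j p) (F.η i p) * (F.gram g' p)⁻¹ i k = if j = k then 1 else 0 :=
    fun k => by
      have := congrFun (congrFun h1 j) k
      rw [Matrix.mul_apply, Matrix.one_apply] at this
      exact this
  unfold horPart
  simp only [map_sub, map_sum, map_smul, sub_apply, sum_apply, smul_apply, smul_eq_mul]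
  have h3 : ∑ i, F.shift g' i p * g' p (F.η i p) (F.η j p) = g' p (F.V p) (F.η j p) := by
    unfold shift evalB
    simp only [Finset.sum_mul]
    rw [Finset.sum_comm]
    have : ∀ k, ∑ i, (F.gram g' p)⁻¹ i k * g' p (F.V p) (F.η k p) * g' p (F.η i p) (F.η j p)
        = (if j = k then 1 else 0) * g' p (F.V p) (F.η k p) := fun k => by
      rw [← h2 k, Finset.sum_mul]
      exact Finset.sum_congr rfl fun i _ => by rw [hg'.symm p (F.η i p)]; ring
    simp only [this]
    simp
  rw [h3, sub_self]

include hg hg' in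
theorem g_horPart_self {p : P} (hp : pb.proj p ∈ F.U) :
    g' p (F.horPart g' p) (F.horPart g' p) = F.normSqHor g' p := by
  conv_lhs => enter [2]; unfold horPart
  rw [map_sub, map_sum]
  simp only [map_smul, g_horPart_η hg hg' _ hp, smul_zero, Finset.sum_const_zero, sub_zero]
  unfold horPart normSqHor evalB
  simp only [map_sub, map_sum, map_smul, sub_apply, sum_apply, smul_apply, smul_eq_mul]
  congr 1
  exact Finset.sum_congr rfl fun i _ => by rw [hg'.symm p (F.η i p)]

theorem proj_horPart {p : P} (hp : pb.proj p ∈ F.U) :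
    mfderiv 𝓘(ℝ, EP) 𝓘(ℝ, ℝ) pb.proj p (F.horPart g' p)
      = mfderiv 𝓘(ℝ, EP) 𝓘(ℝ, ℝ) pb.proj p (F.V p) := by
  unfold horPart
  rw [map_sub, map_sum]
  simp only [map_smul, F.vertical_η _ p hp, smul_zero, Finset.sum_const_zero, sub_zero]

include hdim hg hg' in
theorem normSqHor_pos {p : P} (hp : pb.proj p ∈ F.U) : 0 < F.normSqHor g' p := by
  rw [← g_horPart_self hg hg' hp]
  refine hg'.pos p _ fun h0 => ?_
  have h1 := F.proj_horPart (g' := g') hp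
  rw [h0, map_zero] at h1
  exact proj_V_ne_zero hdim hg hp h1.symm

variable (F' : OrthonormalFrame pb g' m')

include hdim hg hg' in
/-- The horizontal unit vector of another frame. -/
theorem V_eq_smul_horPart {p : P} (hp : pb.proj p ∈ F.U) (hp' : pb.proj p ∈ F'.U) :
    F'.V p = g p (F'.V p) (F.V p) • F.horPart g' p ∧
      g p (F'.V p) (F.V p) ^ 2 * F.normSqHor g' p = 1 := by
  set φ := g p (F'.V p) (F.V p) with hφ
  -- Z is vertical, since both terms have the same projection, and g'-orthogonal to all vertical
  -- vectors; so it is orthogonal to itself.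
  set Z := F'.V p - φ • F.horPart g' p with hZ
  have hZv : Z = ∑ k, g p Z (F.η k p) • F.η k p := by
    refine expansion_vertical hdim hg hp ?_
    have h1 := F.proj_horPart (g' := g') hp
    have h2 := congrArg (mfderiv 𝓘(ℝ, EP) 𝓘(ℝ, ℝ) pb.proj p) (expansion hdim hg hp (F'.V p))
    rw [map_add, map_sum, map_smul] at h2
    simp only [map_smul, F.vertical_η _ p hp, smul_zero, Finset.sum_const_zero, add_zero] at h2
    rw [hZ, map_sub, map_smul, h1, h2, hφ]
    exact sub_self _
  have hη : ∀ j, g' p Z (F.η j p) = 0 := fun j => by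
    rw [hZ, map_sub, map_smul, sub_apply, smul_apply, g_horPart_η hg hg' j hp, smul_zero, sub_zero,
      hg'.symm]
    exact g_V_of_vertical hdim hg' hp' (F.vertical_η j p hp)
  have hZ0 : Z = 0 := by
    by_contra hne
    refine (hg'.pos p Z hne).ne' ?_
    conv_lhs => enter [2]; rw [hZv]
    rw [map_sum]
    exact Finset.sum_eq_zero fun j _ => by rw [map_smul, hη, smul_zero]
  have hV : F'.V p = φ • F.horPart g' p := sub_eq_zero.1 hZ0
  refine ⟨hV, ?_⟩
  have h1 := F'.unit_V p hp'
  unfold evalB at h1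
  rw [hV, map_smul, map_smul, smul_apply, g_horPart_self hg hg' hp, smul_eq_mul, smul_eq_mul] at h1
  rw [← h1]
  ring

/-- The coefficients of one vertical frame in another. -/
def trans (F : OrthonormalFrame pb g m) (F' : OrthonormalFrame pb g' m') (i k : Fin 3) : P → ℝ :=
  evalB g (F'.η i) (F.η k)

include hdim hg in
theorem η_eq_sum (i : Fin 3) {p : P} (hp : pb.proj p ∈ F.U) (hp' : pb.proj p ∈ F'.U) :
    F'.η i p = ∑ k, F.trans F' i k p • F.η k p :=
  expansion_vertical hdim hg hp (F'.vertical_η i p hp')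

include hg hg' in
theorem invFun_trans (i k : Fin 3) : InvFun pb (F.trans F' i k) (F.U ∩ F'.U) :=
  hg.invFun (F.isOpen.inter F'.isOpen) ((F'.invField_η i).mono inter_subset_right)
    ((F.invField_η k).mono inter_subset_left)

include hdim hg in
theorem evalB_η_eq (i j : Fin 3) {p : P} (hp : pb.proj p ∈ F.U) (hp' : pb.proj p ∈ F'.U) :
    evalB g' (F'.η i) (F'.η j) p
      = ∑ k, ∑ l, F.trans F' i k p * F.trans F' j l p * evalB g' (F.η k) (F.η l) p := by
  unfold evalB
  rw [η_eq_sum hdim hg F' i hp hp', η_eq_sum hdim hg F' j hp hp']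
  simp only [map_sum, map_smul, sum_apply, smul_apply, smul_eq_mul, Finset.mul_sum]
  rw [Finset.sum_comm]
  exact Finset.sum_congr rfl fun k _ => Finset.sum_congr rfl fun l _ => by ring

include hdim hg hg' in
-- With V' = φ (V − ∑ shiftₗ ηₗ), differentiating an invariant function along V' is φ times
-- differentiating it along V. In the bracket with ηₖ no derivative of φ or of the shift appears,
-- because these are constant along fibres.
theorem bracket_V_η_trans (i : Fin 3) {p : P} (hp : pb.proj p ∈ F.U)
    (hp' : pb.proj p ∈ F'.U) :
    bracket F'.V (F'.η i) p = ∑ n, (g p (F'.V p) (F.V p) * (dirDeriv F.V (F.trans F' i n) p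
      + ∑ k, F.trans F' i k p * (F.conn k n p - ∑ l, F.shift g' l p * F.struc l k n p)))
        • F.η n p := by
  have _hc : CompleteSpace EP := FiniteDimensional.complete ℝ EP
  set φ := g p (F'.V p) (F.V p) with hφ
  have hU : IsOpen (F.U ∩ F'.U) := F.isOpen.inter F'.isOpen
  have hW := pb.isOpen_preimage hU
  have hpW : pb.proj p ∈ F.U ∩ F'.U := ⟨hp, hp'⟩
  have iη := fun k => (F.invField_η k).mono (inter_subset_left (t := F'.U))
  have vη : ∀ k, IsVertical pb (F.η k) (F.U ∩ F'.U) := fun k q hq => F.isVertical_η k q hq.1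
  have iV := F.invField_V.mono (inter_subset_left (t := F'.U))
  have iV' := F'.invField_V.mono (inter_subset_right (s := F.U))
  have iO := fun k => invFun_trans hg hg' F' (F := F) i k
  obtain ⟨hV', -⟩ := V_eq_smul_horPart hdim hg hg' F' hp hp'
  rw [← hφ] at hV'
  -- the derivative along the new horizontal field
  have hder : ∀ f : P → ℝ, InvFun pb f (F.U ∩ F'.U) →
      dirDeriv F'.V f p = φ * dirDeriv F.V f p := fun f hf => by
    have h0 : ∀ k, mfderiv 𝓘(ℝ, EP) 𝓘(ℝ, ℝ) f p (F.η k p) = 0 := fun k =>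
      hf.dirDeriv_eq_zero hU hpW (vη k p hpW)
    unfold dirDeriv
    rw [hV', map_smul]
    unfold horPart
    rw [map_sub, map_sum]
    simp only [map_smul, h0, smul_zero, Finset.sum_const_zero, sub_zero]
    rfl
  -- brackets with the new horizontal field
  have hbr : ∀ k, bracket F'.V (F.η k) p
      = ∑ n, (φ * (F.conn k n p - ∑ l, F.shift g' l p * F.struc l k n p)) • F.η n p := fun k => by
    have iφ : InvFun pb (evalB g F'.V F.V) (F.U ∩ F'.U) := hg.invFun hU iV' iV
    have iw := fun l => hg.invFun hU iV' (iη l)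
    have e1 : bracket F'.V (F.η k) p = - bracket (F.η k)
        (evalB g F'.V F.V • F.V + ∑ l, evalB g F'.V (F.η l) • F.η l) p := by
      rw [bracket_swap]
      exact congrArg _ (bracket_congr hW (fun q _ => rfl) (fun q hq => by
        rw [Pi.add_apply, Finset.sum_apply]; exact expansion hdim hg hq.1 (F'.V q)) hpW)
    have hw : ∀ l, evalB g F'.V (F.η l) p = - (φ * F.shift g' l p) := fun l => by
      unfold evalB
      rw [hV']
      unfold horPart
      simp only [map_sub, map_sum, map_smul, sub_apply, sum_apply, smul_apply, smul_eq_mul,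
        g_ηη hg hp, g_Vη hg hp]
      simp
    have hn : bracket (F.η k) F.V p = - bracket F.V (F.η k) p := bracket_swap
    rw [e1, bracket_add_right hW (InvField.smul iφ iV).smooth
        (InvField.sum _ fun l _ => InvField.smul (iw l) (iη l)).smooth hpW,
      bracket_smul_right_of_vertical hU (vη k) iφ iV hpW,
      bracket_sum_smul_of_vertical hU (vη k) iw iη hpW, hn, bracket_V_η hdim hg k hp]
    have hs : ∀ l n, F.struc k l n p = - F.struc l k n p := fun l n => F.struc_swap k l n p
    simp only [bracket_η_η hdim hg k _ hp, hw, hs]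
    change -(φ • (-∑ n, _) + _) = _
    simp only [Fin.sum_univ_three]
    module
  have e2 : bracket F'.V (F'.η i) p = bracket F'.V (∑ k, F.trans F' i k • F.η k) p :=
    bracket_congr hW (fun q _ => rfl) (fun q hq => by
      rw [Finset.sum_apply]; exact η_eq_sum hdim hg F' i hq.1 hq.2) hpW
  rw [e2, bracket_sum_smul_right _ hW (fun k _ => (iO k).smooth) (fun k _ => (iη k).smooth) hpW]
  simp only [hbr, hder _ (iO _)]
  simp only [Fin.sum_univ_three]
  module

include hdim hg hg' in
-- The derivatives of the frame change O drop out on differentiating O G' Oᵀ = 1, so DG in the new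
-- frame is φ O K Oᵀ with K = `varG`.
theorem DG_η_trans (i j : Fin 3) {p : P} (hp : pb.proj p ∈ F.U) (hp' : pb.proj p ∈ F'.U) :
    F'.DG (F'.η i) (F'.η j) p = g p (F'.V p) (F.V p) *
      ∑ k, ∑ l, F.trans F' i k p * F.varG g' p k l * F.trans F' j l p := by
  have hU : IsOpen (F.U ∩ F'.U) := F.isOpen.inter F'.isOpen
  have hpW : pb.proj p ∈ F.U ∩ F'.U := ⟨hp, hp'⟩
  have iO := fun i k => invFun_trans hg hg' F' (F := F) i k
  have iG := fun k l => (hg'.invFun F.isOpen (F.invField_η k) (F.invField_η l)).mono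
    (inter_subset_left (t := F'.U))
  have hgs : ∀ k l, evalB g' (F.η k) (F.η l) p = evalB g' (F.η l) (F.η k) p :=
    fun k l => hg'.symm _ _ _
  -- This is the derivative along V of the relation O G' Oᵀ = 1.
  have hrel : ∑ k, ∑ l, (F.trans F' i k p * F.trans F' j l p
      * dirDeriv F.V (evalB g' (F.η k) (F.η l)) p + evalB g' (F.η k) (F.η l) p *
        (F.trans F' i k p * dirDeriv F.V (F.trans F' j l) p
        + F.trans F' j l p * dirDeriv F.V (F.trans F' i k) p)) = 0 := by
    have h0 := dirDeriv_eq_zero_of_eqOn_const (X := F.V) (f := fun q => ∑ k, ∑ l,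
      F.trans F' i k q * F.trans F' j l q * evalB g' (F.η k) (F.η l) q)
      (c := if i = j then 1 else 0) (pb.isOpen_preimage hU)
      (fun q hq => (evalB_η_eq hdim hg F' i j hq.1 hq.2).symm.trans (F'.orthonormal_η i j q hq.2))
      hpW
    have d3 := fun k l => (((iO i k).mul (iO j l)).mul (iG k l)).mdifferentiableAt hU hpW
    rw [dirDeriv_sum _ fun k _ => MDifferentiableAt.sum_fun _ fun l _ => d3 k l] at h0
    rw [← h0]
    refine Finset.sum_congr rfl fun k _ => ?_
    rw [dirDeriv_sum _ fun l _ => d3 k l]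
    refine Finset.sum_congr rfl fun l _ => ?_
    rw [dirDeriv_mul (f := fun q => F.trans F' i k q * F.trans F' j l q)
      (((iO i k).mul (iO j l)).mdifferentiableAt hU hpW) ((iG k l).mdifferentiableAt hU hpW),
      dirDeriv_mul ((iO i k).mdifferentiableAt hU hpW) ((iO j l).mdifferentiableAt hU hpW)]
  have hc : ∀ i j, F'.conn i j p = ∑ n, (g p (F'.V p) (F.V p) * (dirDeriv F.V (F.trans F' i n) p
      + ∑ k, F.trans F' i k p * (F.conn k n p - ∑ l, F.shift g' l p * F.struc l k n p)))
        * ∑ l, F.trans F' j l p * evalB g' (F.η n) (F.η l) p := fun i j => by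
    unfold conn evalB
    rw [bracket_V_η_trans hdim hg hg' F' i hp hp', η_eq_sum hdim hg F' j hp hp']
    simp only [map_sum, map_smul, sum_apply, smul_apply, smul_eq_mul, Finset.mul_sum]
    rw [Finset.sum_comm]
    refine Finset.sum_congr rfl fun k _ => Finset.sum_congr rfl fun l _ => ?_
    simp only [conn, evalB]
    ring
  rw [F'.DG_η hdim hg' i j hp', hc, hc]
  simp only [varG, Matrix.of_apply]
  generalize g p (F'.V p) (F.V p) = φ
  generalize hb : (fun k n => F.conn k n p - ∑ l, F.shift g' l p * F.struc l k n p) = b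
  have hb' : ∀ k n, F.conn k n p - ∑ l, F.shift g' l p * F.struc l k n p = b k n :=
    fun k n => congrFun (congrFun hb k) n
  simp only [hb']
  have h10 := hgs 1 0
  have h20 := hgs 2 0
  have h21 := hgs 2 1
  simp only [Fin.sum_univ_three, h10, h20, h21] at hrel ⊢
  linear_combination (-φ) * hrel

include hdim hg hg' in
theorem evalT_V_η_trans (i j : Fin 3) {p : P}
    (hp : pb.proj p ∈ F.U) (hp' : pb.proj p ∈ F'.U) :
    evalT H' F'.V (F'.η i) (F'.η j) p = g p (F'.V p) (F.V p) *
      ∑ k, ∑ l, F.trans F' i k p * F.varH g' H' p k l * F.trans F' j l p := by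
  obtain ⟨hV', -⟩ := V_eq_smul_horPart hdim hg hg' F' hp hp'
  simp only [varH, Matrix.of_apply]
  unfold evalT
  rw [η_eq_sum hdim hg F' i hp hp', η_eq_sum hdim hg F' j hp hp']
  generalize g p (F'.V p) (F.V p) = φ at hV' ⊢
  rw [hV']
  unfold horPart
  simp only [map_sub, map_sum, map_smul, sub_apply, sum_apply, smul_apply, smul_eq_mul,
    Finset.mul_sum]
  rw [Finset.sum_comm]
  refine Finset.sum_congr rfl fun k _ => Finset.sum_congr rfl fun l _ => ?_
  rw [Finset.sum_congr rfl fun n _ => rfl]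
  simp only [Fin.sum_univ_three]
  ring

theorem trHsq_eq (hH : IsInvariantClosedForm pb H') (p : P) :
    F.trHsq H' p = ∑ i, ∑ j, evalT H' F.V (F.η i) (F.η j) p ^ 2 := by
  unfold trHsq Hsq
  rw [Fin.sum_univ_succ]
  have h0 : ∀ b, evalT H' F.V (F.e 0) (F.e b) p = 0 := fun b => evalT_self_left hH _ _ _
  have h1 : ∀ a, evalT H' F.V (F.e a) (F.e 0) p = 0 := fun a => evalT_self_outer hH _ _ _
  simp only [h0, mul_zero, Finset.sum_const_zero, zero_add]
  refine Finset.sum_congr rfl fun i _ => ?_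
  rw [Fin.sum_univ_succ, h1, mul_zero, zero_add]
  exact Finset.sum_congr rfl fun j _ => (sq _).symm

include hdim hg hg' in
theorem trans_gram {p : P} (hp : pb.proj p ∈ F.U) (hp' : pb.proj p ∈ F'.U) :
    (Matrix.of fun i k => F.trans F' i k p) * F.gram g' p *
      (Matrix.of fun i k => F.trans F' i k p).transpose = 1 := by
  ext i j
  rw [Matrix.one_apply]
  refine Eq.trans ?_ (F'.orthonormal_η i j p hp')
  rw [evalB_η_eq hdim hg F' i j hp hp']
  simp only [Matrix.mul_apply, Matrix.of_apply, Matrix.transpose_apply, gram, Finset.sum_mul]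
  rw [Finset.sum_comm]
  exact Finset.sum_congr rfl fun k _ => Finset.sum_congr rfl fun l _ => by ring

theorem sum_trans_eq (O K : Fin 3 → Fin 3 → ℝ) (i j : Fin 3) :
    ∑ k, ∑ l, O i k * K k l * O j l
      = ((Matrix.of O) * (Matrix.of K) * (Matrix.of O).transpose) i j := by
  simp only [Matrix.mul_apply, Matrix.of_apply, Matrix.transpose_apply, Finset.sum_mul]
  rw [Finset.sum_comm]

include hdim hg hg' in
-- The factor φ² equals the inverse of the square length of the horizontal part of V. The right-hand
-- side uses only F, so it can be differentiated in time without choosing a frame for each metric,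
-- and it shows that the choice of F' is immaterial.
theorem normSqDG_eq_normSqVarG {p : P} (hp : pb.proj p ∈ F.U) (hp' : pb.proj p ∈ F'.U) :
    F'.normSqDG p = F.normSqVarG g' p := by
  obtain ⟨-, hφ⟩ := V_eq_smul_horPart hdim hg hg' F' hp hp'
  have hu := (normSqHor_pos hdim hg hg' hp).ne'
  unfold normSqDG normSqVarG
  simp only [DG_η_trans hdim hg hg' F' _ _ hp hp']
  have e := sum_trans_eq (fun i k => F.trans F' i k p) (F.varG g' p)
  simp only [e]
  rw [sum_sq_congruence (trans_gram hdim hg hg' F' hp hp'), eq_div_iff hu, mul_right_comm, hφ,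
    one_mul]
  rfl

include hdim hg hg' in
theorem trHsq_eq_normSqVarH (hH' : IsInvariantClosedForm pb H') {p : P} (hp : pb.proj p ∈ F.U)
    (hp' : pb.proj p ∈ F'.U) : F'.trHsq H' p = F.normSqVarH g' H' p := by
  obtain ⟨-, hφ⟩ := V_eq_smul_horPart hdim hg hg' F' hp hp'
  have hu := (normSqHor_pos hdim hg hg' hp).ne'
  rw [trHsq_eq hH']
  unfold normSqVarH
  simp only [evalT_V_η_trans hdim hg hg' F' _ _ hp hp']
  have e := sum_trans_eq (fun i k => F.trans F' i k p) (F.varH g' H' p)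
  simp only [e]
  rw [sum_sq_congruence (trans_gram hdim hg hg' F' hp hp'), eq_div_iff hu, mul_right_comm, hφ,
    one_mul]
  rfl

end OrthonormalFrame

end Bundle

/-! ### Partial derivatives in the plane. -/

section Plane

/-- Partial derivative in the first variable. -/
def partial₁ (f : ℝ × ℝ → ℝ) (z : ℝ × ℝ) : ℝ := fderiv ℝ f z (1, 0)

/-- Partial derivative in the second variable. -/
def partial₂ (f : ℝ × ℝ → ℝ) (z : ℝ × ℝ) : ℝ := fderiv ℝ f z (0, 1)

variable {f : ℝ × ℝ → ℝ} {Ω : Set (ℝ × ℝ)} {x s : ℝ}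

theorem contDiffOn_partial₁ (hΩ : IsOpen Ω) (hf : ContDiffOn ℝ ∞ f Ω) :
    ContDiffOn ℝ ∞ (partial₁ f) Ω :=
  (hf.fderiv_of_isOpen hΩ (by simp)).clm_apply contDiffOn_const

theorem contDiffOn_partial₂ (hΩ : IsOpen Ω) (hf : ContDiffOn ℝ ∞ f Ω) :
    ContDiffOn ℝ ∞ (partial₂ f) Ω :=
  (hf.fderiv_of_isOpen hΩ (by simp)).clm_apply contDiffOn_const

theorem hasDerivAt_partial₁ (hf : DifferentiableAt ℝ f (x, s)) :
    HasDerivAt (fun y => f (y, s)) (partial₁ f (x, s)) x :=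
  hf.hasFDerivAt.comp_hasDerivAt x ((hasDerivAt_id x).prodMk (hasDerivAt_const x s))

theorem hasDerivAt_partial₂ (hf : DifferentiableAt ℝ f (x, s)) :
    HasDerivAt (fun r => f (x, r)) (partial₂ f (x, s)) s :=
  hf.hasFDerivAt.comp_hasDerivAt s ((hasDerivAt_const s x).prodMk (hasDerivAt_id s))

theorem partial₂_partial₁ (hΩ : IsOpen Ω) (hf : ContDiffOn ℝ ∞ f Ω) (h : (x, s) ∈ Ω) :
    partial₂ (partial₁ f) (x, s) = partial₁ (partial₂ f) (x, s) := by
  have hat : ContDiffAt ℝ ∞ f (x, s) := hf.contDiffAt (hΩ.mem_nhds h)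
  have hd : DifferentiableAt ℝ (fderiv ℝ f) (x, s) :=
    ((hf.fderiv_of_isOpen (m := ∞) hΩ (by simp)).contDiffAt (hΩ.mem_nhds h)).differentiableAt
      (by simp)
  have hs : IsSymmSndFDerivAt ℝ f (x, s) := hat.isSymmSndFDerivAt (by simpa using ENat.LEInfty.out (m := 2))
  have e1 : ∀ v w : ℝ × ℝ, fderiv ℝ (fun z => fderiv ℝ f z v) (x, s) w
      = fderiv ℝ (fderiv ℝ f) (x, s) w v := fun v w => by
    rw [fderiv_clm_apply hd (differentiableAt_const v)]
    simp
  unfold partial₁ partial₂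
  rw [e1, e1]
  exact hs.eq _ _

end Plane

/-! ### Coordinates on the base and smooth families of invariant functions. -/

section Bundle

variable {EP EG P M G : Type*}
  [NormedAddCommGroup EP] [NormedSpace ℝ EP] [NormedAddCommGroup EG] [NormedSpace ℝ EG]
  [FiniteDimensional ℝ EP] [FiniteDimensional ℝ EG]
  [TopologicalSpace P] [ChartedSpace EP P] [IsManifold 𝓘(ℝ, EP) ∞ P]
  [TopologicalSpace M] [ChartedSpace ℝ M] [IsManifold 𝓘(ℝ, ℝ) ∞ M]
  [TopologicalSpace G] [ChartedSpace EG G] [Group G] [LieGroup 𝓘(ℝ, EG) ∞ G]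
  {pb : PrincipalBundle EP EG P M G}

/-- A coordinate of the base together with a local section of the bundle. -/
structure PrincipalBundle.Coord (pb : PrincipalBundle EP EG P M G) where
  N : Set M
  x : M → ℝ
  σ : ℝ → P
  isOpen : IsOpen N
  isOpen_image : IsOpen (x '' N)
  injOn : InjOn x N
  smooth_x : ContMDiffOn 𝓘(ℝ, ℝ) 𝓘(ℝ, ℝ) ∞ x N
  smooth_σ : ContMDiffOn 𝓘(ℝ, ℝ) 𝓘(ℝ, EP) ∞ σ (x '' N)
  proj_σ : ∀ y ∈ x '' N, pb.proj (σ y) ∈ N ∧ x (pb.proj (σ y)) = y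

theorem PrincipalBundle.exists_coord (pb : PrincipalBundle EP EG P M G) {m m₀ : M} {U : Set M}
    (hU : IsOpen U) (hm : m ∈ U) (hm₀ : m ∈ (chartAt ℝ m₀).source) :
    ∃ C : pb.Coord, C.x = chartAt ℝ m₀ ∧ m ∈ C.N ∧ C.N ⊆ U ∧ C.N ⊆ (chartAt ℝ m₀).source := by
  obtain ⟨T⟩ := pb.nonempty_gauge m
  set c := chartAt ℝ m₀ with hc
  have hcs : U ∩ T.U ∩ c.source ⊆ c.source := inter_subset_right
  have hsymm : ∀ y ∈ c '' (U ∩ T.U ∩ c.source), c.symm y ∈ U ∩ T.U ∩ c.source := by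
    rintro _ ⟨q, hq, rfl⟩
    rwa [c.left_inv (hcs hq)]
  refine ⟨⟨U ∩ T.U ∩ c.source, c, fun y => T.σ (c.symm y),
    (hU.inter T.isOpen).inter c.open_source, ?_, c.injOn.mono hcs, ?_, ?_, ?_⟩, rfl,
    ⟨⟨hm, T.mem⟩, hm₀⟩, fun q hq => hq.1.1, hcs⟩
  · exact c.isOpen_image_of_subset_source ((hU.inter T.isOpen).inter c.open_source) hcs
  · exact (contMDiffOn_chart (I := 𝓘(ℝ, ℝ))).mono hcs
  · refine T.smooth_σ.comp ((contMDiffOn_chart_symm (I := 𝓘(ℝ, ℝ)) (x := m₀)).mono ?_)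
      fun y hy => (hsymm y hy).1.2
    rintro _ ⟨q, hq, rfl⟩
    exact c.map_source (hcs hq)
  · intro y hy
    rw [T.proj_σ _ (hsymm y hy).1.2]
    refine ⟨hsymm y hy, ?_⟩
    obtain ⟨q, hq, rfl⟩ := hy
    rw [c.left_inv (hcs hq)]

namespace PrincipalBundle.Coord

variable (C : pb.Coord)

/-- The coordinate as a function on the total space. -/
def coord (p : P) : ℝ := C.x (pb.proj p)

theorem invFun_coord : InvFun pb C.coord C.N :=
  ⟨C.smooth_x.comp pb.contMDiff_proj.contMDiffOn fun _ hq => hq, fun q _ a => by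
    unfold coord; rw [pb.proj_act]⟩

theorem coord_mem {p : P} (hp : pb.proj p ∈ C.N) : C.coord p ∈ C.x '' C.N := ⟨_, hp, rfl⟩

theorem exists_act {p : P} (hp : pb.proj p ∈ C.N) : ∃ a, pb.act (C.σ (C.coord p)) a = p := by
  obtain ⟨h1, h2⟩ := C.proj_σ _ (C.coord_mem hp)
  exact pb.exists_act_eq (C.injOn h1 hp h2)

/-- A family of invariant functions that is smooth jointly in the coordinate and the parameter. -/
def IsSmoothFamily (J : Set ℝ) (f : ℝ → P → ℝ) : Prop :=
  ∃ φ : ℝ × ℝ → ℝ, ContDiffOn ℝ ∞ φ ((C.x '' C.N) ×ˢ J) ∧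
    ∀ s ∈ J, ∀ p, pb.proj p ∈ C.N → f s p = φ (C.coord p, s)

variable {C} {J : Set ℝ} {f h : ℝ → P → ℝ}

/-- The chain rule through the base coordinate: derivatives of invariant functions become ordinary
derivatives in one variable. -/
theorem dirDeriv_of_eq {X : VF EP P} {k : P → ℝ} {φ : ℝ → ℝ} {p : P} (hp : pb.proj p ∈ C.N)
    (hk : ∀ q, pb.proj q ∈ C.N → k q = φ (C.coord q)) {d : ℝ} (hφ : HasDerivAt φ d (C.coord p)) :
    dirDeriv X k p = dirDeriv X C.coord p * d := by
  have hx := C.invFun_coord.mdifferentiableAt C.isOpen hp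
  have h1 : k =ᶠ[𝓝 p] φ ∘ C.coord := by
    filter_upwards [(pb.isOpen_preimage C.isOpen).mem_nhds hp] with q hq
    exact hk q hq
  have h2 := mfderiv_apply_of_comp_eq hφ.differentiableAt.mdifferentiableAt hx rfl h1 (X p)
  unfold dirDeriv
  refine h2.trans ?_
  rw [mfderiv_eq_fderiv]
  have h3 := hφ.hasFDerivAt.fderiv
  have h4 : ∀ r : ℝ, ContinuousLinearMap.toSpanSingleton ℝ d r = r * d := fun r => rfl
  exact (congrArg (fun L : ℝ →L[ℝ] ℝ => L (mfderiv 𝓘(ℝ, EP) 𝓘(ℝ, ℝ) C.coord p (X p))) h3).trans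
    (h4 _)

namespace IsSmoothFamily

theorem congr (hf : C.IsSmoothFamily J f)
    (hh : ∀ s ∈ J, ∀ p, pb.proj p ∈ C.N → h s p = f s p) : C.IsSmoothFamily J h := by
  obtain ⟨φ, hφ, e⟩ := hf
  exact ⟨φ, hφ, fun s hs p hp => by rw [hh s hs p hp, e s hs p hp]⟩

theorem const (c : ℝ) : C.IsSmoothFamily J fun _ _ => c := ⟨fun _ => c, contDiffOn_const,
  fun _ _ _ _ => rfl⟩

theorem add (hf : C.IsSmoothFamily J f) (hh : C.IsSmoothFamily J h) :
    C.IsSmoothFamily J fun s p => f s p + h s p := by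
  obtain ⟨φ, hφ, e⟩ := hf
  obtain ⟨ψ, hψ, e'⟩ := hh
  exact ⟨_, hφ.add hψ, fun s hs p hp => by simp only [e s hs p hp, e' s hs p hp]⟩

theorem sub (hf : C.IsSmoothFamily J f) (hh : C.IsSmoothFamily J h) :
    C.IsSmoothFamily J fun s p => f s p - h s p := by
  obtain ⟨φ, hφ, e⟩ := hf
  obtain ⟨ψ, hψ, e'⟩ := hh
  exact ⟨_, hφ.sub hψ, fun s hs p hp => by simp only [e s hs p hp, e' s hs p hp]⟩

theorem mul (hf : C.IsSmoothFamily J f) (hh : C.IsSmoothFamily J h) :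
    C.IsSmoothFamily J fun s p => f s p * h s p := by
  obtain ⟨φ, hφ, e⟩ := hf
  obtain ⟨ψ, hψ, e'⟩ := hh
  exact ⟨_, hφ.mul hψ, fun s hs p hp => by simp only [e s hs p hp, e' s hs p hp]⟩

theorem sum {ι : Type*} (s : Finset ι) {f : ι → ℝ → P → ℝ}
    (hf : ∀ i ∈ s, C.IsSmoothFamily J (f i)) :
    C.IsSmoothFamily J fun r p => ∑ i ∈ s, f i r p := by
  classical
  induction s using Finset.induction_on with
  | empty => simpa using IsSmoothFamily.const 0
  | insert i s hi ih =>
    simp only [Finset.sum_insert hi]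
    exact (hf i (by simp)).add (ih fun j hj => hf j (by simp [hj]))

theorem div (hf : C.IsSmoothFamily J f) (hh : C.IsSmoothFamily J h)
    (h0 : ∀ s ∈ J, ∀ p, pb.proj p ∈ C.N → h s p ≠ 0) :
    C.IsSmoothFamily J fun s p => f s p / h s p := by
  obtain ⟨φ, hφ, e⟩ := hf
  obtain ⟨ψ, hψ, e'⟩ := hh
  refine ⟨fun z => φ z / ψ z, hφ.div hψ ?_, fun s hs p hp => by
    simp only [e s hs p hp, e' s hs p hp]⟩
  rintro ⟨y, s⟩ ⟨hy, hs⟩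
  obtain ⟨h1, h2⟩ := C.proj_σ y hy
  have := h0 s hs _ h1
  rw [e' s hs _ h1] at this
  unfold coord at this
  rwa [h2] at this

theorem of_invFun {k : P → ℝ} {U : Set M} (hk : InvFun pb k U) (hU : C.N ⊆ U) :
    C.IsSmoothFamily J fun _ => k := by
  have hk' := hk.mono hU
  refine ⟨fun z => k (C.σ z.1), ?_, fun s _ p hp => ?_⟩
  · have h1 : ContMDiffOn 𝓘(ℝ, ℝ) 𝓘(ℝ, ℝ) ∞ (fun y => k (C.σ y)) (C.x '' C.N) :=
      hk'.smooth.comp C.smooth_σ fun y hy => (C.proj_σ y hy).1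
    exact (contMDiffOn_iff_contDiffOn.1 h1).comp contDiffOn_fst fun z hz => hz.1
  · obtain ⟨a, ha⟩ := C.exists_act hp
    have := hk'.inv (C.σ (C.coord p)) (C.proj_σ _ (C.coord_mem hp)).1 a
    rw [ha] at this
    exact this

/-- The representative is the restriction to the local section; invariance along the fibre makes it
represent the family at every point. -/
theorem of_contMDiffOn (hinv : ∀ s ∈ J, InvFun pb (f s) C.N)
    (hf : ContMDiffOn (𝓘(ℝ, EP).prod 𝓘(ℝ, ℝ)) 𝓘(ℝ, ℝ) ∞ (fun q : P × ℝ => f q.2 q.1)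
      ((pb.proj ⁻¹' C.N) ×ˢ J)) : C.IsSmoothFamily J f := by
  refine ⟨fun z => f z.2 (C.σ z.1), ?_, fun s hs p hp => ?_⟩
  · have h1 : ContMDiffOn 𝓘(ℝ, ℝ × ℝ) (𝓘(ℝ, EP).prod 𝓘(ℝ, ℝ)) ∞
        (fun z : ℝ × ℝ => (C.σ z.1, z.2)) ((C.x '' C.N) ×ˢ J) :=
      (C.smooth_σ.comp (contDiff_fst.contMDiff.contMDiffOn (s := (C.x '' C.N) ×ˢ J))
        fun z hz => hz.1).prodMk contDiff_snd.contMDiff.contMDiffOn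
    exact contMDiffOn_iff_contDiffOn.1
      (hf.comp h1 fun z hz => ⟨(C.proj_σ _ hz.1).1, hz.2⟩)
  · obtain ⟨a, ha⟩ := C.exists_act hp
    have := (hinv s hs).inv (C.σ (C.coord p)) (C.proj_σ _ (C.coord_mem hp)).1 a
    rw [ha] at this
    exact this

theorem dirDeriv (hJ : IsOpen J) (hf : C.IsSmoothFamily J f) {X : VF EP P} (hX : InvField pb X C.N) :
    C.IsSmoothFamily J fun s => dirDeriv X (f s) := by
  obtain ⟨φ, hφ, e⟩ := hf
  have hΩ : IsOpen ((C.x '' C.N) ×ˢ J) := C.isOpen_image.prod hJ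
  have hv : C.IsSmoothFamily J fun _ => InvariantFlow.dirDeriv X C.coord :=
    of_invFun (C.invFun_coord.dirDeriv hX C.isOpen) subset_rfl
  have hφ' : C.IsSmoothFamily J fun s p => partial₁ φ (C.coord p, s) :=
    ⟨_, contDiffOn_partial₁ hΩ hφ, fun _ _ _ _ => rfl⟩
  refine (hv.mul hφ').congr fun s hs p hp => ?_
  exact dirDeriv_of_eq hp (fun q hq => e s hs q hq) (hasDerivAt_partial₁
    ((hφ.contDiffAt (hΩ.mem_nhds ⟨C.coord_mem hp, hs⟩)).differentiableAt (by simp)))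

theorem differentiableAt (hJ : IsOpen J) (hf : C.IsSmoothFamily J f) {p : P}
    (hp : pb.proj p ∈ C.N) {t : ℝ} (ht : t ∈ J) : DifferentiableAt ℝ (fun s => f s p) t := by
  obtain ⟨φ, hφ, e⟩ := hf
  have hΩ : IsOpen ((C.x '' C.N) ×ˢ J) := C.isOpen_image.prod hJ
  refine (hasDerivAt_partial₂ ((hφ.contDiffAt
    (hΩ.mem_nhds ⟨C.coord_mem hp, ht⟩)).differentiableAt (by simp))).differentiableAt.congr_of_eventuallyEq ?_
  filter_upwards [hJ.mem_nhds ht] with s hs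
  exact e s hs p hp

/-- The parameter derivative commutes with the derivative along an invariant field. -/
theorem hasDerivAt_dirDeriv (hJ : IsOpen J) (hf : C.IsSmoothFamily J f) {X : VF EP P}
    {p : P} (hp : pb.proj p ∈ C.N) {t : ℝ} (ht : t ∈ J) {f' : P → ℝ}
    (hf' : ∀ q, pb.proj q ∈ C.N → HasDerivAt (fun s => f s q) (f' q) t) :
    HasDerivAt (fun s => InvariantFlow.dirDeriv X (f s) p) (InvariantFlow.dirDeriv X f' p) t := by
  obtain ⟨φ, hφ, e⟩ := hf
  have hΩ : IsOpen ((C.x '' C.N) ×ˢ J) := C.isOpen_image.prod hJ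
  have hd : ∀ {ψ : ℝ × ℝ → ℝ}, ContDiffOn ℝ ∞ ψ ((C.x '' C.N) ×ˢ J) → ∀ {q : P},
      pb.proj q ∈ C.N → ∀ {s : ℝ}, s ∈ J → DifferentiableAt ℝ ψ (C.coord q, s) :=
    fun hψ q hq s hs => (hψ.contDiffAt (hΩ.mem_nhds ⟨C.coord_mem hq, hs⟩)).differentiableAt (by simp)
  have h1 : ∀ s ∈ J, InvariantFlow.dirDeriv X (f s) p
      = InvariantFlow.dirDeriv X C.coord p * partial₁ φ (C.coord p, s) := fun s hs =>
    dirDeriv_of_eq hp (fun q hq => e s hs q hq) (hasDerivAt_partial₁ (hd hφ hp hs))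
  have h2 : ∀ q, pb.proj q ∈ C.N → f' q = partial₂ φ (C.coord q, t) := fun q hq => by
    refine (hf' q hq).unique ((hasDerivAt_partial₂ (hd hφ hq ht)).congr_of_eventuallyEq ?_)
    filter_upwards [hJ.mem_nhds ht] with s hs
    exact e s hs q hq
  have h3 := dirDeriv_of_eq (X := X) hp h2
    (hasDerivAt_partial₁ (hd (contDiffOn_partial₂ hΩ hφ) hp ht))
  have hm : (C.coord p, t) ∈ (C.x '' C.N) ×ˢ J := ⟨C.coord_mem hp, ht⟩
  -- The factor V(x) does not depend on time, so the exchange amounts to the symmetry of the second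
  -- derivative of φ.
  rw [h3, ← partial₂_partial₁ hΩ hφ hm]
  refine ((hasDerivAt_partial₂ (hd (contDiffOn_partial₁ hΩ hφ) hp ht)).const_mul
    (InvariantFlow.dirDeriv X C.coord p)).congr_of_eventuallyEq ?_
  filter_upwards [hJ.mem_nhds ht] with s hs
  exact h1 s hs

end IsSmoothFamily

end PrincipalBundle.Coord

end Bundle

/-! ### Induced metric, connection form and smooth dependence on time. -/

section Bundle

variable {EP EG P M G : Type*}
  [NormedAddCommGroup EP] [NormedSpace ℝ EP] [NormedAddCommGroup EG] [NormedSpace ℝ EG]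
  [FiniteDimensional ℝ EP] [FiniteDimensional ℝ EG]
  [TopologicalSpace P] [ChartedSpace EP P] [IsManifold 𝓘(ℝ, EP) ∞ P]
  [TopologicalSpace M] [ChartedSpace ℝ M] [IsManifold 𝓘(ℝ, ℝ) ∞ M]
  [TopologicalSpace G] [ChartedSpace EG G] [Group G] [LieGroup 𝓘(ℝ, EG) ∞ G]
  {pb : PrincipalBundle EP EG P M G} {g g' : BilinField EP P} {p : P}

/-- Two lifts differ by a vertical vector to which both are orthogonal, so the difference has zero
length. This frees `horLift` from its choice. -/
theorem horLift_eq (hg : IsInvariantMetric pb g) {v : TangentBundle 𝓘(ℝ, ℝ) M}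
    {Z : TangentSpace 𝓘(ℝ, EP) p}
    (hZ : tangentMap 𝓘(ℝ, EP) 𝓘(ℝ, ℝ) pb.proj ⟨p, Z⟩ = v)
    (ho : ∀ W : TangentSpace 𝓘(ℝ, EP) p,
      mfderiv 𝓘(ℝ, EP) 𝓘(ℝ, ℝ) pb.proj p W = 0 → g p Z W = 0) :
    horLift pb g p v = Z := by
  have hex : ∃ Z : TangentSpace 𝓘(ℝ, EP) p,
      tangentMap 𝓘(ℝ, EP) 𝓘(ℝ, ℝ) pb.proj ⟨p, Z⟩ = v ∧
      ∀ W : TangentSpace 𝓘(ℝ, EP) p, mfderiv 𝓘(ℝ, EP) 𝓘(ℝ, ℝ) pb.proj p W = 0 → g p Z W = 0 :=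
    ⟨Z, hZ, ho⟩
  unfold horLift
  rw [dif_pos hex]
  obtain ⟨h1, h2⟩ := hex.choose_spec
  set Z' := hex.choose
  have h3 := h1.trans hZ.symm
  have h4 : mfderiv 𝓘(ℝ, EP) 𝓘(ℝ, ℝ) pb.proj p Z' = mfderiv 𝓘(ℝ, EP) 𝓘(ℝ, ℝ) pb.proj p Z :=
    Bundle.TotalSpace.mk_inj.1 h3
  have hv : mfderiv 𝓘(ℝ, EP) 𝓘(ℝ, ℝ) pb.proj p (Z' - Z) = 0 := by
    rw [map_sub, h4]; exact sub_self _
  by_contra hne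
  refine (hg.pos p (Z' - Z) (sub_ne_zero.2 hne)).ne' ?_
  rw [show g p (Z' - Z) = g p Z' - g p Z from map_sub _ _ _, sub_apply, h2 _ hv, ho _ hv, sub_zero]

theorem tangentMap_proj_act (p : P) (a : G) (Z : TangentSpace 𝓘(ℝ, EP) p) :
    tangentMap 𝓘(ℝ, EP) 𝓘(ℝ, ℝ) pb.proj
      ⟨pb.act p a, mfderiv 𝓘(ℝ, EP) 𝓘(ℝ, EP) (fun q => pb.act q a) p Z⟩
      = tangentMap 𝓘(ℝ, EP) 𝓘(ℝ, ℝ) pb.proj ⟨p, Z⟩ := by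
  have h := tangentMap_comp_at (I := 𝓘(ℝ, EP)) (I' := 𝓘(ℝ, EP)) (I'' := 𝓘(ℝ, ℝ))
    (f := fun q => pb.act q a) (g := pb.proj) (⟨p, Z⟩ : TangentBundle 𝓘(ℝ, EP) P)
    (pb.mdifferentiableAt_proj _) (pb.mdifferentiableAt_act a p)
  have e : pb.proj ∘ (fun q => pb.act q a) = pb.proj := funext fun q => pb.proj_act q a
  rw [e] at h
  exact h.symm

/-- The induced metric on the base can be computed at any point of the fibre. -/
theorem baseMetric_eq (hg : IsInvariantMetric pb g) {v w : TangentSpace 𝓘(ℝ, ℝ) (pb.proj p)}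
    {Z₁ Z₂ : TangentSpace 𝓘(ℝ, EP) p}
    (hZ₁ : mfderiv 𝓘(ℝ, EP) 𝓘(ℝ, ℝ) pb.proj p Z₁ = v)
    (hZ₂ : mfderiv 𝓘(ℝ, EP) 𝓘(ℝ, ℝ) pb.proj p Z₂ = w)
    (ho₁ : ∀ W : TangentSpace 𝓘(ℝ, EP) p,
      mfderiv 𝓘(ℝ, EP) 𝓘(ℝ, ℝ) pb.proj p W = 0 → g p Z₁ W = 0)
    (ho₂ : ∀ W : TangentSpace 𝓘(ℝ, EP) p,
      mfderiv 𝓘(ℝ, EP) 𝓘(ℝ, ℝ) pb.proj p W = 0 → g p Z₂ W = 0) :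
    baseMetric pb g (pb.proj p) v w = g p Z₁ Z₂ := by
  have hex : ∃ q, pb.proj q = pb.proj p := ⟨p, rfl⟩
  unfold baseMetric
  rw [dif_pos hex]
  -- The point chosen in the definition of `baseMetric` is a translate of p, and translation by a is
  -- an isometry over the identity of the base, so it carries horizontal lifts to horizontal lifts.
  obtain ⟨a, ha⟩ := pb.exists_act_eq hex.choose_spec.symm
  generalize hex.choose = q at ha ⊢
  subst ha
  have key : ∀ (v : TangentSpace 𝓘(ℝ, ℝ) (pb.proj p)) (Z : TangentSpace 𝓘(ℝ, EP) p),
      mfderiv 𝓘(ℝ, EP) 𝓘(ℝ, ℝ) pb.proj p Z = v →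
      (∀ W : TangentSpace 𝓘(ℝ, EP) p,
        mfderiv 𝓘(ℝ, EP) 𝓘(ℝ, ℝ) pb.proj p W = 0 → g p Z W = 0) →
      horLift pb g (pb.act p a) ⟨pb.proj p, v⟩
        = mfderiv 𝓘(ℝ, EP) 𝓘(ℝ, EP) (fun q => pb.act q a) p Z := by
    intro v Z hZ ho
    refine horLift_eq hg ?_ fun W hW => ?_
    · rw [tangentMap_proj_act]
      exact Bundle.TotalSpace.mk_inj.2 hZ
    · let L : EP →L[ℝ] EP := mfderiv 𝓘(ℝ, EP) 𝓘(ℝ, EP) (fun q => pb.act q a) p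
      have hinj : Function.Injective (L : EP →ₗ[ℝ] EP) := pb.mfderiv_act_injective p a
      obtain ⟨W', hW'⟩ : ∃ W' : TangentSpace 𝓘(ℝ, EP) p,
          mfderiv 𝓘(ℝ, EP) 𝓘(ℝ, EP) (fun q => pb.act q a) p W' = W :=
        LinearMap.injective_iff_surjective.1 hinj (W : EP)
      subst hW'
      exact (hg.invariant p a Z W').trans (ho W' ((pb.mfderiv_proj_act p a W').symm.trans hW))
  rw [key v Z₁ hZ₁ ho₁, key w Z₂ hZ₂ ho₂, hg.invariant]

namespace OrthonormalFrame

variable {m : M} {F : OrthonormalFrame pb g m} (hdim : Module.finrank ℝ EG = 3)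
  (hg : SmoothMetric pb g) (hg' : SmoothMetric pb g')

include hdim hg hg' in
theorem horPart_orthogonal (hp : pb.proj p ∈ F.U) (W : TangentSpace 𝓘(ℝ, EP) p)
    (hW : mfderiv 𝓘(ℝ, EP) 𝓘(ℝ, ℝ) pb.proj p W = 0) : g' p (F.horPart g' p) W = 0 := by
  rw [expansion_vertical hdim hg hp hW, map_sum]
  exact Finset.sum_eq_zero fun i _ => by rw [map_smul, g_horPart_η hg hg' i hp, smul_zero]

include hdim hg hg' in
theorem connectionForm_V (hp : pb.proj p ∈ F.U) :
    connectionForm pb g' p (F.V p) = ∑ i, F.shift g' i p • F.η i p := by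
  unfold connectionForm
  have h : tangentMap 𝓘(ℝ, EP) 𝓘(ℝ, ℝ) pb.proj ⟨p, F.horPart g' p⟩
      = tangentMap 𝓘(ℝ, EP) 𝓘(ℝ, ℝ) pb.proj ⟨p, F.V p⟩ :=
    Bundle.TotalSpace.mk_inj.2 (F.proj_horPart hp)
  rw [horLift_eq hg'.toIsInvariantMetric h (horPart_orthogonal hdim hg hg' hp)]
  unfold horPart
  rw [sub_sub_cancel]

include hdim hg hg' in
-- Through this the flow equation for the connection becomes the time derivative of `shift`.
theorem g_connectionForm (hp : pb.proj p ∈ F.U) (i : Fin 3) :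
    g p (connectionForm pb g' p (F.V p)) (F.η i p) = F.shift g' i p := by
  rw [connectionForm_V hdim hg hg' hp]
  simp only [map_sum, map_smul, sum_apply, smul_apply, smul_eq_mul, g_ηη hg hp]
  simp

include hdim hg hg' in
-- The horizontal lift of the projection of rV is r times the horizontal part of V. Through this the
-- flow equation for g becomes the time derivative of `normSqHor`.
theorem baseMetric_smul (hp : pb.proj p ∈ F.U) (r : ℝ) {v : TangentSpace 𝓘(ℝ, ℝ) (pb.proj p)}
    (hv : v = r • mfderiv 𝓘(ℝ, EP) 𝓘(ℝ, ℝ) pb.proj p (F.V p)) :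
    baseMetric pb g' (pb.proj p) v v = r ^ 2 * F.normSqHor g' p := by
  have h1 : mfderiv 𝓘(ℝ, EP) 𝓘(ℝ, ℝ) pb.proj p (r • F.horPart g' p) = v := by
    rw [map_smul, F.proj_horPart hp, hv]
  have h2 : ∀ W : TangentSpace 𝓘(ℝ, EP) p,
      mfderiv 𝓘(ℝ, EP) 𝓘(ℝ, ℝ) pb.proj p W = 0 → g' p (r • F.horPart g' p) W = 0 := fun W hW => by
    rw [map_smul, smul_apply, horPart_orthogonal hdim hg hg' hp W hW, smul_zero]
  rw [baseMetric_eq hg'.toIsInvariantMetric h1 h1 h2 h2, map_smul, map_smul, smul_apply,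
    g_horPart_self hg hg' hp, smul_eq_mul, smul_eq_mul]
  ring

end OrthonormalFrame

/-- A smooth family of invariant metrics consists of smooth metrics. -/
theorem SmoothFamilyB.smoothMetric {J : Set ℝ} {g : ℝ → BilinField EP P} (h : SmoothFamilyB J g)
    {s : ℝ} (hs : s ∈ J) (hg : IsInvariantMetric pb (g s)) : SmoothMetric pb (g s) :=
  { hg with
    smooth := fun O X Y hO hX hY => (h O X Y hO hX hY).comp
      (contMDiffOn_id.prodMk (contMDiffOn_const (c := s))) fun _ hp => ⟨hp, hs⟩ }

theorem SmoothFamilyT.smoothForm {J : Set ℝ} {H : ℝ → TrilinField EP P} (h : SmoothFamilyT J H)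
    {s : ℝ} (hs : s ∈ J) (hH : IsInvariantClosedForm pb (H s)) : SmoothForm pb (H s) :=
  { hH with
    smooth := fun O X Y Z hO hX hY hZ => (h O X Y Z hO hX hY hZ).comp
      (contMDiffOn_id.prodMk (contMDiffOn_const (c := s))) fun _ hp => ⟨hp, hs⟩ }

namespace PrincipalBundle.Coord.IsSmoothFamily

variable {C : pb.Coord} {J : Set ℝ} {A : ℝ → P → Matrix (Fin 3) (Fin 3) ℝ}
  {g₀ : ℝ → BilinField EP P}

/-- Cramer's rule: the entries of the inverse are polynomials in the entries divided by the
nonvanishing determinant. -/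
theorem inv_apply (hA : ∀ i j, C.IsSmoothFamily J fun s p => A s p i j)
    (h0 : ∀ s ∈ J, ∀ p, pb.proj p ∈ C.N → (A s p).det ≠ 0) (i j : Fin 3) :
    C.IsSmoothFamily J fun s p => (A s p)⁻¹ i j := by
  have hm := fun i j k l => (hA i j).mul (hA k l)
  have hdet : C.IsSmoothFamily J fun s p => (A s p).det := by
    simp only [Matrix.det_fin_three]
    exact ((((((hm 0 0 1 1).mul (hA 2 2)).sub ((hm 0 0 1 2).mul (hA 2 1))).sub
      ((hm 0 1 1 0).mul (hA 2 2))).add ((hm 0 1 1 2).mul (hA 2 0))).add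
      ((hm 0 2 1 0).mul (hA 2 1))).sub ((hm 0 2 1 1).mul (hA 2 0))
  have hn : ∀ {f : ℝ → P → ℝ}, C.IsSmoothFamily J f → C.IsSmoothFamily J fun s p => - f s p :=
    fun hf => ((const 0).sub hf).congr fun s _ p _ => by simp
  have hadj : C.IsSmoothFamily J fun s p => (A s p).adjugate i j := by
    simp only [Matrix.adjugate_fin_three]
    fin_cases i <;> fin_cases j <;>
      simp only [Fin.mk_zero, Fin.mk_one, Fin.reduceFinMk, Matrix.of_apply, Matrix.cons_val] <;>
      first
        | exact (hm _ _ _ _).sub (hm _ _ _ _)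
        | exact (hn (hm _ _ _ _)).add (hm _ _ _ _)
  refine (hadj.div hdet h0).congr fun s hs p hp => ?_
  rw [Matrix.inv_def, Ring.inverse_eq_inv', Matrix.smul_apply, smul_eq_mul, div_eq_inv_mul]

theorem evalB (hg : ∀ s ∈ J, SmoothMetric pb (g₀ s)) (h : SmoothFamilyB J g₀) {X Y : VF EP P}
    (hX : InvField pb X C.N) (hY : InvField pb Y C.N) :
    C.IsSmoothFamily J fun s => InvariantFlow.evalB (g₀ s) X Y :=
  of_contMDiffOn (fun s hs => (hg s hs).invFun C.isOpen hX hY)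
    (h _ X Y (pb.isOpen_preimage C.isOpen) hX.smooth hY.smooth)

theorem evalT {H : ℝ → TrilinField EP P} (hH : ∀ s ∈ J, SmoothForm pb (H s))
    (h : SmoothFamilyT J H) {X Y Z : VF EP P} (hX : InvField pb X C.N) (hY : InvField pb Y C.N)
    (hZ : InvField pb Z C.N) : C.IsSmoothFamily J fun s => InvariantFlow.evalT (H s) X Y Z :=
  of_contMDiffOn (fun s hs => (hH s hs).invFun C.isOpen hX hY hZ)
    (h _ X Y Z (pb.isOpen_preimage C.isOpen) hX.smooth hY.smooth hZ.smooth)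

theorem trace_mul {B D E : ℝ → P → Matrix (Fin 3) (Fin 3) ℝ}
    (hA : ∀ i j, C.IsSmoothFamily J fun s p => A s p i j)
    (hB : ∀ i j, C.IsSmoothFamily J fun s p => B s p i j)
    (hD : ∀ i j, C.IsSmoothFamily J fun s p => D s p i j)
    (hE : ∀ i j, C.IsSmoothFamily J fun s p => E s p i j) :
    C.IsSmoothFamily J fun s p => (A s p * B s p * D s p * (E s p).transpose).trace := by
  simp only [Matrix.trace, Matrix.diag, Matrix.mul_apply, Matrix.transpose_apply]
  exact sum _ fun i _ => sum _ fun j _ => (sum _ fun k _ => (sum _ fun l _ =>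
    (hA i l).mul (hB l k)).mul (hD k j)).mul (hE i j)

end PrincipalBundle.Coord.IsSmoothFamily

namespace OrthonormalFrame

variable {m : M} {F : OrthonormalFrame pb g m} {C : pb.Coord} {J : Set ℝ}
  {g₀ : ℝ → BilinField EP P} {H : ℝ → TrilinField EP P} (hg : SmoothMetric pb g)
  (hN : C.N ⊆ F.U) (hg₀ : ∀ s ∈ J, SmoothMetric pb (g₀ s)) (hgs : SmoothFamilyB J g₀)

open PrincipalBundle.Coord

include hN hg₀ hgs in
theorem isSmoothFamily_gram (i j : Fin 3) : C.IsSmoothFamily J fun s p => F.gram (g₀ s) p i j :=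
  IsSmoothFamily.evalB hg₀ hgs ((F.invField_η i).mono hN) ((F.invField_η j).mono hN)

include hg hN hg₀ hgs in
theorem isSmoothFamily_gram_inv (i j : Fin 3) :
    C.IsSmoothFamily J fun s p => (F.gram (g₀ s) p)⁻¹ i j :=
  IsSmoothFamily.inv_apply (isSmoothFamily_gram hN hg₀ hgs)
    (fun s hs _ hp => det_gram_ne_zero hg (hg₀ s hs) (hN hp)) i j

include hg hN hg₀ hgs in
theorem isSmoothFamily_shift (i : Fin 3) : C.IsSmoothFamily J fun s => F.shift (g₀ s) i :=
  IsSmoothFamily.sum _ fun j _ => (isSmoothFamily_gram_inv hg hN hg₀ hgs i j).mul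
    (IsSmoothFamily.evalB hg₀ hgs (F.invField_V.mono hN) ((F.invField_η j).mono hN))

include hg hN hg₀ hgs in
theorem isSmoothFamily_normSqHor : C.IsSmoothFamily J fun s => F.normSqHor (g₀ s) :=
  (IsSmoothFamily.evalB hg₀ hgs (F.invField_V.mono hN) (F.invField_V.mono hN)).sub
    (IsSmoothFamily.sum _ fun i _ => (isSmoothFamily_shift hg hN hg₀ hgs i).mul
      (IsSmoothFamily.evalB hg₀ hgs (F.invField_V.mono hN) ((F.invField_η i).mono hN)))

include hg hN hg₀ hgs in
theorem isSmoothFamily_varG (hJ : IsOpen J) (i j : Fin 3) :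
    C.IsSmoothFamily J fun s p => F.varG (g₀ s) p i j := by
  have hc : ∀ i k, C.IsSmoothFamily J fun s p =>
      F.conn i k p - ∑ l, F.shift (g₀ s) l p * F.struc l i k p := fun i k =>
    (IsSmoothFamily.of_invFun (invFun_conn hg i k) hN).sub (IsSmoothFamily.sum _ fun l _ =>
      (isSmoothFamily_shift hg hN hg₀ hgs l).mul (IsSmoothFamily.of_invFun (invFun_struc hg l i k) hN))
  have hG : ∀ i j, C.IsSmoothFamily J fun s => evalB (g₀ s) (F.η i) (F.η j) := fun i j =>
    IsSmoothFamily.evalB hg₀ hgs ((F.invField_η i).mono hN) ((F.invField_η j).mono hN)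
  exact (((hG i j).dirDeriv hJ (F.invField_V.mono hN)).sub (IsSmoothFamily.sum _ fun k _ =>
    (hc i k).mul (hG k j))).sub (IsSmoothFamily.sum _ fun k _ => (hc j k).mul (hG i k))

variable (hH : ∀ s ∈ J, SmoothForm pb (H s)) (hHs : SmoothFamilyT J H)

include hg hN hg₀ hgs hH hHs in
theorem isSmoothFamily_varH (i j : Fin 3) :
    C.IsSmoothFamily J fun s p => F.varH (g₀ s) (H s) p i j :=
  (IsSmoothFamily.evalT hH hHs (F.invField_V.mono hN) ((F.invField_η i).mono hN)
    ((F.invField_η j).mono hN)).sub (IsSmoothFamily.sum _ fun k _ =>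
    (isSmoothFamily_shift hg hN hg₀ hgs k).mul (IsSmoothFamily.evalT hH hHs
      ((F.invField_η k).mono hN) ((F.invField_η i).mono hN) ((F.invField_η j).mono hN)))

include hg hN hg₀ hgs hH hHs in
theorem isSmoothFamily_density (hdim : Module.finrank ℝ EG = 3) (hJ : IsOpen J) :
    C.IsSmoothFamily J fun s p => F.normSqVarG (g₀ s) p + F.normSqVarH (g₀ s) (H s) p := by
  have hu := isSmoothFamily_normSqHor hg hN hg₀ hgs
  have hu0 : ∀ s ∈ J, ∀ p, pb.proj p ∈ C.N → F.normSqHor (g₀ s) p ≠ 0 := fun s hs p hp =>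
    (normSqHor_pos hdim hg (hg₀ s hs) (hN hp)).ne'
  have hi := isSmoothFamily_gram_inv hg hN hg₀ hgs
  have hK := isSmoothFamily_varG hg hN hg₀ hgs hJ
  have hh := isSmoothFamily_varH hg hN hg₀ hgs hH hHs
  exact ((IsSmoothFamily.trace_mul hi hK hi hK).div hu hu0).add
    ((IsSmoothFamily.trace_mul hi hh hi hh).div hu hu0)

end OrthonormalFrame

end Bundle

/-- The connection terms are contracted with symmetric matrices, so only the symmetric part −K/2 of
a contributes; this produces the two cubic sums. -/
theorem energy_derivative_identity {a K X h z vK vh : Fin 3 → Fin 3 → ℝ}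
    (hK : ∀ i j, K i j = -(a i j + a j i)) (hX : ∀ i j, X i j = X j i)
    (hh : ∀ i j, h i j = -h j i) (hz : ∀ i j, z i j = -z j i)
    (hvK : ∀ i j, vK i j = X i j + ∑ k, a i k * K k j + ∑ k, a j k * K i k)
    (hvh : ∀ i j, vh i j = z i j + ∑ k, a i k * h k j + ∑ k, a j k * h i k) :
    ∑ i, ∑ j, (K i j * vK i j + K i j * vK i j) + ∑ i, ∑ j, (h i j * vh i j + h i j * vh i j)
      = 2 * ∑ i, ∑ j, K i j * X i j - 2 * ∑ i, ∑ j, ∑ k, K i j * K j k * K k i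
        + 2 * ∑ i, ∑ j, h i j * z i j - 2 * ∑ i, ∑ j, ∑ k, K i j * h j k * h i k := by
  have diag : ∀ u : Fin 3 → Fin 3 → ℝ, (∀ i j, u i j = - u j i) → ∀ i, u i i = 0 :=
    fun u hu i => by linarith [hu i i]
  have h0 := diag h hh
  have z0 := diag z hz
  have h10 := hh 1 0
  have h20 := hh 2 0
  have h21 := hh 2 1
  have z10 := hz 1 0
  have z20 := hz 2 0
  have z21 := hz 2 1
  have X10 := hX 1 0
  have X20 := hX 2 0
  have X21 := hX 2 1
  clear hh hz hX diag
  simp only [hvh, hvK]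
  simp only [Fin.sum_univ_three]
  simp only [h0, z0, h10, h20, h21, z10, z20, z21, X10, X20, X21]
  simp only [hK]
  ring

/-! ### The density |DG|² + tr_g H² and the flow terms in components. -/

section Bundle

variable {EP EG P M G : Type*}
  [NormedAddCommGroup EP] [NormedSpace ℝ EP] [NormedAddCommGroup EG] [NormedSpace ℝ EG]
  [FiniteDimensional ℝ EP] [FiniteDimensional ℝ EG]
  [TopologicalSpace P] [ChartedSpace EP P] [IsManifold 𝓘(ℝ, EP) ∞ P]
  [TopologicalSpace M] [ChartedSpace ℝ M] [IsManifold 𝓘(ℝ, ℝ) ∞ M]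
  [TopologicalSpace G] [ChartedSpace EG G] [Group G] [LieGroup 𝓘(ℝ, EG) ∞ G]
  {pb : PrincipalBundle EP EG P M G}

/-- `f` is differentiable at `p` with derivative `d` along `X`. -/
structure HasDirDeriv (X : VF EP P) (f : P → ℝ) (d : ℝ) (p : P) : Prop where
  mdifferentiableAt : MDifferentiableAt 𝓘(ℝ, EP) 𝓘(ℝ, ℝ) f p
  eq : dirDeriv X f p = d

namespace HasDirDeriv

variable {X : VF EP P} {f h : P → ℝ} {d e : ℝ} {p : P}

theorem add (hf : HasDirDeriv X f d p) (hh : HasDirDeriv X h e p) :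
    HasDirDeriv X (fun q => f q + h q) (d + e) p :=
  ⟨hf.1.add hh.1, by rw [dirDeriv_add hf.1 hh.1, hf.2, hh.2]⟩

theorem sub (hf : HasDirDeriv X f d p) (hh : HasDirDeriv X h e p) :
    HasDirDeriv X (fun q => f q - h q) (d - e) p :=
  ⟨hf.1.sub hh.1, by rw [dirDeriv_sub hf.1 hh.1, hf.2, hh.2]⟩

theorem mul (hf : HasDirDeriv X f d p) (hh : HasDirDeriv X h e p) :
    HasDirDeriv X (fun q => f q * h q) (d * h p + f p * e) p :=
  ⟨hf.1.mul hh.1, by rw [dirDeriv_mul hf.1 hh.1, hf.2, hh.2]; ring⟩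

theorem const_mul (c : ℝ) (hf : HasDirDeriv X f d p) : HasDirDeriv X (fun q => c * f q) (c * d) p :=
  ⟨mdifferentiableAt_const.mul hf.1, by rw [dirDeriv_const_mul c hf.1, hf.2]⟩

theorem mul_const (hf : HasDirDeriv X f d p) (c : ℝ) : HasDirDeriv X (fun q => f q * c) (d * c) p := by
  simpa only [mul_comm] using hf.const_mul c

theorem sum {ι : Type*} [Fintype ι] {f : ι → P → ℝ} {d : ι → ℝ}
    (hf : ∀ i, HasDirDeriv X (f i) (d i) p) :
    HasDirDeriv X (fun q => ∑ i, f i q) (∑ i, d i) p :=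
  ⟨MDifferentiableAt.sum_fun _ fun i _ => (hf i).1, by
    rw [dirDeriv_sum _ fun i _ => (hf i).1]
    exact Finset.sum_congr rfl fun i _ => (hf i).2⟩

theorem congr {W : Set P} (hf : HasDirDeriv X f d p) (hW : IsOpen W) (hp : p ∈ W)
    (h' : EqOn h f W) : HasDirDeriv X h d p :=
  ⟨hf.1.congr_of_eventuallyEq (h'.eventuallyEq_of_mem (hW.mem_nhds hp)), by
    rw [dirDeriv_congr_of_eqOn hW h' hp, hf.2]⟩

end HasDirDeriv

theorem InvFun.hasDirDeriv {U : Set M} {f : P → ℝ} (hf : InvFun pb f U) (hU : IsOpen U) {p : P}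
    (hp : pb.proj p ∈ U) {X : VF EP P} {d : ℝ} (hd : InvariantFlow.dirDeriv X f p = d) :
    HasDirDeriv X f d p := ⟨hf.mdifferentiableAt hU hp, hd⟩

namespace OrthonormalFrame

variable {g : BilinField EP P} {m : M} {F : OrthonormalFrame pb g m} {H : TrilinField EP P}
  {T : VF EP P → VF EP P → P → ℝ}
  (hdim : Module.finrank ℝ EG = 3) (hg : SmoothMetric pb g) (hH : SmoothForm pb H)

theorem IsTensorial.hasDirDeriv (hdim : Module.finrank ℝ EG = 3) (hg : SmoothMetric pb g)
    (hT : F.IsTensorial T) (i j : Fin 3) {p : P} (hp : pb.proj p ∈ F.U) :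
    HasDirDeriv F.V (T (F.η i) (F.η j)) (F.lie T (F.η i) (F.η j) p
      + ∑ k, F.conn i k p * T (F.η k) (F.η j) p + ∑ k, F.conn j k p * T (F.η i) (F.η k) p) p :=
  (hT.inv i j).hasDirDeriv F.isOpen hp (by rw [hT.lie_apply hdim hg i j hp]; ring)

include hdim hg in
theorem DG_symm (i j : Fin 3) {p : P} (hp : pb.proj p ∈ F.U) :
    F.DG (F.η i) (F.η j) p = F.DG (F.η j) (F.η i) p := by
  rw [F.DG_η hdim hg i j hp, F.DG_η hdim hg j i hp, add_comm]

include hdim hg in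
-- Covariant differentiation commutes with exchanging the arguments; ε = 1 covers symmetric tensors
-- and ε = −1 skew ones.
theorem lie_symm (hT : F.IsTensorial T) (ε : ℝ)
    (h : ∀ i j p, pb.proj p ∈ F.U → T (F.η i) (F.η j) p = ε * T (F.η j) (F.η i) p)
    (i j : Fin 3) {p : P} (hp : pb.proj p ∈ F.U) :
    F.lie T (F.η i) (F.η j) p = ε * F.lie T (F.η j) (F.η i) p := by
  have e : dirDeriv F.V (T (F.η i) (F.η j)) p = ε * dirDeriv F.V (T (F.η j) (F.η i)) p := by
    rw [dirDeriv_congr_of_eqOn (pb.isOpen_preimage F.isOpen) (fun q hq => h i j q hq) hp,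
      dirDeriv_const_mul ε ((hT.inv j i).mdifferentiableAt F.isOpen hp)]
  rw [hT.lie_apply hdim hg i j hp, hT.lie_apply hdim hg j i hp, e]
  simp only [fun k => h k j p hp, fun k => h i k p hp, Finset.mul_sum, mul_sub, mul_left_comm _ ε]
  ring

include hdim hg in
theorem DDG_symm (i j : Fin 3) {p : P} (hp : pb.proj p ∈ F.U) :
    F.DDG (F.η i) (F.η j) p = F.DDG (F.η j) (F.η i) p :=
  (lie_symm hdim hg (F.isTensorial_DG hdim hg) 1
    (fun i j q hq => by rw [one_mul]; exact DG_symm hdim hg i j hq) i j hp).trans (one_mul _)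

include hdim hg hH in
theorem DH_skew (i j : Fin 3) {p : P} (hp : pb.proj p ∈ F.U) :
    F.DH H F.V (F.η i) (F.η j) p = - F.DH H F.V (F.η j) (F.η i) p := by
  rw [F.DH_V_eq_lie hdim hg _ _ hp, F.DH_V_eq_lie hdim hg _ _ hp,
    lie_symm hdim hg (hH.isTensorial F hdim hg F.invField_V) (-1)
      (fun i j q hq => by
        rw [neg_one_mul]; exact evalT_swap_right hH.toIsInvariantClosedForm _ _ _ _) i j hp,
    neg_one_mul]

include hdim hg hH in
theorem lie_DH_skew (i j : Fin 3) {p : P} (hp : pb.proj p ∈ F.U) :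
    F.lie (F.DH H F.V) (F.η i) (F.η j) p = - F.lie (F.DH H F.V) (F.η j) (F.η i) p := by
  rw [lie_symm hdim hg (F.isTensorial_DH hdim hg hH) (-1)
      (fun i j q hq => by rw [neg_one_mul]; exact DH_skew hdim hg hH i j hq) i j hp,
    neg_one_mul]

include hdim hg in
theorem hasDirDeriv_DG (i j : Fin 3) {p : P} (hp : pb.proj p ∈ F.U) :
    HasDirDeriv F.V (F.DG (F.η i) (F.η j)) (F.DDG (F.η i) (F.η j) p
      + ∑ k, F.conn i k p * F.DG (F.η k) (F.η j) p
      + ∑ k, F.conn j k p * F.DG (F.η i) (F.η k) p) p :=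
  (F.isTensorial_DG hdim hg).hasDirDeriv hdim hg i j hp

include hdim hg in
theorem hasDirDeriv_DDG (i j : Fin 3) {p : P} (hp : pb.proj p ∈ F.U) :
    HasDirDeriv F.V (F.DDG (F.η i) (F.η j)) (F.lie F.DDG (F.η i) (F.η j) p
      + ∑ k, F.conn i k p * F.DDG (F.η k) (F.η j) p
      + ∑ k, F.conn j k p * F.DDG (F.η i) (F.η k) p) p :=
  (F.isTensorial_DDG hdim hg).hasDirDeriv hdim hg i j hp

include hdim hg hH in
theorem hasDirDeriv_evalT (i j : Fin 3) {p : P} (hp : pb.proj p ∈ F.U) :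
    HasDirDeriv F.V (evalT H F.V (F.η i) (F.η j)) (F.DH H F.V (F.η i) (F.η j) p
      + ∑ k, F.conn i k p * evalT H F.V (F.η k) (F.η j) p
      + ∑ k, F.conn j k p * evalT H F.V (F.η i) (F.η k) p) p := by
  rw [F.DH_V_eq_lie hdim hg _ _ hp]
  exact (hH.isTensorial F hdim hg F.invField_V).hasDirDeriv hdim hg i j hp

include hdim hg hH in
theorem hasDirDeriv_DH (i j : Fin 3) {p : P} (hp : pb.proj p ∈ F.U) :
    HasDirDeriv F.V (F.DH H F.V (F.η i) (F.η j)) (F.lie (F.DH H F.V) (F.η i) (F.η j) p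
      + ∑ k, F.conn i k p * F.DH H F.V (F.η k) (F.η j) p
      + ∑ k, F.conn j k p * F.DH H F.V (F.η i) (F.η k) p) p :=
  (F.isTensorial_DH hdim hg hH).hasDirDeriv hdim hg i j hp

variable (F H) in
/-- `|DG|² + tr_g H²`. -/
def density (p : P) : ℝ := F.normSqDG p + F.trHsq H p

theorem density_eq (hH : IsInvariantClosedForm pb H) (p : P) :
    F.density H p = ∑ i, ∑ j, F.DG (F.η i) (F.η j) p * F.DG (F.η i) (F.η j) p
      + ∑ i, ∑ j, evalT H F.V (F.η i) (F.η j) p * evalT H F.V (F.η i) (F.η j) p := by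
  unfold density normSqDG
  rw [trHsq_eq hH]
  simp only [sq]

include hdim hg hH in
-- The formula holds on the whole domain of the frame, so it can be differentiated along V once more
-- to give V V Q.
theorem dirDeriv_density {p : P} (hp : pb.proj p ∈ F.U) :
    dirDeriv F.V (F.density H) p
      = 2 * ∑ i, ∑ j, F.DG (F.η i) (F.η j) p * F.DDG (F.η i) (F.η j) p
        - 2 * ∑ i, ∑ j, ∑ k, F.DG (F.η i) (F.η j) p * F.DG (F.η j) (F.η k) p
          * F.DG (F.η k) (F.η i) p
        + 2 * ∑ i, ∑ j, evalT H F.V (F.η i) (F.η j) p * F.DH H F.V (F.η i) (F.η j) p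
        - 2 * ∑ i, ∑ j, ∑ k, F.DG (F.η i) (F.η j) p * evalT H F.V (F.η j) (F.η k) p
          * evalT H F.V (F.η i) (F.η k) p := by
  have hQ : F.density H = fun p => ∑ i, ∑ j, F.DG (F.η i) (F.η j) p * F.DG (F.η i) (F.η j) p
      + ∑ i, ∑ j, evalT H F.V (F.η i) (F.η j) p * evalT H F.V (F.η i) (F.η j) p :=
    funext fun p => density_eq hH.toIsInvariantClosedForm p
  have dK := fun i j => hasDirDeriv_DG (F := F) hdim hg i j hp
  have dh := fun i j => hasDirDeriv_evalT (F := F) hdim hg hH i j hp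
  rw [hQ, ((HasDirDeriv.sum fun i => HasDirDeriv.sum fun j => (dK i j).mul (dK i j)).add
    (HasDirDeriv.sum fun i => HasDirDeriv.sum fun j => (dh i j).mul (dh i j))).eq]
  rw [← energy_derivative_identity (a := fun i j => F.conn i j p)
    (fun i j => F.DG_η hdim hg i j hp) (fun i j => DDG_symm hdim hg i j hp)
    (fun i j => evalT_swap_right hH.toIsInvariantClosedForm _ _ _ _)
    (fun i j => DH_skew hdim hg hH i j hp) (fun _ _ => rfl) (fun _ _ => rfl)]
  simp only [mul_comm]

include hdim hg in
theorem trDGbracket_η [CompleteSpace EG] (hA : F.IsAdapted)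
    (hnil : LieRing.IsNilpotent (GroupLieAlgebra 𝓘(ℝ, EG) G)) (i : Fin 3) {p : P}
    (hp : pb.proj p ∈ F.U) : F.trDGbracket (F.η i) p
      = ∑ k, ∑ j, F.struc 0 1 2 p * heisenberg k i j * F.DG (F.η j) (F.η k) p := by
  have _hc : CompleteSpace EP := FiniteDimensional.complete ℝ EP
  unfold trDGbracket
  refine Finset.sum_congr rfl fun k _ => ?_
  rw [(F.isTensorial_DG hdim hg).expand _ _ ((F.invField_η k).bracket F.isOpen (F.invField_η i))
    (IsVertical.bracket F.isOpen (F.invField_η k) (F.invField_η i) (F.isVertical_η i))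
    (F.invField_η k) (F.isVertical_η k) p hp]
  refine Finset.sum_congr rfl fun j _ => ?_
  have h1 : evalB g (bracket (F.η k) (F.η i)) (F.η j) p = _ := hA.struc_eq hdim hg hnil k i j hp
  rw [h1]
  simp [evalB, g_ηη hg hp]

theorem Hsq_V_η (hH : IsInvariantClosedForm pb H) (i : Fin 3) (p : P) :
    F.Hsq H F.V (F.η i) p = evalT H (F.η 0) (F.η 1) (F.η 2) p
      * ∑ j, ∑ k, evalT H F.V (F.η j) (F.η k) p * leviCivita i j k := by
  have hf := fun i j k => F.evalT_η hH i j k p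
  unfold Hsq
  generalize evalT H (F.η 0) (F.η 1) (F.η 2) p = f at hf ⊢
  rw [Fin.sum_univ_succ, Finset.mul_sum]
  have h0 : ∀ b, evalT H F.V (F.e 0) (F.e b) p = 0 := fun b => evalT_self_left hH _ _ _
  have h1 : ∀ a, evalT H F.V (F.e a) (F.e 0) p = 0 := fun a => evalT_self_outer hH _ _ _
  simp only [h0, zero_mul, Finset.sum_const_zero, zero_add]
  refine Finset.sum_congr rfl fun j _ => ?_
  rw [Fin.sum_univ_succ, h1, zero_mul, zero_add, Finset.mul_sum]
  refine Finset.sum_congr rfl fun k _ => ?_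
  have h2 : evalT H (F.η i) (F.e j.succ) (F.e k.succ) p = f * leviCivita i j k := hf i j k
  rw [h2]
  change evalT H F.V (F.η j) (F.η k) p * _ = _
  ring

/-- The index of V may stand in either of the two contracted slots, and each vertical pair occurs in
two orders; hence both factors 2. -/
theorem Hsq_η_η (hH : IsInvariantClosedForm pb H) (i j : Fin 3) (p : P) :
    F.Hsq H (F.η i) (F.η j) p
      = 2 * ∑ k, evalT H F.V (F.η i) (F.η k) p * evalT H F.V (F.η j) (F.η k) p
        + 2 * (evalT H (F.η 0) (F.η 1) (F.η 2) p * evalT H (F.η 0) (F.η 1) (F.η 2) p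
          * if i = j then 1 else 0) := by
  have hf := fun i j k => F.evalT_η hH i j k p
  unfold Hsq
  generalize evalT H (F.η 0) (F.η 1) (F.η 2) p = f at hf ⊢
  have e1 : ∀ i k : Fin 3, evalT H (F.η i) (F.e 0) (F.e k.succ) p
      = - evalT H F.V (F.η i) (F.η k) p := fun i k => evalT_swap_left hH _ _ _ _
  have e2 : ∀ i k : Fin 3, evalT H (F.η i) (F.e k.succ) (F.e 0) p
      = evalT H F.V (F.η i) (F.η k) p := fun i k => by
    rw [evalT_swap_right hH, e1, neg_neg]
  have e3 : ∀ i, evalT H (F.η i) (F.e 0) (F.e 0) p = 0 := fun i => evalT_self_right hH _ _ _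
  have e4 : ∀ i k l : Fin 3, evalT H (F.η i) (F.e k.succ) (F.e l.succ) p
      = f * leviCivita i k l := fun i k l => hf i k l
  simp only [Fin.sum_univ_succ (n := 3), e1, e2, e3, e4]
  fin_cases i <;> fin_cases j <;> simp [Fin.sum_univ_three, leviCivita] <;> ring

include hdim hg in
-- All brackets of the frame lie on the line of η₃, so only their last components meet.
theorem evalB_bracket_bracket [CompleteSpace EG] (hA : F.IsAdapted)
    (hnil : LieRing.IsNilpotent (GroupLieAlgebra 𝓘(ℝ, EG) G)) (i j k l : Fin 3) {p : P}
    (hp : pb.proj p ∈ F.U) : evalB g (bracket (F.η i) (F.η j)) (bracket (F.η k) (F.η l)) p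
      = F.struc 0 1 2 p ^ 2 * (heisenberg i j 2 * heisenberg k l 2) := by
  have h1 := fun i j => bracket_η_η (F := F) hdim hg i j hp
  have h2 := fun i j k => hA.struc_eq hdim hg hnil i j k hp
  unfold evalB
  rw [h1, h1]
  generalize F.struc 0 1 2 p = c at h2 ⊢
  simp only [map_sum, map_smul, sum_apply, smul_apply, smul_eq_mul, g_ηη hg hp, h2]
  have h3 : ∀ i j k, heisenberg i j k = if k = 2 then heisenberg i j 2 else 0 := fun i j k => by
    fin_cases i <;> fin_cases j <;> fin_cases k <;> simp [heisenberg]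
  simp [Fin.sum_univ_three, h3 i j 0, h3 i j 1, h3 k l 0, h3 k l 1]
  ring

include hdim hg hH in
-- The bracket terms combine to l² diag(1, 1, −1): the adjoint term acts on η₁ and η₂, the term with
-- factor −½ on η₃, where [η₁, η₂] is counted twice.
theorem rhsG_η [CompleteSpace EG] (hA : F.IsAdapted)
    (hnil : LieRing.IsNilpotent (GroupLieAlgebra 𝓘(ℝ, EG) G)) (i j : Fin 3) {p : P}
    (hp : pb.proj p ∈ F.U) : F.rhsG H (F.η i) (F.η j) p
      = F.DDG (F.η i) (F.η j) p - ∑ k, F.DG (F.η i) (F.η k) p * F.DG (F.η k) (F.η j) p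
        + F.struc 0 1 2 p * F.struc 0 1 2 p * (if i = j then ![1, 1, -1] i else 0)
        + ∑ k, evalT H F.V (F.η i) (F.η k) p * evalT H F.V (F.η j) (F.η k) p
        + evalT H (F.η 0) (F.η 1) (F.η 2) p * evalT H (F.η 0) (F.η 1) (F.η 2) p
          * if i = j then 1 else 0 := by
  have hs : ∀ k l i, evalB g (bracket (F.η k) (F.η l)) (F.η i) p
    = F.struc 0 1 2 p * heisenberg k l i := fun k l i => hA.struc_eq hdim hg hnil k l i hp
  unfold rhsG
  rw [Hsq_η_η hH.toIsInvariantClosedForm]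
  simp only [evalB_bracket_bracket hdim hg hA hnil _ _ _ _ hp, hs]
  generalize F.struc 0 1 2 p = c
  have hc : ∑ k, c ^ 2 * (heisenberg k i 2 * heisenberg k j 2) - 1 / 2 * ∑ k, ∑ l,
      c * heisenberg k l i * (c * heisenberg k l j)
      = c * c * (if i = j then ![1, 1, -1] i else 0) := by
    fin_cases i <;> fin_cases j <;> simp [Fin.sum_univ_three, heisenberg] <;> ring
  linear_combination hc

include hdim hg hH in
-- In an adapted frame |[,]|² = 2l² counts the two orders of η₁, η₂, |H^𝔊|² = 6f² counts six
-- permutations, and H(V, ·, ·)[·, ·] = 2 l H(V, η₁, η₂) η₃.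
theorem SB_eq [CompleteSpace EG] (hA : F.IsAdapted)
    (hnil : LieRing.IsNilpotent (GroupLieAlgebra 𝓘(ℝ, EG) G)) {p : P}
    (hp : pb.proj p ∈ F.U) : F.SB H p =
      2 * ∑ i, ∑ j, (F.DDG (F.η i) (F.η j) p
        - ∑ k, F.DG (F.η i) (F.η k) p * F.DG (F.η j) (F.η k) p
        + ∑ k, evalT H F.V (F.η i) (F.η k) p * evalT H F.V (F.η j) (F.η k) p) ^ 2
      + 2 * ∑ i, ∑ j, (F.DH H F.V (F.η i) (F.η j) p
        + ∑ k, evalT H F.V (F.η k) (F.η i) p * F.DG (F.η k) (F.η j) p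
        - ∑ k, evalT H F.V (F.η k) (F.η j) p * F.DG (F.η k) (F.η i) p) ^ 2
      + 2 * F.struc 0 1 2 p ^ 2 * (∑ k, F.DG (F.η k) (F.η k) p - 2 * F.DG (F.η 2) (F.η 2) p) ^ 2
      + 4 * F.struc 0 1 2 p ^ 2 * (∑ k, F.DG (F.η k) (F.η 2) p ^ 2 - F.DG (F.η 2) (F.η 2) p ^ 2)
      + 2 * ∑ i, F.trDGbracket (F.η i) p ^ 2
      + 2 * ∑ i, (F.trDGbracket (F.η i) p + evalT H (F.η 0) (F.η 1) (F.η 2) p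
        * ∑ j, ∑ k, evalT H F.V (F.η j) (F.η k) p * leviCivita i j k) ^ 2
      + 8 * (F.struc 0 1 2 p * evalT H F.V (F.η 0) (F.η 1) p) ^ 2
      + 2 * evalT H (F.η 0) (F.η 1) (F.η 2) p ^ 2 * (∑ k, F.DG (F.η k) (F.η k) p) ^ 2 := by
  have hH' := hH.toIsInvariantClosedForm
  have hb := fun i j k l => evalB_bracket_bracket (F := F) hdim hg hA hnil i j k l hp
  have hf := fun i j k => F.evalT_η hH' i j k p
  have e1 : F.normSqBracket p = 2 * F.struc 0 1 2 p ^ 2 := by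
    unfold normSqBracket
    simp only [hb]
    simp [Fin.sum_univ_three, heisenberg]
    ring
  have e2 : F.normSqHG H p = 6 * evalT H (F.η 0) (F.η 1) (F.η 2) p ^ 2 := by
    unfold normSqHG
    generalize evalT H (F.η 0) (F.η 1) (F.η 2) p = f at hf ⊢
    simp only [hf]
    simp [Fin.sum_univ_three, leviCivita]
    ring
  have e3 : evalB g (F.HVbracket H) (F.HVbracket H) p
      = 4 * (F.struc 0 1 2 p * evalT H F.V (F.η 0) (F.η 1) p) ^ 2 := by
    have h10 := evalT_swap_right hH' F.V (F.η 1) (F.η 0) p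
    have hbb : ∀ i j k l, g p (bracket (F.η i) (F.η j) p) (bracket (F.η k) (F.η l) p)
      = F.struc 0 1 2 p ^ 2 * (heisenberg i j 2 * heisenberg k l 2) := hb
    unfold evalB HVbracket
    simp only [map_sum, map_smul, sum_apply, smul_apply, smul_eq_mul, hbb]
    simp [Fin.sum_univ_three, heisenberg, h10]
    ring
  unfold SB
  rw [e1, e2, e3]
  simp only [Hsq_V_η hH', trDG]
  ring

end OrthonormalFrame

end Bundle

/-! ### Derivatives of matrix curves at the identity. -/

section MatrixCurve

variable {A B K : ℝ → Matrix (Fin 3) (Fin 3) ℝ} {S K' : Fin 3 → Fin 3 → ℝ} {t : ℝ}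

/-- Differentiate B⁻¹ B = 1 at a time where B = 1. -/
theorem hasDerivAt_inv_of_eq_one (hB : ∀ i j, HasDerivAt (fun s => B s i j) (S i j) t)
    (hB1 : B t = 1) (hA : ∀ i j, DifferentiableAt ℝ (fun s => (B s)⁻¹ i j) t)
    (hdet : ∀ᶠ s in 𝓝 t, (B s).det ≠ 0) (i j : Fin 3) :
    HasDerivAt (fun s => (B s)⁻¹ i j) (- S i j) t := by
  have h1 : HasDerivAt (fun s => ∑ k, (B s)⁻¹ i k * B s k j)
      (∑ k, (deriv (fun s => (B s)⁻¹ i k) t * B t k j + (B t)⁻¹ i k * S k j)) t :=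
    HasDerivAt.fun_sum fun k _ => (hA i k).hasDerivAt.mul (hB k j)
  have h2 : HasDerivAt (fun s => ∑ k, (B s)⁻¹ i k * B s k j) 0 t := by
    refine (hasDerivAt_const t ((1 : Matrix (Fin 3) (Fin 3) ℝ) i j)).congr_of_eventuallyEq ?_
    filter_upwards [hdet] with s hs
    rw [← Matrix.nonsing_inv_mul (B s) (isUnit_iff_ne_zero.2 hs), Matrix.mul_apply]
  have h3 := h1.unique h2
  rw [hB1, inv_one] at h3
  have h4 : deriv (fun s => (B s)⁻¹ i j) t = - S i j := by
    simp only [Finset.sum_add_distrib, Matrix.one_apply, mul_ite, mul_one, mul_zero, ite_mul,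
      one_mul, zero_mul, Finset.sum_ite_eq, Finset.sum_ite_eq', Finset.mem_univ, if_true] at h3
    linarith
  rw [← h4]
  exact (hA i j).hasDerivAt

/-- The product rule gives two terms from the factors A and two from K. The hypothesis `hsymm`,
valid for symmetric and for skew K, makes the two A-terms equal. -/
theorem hasDerivAt_trace (hA : ∀ i j, HasDerivAt (fun s => A s i j) (- S i j) t) (hA1 : A t = 1)
    (hK : ∀ i j, HasDerivAt (fun s => K s i j) (K' i j) t)
    (hsymm : ∀ i j k, K t i j * K t i k = K t j i * K t k i) :
    HasDerivAt (fun s => (A s * K s * A s * (K s).transpose).trace)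
      (- 2 * ∑ i, ∑ j, ∑ k, S i j * K t j k * K t i k + 2 * ∑ i, ∑ j, K' i j * K t i j) t := by
  simp only [Matrix.trace, Matrix.diag, Matrix.mul_apply, Matrix.transpose_apply]
  have h := HasDerivAt.fun_sum (u := Finset.univ) fun i (_ : i ∈ Finset.univ) =>
    HasDerivAt.fun_sum (u := Finset.univ) fun j (_ : j ∈ Finset.univ) =>
    (HasDerivAt.fun_sum (u := Finset.univ) fun k (_ : k ∈ Finset.univ) =>
      (HasDerivAt.fun_sum (u := Finset.univ) fun l (_ : l ∈ Finset.univ) =>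
        (hA i l).mul (hK l k)).mul (hA k j)).mul (hK i j)
  refine h.congr_deriv ?_
  simp only [Pi.mul_apply, hA1]
  simp only [Matrix.one_apply, Fin.sum_univ_three, Fin.reduceEq, ↓reduceIte, mul_one, one_mul,
    zero_mul, mul_zero, add_zero, zero_add]
  have e : ∀ j k, ∑ i, K t i j * K t i k = ∑ i, K t j i * K t k i := fun j k =>
    Finset.sum_congr rfl fun i _ => hsymm i j k
  simp only [Fin.sum_univ_three] at e
  linear_combination -(S 0 0 * e 0 0 + S 1 0 * e 1 0 + S 2 0 * e 2 0 + S 0 1 * e 0 1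
    + S 1 1 * e 1 1 + S 2 1 * e 2 1 + S 0 2 * e 0 2 + S 1 2 * e 1 2 + S 2 2 * e 2 2)

end MatrixCurve

/-! ### Pointwise evolution of the density along the flow. -/

section Bundle

variable {EP EG P M G : Type*}
  [NormedAddCommGroup EP] [NormedSpace ℝ EP] [NormedAddCommGroup EG] [NormedSpace ℝ EG]
  [FiniteDimensional ℝ EP] [FiniteDimensional ℝ EG]
  [TopologicalSpace P] [ChartedSpace EP P] [IsManifold 𝓘(ℝ, EP) ∞ P]
  [TopologicalSpace M] [ChartedSpace ℝ M] [IsManifold 𝓘(ℝ, ℝ) ∞ M]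
  [TopologicalSpace G] [ChartedSpace EG G] [Group G] [LieGroup 𝓘(ℝ, EG) ∞ G]
  {pb : PrincipalBundle EP EG P M G}

namespace OrthonormalFrame

section Diagonal

variable {g : BilinField EP P} {m : M} {F : OrthonormalFrame pb g m} {H : TrilinField EP P} {p : P}
  (hdim : Module.finrank ℝ EG = 3) (hg : SmoothMetric pb g) (hp : pb.proj p ∈ F.U)

include hg hp

theorem gram_self : F.gram g p = 1 := by
  ext i j
  rw [Matrix.one_apply]
  exact F.orthonormal_η i j p hp

theorem shift_self (i : Fin 3) : F.shift g i p = 0 :=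
  Finset.sum_eq_zero fun j _ => by
    unfold evalB
    rw [g_Vη hg hp, mul_zero]

theorem normSqHor_self : F.normSqHor g p = 1 := by
  unfold normSqHor evalB
  simp [shift_self hg hp, g_VV hg hp]

include hdim in
theorem varG_self (i j : Fin 3) : F.varG g p i j = F.DG (F.η i) (F.η j) p := by
  have h0 : dirDeriv F.V (evalB g (F.η i) (F.η j)) p = 0 :=
    dirDeriv_eq_zero_of_eqOn_const (pb.isOpen_preimage F.isOpen)
      (fun q hq => F.orthonormal_η i j q hq) hp
  rw [F.DG_η hdim hg i j hp]
  simp only [varG, Matrix.of_apply, h0, shift_self hg hp, evalB, g_ηη hg hp]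
  simp
  ring

theorem varH_self (i j : Fin 3) : F.varH g H p i j = evalT H F.V (F.η i) (F.η j) p := by
  simp only [varH, Matrix.of_apply, shift_self hg hp]
  simp

end Diagonal

variable {J : Set ℝ} {g : ℝ → BilinField EP P} {H : ℝ → TrilinField EP P} {t : ℝ} {m : M}
  {F : OrthonormalFrame pb (g t) m} {p : P}

/-- The derivative in time of `|DG|² + tr_g H²` along the flow. -/
theorem hasDerivAt_density [CompleteSpace EG] (hdim : Module.finrank ℝ EG = 3)
    (hnil : LieRing.IsNilpotent (GroupLieAlgebra 𝓘(ℝ, EG) G)) (hJ : IsOpen J)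
    (hg : ∀ s ∈ J, SmoothMetric pb (g s)) (hH : ∀ s ∈ J, SmoothForm pb (H s))
    (hgs : SmoothFamilyB J g) (hflow : SatisfiesFlow pb J g H)
    (ht : t ∈ J) (hA : F.IsAdapted) (hp : pb.proj p ∈ F.U) :
    HasDerivAt (fun s => F.normSqVarG (g s) p + F.normSqVarH (g s) (H s) p)
      (dirDeriv F.V (dirDeriv F.V (F.density (H t))) p - 1 / 2 * F.density (H t) p ^ 2
        - F.SB (H t) p) t := by
  have hgt := hg t ht
  have hHt := hH t ht
  have hHt' := hHt.toIsInvariantClosedForm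
  have hJt := hJ.mem_nhds ht
  obtain ⟨C, -, hmC, hN, -⟩ := pb.exists_coord F.isOpen hp (mem_chart_source ℝ _)
  have hW := pb.isOpen_preimage F.isOpen
  -- the Gram matrix
  have dG : ∀ q, pb.proj q ∈ F.U → ∀ i j, HasDerivAt (fun s => evalB (g s) (F.η i) (F.η j) q)
      (F.rhsG (H t) (F.η i) (F.η j) q) t := fun q hq i j => hflow.eqG t ht q (F.at' hq) i j
  have dGi : ∀ i j, HasDerivAt (fun s => (F.gram (g s) p)⁻¹ i j)
      (- F.rhsG (H t) (F.η i) (F.η j) p) t :=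
    hasDerivAt_inv_of_eq_one (dG p hp) (gram_self hgt hp)
      (fun i j => (isSmoothFamily_gram_inv hgt hN hg hgs i j).differentiableAt hJ hmC ht)
      (by filter_upwards [hJt] with s hs using det_gram_ne_zero hgt (hg s hs) hp)
  -- the connection
  have dA : ∀ i, HasDerivAt (fun s => F.shift (g s) i p) (F.trDGbracket (F.η i) p
      + 1 / 2 * F.Hsq (H t) F.V (F.η i) p) t := fun i => by
    refine (hflow.eqA t ht p (F.at' hp) i).congr_of_eventuallyEq ?_
    filter_upwards [hJt] with s hs
    exact (g_connectionForm hdim hgt (hg s hs) hp i).symm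
  -- the base metric
  have du : HasDerivAt (fun s => F.normSqHor (g s) p) (1 / 2 * F.density (H t) p) t := by
    have h := hflow.eqg t ht p (F.at' hp)
    refine (h.congr_of_eventuallyEq ?_).congr_deriv ?_
    · filter_upwards [hJt] with s hs
      have := baseMetric_smul hdim hgt (hg s hs) hp 1 (one_smul ℝ _).symm
      rw [one_pow, one_mul] at this
      exact this.symm
    · unfold density trHsq
      rw [mul_add]
      rfl
  -- the derivative of the fibre metric
  have dVG : ∀ i j, HasDerivAt (fun s => dirDeriv F.V (evalB (g s) (F.η i) (F.η j)) p)
      (dirDeriv F.V (F.rhsG (H t) (F.η i) (F.η j)) p) t := fun i j =>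
    (PrincipalBundle.Coord.IsSmoothFamily.evalB hg hgs ((F.invField_η i).mono hN)
      ((F.invField_η j).mono hN)).hasDerivAt_dirDeriv hJ hmC ht
      fun q hq => dG q (hN hq) i j
  have dC : ∀ i k, HasDerivAt (fun s => F.conn i k p - ∑ l, F.shift (g s) l p * F.struc l i k p)
      (- ∑ l, (F.trDGbracket (F.η l) p + 1 / 2 * F.Hsq (H t) F.V (F.η l) p) * F.struc l i k p)
      t := fun i k => by
    have := (hasDerivAt_const t (F.conn i k p)).sub (HasDerivAt.fun_sum (u := Finset.univ)
      fun l (_ : l ∈ Finset.univ) => (dA l).mul_const (F.struc l i k p))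
    rw [zero_sub] at this
    exact this
  have dK : ∀ i j, HasDerivAt (fun s => F.varG (g s) p i j)
      (dirDeriv F.V (F.rhsG (H t) (F.η i) (F.η j)) p
        - ∑ k, F.conn i k p * F.rhsG (H t) (F.η k) (F.η j) p
        - ∑ k, F.conn j k p * F.rhsG (H t) (F.η i) (F.η k) p
        + ∑ l, (F.trDGbracket (F.η l) p + 1 / 2 * F.Hsq (H t) F.V (F.η l) p) * F.struc l i j p
        + ∑ l, (F.trDGbracket (F.η l) p + 1 / 2 * F.Hsq (H t) F.V (F.η l) p) * F.struc l j i p)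
      t := fun i j => by
    refine (((dVG i j).sub (HasDerivAt.fun_sum (u := Finset.univ) fun k (_ : k ∈ Finset.univ) =>
      (dC i k).mul (dG p hp k j))).sub (HasDerivAt.fun_sum (u := Finset.univ)
        fun k (_ : k ∈ Finset.univ) => (dC j k).mul (dG p hp i k))).congr_deriv ?_
    simp only [shift_self hgt hp, evalB, g_ηη hgt hp]
    simp [Finset.sum_add_distrib]
    ring
  -- the three-form
  have dH : ∀ a b c, HasDerivAt (fun s => H s p (F.e a p) (F.e b p) (F.e c p))
      (extDeriv₂ (F.B (H t)) (F.e a) (F.e b) (F.e c) p) t := fun a b c =>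
    hflow.eqH t ht p (F.at' hp) a b c
  have dh : ∀ i j, HasDerivAt (fun s => F.varH (g s) (H s) p i j)
      (extDeriv₂ (F.B (H t)) F.V (F.η i) (F.η j) p
        - ∑ k, (F.trDGbracket (F.η k) p + 1 / 2 * F.Hsq (H t) F.V (F.η k) p)
          * evalT (H t) (F.η k) (F.η i) (F.η j) p) t := fun i j => by
    -- In the family `e` the index 0 is V and the successors are the ηᵢ. Terms with ∂H/∂t on three
    -- vertical vectors carry the factor `shift`, which is zero at time t.
    refine ((dH 0 i.succ j.succ).sub (HasDerivAt.fun_sum (u := Finset.univ)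
      fun k (_ : k ∈ Finset.univ) => (dA k).mul (dH k.succ i.succ j.succ))).congr_deriv ?_
    simp only [shift_self hgt hp, zero_mul, add_zero]
    rfl
  -- assembling
  have hK0 : ∀ i j, F.varG (g t) p i j = F.DG (F.η i) (F.η j) p := varG_self hdim hgt hp
  have hh0 : ∀ i j, F.varH (g t) (H t) p i j = evalT (H t) F.V (F.η i) (F.η j) p :=
    varH_self hgt hp
  have hG1 : (F.gram (g t) p)⁻¹ = 1 := by rw [gram_self hgt hp, inv_one]
  have T1 := hasDerivAt_trace dGi hG1 dK fun i j k => by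
    simp only [hK0]
    rw [DG_symm hdim hgt i j hp, DG_symm hdim hgt i k hp]
  have T2 := hasDerivAt_trace dGi hG1 dh fun i j k => by
    simp only [hh0]
    rw [evalT_swap_right hHt' F.V (F.η i) (F.η j), evalT_swap_right hHt' F.V (F.η i) (F.η k),
      neg_mul_neg]
  have hu1 : F.normSqHor (g t) p = 1 := normSqHor_self hgt hp
  have hT1 : ((F.gram (g t) p)⁻¹ * F.varG (g t) p * (F.gram (g t) p)⁻¹
      * (F.varG (g t) p).transpose).trace = F.normSqDG p := by
    have := normSqDG_eq_normSqVarG hdim hgt hgt F hp hp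
    rw [this]; unfold normSqVarG; rw [hu1, div_one]
  have hT2 : ((F.gram (g t) p)⁻¹ * F.varH (g t) (H t) p * (F.gram (g t) p)⁻¹
      * (F.varH (g t) (H t) p).transpose).trace = F.trHsq (H t) p := by
    have := trHsq_eq_normSqVarH hdim hgt hgt F hHt' hp hp
    rw [this]; unfold normSqVarH; rw [hu1, div_one]
  -- Quotient rule with denominator 1 and derivative ½ Q: dividing by `normSqHor` contributes −½ Q².
  have main := (T1.div du (by rw [hu1]; exact one_ne_zero)).add
    (T2.div du (by rw [hu1]; exact one_ne_zero))
  refine main.congr_deriv ?_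
  rw [hu1, hT1, hT2]
  simp only [hK0, hh0]
  -- the algebraic identity
  have hs := fun i j k => hA.struc_eq hdim hgt hnil i j k hp
  obtain ⟨hvl, hl0, hl1⟩ := hA.dirDeriv_struc hdim hgt hnil hp
  have hvf := hA.dirDeriv_evalT hdim hgt hHt hnil hp
  have vK := fun i j => hasDirDeriv_DG (F := F) hdim hgt i j hp
  have vX := fun i j => hasDirDeriv_DDG (F := F) hdim hgt i j hp
  have vh := fun i j => hasDirDeriv_evalT (F := F) hdim hgt hHt i j hp
  have vz := fun i j => hasDirDeriv_DH (F := F) hdim hgt hHt i j hp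
  have vl := (invFun_struc (F := F) hgt 0 1 2).hasDirDeriv F.isOpen hp hvl
  have vf := (hHt.invFun F.isOpen (F.invField_η 0) (F.invField_η 1)
    (F.invField_η 2)).hasDirDeriv F.isOpen hp hvf
  -- The component formulas for ∂G/∂t, and below for B and V Q, hold on the whole domain of the
  -- frame, which is what allows differentiating them along V.
  have vS := fun i j => (((((vX i j).sub (HasDirDeriv.sum fun k => (vK i k).mul (vK k j))).add
    ((vl.mul vl).mul_const (if i = j then ![1, 1, -1] i else 0))).add
    (HasDirDeriv.sum fun k => (vh i k).mul (vh j k))).add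
    ((vf.mul vf).mul_const (if i = j then 1 else 0))).congr hW hp
    (fun q hq => rhsG_η hdim hgt hHt hA hnil i j hq)
  have vB := fun i j => ((vz i j).sub (HasDirDeriv.sum fun k =>
    ((vK k i).mul (vh k j)).sub ((vK k j).mul (vh k i)))).congr hW hp
    (fun q hq => B_η hdim hgt hHt hA hnil i j hq)
  have vQ := ((((HasDirDeriv.sum fun i => HasDirDeriv.sum fun j =>
      (vK i j).mul (vX i j)).const_mul 2).sub ((HasDirDeriv.sum fun i => HasDirDeriv.sum fun j =>
      HasDirDeriv.sum fun k => ((vK i j).mul (vK j k)).mul (vK k i)).const_mul 2)).add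
      ((HasDirDeriv.sum fun i => HasDirDeriv.sum fun j => (vh i j).mul (vz i j)).const_mul 2)).sub
      ((HasDirDeriv.sum fun i => HasDirDeriv.sum fun j => HasDirDeriv.sum fun k =>
      ((vK i j).mul (vh j k)).mul (vh i k)).const_mul 2)
  have vQ' := vQ.congr hW hp fun q hq => dirDeriv_density hdim hgt hHt hq
  have hid := variation_identity
    (a := fun i j => F.conn i j p) (K := fun i j => F.DG (F.η i) (F.η j) p)
    (X := fun i j => F.DDG (F.η i) (F.η j) p) (Y := fun i j => F.lie F.DDG (F.η i) (F.η j) p)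
    (h := fun i j => evalT (H t) F.V (F.η i) (F.η j) p)
    (z := fun i j => F.DH (H t) F.V (F.η i) (F.η j) p)
    (y := fun i j => F.lie (F.DH (H t) F.V) (F.η i) (F.η j) p)
    (S := fun i j => F.rhsG (H t) (F.η i) (F.η j) p)
    (B := fun i j => F.B (H t) (F.η i) (F.η j) p)
    (vS := fun i j => dirDeriv F.V (F.rhsG (H t) (F.η i) (F.η j)) p)
    (vB := fun i j => dirDeriv F.V (F.B (H t) (F.η i) (F.η j)) p)
    (dK := fun i j => dirDeriv F.V (F.rhsG (H t) (F.η i) (F.η j)) p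
        - ∑ k, F.conn i k p * F.rhsG (H t) (F.η k) (F.η j) p
        - ∑ k, F.conn j k p * F.rhsG (H t) (F.η i) (F.η k) p
        + ∑ l, (F.trDGbracket (F.η l) p + 1 / 2 * F.Hsq (H t) F.V (F.η l) p) * F.struc l i j p
        + ∑ l, (F.trDGbracket (F.η l) p + 1 / 2 * F.Hsq (H t) F.V (F.η l) p) * F.struc l j i p)
    (dh := fun i j => extDeriv₂ (F.B (H t)) F.V (F.η i) (F.η j) p
        - ∑ k, (F.trDGbracket (F.η k) p + 1 / 2 * F.Hsq (H t) F.V (F.η k) p)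
          * evalT (H t) (F.η k) (F.η i) (F.η j) p)
    (A₀ := fun i => F.trDGbracket (F.η i) p)
    (A := fun i => F.trDGbracket (F.η i) p + 1 / 2 * F.Hsq (H t) F.V (F.η i) p)
    (l := F.struc 0 1 2 p) (f := evalT (H t) (F.η 0) (F.η 1) (F.η 2) p)
    (Q := F.density (H t) p) (VVQ := dirDeriv F.V (dirDeriv F.V (F.density (H t))) p)
    (fun i j => F.DG_η hdim hgt i j hp) (fun i j => DDG_symm hdim hgt i j hp)
    (fun i j => evalT_swap_right hHt' _ _ _ _) (fun i j => DH_skew hdim hgt hHt i j hp)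
    (fun i j => lie_DH_skew hdim hgt hHt i j hp) hl0 hl1
    (fun _ _ => rfl) (fun _ _ => rfl) (fun _ _ => rfl) (fun _ _ => rfl) rfl rfl
    (fun i j => rhsG_η hdim hgt hHt hA hnil i j hp)
    (fun i j => (vS i j).eq) (fun i j => B_η hdim hgt hHt hA hnil i j hp)
    (fun i j => (vB i j).eq)
    (fun i => trDGbracket_η hdim hgt hA hnil i hp)
    (fun i => by rw [Hsq_V_η hHt'])
    (fun i j => by simp only [← hs])
    (fun i j => by
      rw [extDeriv₂_B hdim hgt hHt hA hnil i j hp]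
      simp only [← F.evalT_η hHt'])
    (by unfold density normSqDG; rw [trHsq_eq hHt'])
    (by
      rw [vQ'.eq]
      simp only [Finset.mul_sum, add_mul])
  rw [SB_eq hdim hgt hHt hA hnil hp]
  have hdd : F.density (H t) p = F.normSqDG p + F.trHsq (H t) p := rfl
  rw [hdd] at hid ⊢
  linear_combination hid

end OrthonormalFrame

end Bundle

/-! ### Gluing measures along a countable cover. -/

section Gluing

variable {α ι : Type*} [MeasurableSpace α]

/-- A supremum of measures that are concentrated on a countable cover and agree on the overlaps
restricts to each of them. -/
theorem iSup_measure_apply {ν : ι → Measure α} {S : ι → Set α} (hS : ∀ i, MeasurableSet (S i))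
    (hν : ∀ i, ν i (S i)ᶜ = 0)
    (hagree : ∀ i j E, MeasurableSet E → E ⊆ S i → E ⊆ S j → ν i E = ν j E)
    {f : ℕ → ι} (hf : ⋃ n, S (f n) = univ) (i : ι) {E : Set α} (hE : MeasurableSet E)
    (hES : E ⊆ S i) : (⨆ j, ν j) E = ν i E := by
  set D := disjointed fun n => S (f n) with hD
  have hDm : ∀ n, MeasurableSet (D n) := fun n => MeasurableSet.disjointed (fun n => hS (f n)) n
  have hDS : ∀ n, D n ⊆ S (f n) := fun n => disjointed_subset _ n
  have hDu : ⋃ n, D n = univ := by rw [hD, iUnion_disjointed, hf]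
  have hdis : Pairwise fun a b => Disjoint (D a) (D b) := disjoint_disjointed _
  -- θ takes the measure ν (f n) on the n-th piece of a disjoint partition. Agreement on overlaps
  -- makes θ an upper bound of all ν j, which controls the supremum from above.
  set θ : Measure α := Measure.sum fun n => (ν (f n)).restrict (D n) with hθ
  have hsplit : ∀ j {A : Set α}, MeasurableSet A → ν j A = ∑' n, ν j (A ∩ D n) := fun j A hA => by
    rw [← measure_iUnion (fun a b hab => (hdis hab).mono inter_subset_right inter_subset_right)
      (fun n => hA.inter (hDm n)), ← inter_iUnion, hDu, inter_univ]
  have hθA : ∀ {A : Set α}, MeasurableSet A → θ A = ∑' n, ν (f n) (A ∩ D n) := fun hA => by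
    rw [hθ, Measure.sum_apply _ hA]
    exact tsum_congr fun n => Measure.restrict_apply hA
  have hle : ⨆ j, ν j ≤ θ := by
    refine iSup_le fun j => Measure.le_iff.2 fun A hA => ?_
    have h1 : ν j A ≤ ν j (A ∩ S j) := by
      calc ν j A ≤ ν j (A ∩ S j) + ν j (A \ S j) := measure_le_inter_add_sdiff _ _ _
        _ = ν j (A ∩ S j) := by
          have h2 : ν j (A \ S j) = 0 := measure_mono_null (fun x hx => hx.2) (hν j)
          rw [h2, add_zero]
    refine h1.trans ?_
    rw [hsplit j (hA.inter (hS j)), hθA hA]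
    refine ENNReal.tsum_le_tsum fun n => ?_
    rw [hagree j (f n) _ ((hA.inter (hS j)).inter (hDm n)) (fun x hx => hx.1.2)
      (fun x hx => hDS n hx.2)]
    exact measure_mono fun x hx => ⟨hx.1.1, hx.2⟩
  refine le_antisymm ((hle E).trans ?_) (Measure.le_iff'.1 (le_iSup ν i) E)
  rw [hθA hE, hsplit i hE]
  exact ENNReal.tsum_le_tsum fun n => (hagree (f n) i _ (hE.inter (hDm n))
    (fun x hx => hDS n hx.2) fun x hx => hES hx.1).le

end Gluing

/-! ### Riemannian volume of a one-dimensional manifold. -/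

section Volume

variable {M : Type*} [TopologicalSpace M] [ChartedSpace ℝ M] [IsManifold 𝓘(ℝ, ℝ) ∞ M]

/-- The coordinate vector of the chart at `m₀`. -/
def chartVector (m₀ : M) (x : ℝ) : ℝ :=
  mfderiv 𝓘(ℝ, ℝ) 𝓘(ℝ, ℝ) (chartAt ℝ m₀).symm x (1 : ℝ)

/-- The square length of the coordinate vector of the chart at `m₀`. -/
def chartMetric (b : (m : M) → TangentSpace 𝓘(ℝ, ℝ) m → TangentSpace 𝓘(ℝ, ℝ) m → ℝ) (m₀ : M)
    (x : ℝ) : ℝ := b ((chartAt ℝ m₀).symm x) (chartVector m₀ x) (chartVector m₀ x)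

theorem mdifferentiableAt_chart_symm (m₀ : M) {x : ℝ} (hx : x ∈ (chartAt ℝ m₀).target) :
    MDifferentiableAt 𝓘(ℝ, ℝ) 𝓘(ℝ, ℝ) (chartAt ℝ m₀).symm x :=
  (mdifferentiable_chart (I := 𝓘(ℝ, ℝ)) m₀).mdifferentiableAt_symm hx

/-- The derivative of a function along the coordinate vector `1` of the model space. -/
def derivAt (f : M → ℝ) (m : M) : ℝ := mfderiv 𝓘(ℝ, ℝ) 𝓘(ℝ, ℝ) f m (1 : ℝ)

/-- The coordinate expression of a function. -/
theorem hasDerivAt_comp_chart_symm (m₀ : M) {x : ℝ} (hx : x ∈ (chartAt ℝ m₀).target) {f : M → ℝ}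
    (hf : MDifferentiableAt 𝓘(ℝ, ℝ) 𝓘(ℝ, ℝ) f ((chartAt ℝ m₀).symm x)) :
    HasDerivAt (fun y => f ((chartAt ℝ m₀).symm y))
      (chartVector m₀ x * derivAt f ((chartAt ℝ m₀).symm x)) x := by
  let L : ℝ →L[ℝ] ℝ := mfderiv 𝓘(ℝ, ℝ) 𝓘(ℝ, ℝ) f ((chartAt ℝ m₀).symm x)
  let K : ℝ →L[ℝ] ℝ := mfderiv 𝓘(ℝ, ℝ) 𝓘(ℝ, ℝ) (chartAt ℝ m₀).symm x
  have h1 := hf.hasMFDerivAt.comp x (mdifferentiableAt_chart_symm m₀ hx).hasMFDerivAt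
  have h2 : HasFDerivAt (fun y => f ((chartAt ℝ m₀).symm y)) (L.comp K) x :=
    hasMFDerivAt_iff_hasFDerivAt.1 h1
  convert h2.hasDerivAt using 1
  change K 1 * L 1 = L (K 1)
  rw [← smul_eq_mul, ← map_smul, smul_eq_mul, mul_one]

theorem chartVector_ne_zero (m₀ : M) {x : ℝ} (hx : x ∈ (chartAt ℝ m₀).target) :
    chartVector m₀ x ≠ 0 := by
  intro h0
  have hm := (chartAt ℝ m₀).map_target hx
  have h1 := hasDerivAt_comp_chart_symm m₀ hx
    ((mdifferentiable_chart (I := 𝓘(ℝ, ℝ)) m₀).mdifferentiableAt hm)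
  have h2 : HasDerivAt (fun y => chartAt ℝ m₀ ((chartAt ℝ m₀).symm y)) 1 x := by
    refine (hasDerivAt_id x).congr_of_eventuallyEq ?_
    filter_upwards [(chartAt ℝ m₀).open_target.mem_nhds hx] with y hy
    exact (chartAt ℝ m₀).right_inv hy
  have h3 := h1.unique h2
  rw [h0, zero_mul] at h3
  exact zero_ne_one h3

/-- Change of the coordinate vector between charts. -/
theorem chartVector_eq (m₀ m₁ : M) {x : ℝ} (hx : x ∈ (chartAt ℝ m₀).target)
    (hx₁ : (chartAt ℝ m₀).symm x ∈ (chartAt ℝ m₁).source) :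
    DifferentiableAt ℝ (fun y => chartAt ℝ m₁ ((chartAt ℝ m₀).symm y)) x ∧
    chartVector m₀ x = deriv (fun y => chartAt ℝ m₁ ((chartAt ℝ m₀).symm y)) x
      * chartVector m₁ (chartAt ℝ m₁ ((chartAt ℝ m₀).symm x)) := by
  set τ : ℝ → ℝ := fun y => chartAt ℝ m₁ ((chartAt ℝ m₀).symm y) with hτ
  have hd : DifferentiableAt ℝ τ x := (hasDerivAt_comp_chart_symm m₀ hx
    ((mdifferentiable_chart (I := 𝓘(ℝ, ℝ)) m₁).mdifferentiableAt hx₁)).differentiableAt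
  refine ⟨hd, ?_⟩
  have ht : τ x ∈ (chartAt ℝ m₁).target := (chartAt ℝ m₁).map_source hx₁
  let K : ℝ →L[ℝ] ℝ := mfderiv 𝓘(ℝ, ℝ) 𝓘(ℝ, ℝ) (chartAt ℝ m₁).symm (τ x)
  let T : ℝ →L[ℝ] ℝ := ContinuousLinearMap.toSpanSingleton ℝ (deriv τ x)
  have hT : HasMFDerivAt 𝓘(ℝ, ℝ) 𝓘(ℝ, ℝ) τ x T := hd.hasDerivAt.hasFDerivAt.hasMFDerivAt
  have h1 : HasMFDerivAt 𝓘(ℝ, ℝ) 𝓘(ℝ, ℝ) ((chartAt ℝ m₁).symm ∘ τ) x (K.comp T) :=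
    (mdifferentiableAt_chart_symm m₁ ht).hasMFDerivAt.comp x hT
  have h2 : (chartAt ℝ m₀).symm =ᶠ[𝓝 x] (chartAt ℝ m₁).symm ∘ τ := by
    have hc : ContinuousAt (chartAt ℝ m₀).symm x :=
      (chartAt ℝ m₀).continuousAt_symm hx
    filter_upwards [hc.preimage_mem_nhds ((chartAt ℝ m₁).open_source.mem_nhds hx₁)] with y hy
    exact ((chartAt ℝ m₁).left_inv hy).symm
  have h3 := (h1.congr_of_eventuallyEq h2).mfderiv
  have h4 : chartVector m₀ x = K (T 1) := congrArg (fun L : ℝ →L[ℝ] ℝ => L (1 : ℝ)) h3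
  have h5 : T 1 = deriv τ x • (1 : ℝ) := by
    simp only [T, ContinuousLinearMap.toSpanSingleton_apply, smul_eq_mul, mul_one, one_mul]
  rw [h4, h5, map_smul, smul_eq_mul]
  rfl

variable {b : (m : M) → TangentSpace 𝓘(ℝ, ℝ) m → TangentSpace 𝓘(ℝ, ℝ) m → ℝ}

theorem chartMetric_eq (hom : ∀ m (r : ℝ), b m (r : ℝ) (r : ℝ) = r ^ 2 * b m (1 : ℝ) (1 : ℝ))
    (m₀ : M) (x : ℝ) : chartMetric b m₀ x = chartVector m₀ x ^ 2
      * b ((chartAt ℝ m₀).symm x) (1 : ℝ) (1 : ℝ) := hom _ _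

theorem chartMetric_change
    (hom : ∀ m (r : ℝ), b m (r : ℝ) (r : ℝ) = r ^ 2 * b m (1 : ℝ) (1 : ℝ))
    (m₀ m₁ : M) {x : ℝ} (hx : x ∈ (chartAt ℝ m₀).target)
    (hx₁ : (chartAt ℝ m₀).symm x ∈ (chartAt ℝ m₁).source) :
    chartMetric b m₀ x = deriv (fun y => chartAt ℝ m₁ ((chartAt ℝ m₀).symm y)) x ^ 2
      * chartMetric b m₁ (chartAt ℝ m₁ ((chartAt ℝ m₀).symm x)) := by
  rw [chartMetric_eq hom, chartMetric_eq hom, (chartVector_eq m₀ m₁ hx hx₁).2,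
    (chartAt ℝ m₁).left_inv hx₁]
  ring

variable [MeasurableSpace M] [BorelSpace M]

/-- The volume measure of the chart at `m₀`. -/
def chartVolume (b : (m : M) → TangentSpace 𝓘(ℝ, ℝ) m → TangentSpace 𝓘(ℝ, ℝ) m → ℝ) (m₀ : M) :
    Measure M :=
  Measure.map (chartAt ℝ m₀).symm
    ((volume.restrict (chartAt ℝ m₀).target).withDensity fun x =>
      ENNReal.ofReal √(chartMetric b m₀ x))

theorem aemeasurable_chart_symm (m₀ : M) (ρ : ℝ → ENNReal) :
    AEMeasurable (chartAt ℝ m₀).symm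
      ((volume.restrict (chartAt ℝ m₀).target).withDensity ρ) :=
  ((chartAt ℝ m₀).continuousOn_symm.aemeasurable
    (chartAt ℝ m₀).open_target.measurableSet).mono_ac (withDensity_absolutelyContinuous _ _)

theorem measurableSet_chart_preimage (m₀ : M) {E : Set M} (hE : MeasurableSet E) :
    MeasurableSet ((chartAt ℝ m₀).target ∩ (chartAt ℝ m₀).symm ⁻¹' E) := by
  have h1 : Measurable ((chartAt ℝ m₀).target.domRestrict (chartAt ℝ m₀).symm) :=
    (chartAt ℝ m₀).continuousOn_symm.domRestrict.measurable
  have h2 := (MeasurableEmbedding.subtype_coe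
    (chartAt ℝ m₀).open_target.measurableSet).measurableSet_image' (h1 hE)
  convert! h2 using 1
  ext x
  constructor
  · rintro ⟨h3, h4⟩
    exact ⟨⟨x, h3⟩, h4, rfl⟩
  · rintro ⟨⟨y, hy⟩, h3, rfl⟩
    exact ⟨hy, h3⟩

theorem chartVolume_apply (m₀ : M) {E : Set M} (hE : MeasurableSet E) :
    chartVolume b m₀ E = ∫⁻ x in (chartAt ℝ m₀).target ∩ (chartAt ℝ m₀).symm ⁻¹' E,
      ENNReal.ofReal √(chartMetric b m₀ x) := by
  have hO := measurableSet_chart_preimage m₀ hE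
  unfold chartVolume
  rw [Measure.map_apply_of_aemeasurable (aemeasurable_chart_symm m₀ _) hE]
  have hT := (chartAt ℝ m₀).open_target.measurableSet
  rw [← withDensity_apply _ hO, ← restrict_withDensity hT, Measure.restrict_apply' hT,
    inter_comm]

theorem chartVolume_compl (m₀ : M) : chartVolume b m₀ (chartAt ℝ m₀).sourceᶜ = 0 := by
  rw [chartVolume_apply m₀ (chartAt ℝ m₀).open_source.measurableSet.compl]
  have : (chartAt ℝ m₀).target ∩ (chartAt ℝ m₀).symm ⁻¹' (chartAt ℝ m₀).sourceᶜ = ∅ := by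
    ext x
    simp only [mem_inter_iff, mem_preimage, mem_compl_iff, mem_empty_iff_false, iff_false, not_and,
      not_not]
    exact fun hx => (chartAt ℝ m₀).map_target hx
  rw [this, Measure.restrict_empty, lintegral_zero_measure]

/-- Change of variables by the transition map τ: the densities satisfy √γ₀ = |τ'| √γ₁. -/
theorem chartVolume_agree
    (hom : ∀ m (r : ℝ), b m (r : ℝ) (r : ℝ) = r ^ 2 * b m (1 : ℝ) (1 : ℝ))
    (m₀ m₁ : M) {E : Set M} (hE : MeasurableSet E) (h₀ : E ⊆ (chartAt ℝ m₀).source)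
    (h₁ : E ⊆ (chartAt ℝ m₁).source) : chartVolume b m₀ E = chartVolume b m₁ E := by
  rw [chartVolume_apply m₀ hE, chartVolume_apply m₁ hE]
  set A := (chartAt ℝ m₀).target ∩ (chartAt ℝ m₀).symm ⁻¹' E with hA
  set τ : ℝ → ℝ := fun y => chartAt ℝ m₁ ((chartAt ℝ m₀).symm y) with hτ
  have hAm : MeasurableSet A := measurableSet_chart_preimage m₀ hE
  have himg : τ '' A = (chartAt ℝ m₁).target ∩ (chartAt ℝ m₁).symm ⁻¹' E := by
    ext y
    constructor
    · rintro ⟨x, ⟨hx, hxE⟩, rfl⟩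
      refine ⟨(chartAt ℝ m₁).map_source (h₁ hxE), ?_⟩
      rw [mem_preimage, hτ, (chartAt ℝ m₁).left_inv (h₁ hxE)]
      exact hxE
    · rintro ⟨hy, hyE⟩
      refine ⟨chartAt ℝ m₀ ((chartAt ℝ m₁).symm y),
        ⟨(chartAt ℝ m₀).map_source (h₀ hyE), ?_⟩, ?_⟩
      · rw [mem_preimage, (chartAt ℝ m₀).left_inv (h₀ hyE)]; exact hyE
      · rw [hτ]
        simp only
        rw [(chartAt ℝ m₀).left_inv (h₀ hyE), (chartAt ℝ m₁).right_inv hy]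
  have hinj : InjOn τ A := by
    rintro x ⟨hx, hxE⟩ y ⟨hy, hyE⟩ hxy
    exact (chartAt ℝ m₀).symm.injOn hx hy ((chartAt ℝ m₁).injOn (h₁ hxE) (h₁ hyE) hxy)
  rw [← himg, lintegral_image_eq_lintegral_abs_deriv_mul hAm
    (fun x hx => ((chartVector_eq m₀ m₁ hx.1 (h₁ hx.2)).1.hasDerivAt).hasDerivWithinAt) hinj]
  refine setLIntegral_congr_fun hAm fun x hx => ?_
  rw [chartMetric_change hom m₀ m₁ hx.1 (h₁ hx.2), Real.sqrt_mul (sq_nonneg _), Real.sqrt_sq_eq_abs,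
    ENNReal.ofReal_mul (abs_nonneg _)]

/-- By compactness finitely many charts cover M, so the gluing lemma applies to the chart measures.
-/
theorem riemannianVolume_restrict [CompactSpace M]
    (hom : ∀ m (r : ℝ), b m (r : ℝ) (r : ℝ) = r ^ 2 * b m (1 : ℝ) (1 : ℝ)) (m₀ : M) :
    (riemannianVolume b).restrict (chartAt ℝ m₀).source = chartVolume b m₀ := by
  have hS : ∀ m : M, MeasurableSet (chartAt ℝ m).source := fun m =>
    (chartAt ℝ m).open_source.measurableSet
  obtain ⟨f, hf⟩ : ∃ f : ℕ → M, ⋃ n, (chartAt ℝ (f n)).source = univ := by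
    obtain ⟨s, hs⟩ := isCompact_univ.elim_finite_subcover (fun m : M => (chartAt ℝ m).source)
      (fun m => (chartAt ℝ m).open_source) fun m _ => mem_iUnion.2 ⟨m, mem_chart_source ℝ m⟩
    have hne : (s : Set M).Nonempty := by
      have := hs (mem_univ m₀)
      simp only [mem_iUnion] at this
      obtain ⟨i, hi, -⟩ := this
      exact ⟨i, hi⟩
    obtain ⟨f, hf⟩ := s.countable_toSet.exists_eq_range hne
    refine ⟨f, eq_univ_of_forall fun m => ?_⟩
    have := hs (mem_univ m)
    simp only [mem_iUnion] at this ⊢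
    obtain ⟨i, hi, hm⟩ := this
    have hi' : i ∈ range f := by rw [← hf]; exact hi
    obtain ⟨n, rfl⟩ := hi'
    exact ⟨n, hm⟩
  refine Measure.ext fun E hE => ?_
  rw [Measure.restrict_apply hE]
  have h1 : riemannianVolume b (E ∩ (chartAt ℝ m₀).source)
      = chartVolume b m₀ (E ∩ (chartAt ℝ m₀).source) :=
    iSup_measure_apply (ν := chartVolume b) (S := fun m => (chartAt ℝ m).source) hS
      chartVolume_compl (fun i j E hE => chartVolume_agree hom i j hE) hf m₀ (hE.inter (hS m₀))
      inter_subset_right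
  rw [h1]
  refine le_antisymm (measure_mono inter_subset_left) ?_
  refine (measure_le_inter_add_sdiff _ E (chartAt ℝ m₀).source).trans ?_
  have h2 : chartVolume b m₀ (E \ (chartAt ℝ m₀).source) = 0 :=
    measure_mono_null (fun x hx => hx.2) (chartVolume_compl m₀)
  rw [h2, add_zero]

/-- The integral of a function that is supported in the domain of a chart. -/
theorem integral_riemannianVolume [CompactSpace M]
    (hom : ∀ m (r : ℝ), b m (r : ℝ) (r : ℝ) = r ^ 2 * b m (1 : ℝ) (1 : ℝ)) (m₀ : M)
    (hb : ContinuousOn (chartMetric b m₀) (chartAt ℝ m₀).target) {F : M → ℝ} (hF : Continuous F)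
    (hsupp : ∀ m, m ∉ (chartAt ℝ m₀).source → F m = 0) :
    ∫ m, F m ∂(riemannianVolume b)
      = ∫ x in (chartAt ℝ m₀).target, F ((chartAt ℝ m₀).symm x) * √(chartMetric b m₀ x) := by
  have hT := (chartAt ℝ m₀).open_target.measurableSet
  rw [← setIntegral_eq_integral_of_forall_compl_eq_zero hsupp, riemannianVolume_restrict hom]
  unfold chartVolume
  rw [integral_map (aemeasurable_chart_symm m₀ _) hF.aestronglyMeasurable,
    integral_withDensity_eq_integral_toReal_smul₀]
  · refine setIntegral_congr_fun hT fun x hx => ?_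
    rw [ENNReal.toReal_ofReal (Real.sqrt_nonneg _), smul_eq_mul, mul_comm]
  · exact ENNReal.measurable_ofReal.comp_aemeasurable (hb.sqrt.aemeasurable hT)
  · exact Eventually.of_forall fun x => ENNReal.ofReal_lt_top

/-- The density is bounded on a compact neighbourhood in each chart, so the measure is locally
finite, hence finite on a compact space. -/
theorem isFiniteMeasure_riemannianVolume [CompactSpace M]
    (hom : ∀ m (r : ℝ), b m (r : ℝ) (r : ℝ) = r ^ 2 * b m (1 : ℝ) (1 : ℝ))
    (hb : ∀ m₀, ContinuousOn (chartMetric b m₀) (chartAt ℝ m₀).target) :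
    IsFiniteMeasure (riemannianVolume b) := by
  have hloc : IsLocallyFiniteMeasure (riemannianVolume b) := by
    refine ⟨fun m => ?_⟩
    have hx := mem_chart_target ℝ m
    obtain ⟨K, hK, hxK, hKT⟩ := exists_compact_subset (chartAt ℝ m).open_target hx
    have hO : IsOpen ((chartAt ℝ m).source ∩ chartAt ℝ m ⁻¹' interior K) :=
      (chartAt ℝ m).continuousOn.isOpen_inter_preimage (chartAt ℝ m).open_source isOpen_interior
    refine ⟨_, hO.mem_nhds ⟨mem_chart_source ℝ m, hxK⟩, ?_⟩
    have h1 : riemannianVolume b ((chartAt ℝ m).source ∩ chartAt ℝ m ⁻¹' interior K)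
        = chartVolume b m ((chartAt ℝ m).source ∩ chartAt ℝ m ⁻¹' interior K) := by
      rw [← riemannianVolume_restrict hom, Measure.restrict_apply hO.measurableSet]
      congr 1
      exact (inter_eq_left.2 inter_subset_left).symm
    rw [h1, chartVolume_apply m hO.measurableSet]
    refine lt_of_le_of_lt (lintegral_mono_set (t := K) ?_) ?_
    · rintro x ⟨hx, hx2⟩
      have := hx2.2
      rw [mem_preimage, (chartAt ℝ m).right_inv hx] at this
      exact interior_subset this
    · obtain ⟨c, hc⟩ := hK.exists_bound_of_continuousOn ((hb m).sqrt.mono hKT)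
      refine lt_of_le_of_lt (setLIntegral_mono (g := fun _ => ENNReal.ofReal c) measurable_const
        fun x hx => ENNReal.ofReal_le_ofReal ((le_abs_self _).trans (hc x hx))) ?_
      rw [setLIntegral_const]
      exact ENNReal.mul_lt_top ENNReal.ofReal_lt_top hK.measure_lt_top
  exact ⟨isCompact_univ.measure_lt_top⟩

end Volume

/-! ### Integration by parts and parameter integrals on the line. -/

section Line

variable {k f : ℝ → ℝ} {T : Set ℝ}

theorem continuous_mul_of_tsupport_subset (hk : Continuous k) (hT : IsOpen T)
    (hkT : tsupport k ⊆ T) (hf : ContinuousOn f T) : Continuous fun x => k x * f x :=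
  continuous_of_tsupport fun _ hx => hk.continuousAt.mul
    (hf.continuousAt (hT.mem_nhds (hkT (tsupport_mul_subset_left hx))))

theorem integrable_mul_of_hasCompactSupport (hk : Continuous k) (hkc : HasCompactSupport k)
    (hT : IsOpen T) (hkT : tsupport k ⊆ T) (hf : ContinuousOn f T) :
    Integrable fun x => k x * f x :=
  (continuous_mul_of_tsupport_subset hk hT hkT hf).integrable_of_hasCompactSupport hkc.mul_right

/-- Integration by parts against a compactly supported function. -/
theorem setIntegral_mul_deriv (hk : ContDiff ℝ 1 k) (hkc : HasCompactSupport k)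
    (hT : IsOpen T) (hkT : tsupport k ⊆ T) (hf : ContDiffOn ℝ 1 f T) :
    ∫ x in T, k x * deriv f x = - ∫ x in T, deriv k x * f x := by
  have hdf : ContinuousOn (deriv f) T := hf.continuousOn_deriv_of_isOpen hT le_rfl
  have hdk : Continuous (deriv k) := hk.continuous_deriv le_rfl
  have hdkT : tsupport (deriv k) ⊆ T := tsupport_deriv_subset.trans hkT
  have h1 := integrable_mul_of_hasCompactSupport hk.continuous hkc hT hkT hdf
  have h2 := integrable_mul_of_hasCompactSupport hdk hkc.deriv hT hdkT hf.continuousOn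
  have h0 := integrable_mul_of_hasCompactSupport hk.continuous hkc hT hkT hf.continuousOn
  -- The product rule holds on the whole line, although f is only smooth on T: away from the support
  -- of k the product vanishes identically near x.
  have hd : ∀ x, HasDerivAt (fun y => k y * f y) (deriv k x * f x + k x * deriv f x) x := by
    intro x
    by_cases hx : x ∈ tsupport k
    · exact ((hk.differentiable one_ne_zero).differentiableAt.hasDerivAt).mul
        (((hf.contDiffAt (hT.mem_nhds (hkT hx))).differentiableAt one_ne_zero).hasDerivAt)
    · have he : ∀ᶠ y in 𝓝 x, k y = 0 := by
        filter_upwards [(isClosed_tsupport k).isOpen_compl.mem_nhds hx] with y hy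
        exact image_eq_zero_of_notMem_tsupport hy
      have hk' : k =ᶠ[𝓝 x] fun _ => 0 := he
      rw [hk'.deriv_eq, he.self_of_nhds, deriv_const, zero_mul, zero_mul, add_zero]
      refine (hasDerivAt_const x (0 : ℝ)).congr_of_eventuallyEq ?_
      filter_upwards [he] with y hy
      rw [hy, zero_mul]
  have h3 := integral_eq_zero_of_hasDerivAt_of_integrable hd (h2.add h1) h0
  rw [integral_add h2 h1] at h3
  rw [setIntegral_eq_integral_of_forall_compl_eq_zero, setIntegral_eq_integral_of_forall_compl_eq_zero]
  · linarith
  · intro x hx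
    rw [image_eq_zero_of_notMem_tsupport fun h => hx (hdkT h), zero_mul]
  · intro x hx
    rw [image_eq_zero_of_notMem_tsupport fun h => hx (hkT h), zero_mul]

/-- Differentiation under the integral sign against a compactly supported function. -/
theorem hasDerivAt_setIntegral_mul {J : Set ℝ} {φ : ℝ × ℝ → ℝ} {t : ℝ} (hk : Continuous k)
    (hkc : HasCompactSupport k) (hT : IsOpen T) (hkT : tsupport k ⊆ T) (hJ : IsOpen J) (ht : t ∈ J)
    (hφ : ContDiffOn ℝ ∞ φ (T ×ˢ J)) :
    HasDerivAt (fun s => ∫ x in T, k x * φ (x, s)) (∫ x in T, k x * partial₂ φ (x, t)) t := by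
  obtain ⟨ε, hε, hεJ⟩ := Metric.nhds_basis_closedBall.mem_iff.1 (hJ.mem_nhds ht)
  have hd := contDiffOn_partial₂ (hT.prod hJ) hφ
  have hslice : ∀ {ψ : ℝ × ℝ → ℝ} {s : ℝ}, ContDiffOn ℝ ∞ ψ (T ×ˢ J) → s ∈ J →
      ContinuousOn (fun x => ψ (x, s)) T := fun {ψ s} hψ hs =>
    hψ.continuousOn.comp (by fun_prop) fun x hx => ⟨hx, hs⟩
  have hK : IsCompact (tsupport k ×ˢ Metric.closedBall t ε) :=
    hkc.isCompact.prod (isCompact_closedBall t ε)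
  have hc : ContinuousOn (fun z : ℝ × ℝ => k z.1 * partial₂ φ z)
      (tsupport k ×ˢ Metric.closedBall t ε) :=
    (hk.comp continuous_fst).continuousOn.mul
      (hd.continuousOn.mono fun z hz => ⟨hkT hz.1, hεJ hz.2⟩)
  -- The parameter derivative is bounded on the compact product of the support of k and a closed
  -- interval around t; this constant on the support is the dominating function.
  obtain ⟨C, hC⟩ := hK.exists_bound_of_continuousOn hc
  refine (hasDerivAt_integral_of_dominated_loc_of_deriv_le (μ := volume.restrict T)
    (F' := fun s x => k x * partial₂ φ (x, s)) (bound := (tsupport k).indicator fun _ => C)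
    (Metric.closedBall_mem_nhds t hε) ?_ ?_ ?_ ?_ ?_ ?_).2
  · filter_upwards [hJ.mem_nhds ht] with s hs
    exact (continuous_mul_of_tsupport_subset hk hT hkT (hslice hφ hs)).aestronglyMeasurable
  · exact (integrable_mul_of_hasCompactSupport hk hkc hT hkT (hslice hφ ht)).restrict
  · exact (continuous_mul_of_tsupport_subset hk hT hkT (hslice hd ht)).aestronglyMeasurable
  · refine Eventually.of_forall fun x s hs => ?_
    by_cases hx : x ∈ tsupport k
    · rw [indicator_of_mem hx]
      exact hC (x, s) ⟨hx, hs⟩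
    · rw [indicator_of_notMem hx, image_eq_zero_of_notMem_tsupport hx, zero_mul, norm_zero]
  · refine Integrable.restrict ?_
    exact (integrable_indicator_iff (isClosed_tsupport k).measurableSet).2
      (integrableOn_const hkc.isCompact.measure_lt_top.ne)
  · refine (ae_restrict_mem hT.measurableSet).mono fun x hx s hs => ?_
    exact (hasDerivAt_partial₂ (((hφ.contDiffAt ((hT.prod hJ).mem_nhds ⟨hx, hεJ hs⟩))).differentiableAt
      (by simp))).const_mul _

end Line

/-! ### Coordinate expressions and partitions of unity. -/

section Charts

variable {M : Type*} [TopologicalSpace M] [ChartedSpace ℝ M] [IsManifold 𝓘(ℝ, ℝ) ∞ M]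

/-- A function is continuous if its coordinate expressions are. -/
theorem continuous_of_charts {F : M → ℝ}
    (h : ∀ m₀ : M, ContinuousOn (fun x => F ((chartAt ℝ m₀).symm x)) (chartAt ℝ m₀).target) :
    Continuous F := by
  refine continuous_iff_continuousAt.2 fun m => ?_
  have hm := mem_chart_source ℝ m
  have h1 : ContinuousAt (fun x => F ((chartAt ℝ m).symm x)) (chartAt ℝ m m) :=
    (h m).continuousAt ((chartAt ℝ m).open_target.mem_nhds (mem_chart_target ℝ m))
  have h2 := h1.comp ((chartAt ℝ m).continuousAt hm)
  refine h2.congr ?_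
  filter_upwards [(chartAt ℝ m).open_source.mem_nhds hm] with y hy
  simp only [Function.comp_apply, (chartAt ℝ m).left_inv hy]

/-- A function is smooth if its coordinate expressions are. -/
theorem contMDiff_of_charts {F : M → ℝ}
    (h : ∀ m₀ : M, ContDiffOn ℝ ∞ (fun x => F ((chartAt ℝ m₀).symm x)) (chartAt ℝ m₀).target) :
    ContMDiff 𝓘(ℝ, ℝ) 𝓘(ℝ, ℝ) ∞ F := by
  intro m
  have hm := mem_chart_source ℝ m
  have h1 : ContMDiffAt 𝓘(ℝ, ℝ) 𝓘(ℝ, ℝ) ∞ (fun x => F ((chartAt ℝ m).symm x)) (chartAt ℝ m m) :=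
    ((h m).contDiffAt ((chartAt ℝ m).open_target.mem_nhds (mem_chart_target ℝ m))).contMDiffAt
  have h2 := h1.comp m ((contMDiffOn_chart (I := 𝓘(ℝ, ℝ)) (x := m)).contMDiffAt
    ((chartAt ℝ m).open_source.mem_nhds hm))
  refine h2.congr_of_eventuallyEq ?_
  filter_upwards [(chartAt ℝ m).open_source.mem_nhds hm] with y hy
  simp only [Function.comp_apply, (chartAt ℝ m).left_inv hy]

/-- The coordinate expression of a function, extended by zero. -/
def chartExtend (χ : M → ℝ) (m₀ : M) : ℝ → ℝ :=
  (chartAt ℝ m₀).target.indicator fun x => χ ((chartAt ℝ m₀).symm x)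

theorem chartExtend_of_mem (χ : M → ℝ) (m₀ : M) {x : ℝ} (hx : x ∈ (chartAt ℝ m₀).target) :
    chartExtend χ m₀ x = χ ((chartAt ℝ m₀).symm x) := indicator_of_mem hx _

section

variable [CompactSpace M] {χ : M → ℝ} {m₀ : M}

theorem isCompact_chart_image_tsupport
    (hsupp : tsupport χ ⊆ (chartAt ℝ m₀).source) : IsCompact (chartAt ℝ m₀ '' tsupport χ) :=
  (isClosed_tsupport χ).isCompact.image_of_continuousOn ((chartAt ℝ m₀).continuousOn.mono hsupp)

theorem tsupport_chartExtend_subset_image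
    (hsupp : tsupport χ ⊆ (chartAt ℝ m₀).source) :
    tsupport (chartExtend χ m₀) ⊆ chartAt ℝ m₀ '' tsupport χ := by
  refine closure_minimal (fun x hx => ?_) (isCompact_chart_image_tsupport hsupp).isClosed
  have hx' : x ∈ (chartAt ℝ m₀).target := by
    by_contra h
    exact hx (indicator_of_notMem h _)
  rw [Function.mem_support, chartExtend_of_mem χ m₀ hx'] at hx
  exact ⟨(chartAt ℝ m₀).symm x, subset_tsupport χ hx, (chartAt ℝ m₀).right_inv hx'⟩

theorem tsupport_chartExtend_subset
    (hsupp : tsupport χ ⊆ (chartAt ℝ m₀).source) : tsupport (chartExtend χ m₀) ⊆ (chartAt ℝ m₀).target := by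
  refine (tsupport_chartExtend_subset_image hsupp).trans ?_
  rintro _ ⟨m, hm, rfl⟩
  exact (chartAt ℝ m₀).map_source (hsupp hm)

theorem hasCompactSupport_chartExtend
    (hsupp : tsupport χ ⊆ (chartAt ℝ m₀).source) : HasCompactSupport (chartExtend χ m₀) :=
  (isCompact_chart_image_tsupport hsupp).of_isClosed_subset (isClosed_tsupport _)
    (tsupport_chartExtend_subset_image hsupp)

theorem contDiff_chartExtend (hsupp : tsupport χ ⊆ (chartAt ℝ m₀).source)
    (hχ : ContMDiff 𝓘(ℝ, ℝ) 𝓘(ℝ, ℝ) ∞ χ) :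
    ContDiff ℝ ∞ (chartExtend χ m₀) := by
  refine contMDiff_iff_contDiff.1 (contMDiff_of_tsupport fun x hx => ?_)
  have hx' := (chartAt ℝ m₀).open_target.mem_nhds (tsupport_chartExtend_subset hsupp hx)
  refine ((hχ.contMDiffOn (s := univ)).comp (contMDiffOn_chart_symm (I := 𝓘(ℝ, ℝ)) (x := m₀))
    (fun y _ => mem_univ _)).contMDiffAt hx' |>.congr_of_eventuallyEq ?_
  filter_upwards [hx'] with y hy
  exact chartExtend_of_mem χ m₀ hy

end

/-- In a partition of unity subordinate to the chart domains local finiteness and compactness leave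
only finitely many nonzero members. -/
theorem exists_finite_partition [T2Space M] [CompactSpace M] :
    ∃ (s : Finset M) (χ : M → M → ℝ), (∀ i, ContMDiff 𝓘(ℝ, ℝ) 𝓘(ℝ, ℝ) ∞ (χ i)) ∧
      (∀ i, tsupport (χ i) ⊆ (chartAt ℝ i).source) ∧ ∀ m, ∑ i ∈ s, χ i m = 1 := by
  obtain ⟨f, hf⟩ := SmoothPartitionOfUnity.exists_isSubordinate_chartAt_source 𝓘(ℝ, ℝ) M
  have hfin : (Function.support fun i => (f i : M → ℝ)).Finite := by
    refine f.locallyFinite.finite_nonempty_of_compact.subset fun i hi => ?_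
    exact Function.support_nonempty_iff.2 hi
  refine ⟨hfin.toFinset, fun i => f i, fun i => (f i).contMDiff, hf, fun m => ?_⟩
  rw [← f.sum_eq_one (mem_univ m)]
  refine (finsum_eq_sum_of_support_subset _ fun i hi => ?_).symm
  simp only [Finite.coe_toFinset, Function.mem_support]
  intro h
  exact hi (congrFun h m)

end Charts

/-! ### Integrals over the base and the divergence theorem. -/

section Metric

variable {M : Type*} [TopologicalSpace M] [ChartedSpace ℝ M] [IsManifold 𝓘(ℝ, ℝ) ∞ M]
  [CompactSpace M] [MeasurableSpace M] [BorelSpace M]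
  {b : (m : M) → TangentSpace 𝓘(ℝ, ℝ) m → TangentSpace 𝓘(ℝ, ℝ) m → ℝ}
  {s : Finset M} {χ : M → M → ℝ}

theorem integrable_of_continuous
    (hom : ∀ m (r : ℝ), b m (r : ℝ) (r : ℝ) = r ^ 2 * b m (1 : ℝ) (1 : ℝ))
    (hb : ∀ m₀, ContDiffOn ℝ ∞ (chartMetric b m₀) (chartAt ℝ m₀).target) {F : M → ℝ}
    (hF : Continuous F) : Integrable F (riemannianVolume b) := by
  have := isFiniteMeasure_riemannianVolume hom fun m₀ => (hb m₀).continuousOn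
  obtain ⟨C, hC⟩ := isCompact_univ.exists_bound_of_continuousOn hF.continuousOn
  exact Integrable.of_bound hF.aestronglyMeasurable C
    (Eventually.of_forall fun m => hC m (mem_univ m))

/-- An integral over `M` in terms of a partition of unity. -/
theorem integral_eq_sum
    (hom : ∀ m (r : ℝ), b m (r : ℝ) (r : ℝ) = r ^ 2 * b m (1 : ℝ) (1 : ℝ))
    (hb : ∀ m₀, ContDiffOn ℝ ∞ (chartMetric b m₀) (chartAt ℝ m₀).target)
    (hχ : ∀ i, ContMDiff 𝓘(ℝ, ℝ) 𝓘(ℝ, ℝ) ∞ (χ i))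
    (hsupp : ∀ i, tsupport (χ i) ⊆ (chartAt ℝ i).source) (hsum : ∀ m, ∑ i ∈ s, χ i m = 1)
    {F : M → ℝ} (hF : Continuous F) :
    ∫ m, F m ∂(riemannianVolume b) = ∑ i ∈ s, ∫ x in (chartAt ℝ i).target,
      chartExtend (χ i) i x * (F ((chartAt ℝ i).symm x) * √(chartMetric b i x)) := by
  have hc : ∀ i, Continuous fun m => χ i m * F m := fun i => (hχ i).continuous.mul hF
  calc ∫ m, F m ∂(riemannianVolume b) = ∫ m, ∑ i ∈ s, χ i m * F m ∂(riemannianVolume b) := by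
        refine integral_congr_ae (Eventually.of_forall fun m => ?_)
        beta_reduce
        rw [← Finset.sum_mul, hsum, one_mul]
    _ = ∑ i ∈ s, ∫ m, χ i m * F m ∂(riemannianVolume b) :=
        integral_finsetSum _ fun i _ => integrable_of_continuous hom hb (hc i)
    _ = _ := by
        refine Finset.sum_congr rfl fun i _ => ?_
        rw [integral_riemannianVolume hom i (hb i).continuousOn (hc i) fun m hm => by
          rw [image_eq_zero_of_notMem_tsupport fun h => hm (hsupp i h), zero_mul]]
        refine setIntegral_congr_fun (chartAt ℝ i).open_target.measurableSet fun x hx => ?_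
        rw [chartExtend_of_mem _ _ hx, mul_assoc]

/-- The integral of the Laplacian vanishes. -/
theorem sum_integral_laplacian_eq_zero
    (hom : ∀ m (r : ℝ), b m (r : ℝ) (r : ℝ) = r ^ 2 * b m (1 : ℝ) (1 : ℝ))
    (hb : ∀ m₀, ContDiffOn ℝ ∞ (chartMetric b m₀) (chartAt ℝ m₀).target)
    (hpos : ∀ m₀, ∀ x ∈ (chartAt ℝ m₀).target, 0 < chartMetric b m₀ x)
    (hχ : ∀ i, ContMDiff 𝓘(ℝ, ℝ) 𝓘(ℝ, ℝ) ∞ (χ i))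
    (hsupp : ∀ i, tsupport (χ i) ⊆ (chartAt ℝ i).source) (hsum : ∀ m, ∑ i ∈ s, χ i m = 1)
    {q : M → ℝ}
    (hq : ∀ m₀ : M, ContDiffOn ℝ ∞ (fun x => q ((chartAt ℝ m₀).symm x)) (chartAt ℝ m₀).target) :
    ∑ i ∈ s, ∫ x in (chartAt ℝ i).target, chartExtend (χ i) i x
      * deriv (fun y => deriv (fun z => q ((chartAt ℝ i).symm z)) y / √(chartMetric b i y)) x
      = 0 := by
  have hqM := contMDiff_of_charts hq
  have hdiff : ∀ {f : M → ℝ}, ContMDiff 𝓘(ℝ, ℝ) 𝓘(ℝ, ℝ) ∞ f → ∀ (i : M),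
      ∀ x ∈ (chartAt ℝ i).target, HasDerivAt (fun y => f ((chartAt ℝ i).symm y))
        (chartVector i x * derivAt f ((chartAt ℝ i).symm x)) x := fun hf i x hx =>
    hasDerivAt_comp_chart_symm i hx (hf.mdifferentiable (by simp) _)
  -- Γ i is the inner product of dχᵢ and dq, written chart-independently. Integration by parts turns
  -- the i-th summand into −∫ Γ i, and ∑ Γ i vanishes because ∑ χᵢ is constant.
  set Γ : M → M → ℝ := fun i m => derivAt (χ i) m * derivAt q m / b m (1 : ℝ) (1 : ℝ) with hΓ
  have hΓx : ∀ i j, ∀ x ∈ (chartAt ℝ j).target, Γ i ((chartAt ℝ j).symm x)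
      = deriv (fun y => χ i ((chartAt ℝ j).symm y)) x
        * deriv (fun y => q ((chartAt ℝ j).symm y)) x / chartMetric b j x := fun i j x hx => by
    rw [(hdiff (hχ i) j x hx).deriv, (hdiff hqM j x hx).deriv, chartMetric_eq hom j x]
    have := chartVector_ne_zero j hx
    simp only [hΓ]
    rw [mul_mul_mul_comm, ← sq, mul_div_mul_left _ _ (pow_ne_zero 2 this)]
  have hΓc : ∀ i, Continuous (Γ i) := fun i => continuous_of_charts fun j => by
    have hd : ∀ {f : ℝ → ℝ}, ContDiffOn ℝ ∞ f (chartAt ℝ j).target →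
        ContinuousOn (deriv f) (chartAt ℝ j).target := fun hf =>
      hf.continuousOn_deriv_of_isOpen (chartAt ℝ j).open_target (by simp)
    have h1 : ContDiffOn ℝ ∞ (fun y => χ i ((chartAt ℝ j).symm y)) (chartAt ℝ j).target :=
      (((hχ i).contMDiffOn (s := univ)).comp (contMDiffOn_chart_symm (I := 𝓘(ℝ, ℝ)) (x := j))
        (fun y _ => mem_univ _)).contDiffOn
    exact (((hd h1).mul (hd (hq j))).div (hb j).continuousOn fun x hx => (hpos j x hx).ne').congr
      (hΓx i j)
  have hΓ0 : ∀ i m, m ∉ (chartAt ℝ i).source → Γ i m = 0 := fun i m hm => by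
    have hm' : m ∉ tsupport (χ i) := fun h => hm (hsupp i h)
    have he : χ i =ᶠ[𝓝 m] fun _ => 0 := by
      filter_upwards [(isClosed_tsupport (χ i)).isOpen_compl.mem_nhds hm'] with y hy
      exact image_eq_zero_of_notMem_tsupport hy
    have h0 : derivAt (χ i) m = 0 := by
      unfold derivAt
      rw [he.mfderiv_eq, mfderiv_const]
      rfl
    simp only [hΓ, h0, zero_mul, zero_div]
  have hΓs : ∀ m, ∑ i ∈ s, Γ i m = 0 := fun m => by
    have hx := mem_chart_target ℝ m
    have hs : HasDerivAt (fun y => ∑ i ∈ s, χ i ((chartAt ℝ m).symm y))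
        (∑ i ∈ s, chartVector m (chartAt ℝ m m)
          * derivAt (χ i) ((chartAt ℝ m).symm (chartAt ℝ m m))) (chartAt ℝ m m) :=
      HasDerivAt.fun_sum fun i _ => hdiff (hχ i) m _ hx
    simp only [hsum] at hs
    have h0 := hs.unique (hasDerivAt_const _ (1 : ℝ))
    rw [(chartAt ℝ m).left_inv (mem_chart_source ℝ m), ← Finset.mul_sum] at h0
    have h1 := (mul_eq_zero.1 h0).resolve_left (chartVector_ne_zero m hx)
    simp only [hΓ]
    rw [← Finset.sum_div, ← Finset.sum_mul, h1, zero_mul, zero_div]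
  have key : ∀ i, ∫ x in (chartAt ℝ i).target, chartExtend (χ i) i x
      * deriv (fun y => deriv (fun z => q ((chartAt ℝ i).symm z)) y / √(chartMetric b i y)) x
      = - ∫ m, Γ i m ∂(riemannianVolume b) := fun i => by
    have hT := (chartAt ℝ i).open_target
    have hk := contDiff_chartExtend (hsupp i) (hχ i)
    have hf : ContDiffOn ℝ 1 (fun y => deriv (fun z => q ((chartAt ℝ i).symm z)) y
        / √(chartMetric b i y)) (chartAt ℝ i).target :=
      (((hq i).deriv_of_isOpen (m := ∞) hT (by simp)).of_le (by simp)).div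
        (((hb i).of_le (by simp)).sqrt fun x hx => (hpos i x hx).ne')
        fun x hx => (Real.sqrt_pos.2 (hpos i x hx)).ne'
    rw [setIntegral_mul_deriv (hk.of_le (by simp)) (hasCompactSupport_chartExtend (hsupp i)) hT
      (tsupport_chartExtend_subset (hsupp i)) hf,
      integral_riemannianVolume hom i (hb i).continuousOn (hΓc i) (hΓ0 i)]
    congr 1
    refine setIntegral_congr_fun hT.measurableSet fun x hx => ?_
    have he : chartExtend (χ i) i =ᶠ[𝓝 x] fun y => χ i ((chartAt ℝ i).symm y) := by
      filter_upwards [hT.mem_nhds hx] with y hy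
      exact chartExtend_of_mem _ _ hy
    rw [hΓx i i x hx, he.deriv_eq]
    have h1 := Real.sq_sqrt (hpos i x hx).le
    have h2 := (Real.sqrt_pos.2 (hpos i x hx)).ne'
    nth_rewrite 2 [← h1]
    field_simp
  rw [Finset.sum_congr rfl fun i _ => key i, Finset.sum_neg_distrib,
    ← integral_finsetSum _ fun i _ => integrable_of_continuous hom hb (hΓc i)]
  simp only [hΓs, integral_zero, neg_zero]

end Metric

/-! ### Evolution of the energy. -/

section Evolution

variable {M : Type*} [TopologicalSpace M] [ChartedSpace ℝ M] [IsManifold 𝓘(ℝ, ℝ) ∞ M]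
  [T2Space M] [CompactSpace M] [MeasurableSpace M] [BorelSpace M]

/-- Evolution of the energy of a density `Q` on a one-dimensional manifold under
`∂β = ½ Q β` and `∂Q = ΔQ - ½ Q² - S`. -/
theorem energy_evolution {J : Set ℝ} (hJ : IsOpen J)
    {β : ℝ → (m : M) → TangentSpace 𝓘(ℝ, ℝ) m → TangentSpace 𝓘(ℝ, ℝ) m → ℝ}
    {Q : ℝ → M → ℝ} {S : M → ℝ} {t : ℝ} (ht : t ∈ J) (htpos : 0 < t)
    (hom : ∀ s ∈ J, ∀ m (r : ℝ), β s m (r : ℝ) (r : ℝ) = r ^ 2 * β s m (1 : ℝ) (1 : ℝ))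
    (hβ : ∀ m₀ : M, ContDiffOn ℝ ∞ (fun z : ℝ × ℝ => chartMetric (β z.2) m₀ z.1)
      ((chartAt ℝ m₀).target ×ˢ J))
    (hpos : ∀ s ∈ J, ∀ m₀, ∀ x ∈ (chartAt ℝ m₀).target, 0 < chartMetric (β s) m₀ x)
    (hQ : ∀ m₀ : M, ContDiffOn ℝ ∞ (fun z : ℝ × ℝ => Q z.2 ((chartAt ℝ m₀).symm z.1))
      ((chartAt ℝ m₀).target ×ˢ J))
    (hβt : ∀ m₀, ∀ x ∈ (chartAt ℝ m₀).target, HasDerivAt (fun s => chartMetric (β s) m₀ x)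
      (1 / 2 * Q t ((chartAt ℝ m₀).symm x) * chartMetric (β t) m₀ x) t)
    (hQt : ∀ m₀ : M, ∀ x ∈ (chartAt ℝ m₀).target,
      HasDerivAt (fun s => Q s ((chartAt ℝ m₀).symm x))
        (deriv (fun y => deriv (fun z => Q t ((chartAt ℝ m₀).symm z)) y
            / √(chartMetric (β t) m₀ y)) x / √(chartMetric (β t) m₀ x)
          - 1 / 2 * Q t ((chartAt ℝ m₀).symm x) ^ 2 - S ((chartAt ℝ m₀).symm x)) t)
    (hS : ∀ m, 0 ≤ S m) :
    Integrable (Q t) (riemannianVolume (β t)) ∧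
    Integrable S (riemannianVolume (β t)) ∧
    Integrable (fun m => (Q t m - 2 / t) ^ 2) (riemannianVolume (β t)) ∧
    HasDerivAt (fun s => s * ∫ m, (Q s m + 2 / s) / √s ∂(riemannianVolume (β s)))
      (-t * (∫ m, S m / √t ∂(riemannianVolume (β t)))
        - t / 4 * (∫ m, (Q t m - 2 / t) ^ 2 / √t ∂(riemannianVolume (β t)))) t ∧
    -t * (∫ m, S m / √t ∂(riemannianVolume (β t)))
        - t / 4 * (∫ m, (Q t m - 2 / t) ^ 2 / √t ∂(riemannianVolume (β t))) ≤ 0 := by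
  have hb : ∀ s ∈ J, ∀ m₀, ContDiffOn ℝ ∞ (chartMetric (β s) m₀) (chartAt ℝ m₀).target :=
    fun s hs m₀ => (hβ m₀).comp (f := fun x => (x, s)) (by fun_prop) fun x hx => ⟨hx, hs⟩
  have hq : ∀ s ∈ J, ∀ m₀ : M,
      ContDiffOn ℝ ∞ (fun x => Q s ((chartAt ℝ m₀).symm x)) (chartAt ℝ m₀).target :=
    fun s hs m₀ => (hQ m₀).comp (f := fun x => (x, s)) (by fun_prop) fun x hx => ⟨hx, hs⟩
  have hQc : ∀ s ∈ J, Continuous (Q s) := fun s hs =>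
    continuous_of_charts fun m₀ => (hq s hs m₀).continuousOn
  have hO : ∀ m₀ : M, IsOpen ((chartAt ℝ m₀).target ×ˢ J) := fun m₀ =>
    (chartAt ℝ m₀).open_target.prod hJ
  have hsq : ∀ m₀ : M, ∀ x ∈ (chartAt ℝ m₀).target, 0 < √(chartMetric (β t) m₀ x) :=
    fun m₀ x hx => Real.sqrt_pos.2 (hpos t ht m₀ x hx)
  have hsqd : ∀ m₀ : M, ContDiffOn ℝ ∞ (fun x => √(chartMetric (β t) m₀ x)) (chartAt ℝ m₀).target :=
    fun m₀ => (hb t ht m₀).sqrt fun x hx => (hpos t ht m₀ x hx).ne'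
  have hL : ∀ m₀ : M, ContDiffOn ℝ ∞ (fun y => deriv (fun z => Q t ((chartAt ℝ m₀).symm z)) y
      / √(chartMetric (β t) m₀ y)) (chartAt ℝ m₀).target := fun m₀ =>
    ((hq t ht m₀).deriv_of_isOpen (chartAt ℝ m₀).open_target (by simp)).div (hsqd m₀)
      fun x hx => (hsq m₀ x hx).ne'
  -- No regularity of S is assumed: the evolution equation expresses it through continuous
  -- derivatives of Q and γ.
  have hSc : Continuous S := continuous_of_charts fun m₀ => by
    have h1 : ContinuousOn (fun x => partial₂
        (fun z : ℝ × ℝ => Q z.2 ((chartAt ℝ m₀).symm z.1)) (x, t)) (chartAt ℝ m₀).target :=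
      (contDiffOn_partial₂ (hO m₀) (hQ m₀)).continuousOn.comp (by fun_prop) fun x hx => ⟨hx, ht⟩
    have h2 := (hL m₀).continuousOn_deriv_of_isOpen (chartAt ℝ m₀).open_target (by simp)
    refine (((h2.div (hsqd m₀).continuousOn fun x hx => (hsq m₀ x hx).ne').sub
      ((continuousOn_const (c := (1 / 2 : ℝ))).mul ((hq t ht m₀).continuousOn.pow 2))).sub
        h1).congr fun x hx => ?_
    have h3 := (hasDerivAt_partial₂ ((((hQ m₀).contDiffAt ((hO m₀).mem_nhds
      (mk_mem_prod hx ht))).differentiableAt (by simp)))).unique (hQt m₀ x hx)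
    simp only [Pi.sub_apply, Pi.mul_apply, Pi.div_apply, Pi.pow_apply, h3]
    ring
  have hSQ : Continuous fun m => (Q t m - 2 / t) ^ 2 := ((hQc t ht).sub continuous_const).pow 2
  refine ⟨integrable_of_continuous (hom t ht) (hb t ht) (hQc t ht),
    integrable_of_continuous (hom t ht) (hb t ht) hSc,
    integrable_of_continuous (hom t ht) (hb t ht) hSQ, ?_, ?_⟩
  · obtain ⟨c, χ, hχ, hsupp, hsum⟩ := exists_finite_partition (M := M)
    have hJ' : IsOpen (J ∩ Ioi 0) := hJ.inter isOpen_Ioi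
    -- Local form of the energy density, from s (Q + 2/s)/√s = √s Q + 2/√s and dV = √γ dx.
    -- Restricting to s > 0 keeps it smooth.
    set φ : M → ℝ × ℝ → ℝ := fun i z => (√z.2 * Q z.2 ((chartAt ℝ i).symm z.1) + 2 / √z.2)
      * √(chartMetric (β z.2) i z.1) with hφ
    have hφs : ∀ i, ContDiffOn ℝ ∞ (φ i) ((chartAt ℝ i).target ×ˢ (J ∩ Ioi 0)) := fun i => by
      have hsub : (chartAt ℝ i).target ×ˢ (J ∩ Ioi 0) ⊆ (chartAt ℝ i).target ×ˢ J :=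
        prod_mono_right inter_subset_left
      have h1 : ContDiffOn ℝ ∞ (fun z : ℝ × ℝ => √z.2) ((chartAt ℝ i).target ×ˢ (J ∩ Ioi 0)) :=
        contDiff_snd.contDiffOn.sqrt fun z hz => (mem_Ioi.1 hz.2.2).ne'
      exact ((h1.mul ((hQ i).mono hsub)).add (contDiffOn_const.div h1 fun z hz =>
        (Real.sqrt_pos.2 hz.2.2).ne')).mul (((hβ i).mono hsub).sqrt fun z hz =>
          (hpos z.2 hz.2.1 i z.1 hz.1).ne')
    have hE : (fun s => s * ∫ m, (Q s m + 2 / s) / √s ∂(riemannianVolume (β s))) =ᶠ[𝓝 t]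
        fun s => ∑ i ∈ c, ∫ x in (chartAt ℝ i).target, chartExtend (χ i) i x * φ i (x, s) := by
      filter_upwards [hJ'.mem_nhds ⟨ht, htpos⟩] with s hs
      have hs0 : 0 < s := hs.2
      have hc : Continuous fun m => (Q s m + 2 / s) / √s :=
        ((hQc s hs.1).add continuous_const).div_const _
      rw [integral_eq_sum (hom s hs.1) (hb s hs.1) hχ hsupp hsum hc, Finset.mul_sum]
      refine Finset.sum_congr rfl fun i _ => ?_
      rw [← integral_const_mul]
      refine setIntegral_congr_fun (chartAt ℝ i).open_target.measurableSet fun x hx => ?_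
      simp only [hφ]
      have h1 := (Real.sqrt_pos.2 hs0).ne'
      have h2 := Real.sq_sqrt hs0.le
      field_simp
      linear_combination (-(chartExtend (χ i) i x * Q s ((chartAt ℝ i).symm x)
        * √(chartMetric (β s) i x))) * h2
    set R : M → ℝ := fun m => -√t * S m - √t / 4 * (Q t m - 2 / t) ^ 2 with hR
    have hRc : Continuous R := (continuous_const.mul hSc).sub (continuous_const.mul hSQ)
    -- Since √γ grows at the rate ¼ Q √γ, the terms in Q², Q and 1 form the completed square in R.
    -- The Laplacian term is an exact derivative, because its factor 1/√γ cancels the length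
    -- element.
    have hd : ∀ i, ∀ x ∈ (chartAt ℝ i).target, partial₂ (φ i) (x, t)
        = √t * deriv (fun y => deriv (fun z => Q t ((chartAt ℝ i).symm z)) y
            / √(chartMetric (β t) i y)) x
          + R ((chartAt ℝ i).symm x) * √(chartMetric (β t) i x) := fun i x hx => by
      have h1 := hasDerivAt_partial₂ ((((hφs i).contDiffAt
        (((chartAt ℝ i).open_target.prod hJ').mem_nhds (mk_mem_prod hx ⟨ht, htpos⟩))).differentiableAt
          (by simp)))
      have h2 := Real.hasDerivAt_sqrt htpos.ne'
      have h3 := ((h2.mul (hQt i x hx)).add ((hasDerivAt_const t (2 : ℝ)).div h2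
        (Real.sqrt_pos.2 htpos).ne')).mul ((hβt i x hx).sqrt (hpos t ht i x hx).ne')
      rw [h1.unique h3]
      have h4 := hsq i x hx
      have h5 := Real.sq_sqrt (hpos t ht i x hx).le
      have h6 := Real.sqrt_pos.2 htpos
      have h7 := Real.sq_sqrt htpos.le
      simp only [hR, Pi.add_apply, Pi.mul_apply, Pi.div_apply]
      set γ := √(chartMetric (β t) i x)
      set r := √t
      rw [← h5, ← h7]
      field_simp
      ring
    have hLk : ∀ i, Integrable (fun x => chartExtend (χ i) i x * deriv (fun y =>
        deriv (fun z => Q t ((chartAt ℝ i).symm z)) y / √(chartMetric (β t) i y)) x)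
        (volume.restrict (chartAt ℝ i).target) := fun i =>
      (integrable_mul_of_hasCompactSupport (contDiff_chartExtend (hsupp i) (hχ i)).continuous
        (hasCompactSupport_chartExtend (hsupp i)) (chartAt ℝ i).open_target
        (tsupport_chartExtend_subset (hsupp i))
        ((hL i).continuousOn_deriv_of_isOpen (chartAt ℝ i).open_target (by simp))).restrict
    have hRk : ∀ i, Integrable (fun x => chartExtend (χ i) i x
        * (R ((chartAt ℝ i).symm x) * √(chartMetric (β t) i x)))
        (volume.restrict (chartAt ℝ i).target) := fun i =>
      (integrable_mul_of_hasCompactSupport (contDiff_chartExtend (hsupp i) (hχ i)).continuous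
        (hasCompactSupport_chartExtend (hsupp i)) (chartAt ℝ i).open_target
        (tsupport_chartExtend_subset (hsupp i))
        ((hRc.comp_continuousOn (chartAt ℝ i).continuousOn_symm).mul
          (hsqd i).continuousOn)).restrict
    have hderiv : HasDerivAt (fun s => ∑ i ∈ c, ∫ x in (chartAt ℝ i).target,
        chartExtend (χ i) i x * φ i (x, s)) (∑ i ∈ c, ∫ x in (chartAt ℝ i).target,
        chartExtend (χ i) i x * partial₂ (φ i) (x, t)) t :=
      HasDerivAt.fun_sum fun i _ => hasDerivAt_setIntegral_mul
        (contDiff_chartExtend (hsupp i) (hχ i)).continuous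
        (hasCompactSupport_chartExtend (hsupp i)) (chartAt ℝ i).open_target
        (tsupport_chartExtend_subset (hsupp i)) hJ' ⟨ht, htpos⟩ (hφs i)
    convert! hderiv.congr_of_eventuallyEq hE using 1
    have hterm : ∀ i, ∫ x in (chartAt ℝ i).target, chartExtend (χ i) i x * partial₂ (φ i) (x, t)
        = √t * (∫ x in (chartAt ℝ i).target, chartExtend (χ i) i x * deriv (fun y =>
            deriv (fun z => Q t ((chartAt ℝ i).symm z)) y / √(chartMetric (β t) i y)) x)
          + ∫ x in (chartAt ℝ i).target, chartExtend (χ i) i x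
            * (R ((chartAt ℝ i).symm x) * √(chartMetric (β t) i x)) := fun i => by
      rw [← integral_const_mul, ← integral_add ((hLk i).const_mul _) (hRk i)]
      refine setIntegral_congr_fun (chartAt ℝ i).open_target.measurableSet fun x hx => ?_
      rw [hd i x hx]
      ring
    rw [Finset.sum_congr rfl fun i _ => hterm i, Finset.sum_add_distrib, ← Finset.mul_sum,
      sum_integral_laplacian_eq_zero (hom t ht) (hb t ht) (hpos t ht) hχ hsupp hsum (hq t ht),
      mul_zero, zero_add, ← integral_eq_sum (hom t ht) (hb t ht) hχ hsupp hsum hRc]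
    simp only [hR]
    rw [integral_sub ((integrable_of_continuous (hom t ht) (hb t ht) hSc).const_mul _)
      ((integrable_of_continuous (hom t ht) (hb t ht) hSQ).const_mul _), integral_const_mul,
      integral_const_mul, integral_div, integral_div]
    have h6 := Real.sqrt_pos.2 htpos
    have h7 := Real.sq_sqrt htpos.le
    set r := √t
    rw [← h7]
    field_simp
  · have h1 : 0 ≤ ∫ m, S m / √t ∂(riemannianVolume (β t)) :=
      integral_nonneg fun m => div_nonneg (hS m) (Real.sqrt_nonneg _)
    have h2 : 0 ≤ ∫ m, (Q t m - 2 / t) ^ 2 / √t ∂(riemannianVolume (β t)) :=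
      integral_nonneg fun m => div_nonneg (sq_nonneg _) (Real.sqrt_nonneg _)
    have h3 := mul_nonneg htpos.le h1
    have h4 := mul_nonneg htpos.le h2
    linarith

end Evolution

/-! ### From the bundle to the charts of the base. -/

section Bundle

variable {EP EG P M G : Type*}
  [NormedAddCommGroup EP] [NormedSpace ℝ EP] [NormedAddCommGroup EG] [NormedSpace ℝ EG]
  [FiniteDimensional ℝ EP] [FiniteDimensional ℝ EG]
  [TopologicalSpace P] [ChartedSpace EP P] [IsManifold 𝓘(ℝ, EP) ∞ P]
  [TopologicalSpace M] [ChartedSpace ℝ M] [IsManifold 𝓘(ℝ, ℝ) ∞ M]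
  [TopologicalSpace G] [ChartedSpace EG G] [Group G] [LieGroup 𝓘(ℝ, EG) ∞ G]
  {pb : PrincipalBundle EP EG P M G}

namespace OrthonormalFrame

variable {g : BilinField EP P} {m : M} (F : OrthonormalFrame pb g m)

theorem evalB_self_nonneg (hg : IsInvariantMetric pb g) (X : VF EP P) (p : P) :
    0 ≤ evalB g X X p := by
  unfold evalB
  by_cases h : X p = 0
  · rw [h, map_zero]
  · exact (hg.pos p _ h).le

/-- Every term is visibly nonnegative except the fourth, where the square subtracted is one of the
summands. -/
theorem SB_nonneg (hg : IsInvariantMetric pb g) (H : TrilinField EP P) (p : P) :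
    0 ≤ F.SB H p := by
  have hb : 0 ≤ F.normSqBracket p := Finset.sum_nonneg fun i _ => Finset.sum_nonneg fun j _ =>
    evalB_self_nonneg hg _ p
  have hk : 0 ≤ ∑ k, F.DG (F.η k) (F.η 2) p ^ 2 - F.DG (F.η 2) (F.η 2) p ^ 2 := by
    rw [Fin.sum_univ_three, add_sub_cancel_right]
    positivity
  have hH : 0 ≤ F.normSqHG H p := Finset.sum_nonneg fun i _ => Finset.sum_nonneg fun j _ =>
    Finset.sum_nonneg fun k _ => sq_nonneg _
  have hV := evalB_self_nonneg hg (F.HVbracket H) p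
  unfold SB
  positivity

/-- The velocity of the projection of `V`. -/
def speed (p : P) : ℝ := mfderiv 𝓘(ℝ, EP) 𝓘(ℝ, ℝ) pb.proj p (F.V p)

variable {F} {g' : BilinField EP P} {p : P} (hdim : Module.finrank ℝ EG = 3)
  (hg : SmoothMetric pb g) (hg' : SmoothMetric pb g')

include hdim hg hg' in
theorem baseMetric_apply (hp : pb.proj p ∈ F.U) (r : ℝ) :
    baseMetric pb g' (pb.proj p) (r : ℝ) (r : ℝ) = (r / F.speed p) ^ 2 * F.normSqHor g' p := by
  refine baseMetric_smul hdim hg hg' hp (r / F.speed p) ?_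
  have h : r = r / F.speed p * F.speed p := (div_mul_cancel₀ _ (proj_V_ne_zero hdim hg hp)).symm
  exact h

end OrthonormalFrame

open OrthonormalFrame

theorem SB_base_nonneg {g : BilinField EP P} (hg : IsInvariantMetric pb g) (H : TrilinField EP P)
    (m : M) : 0 ≤ SB pb g H m := by
  unfold SB
  split_ifs with h
  · exact SB_nonneg _ hg H _
  · exact le_rfl

/-- Quadratic homogeneity, read off from the horizontal lift, is the only consequence of bilinearity
used in changing charts. -/
theorem baseMetric_homogeneous [CompleteSpace EG] (hdim : Module.finrank ℝ EG = 3)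
    (hnil : LieRing.IsNilpotent (GroupLieAlgebra 𝓘(ℝ, EG) G)) {g : BilinField EP P}
    (hg : SmoothMetric pb g) (m : M) (r : ℝ) :
    baseMetric pb g m (r : ℝ) (r : ℝ) = r ^ 2 * baseMetric pb g m (1 : ℝ) (1 : ℝ) := by
  obtain ⟨p, rfl⟩ := pb.exists_proj_eq m
  obtain ⟨F, -⟩ := exists_isAdapted hdim hnil hg (pb.proj p)
  rw [baseMetric_apply hdim hg hg F.mem, baseMetric_apply hdim hg hg F.mem]
  ring

theorem chartVector_mul_derivAt (m₀ : M) {m : M} (hm : m ∈ (chartAt ℝ m₀).source) :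
    chartVector m₀ (chartAt ℝ m₀ m) * derivAt (chartAt ℝ m₀) m = 1 := by
  have hx := (chartAt ℝ m₀).map_source hm
  have h1 := hasDerivAt_comp_chart_symm m₀ hx (f := chartAt ℝ m₀)
    (by rw [(chartAt ℝ m₀).left_inv hm]
        exact (mdifferentiable_chart (I := 𝓘(ℝ, ℝ)) m₀).mdifferentiableAt hm)
  rw [(chartAt ℝ m₀).left_inv hm] at h1
  have h2 : HasDerivAt (fun y => chartAt ℝ m₀ ((chartAt ℝ m₀).symm y)) 1 (chartAt ℝ m₀ m) := by
    refine (hasDerivAt_id _).congr_of_eventuallyEq ?_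
    filter_upwards [(chartAt ℝ m₀).open_target.mem_nhds hx] with y hy
    exact (chartAt ℝ m₀).right_inv hy
  exact h1.unique h2

namespace PrincipalBundle.Coord

variable {C : pb.Coord} {J : Set ℝ}

theorem exists_coord_eq (C : pb.Coord) {y : ℝ} (hy : y ∈ C.x '' C.N) :
    ∃ p, pb.proj p ∈ C.N ∧ C.coord p = y :=
  ⟨C.σ y, C.proj_σ y hy⟩

theorem IsSmoothFamily.contDiffOn {f : ℝ → P → ℝ} {k : ℝ × ℝ → ℝ} (hf : C.IsSmoothFamily J f)
    (hk : ∀ s ∈ J, ∀ p, pb.proj p ∈ C.N → k (C.coord p, s) = f s p) :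
    ContDiffOn ℝ ∞ k ((C.x '' C.N) ×ˢ J) := by
  obtain ⟨φ, hφ, e⟩ := hf
  refine hφ.congr ?_
  rintro ⟨y, s⟩ ⟨hy, hs⟩
  obtain ⟨p, hp, rfl⟩ := C.exists_coord_eq hy
  rw [hk s hs p hp, e s hs p hp]

variable {m₀ : M} (hx : C.x = chartAt ℝ m₀) (hs : C.N ⊆ (chartAt ℝ m₀).source)

include hx hs in
theorem symm_coord {p : P} (hp : pb.proj p ∈ C.N) : (chartAt ℝ m₀).symm (C.coord p) = pb.proj p := by
  unfold coord
  rw [hx]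
  exact (chartAt ℝ m₀).left_inv (hs hp)

variable {g g' : BilinField EP P} {m : M} {F : OrthonormalFrame pb g m}
  (hdim : Module.finrank ℝ EG = 3)
  (hg : SmoothMetric pb g) (hg' : SmoothMetric pb g') (hN : C.N ⊆ F.U) {p : P}

include hx hs in
theorem dirDeriv_coord (F : OrthonormalFrame pb g m) (hp : pb.proj p ∈ C.N) :
    dirDeriv F.V C.coord p = derivAt (chartAt ℝ m₀) (pb.proj p) * F.speed p := by
  have h1 : MDifferentiableAt 𝓘(ℝ, ℝ) 𝓘(ℝ, ℝ) (chartAt ℝ m₀) (pb.proj p) :=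
    (mdifferentiable_chart (I := 𝓘(ℝ, ℝ)) m₀).mdifferentiableAt (hs hp)
  have h2 := mfderiv_apply_of_comp_eq (k := C.coord) h1 (pb.mdifferentiableAt_proj p) rfl
    (Eq.eventuallyEq (by unfold coord; rw [hx]; rfl)) (F.V p)
  unfold dirDeriv
  refine h2.trans ?_
  let L : ℝ →L[ℝ] ℝ := mfderiv 𝓘(ℝ, ℝ) 𝓘(ℝ, ℝ) (chartAt ℝ m₀) (pb.proj p)
  have h3 : L (F.speed p • (1 : ℝ)) = F.speed p • L 1 := map_smul _ _ _
  rw [smul_eq_mul, mul_one, smul_eq_mul, mul_comm] at h3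
  exact h3

include hx hs hdim hg hN in
theorem dirDeriv_coord_ne_zero (hp : pb.proj p ∈ C.N) : dirDeriv F.V C.coord p ≠ 0 := by
  rw [dirDeriv_coord hx hs F hp]
  exact mul_ne_zero (right_ne_zero_of_mul_eq_one (chartVector_mul_derivAt m₀ (hs hp)))
    (proj_V_ne_zero hdim hg (hN hp))

include hx hs hdim hg hg' hN in
-- The coordinate vector is the projection of V divided by V(x); its square length is therefore that
-- of the horizontal part of V divided by V(x)². Only the numerator depends on the metric g'.
theorem chartMetric_coord [CompleteSpace EG]
    (hnil : LieRing.IsNilpotent (GroupLieAlgebra 𝓘(ℝ, EG) G)) (hp : pb.proj p ∈ C.N) :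
    chartMetric (baseMetric pb g') m₀ (C.coord p)
      = F.normSqHor g' p / (dirDeriv F.V C.coord p * dirDeriv F.V C.coord p) := by
  have h1 := chartVector_mul_derivAt m₀ (hs hp)
  have h2 : C.coord p = chartAt ℝ m₀ (pb.proj p) := by unfold coord; rw [hx]
  have h3 := right_ne_zero_of_mul_eq_one h1
  have h4 : F.speed p ≠ 0 := proj_V_ne_zero hdim hg (hN hp)
  rw [chartMetric_eq (baseMetric_homogeneous hdim hnil hg'), symm_coord hx hs hp,
    baseMetric_apply hdim hg hg' (hN hp), dirDeriv_coord hx hs F hp, h2,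
    eq_one_div_of_mul_eq_one_left h1]
  field_simp

end PrincipalBundle.Coord

theorem contDiffOn_of_coords {m₀ : M} {J : Set ℝ} (hJ : IsOpen J) {k : ℝ × ℝ → ℝ}
    (h : ∀ x ∈ (chartAt ℝ m₀).target, ∀ s ∈ J, ∃ C : pb.Coord, x ∈ C.x '' C.N ∧
      ContDiffOn ℝ ∞ k ((C.x '' C.N) ×ˢ J)) :
    ContDiffOn ℝ ∞ k ((chartAt ℝ m₀).target ×ˢ J) := by
  rintro ⟨x, s⟩ ⟨hx, hs⟩
  obtain ⟨C, hC, hk⟩ := h x hx s hs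
  exact (hk.contDiffAt ((C.isOpen_image.prod hJ).mem_nhds ⟨hC, hs⟩)).contDiffWithinAt

variable [CompleteSpace EG]

/-- The second derivative along the unit field in a coordinate. -/
theorem dirDeriv_dirDeriv_coord {g₁ : BilinField EP P} (hg₁ : SmoothMetric pb g₁) {m m₀ : M}
    {F : OrthonormalFrame pb g₁ m} {C : pb.Coord} (hCx : C.x = chartAt ℝ m₀)
    (hCs : C.N ⊆ (chartAt ℝ m₀).source) (hN : C.N ⊆ F.U)
    (hdim : Module.finrank ℝ EG = 3)
    (hnil : LieRing.IsNilpotent (GroupLieAlgebra 𝓘(ℝ, EG) G))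
    {k : P → ℝ} {φ : ℝ → ℝ} (hφ : ContDiffOn ℝ ∞ φ (chartAt ℝ m₀).target)
    (hγ : ContDiffOn ℝ ∞ (chartMetric (baseMetric pb g₁) m₀) (chartAt ℝ m₀).target)
    (hk : ∀ q, pb.proj q ∈ C.N → k q = φ (C.coord q)) {p : P} (hp : pb.proj p ∈ C.N) :
    dirDeriv F.V (dirDeriv F.V k) p = deriv (fun y => deriv φ y
      / √(chartMetric (baseMetric pb g₁) m₀ y)) (C.coord p)
      / √(chartMetric (baseMetric pb g₁) m₀ (C.coord p)) := by
  set γ := chartMetric (baseMetric pb g₁) m₀ with hγdef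
  have hT := (chartAt ℝ m₀).open_target
  have hmem : ∀ q, pb.proj q ∈ C.N → C.coord q ∈ (chartAt ℝ m₀).target := fun q hq => by
    unfold PrincipalBundle.Coord.coord
    rw [hCx]
    exact (chartAt ℝ m₀).map_source (hCs hq)
  have hd : ∀ {f : ℝ → ℝ}, ContDiffOn ℝ ∞ f (chartAt ℝ m₀).target → ∀ q, pb.proj q ∈ C.N →
      HasDerivAt f (deriv f (C.coord q)) (C.coord q) := fun hf q hq =>
    ((hf.contDiffAt (hT.mem_nhds (hmem q hq))).differentiableAt (by simp)).hasDerivAt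
  have hcomp : ∀ {f : ℝ → ℝ}, ContDiffOn ℝ ∞ f (chartAt ℝ m₀).target →
      HasDirDeriv F.V (fun q => f (C.coord q))
        (dirDeriv F.V C.coord p * deriv f (C.coord p)) p := fun hf =>
    (C.invFun_coord.comp fun q hq => hf.contDiffAt (hT.mem_nhds (hmem q hq))).hasDirDeriv
      C.isOpen hp (PrincipalBundle.Coord.dirDeriv_of_eq hp (fun _ _ => rfl) (hd hf p hp))
  have hφ' : ContDiffOn ℝ ∞ (deriv φ) (chartAt ℝ m₀).target := hφ.deriv_of_isOpen hT (by simp)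
  have hW := pb.isOpen_preimage C.isOpen
  have hv := (C.invFun_coord.dirDeriv (F.invField_V.mono hN) C.isOpen).hasDirDeriv
    (X := F.V) C.isOpen hp rfl
  set v := dirDeriv F.V C.coord with hvdef
  have hv0 : v p ≠ 0 := PrincipalBundle.Coord.dirDeriv_coord_ne_zero hCx hCs hdim hg₁ hN hp
  -- V is a unit field, so v = V(x) satisfies γ v² = 1. Differentiating this relation gives V v
  -- without fixing the sign of v, which is irrelevant since v enters quadratically.
  have hγv : ∀ q, pb.proj q ∈ C.N → γ (C.coord q) * (v q * v q) = 1 := fun q hq => by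
    have h0 : v q ≠ 0 := PrincipalBundle.Coord.dirDeriv_coord_ne_zero hCx hCs hdim hg₁ hN hq
    rw [hγdef, PrincipalBundle.Coord.chartMetric_coord hCx hCs hdim hg₁ hg₁ hN hnil hq,
      normSqHor_self hg₁ (hN hq), div_mul_cancel₀ _ (mul_ne_zero h0 h0)]
  have h1 : dirDeriv F.V (dirDeriv F.V k) p
      = dirDeriv F.V v p * deriv φ (C.coord p) + v p * (v p * deriv (deriv φ) (C.coord p)) := by
    rw [← (hv.mul (hcomp hφ')).2]
    exact dirDeriv_congr_of_eqOn hW (fun q hq =>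
      PrincipalBundle.Coord.dirDeriv_of_eq hq hk (hd hφ q hq)) hp
  have h2 := ((hcomp hγ).mul (hv.mul hv)).2
  rw [dirDeriv_eq_zero_of_eqOn_const hW hγv hp] at h2
  have h3 := hγv p hp
  have hγ0 : 0 < γ (C.coord p) := by
    have := mul_self_pos.2 hv0
    by_contra h
    nlinarith
  have h4 : dirDeriv F.V v p = - (v p * v p) * deriv γ (C.coord p) / (2 * γ (C.coord p)) := by
    rw [eq_div_iff (by positivity)]
    refine mul_left_cancel₀ hv0 ?_
    linear_combination -h2
  have h7 := (hd hφ' p hp).fun_div ((hd hγ p hp).sqrt hγ0.ne') (Real.sqrt_pos.2 hγ0).ne'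
  rw [h7.deriv, h1, h4, ← mul_assoc (v p) (v p), eq_one_div_of_mul_eq_one_right h3]
  have h5 := Real.sqrt_pos.2 hγ0
  have h6 := Real.sq_sqrt hγ0.le
  set r := √(γ (C.coord p))
  rw [← h6]
  field_simp
  ring

variable {J : Set ℝ} {g : ℝ → BilinField EP P} {H : ℝ → TrilinField EP P}
  (hdim : Module.finrank ℝ EG = 3)
  (hnil : LieRing.IsNilpotent (GroupLieAlgebra 𝓘(ℝ, EG) G)) (hJ : IsOpen J)
  (hg : ∀ s ∈ J, SmoothMetric pb (g s)) (hH : ∀ s ∈ J, SmoothForm pb (H s))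
  (hgs : SmoothFamilyB J g) (hHs : SmoothFamilyT J H)

include hdim hnil hg in
/-- Adapted frames and coordinates near a given point. -/
theorem exists_frame_coord {t : ℝ} (ht : t ∈ J) {m₀ : M} {x : ℝ}
    (hx : x ∈ (chartAt ℝ m₀).target) :
    ∃ (m : M) (F : OrthonormalFrame pb (g t) m) (C : pb.Coord), C.x = chartAt ℝ m₀ ∧
      C.N ⊆ (chartAt ℝ m₀).source ∧ C.N ⊆ F.U ∧ x ∈ C.x '' C.N := by
  obtain ⟨F, -⟩ := exists_isAdapted hdim hnil (hg t ht) ((chartAt ℝ m₀).symm x)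
  obtain ⟨C, h1, h2, h3, h4⟩ := pb.exists_coord F.isOpen F.mem ((chartAt ℝ m₀).map_target hx)
  refine ⟨_, F, C, h1, h4, h3, _, h2, ?_⟩
  rw [h1]
  exact (chartAt ℝ m₀).right_inv hx

include hdim hnil hJ hg hH hgs hHs in
/-- `|DG|² + tr_g H²` on the base, in terms of a fixed frame. -/
theorem density_eq_normSqVar {s : ℝ} (hs : s ∈ J) {g₁ : BilinField EP P}
    (hg₁ : SmoothMetric pb g₁) {m : M} (F : OrthonormalFrame pb g₁ m) {p : P}
    (hp : pb.proj p ∈ F.U) :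
    normSqDG pb (g s) (pb.proj p) + trHsq pb (g s) (H s) (pb.proj p)
      = F.normSqVarG (g s) p + F.normSqVarH (g s) (H s) p := by
  have hne : Nonempty ({q : P // pb.proj q = pb.proj p} × OrthonormalFrame pb (g s) (pb.proj p)) :=
    ⟨⟨p, rfl⟩, (exists_isAdapted hdim hnil (hg s hs) (pb.proj p)).choose⟩
  unfold normSqDG trHsq
  rw [dif_pos hne, dif_pos hne]
  obtain ⟨⟨q, hq⟩, F'⟩ := hne.some
  have hq' : pb.proj q ∈ F.U := by rw [hq]; exact hp
  have hqF' : pb.proj q ∈ F'.U := by rw [hq]; exact F'.mem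
  simp only
  rw [normSqDG_eq_normSqVarG hdim hg₁ (hg s hs) F' hq' hqF',
    trHsq_eq_normSqVarH hdim hg₁ (hg s hs) F' (hH s hs).toIsInvariantClosedForm hq' hqF']
  -- The point q chosen in the definitions lies in the fibre of p, and a smooth family of invariant
  -- functions depends on the base coordinate only.
  obtain ⟨C, -, hm, hN, -⟩ := pb.exists_coord F.isOpen hp (mem_chart_source ℝ _)
  obtain ⟨φ, -, e⟩ := isSmoothFamily_density hg₁ hN hg hgs hH hHs hdim hJ
  refine (e s hs q (by rw [hq]; exact hm)).trans (Eq.trans ?_ (e s hs p hm).symm)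
  unfold PrincipalBundle.Coord.coord
  rw [hq]

include hdim hnil hJ hg hH hgs hHs in
theorem density_eq_frame {t : ℝ} (ht : t ∈ J) {m : M} (F : OrthonormalFrame pb (g t) m) {p : P}
    (hp : pb.proj p ∈ F.U) :
    normSqDG pb (g t) (pb.proj p) + trHsq pb (g t) (H t) (pb.proj p) = F.density (H t) p := by
  rw [density_eq_normSqVar hdim hnil hJ hg hH hgs hHs ht (hg t ht) F hp,
    ← normSqDG_eq_normSqVarG hdim (hg t ht) (hg t ht) F hp hp,
    ← trHsq_eq_normSqVarH hdim (hg t ht) (hg t ht) F (hH t ht).toIsInvariantClosedForm hp hp]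
  rfl

include hdim hnil hJ hg hH hgs hHs in
theorem contDiffOn_density (m₀ : M) :
    ContDiffOn ℝ ∞ (fun z : ℝ × ℝ => normSqDG pb (g z.2) ((chartAt ℝ m₀).symm z.1)
      + trHsq pb (g z.2) (H z.2) ((chartAt ℝ m₀).symm z.1)) ((chartAt ℝ m₀).target ×ˢ J) := by
  refine contDiffOn_of_coords (pb := pb) hJ fun x hx t ht => ?_
  obtain ⟨m, F, C, hCx, hCs, hN, hxC⟩ := exists_frame_coord hdim hnil hg ht hx
  refine ⟨C, hxC, (isSmoothFamily_density (hg t ht) hN hg hgs hH hHs hdim hJ).contDiffOn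
    fun s hs p hp => ?_⟩
  simp only
  rw [PrincipalBundle.Coord.symm_coord hCx hCs hp]
  exact density_eq_normSqVar hdim hnil hJ hg hH hgs hHs hs (hg t ht) F (hN hp)

include hdim hnil hJ hg hgs in
theorem contDiffOn_chartMetric (m₀ : M) :
    ContDiffOn ℝ ∞ (fun z : ℝ × ℝ => chartMetric (baseMetric pb (g z.2)) m₀ z.1)
      ((chartAt ℝ m₀).target ×ˢ J) := by
  refine contDiffOn_of_coords (pb := pb) hJ fun x hx t ht => ?_
  obtain ⟨m, F, C, hCx, hCs, hN, hxC⟩ := exists_frame_coord hdim hnil hg ht hx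
  have hv : C.IsSmoothFamily J fun _ => dirDeriv F.V C.coord :=
    PrincipalBundle.Coord.IsSmoothFamily.of_invFun
      (C.invFun_coord.dirDeriv (F.invField_V.mono hN) C.isOpen) subset_rfl
  refine ⟨C, hxC, ((isSmoothFamily_normSqHor (hg t ht) hN hg hgs).div (hv.mul hv)
    fun s hs p hp => ?_).contDiffOn fun s hs p hp => ?_⟩
  · have := PrincipalBundle.Coord.dirDeriv_coord_ne_zero hCx hCs hdim (hg t ht) hN hp
    exact mul_ne_zero this this
  · exact PrincipalBundle.Coord.chartMetric_coord hCx hCs hdim (hg t ht) (hg s hs) hN hnil hp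

include hdim hnil hg in
theorem chartMetric_pos {t : ℝ} (ht : t ∈ J) (m₀ : M) {x : ℝ} (hx : x ∈ (chartAt ℝ m₀).target) :
    0 < chartMetric (baseMetric pb (g t)) m₀ x := by
  obtain ⟨m, F, C, hCx, hCs, hN, hxC⟩ := exists_frame_coord hdim hnil hg ht hx
  obtain ⟨p, hp, rfl⟩ := C.exists_coord_eq hxC
  rw [PrincipalBundle.Coord.chartMetric_coord hCx hCs hdim (hg t ht) (hg t ht) hN hnil hp]
  exact div_pos (normSqHor_pos hdim (hg t ht) (hg t ht) (hN hp)) (mul_self_pos.2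
    (PrincipalBundle.Coord.dirDeriv_coord_ne_zero hCx hCs hdim (hg t ht) hN hp))

include hdim hnil hJ hg hH hgs hHs in
-- In a frame fixed at time t the denominator V(x)² is constant in time, and the flow equation for g
-- gives the derivative of the numerator.
theorem hasDerivAt_chartMetric (hflow : SatisfiesFlow pb J g H) {t : ℝ} (ht : t ∈ J) (m₀ : M)
    {x : ℝ} (hx : x ∈ (chartAt ℝ m₀).target) :
    HasDerivAt (fun s => chartMetric (baseMetric pb (g s)) m₀ x)
      (1 / 2 * (normSqDG pb (g t) ((chartAt ℝ m₀).symm x)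
        + trHsq pb (g t) (H t) ((chartAt ℝ m₀).symm x))
        * chartMetric (baseMetric pb (g t)) m₀ x) t := by
  obtain ⟨m, F, C, hCx, hCs, hN, hxC⟩ := exists_frame_coord hdim hnil hg ht hx
  obtain ⟨p, hp, rfl⟩ := C.exists_coord_eq hxC
  have h1 : ∀ s ∈ J, chartMetric (baseMetric pb (g s)) m₀ (C.coord p)
      = F.normSqHor (g s) p / (dirDeriv F.V C.coord p * dirDeriv F.V C.coord p) := fun s hs =>
    PrincipalBundle.Coord.chartMetric_coord hCx hCs hdim (hg t ht) (hg s hs) hN hnil hp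
  have hsp : F.speed p ≠ 0 := proj_V_ne_zero hdim (hg t ht) (hN hp)
  have h2 : HasDerivAt (fun s => F.normSqHor (g s) p)
      ((1 / 2) * F.normSqDG p + (1 / 2) * F.Hsq (H t) F.V F.V p) t := by
    refine (hflow.eqg t ht p (F.at' (hN hp))).congr_of_eventuallyEq ?_
    filter_upwards [hJ.mem_nhds ht] with s hs
    have h3 := baseMetric_apply (F := F) hdim (hg t ht) (hg s hs) (hN hp) (F.speed p)
    rw [div_self hsp, one_pow, one_mul] at h3
    exact h3.symm
  rw [h1 t ht, PrincipalBundle.Coord.symm_coord hCx hCs hp,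
    density_eq_frame hdim hnil hJ hg hH hgs hHs ht F (hN hp), normSqHor_self (hg t ht) (hN hp)]
  convert! (h2.div_const (dirDeriv F.V C.coord p * dirDeriv F.V C.coord p)).congr_of_eventuallyEq
    (Filter.mem_of_superset (hJ.mem_nhds ht) h1) using 1
  unfold density OrthonormalFrame.trHsq
  ring

include hdim hnil hJ hg hH hgs hHs in
theorem hasDerivAt_density_base (hflow : SatisfiesFlow pb J g H) {t : ℝ} (ht : t ∈ J) (m₀ : M)
    {x : ℝ} (hx : x ∈ (chartAt ℝ m₀).target) :
    HasDerivAt (fun s => normSqDG pb (g s) ((chartAt ℝ m₀).symm x)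
        + trHsq pb (g s) (H s) ((chartAt ℝ m₀).symm x))
      (deriv (fun y => deriv (fun z => normSqDG pb (g t) ((chartAt ℝ m₀).symm z)
          + trHsq pb (g t) (H t) ((chartAt ℝ m₀).symm z)) y
            / √(chartMetric (baseMetric pb (g t)) m₀ y)) x
            / √(chartMetric (baseMetric pb (g t)) m₀ x)
          - 1 / 2 * (normSqDG pb (g t) ((chartAt ℝ m₀).symm x)
            + trHsq pb (g t) (H t) ((chartAt ℝ m₀).symm x)) ^ 2
          - SB pb (g t) (H t) ((chartAt ℝ m₀).symm x)) t := by
  have hne : Nonempty ({q : P // pb.proj q = (chartAt ℝ m₀).symm x}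
      × {F : OrthonormalFrame pb (g t) ((chartAt ℝ m₀).symm x) // F.IsAdapted}) := by
    obtain ⟨q, hq⟩ := pb.exists_proj_eq ((chartAt ℝ m₀).symm x)
    obtain ⟨F, hF⟩ := exists_isAdapted hdim hnil (hg t ht) ((chartAt ℝ m₀).symm x)
    exact ⟨⟨q, hq⟩, F, hF⟩
  have hSB : SB pb (g t) (H t) ((chartAt ℝ m₀).symm x)
      = hne.some.2.1.SB (H t) hne.some.1 := by
    unfold SB
    rw [dif_pos hne]
  rw [hSB]
  -- The evolution equation is derived in the very frame and at the very point selected by the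
  -- definition of `SB`, so independence of S_B from the frame need not be shown.
  obtain ⟨⟨p, hpx⟩, F, hA⟩ := hne.some
  have hp : pb.proj p ∈ F.U := by rw [hpx]; exact F.mem
  obtain ⟨C, hCx, hpC, hN, hCs⟩ := pb.exists_coord (m₀ := m₀) F.isOpen hp
    (by rw [hpx]; exact (chartAt ℝ m₀).map_target hx)
  have hx' : C.coord p = x := by
    unfold PrincipalBundle.Coord.coord
    rw [hCx, hpx]
    exact (chartAt ℝ m₀).right_inv hx
  have hslice : ∀ {k : ℝ × ℝ → ℝ}, ContDiffOn ℝ ∞ k ((chartAt ℝ m₀).target ×ˢ J) →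
      ContDiffOn ℝ ∞ (fun y => k (y, t)) (chartAt ℝ m₀).target := fun hk =>
    hk.comp (by fun_prop) fun y hy => ⟨hy, ht⟩
  have h1 := dirDeriv_dirDeriv_coord (hg t ht) hCx hCs hN hdim hnil (k := F.density (H t))
    (hslice (contDiffOn_density hdim hnil hJ hg hH hgs hHs m₀))
    (hslice (contDiffOn_chartMetric hdim hnil hJ hg hgs m₀))
    (fun q hq => by
      rw [← density_eq_frame hdim hnil hJ hg hH hgs hHs ht F (hN hq)]
      simp only
      rw [PrincipalBundle.Coord.symm_coord hCx hCs hq]) hpC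
  have h2 := hasDerivAt_density hdim hnil hJ hg hH hgs hflow ht hA hp
  rw [h1, hx', ← density_eq_frame hdim hnil hJ hg hH hgs hHs ht F hp, hpx] at h2
  refine h2.congr_of_eventuallyEq ?_
  filter_upwards [hJ.mem_nhds ht] with s hs
  rw [← density_eq_normSqVar hdim hnil hJ hg hH hgs hHs hs (hg t ht) F hp, hpx]

end Bundle

end InvariantFlow

end

end

theorem proposition4p2 {EP EG P M G : Type*}
    [NormedAddCommGroup EP] [NormedSpace ℝ EP] [FiniteDimensional ℝ EP]
    [NormedAddCommGroup EG] [NormedSpace ℝ EG] [FiniteDimensional ℝ EG] [CompleteSpace EG]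
    [TopologicalSpace P] [ChartedSpace EP P] [IsManifold 𝓘(ℝ, EP) ∞ P]
    [TopologicalSpace M] [ChartedSpace ℝ M] [IsManifold 𝓘(ℝ, ℝ) ∞ M]
    [T2Space M] [CompactSpace M] [MeasurableSpace M] [BorelSpace M]
    [TopologicalSpace G] [ChartedSpace EG G] [Group G] [LieGroup 𝓘(ℝ, EG) ∞ G]
    (hdim : Module.finrank ℝ EG = 3)
    (hnil : LieRing.IsNilpotent (GroupLieAlgebra 𝓘(ℝ, EG) G))
    (pb : PrincipalBundle EP EG P M G)
    (J : Set ℝ) (hJ : IsOpen J)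
    (g : ℝ → BilinField EP P) (H : ℝ → TrilinField EP P)
    (hg : ∀ t ∈ J, IsInvariantMetric pb (g t))
    (hH : ∀ t ∈ J, IsInvariantClosedForm pb (H t))
    (hgsmooth : SmoothFamilyB J g) (hHsmooth : SmoothFamilyT J H)
    (hflow : SatisfiesFlow pb J g H)
    (t : ℝ) (ht : t ∈ J) (htpos : 0 < t) :
    Integrable (fun m => normSqDG pb (g t) m + trHsq pb (g t) (H t) m)
        (baseVolume pb (g t)) ∧
    Integrable (SB pb (g t) (H t)) (baseVolume pb (g t)) ∧
    Integrable (fun m => (normSqDG pb (g t) m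
          + trHsq pb (g t) (H t) m - 2 / t) ^ 2)
        (baseVolume pb (g t)) ∧
    HasDerivAt (fun s => energy pb (g s) (H s) s)
      (-t * (∫ m, SB pb (g t) (H t) m / √t ∂(baseVolume pb (g t)))
        - t / 4 * (∫ m, (normSqDG pb (g t) m
            + trHsq pb (g t) (H t) m - 2 / t) ^ 2 / √t
              ∂(baseVolume pb (g t)))) t ∧
    -t * (∫ m, SB pb (g t) (H t) m / √t ∂(baseVolume pb (g t)))
        - t / 4 * (∫ m, (normSqDG pb (g t) m
            + trHsq pb (g t) (H t) m - 2 / t) ^ 2 / √t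
              ∂(baseVolume pb (g t))) ≤ 0 := by 
  have hg' : ∀ s ∈ J, SmoothMetric pb (g s) := fun s hs => hgsmooth.smoothMetric hs (hg s hs)
  have hH' : ∀ s ∈ J, SmoothForm pb (H s) := fun s hs => hHsmooth.smoothForm hs (hH s hs)
  exact energy_evolution hJ (β := fun s => baseMetric pb (g s))
    (Q := fun s m => normSqDG pb (g s) m + trHsq pb (g s) (H s) m) ht htpos
    (fun s hs => baseMetric_homogeneous hdim hnil (hg' s hs))
    (contDiffOn_chartMetric hdim hnil hJ hg' hgsmooth)
    (fun s hs m₀ x hx => chartMetric_pos hdim hnil hg' hs m₀ hx)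
    (contDiffOn_density hdim hnil hJ hg' hH' hgsmooth hHsmooth)
    (fun m₀ x hx => hasDerivAt_chartMetric hdim hnil hJ hg' hH' hgsmooth hHsmooth hflow ht m₀ hx)
    (fun m₀ x hx => hasDerivAt_density_base hdim hnil hJ hg' hH' hgsmooth hHsmooth hflow ht m₀ hx)
    (SB_base_nonneg (hg t ht) (H t))
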